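/- **Setting.** Let $\Bbbk$ be a field of characteristic $0$, $M=\mathbb Z^2$, $M_{\mathbb R}=\mathbb R^2$, $N=\mathrm{Hom}(M,\mathbb Z)$, $R=\Bbbk[[t_1,\dots,t_n]]$ with maximal ideal $\mathfrak m_R$, and $A=\Bbbk[M]\widehat\otimes_\Bbbk R=\varprojlim_r \Bbbk[M]\otimes R/\mathfrak m_R^r$. A line (ray) is a pair $(\mathfrak d,f_{\mathfrak d})$ with $\mathfrak d=p+\mathbb R m$ (resp. $\mathfrak d=p+\mathbb R_{\ge 0}m$), $p\in M_{\mathbb R}$, $m\in M\setminus\{0\}$, $f_{\mathfrak d}\in\Bbbk[z^m]\widehat\otimes R$ and $f_{\mathfrak d}\equiv 1$ mod $z^m\mathfrak m_R$. A scattering diagram is a set of lines and rays of which, for every $r$, only finitely many have $f_{\mathfrak d}\not\equiv1$ mod $\mathfrak m_R^r$. $\mathrm{Sing}$ of a diagram is the set of initial points of its rays and of isolated intersection points of two elements. For a smooth immersion $\gamma:[0,1]\to M_{\mathbb R}\setminus \mathrm{Sing}$, transverse to all elements of the diagram and with endpoints off them, the path ordered product $\theta_\gamma$ is the limit over $r$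 of the compositions $\theta_{\mathfrak d_s}\circ\cdots\circ\theta_{\mathfrak d_1}$ over the successive crossings with the elements having $f_{\mathfrak d}\not\equiv 1$ mod $\mathfrak m_R^r$, where $\theta_{\mathfrak d}=\exp(\log (f_{\mathfrak d})\,\partial_{n_0})$, $\partial_{n_0}(z^m)=\langle m,n_0\rangle z^m$, and $n_0\in N$ is primitive, annihilates the direction of $\mathfrak d$ and satisfies $\langle n_0,\gamma'\rangle>0$ at the crossing. Let $\mathfrak D=\{(\mathfrak d_i,f_i)\mid 1\le i\le n\}$ be a standard scattering diagram: $\mathfrak d_i=\mathbb R m_i$ with $m_i\in M$ primitive (repetitions allowed), and $t_i$ is the only one of the variables $t_1,\dots,t_n$ occurring in $f_i$. Write $\log f_i=\sum_{j\ge1}\sum_{w\ge1} w\,a_{ijw}z^{wm_i}t_i^j$ with $a_{ijw}\in\Bbbk$. Let $\mathrm{Scatter}(\mathfrak D)$ be a scattering diagram which contains $\mathfrak D$, is obtained from $\mathfrak D$ by adding only rays, satisfies $\theta_\gamma=\mathrm{id}$ for every closed path $\gamma$ for which $\theta_\gamma$ is defined, and has at most one ray in any given direction. **Tropical counts.** A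 weight vector $\mathbf w_i=(w_{i1},\dots,w_{il_i})$, $l_i\ge0$, consists of integers $0<w_{i1}\le\cdots\le w_{il_i}$; put $|\mathbf w_i|=\sum_j w_{ij}$. For $\mathbf m=(m_1,\dots,m_n)$ and $\mathbf w=(\mathbf w_1,\dots,\mathbf w_n)$ put $m_{\rm out}=\sum_i|\mathbf w_i|m_i$; if $m_{\rm out}\ne0$, let $w_{\rm out}(\mathbf w)$ be its index, i.e. $m_{\rm out}=w_{\rm out}(\mathbf w)\,m'_{\rm out}$ with $m'_{\rm out}$ primitive. A rational tropical curve is a balanced map $h:\Gamma\to M_{\mathbb R}$, up to isomorphism, from a finite weighted tree with unbounded edges and without divalent vertices, which embeds every edge into a line of rational slope. For a general choice of lines $\mathfrak d_{ij}=m_{ij}+\mathbb R m_i$ ($1\le i\le n$, $1\le j\le l_i$), $N^{\rm trop}_{\mathbf m}(\mathbf w)$ is the number of rational tropical curves whose unbounded edges are $\sum_i l_i+1$ distinct edges $E_{ij}$ and $E_{\rm out}$ (so that $\Gamma$ has a vertex), such that $E_{ij}$ has weight $w_{ij}$, is mapped into $\mathfrak d_{ij}$ and has unbounded direction $-m_i$,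 and $E_{\rm out}$ points in the direction of $m_{\rm out}$. A curve, which is trivalent for general lines, is counted with multiplicity the product over its vertices of $w_1w_2|m_1\wedge m_2|$, where $w_1,w_2$ are the weights and $m_1,m_2$ the primitive directions of two of the three edges at the vertex. ("General": outside finitely many proper affine subspaces of the space of all $(m_{ij})$.) **Theorem.** If $m_{\rm out}\neq 0$, then for general lines the number of curves is finite, all of them are trivalent, and $N^{\rm trop}_{\mathbf m}(\mathbf w)$ does not depend on the choice. Moreover, for every ray $(\mathfrak d,f_{\mathfrak d})\in\mathrm{Scatter}(\mathfrak D)\setminus\mathfrak D$, $$\log f_{\mathfrak d}=\sum_{\mathbf w}\sum_{\mathbf k}\frac{w_{\rm out}(\mathbf w)\,N^{\rm trop}_{\mathbf m}(\mathbf w)}{|\mathrm{Aut}(\mathbf w,\mathbf k)|}\Bigl(\prod_{1\le i\le n,\ 1\le j\le l_i}a_{ik_{ij}w_{ij}}t_i^{k_{ij}}\Bigr)z^{\sum_i|\mathbf w_i|m_i},$$ where only finitely many summands contribute to the coefficient of any given monomial in $t_1,\dots,t_n$, and * the first sum is over all $n$-tuples of weight vectors with $0\ne\sum_i|\mathbf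 w_i|m_i\in\mathbb R_{\ge0}m_{\mathfrak d}$, where $m_{\mathfrak d}$ is the direction of $\mathfrak d$ (so $\mathbb R_{\ge 0}m_{\mathfrak d}=\mathfrak d$ for a ray starting at the origin); * the second sum is over all $\mathbf k=(\mathbf k_1,\dots,\mathbf k_n)$, $\mathbf k_i=(k_{i1},\dots,k_{il_i})$, of positive integers with $k_{ij}\le k_{i(j+1)}$ if $w_{ij}=w_{i(j+1)}$; * $|\mathrm{Aut}(\mathbf w,\mathbf k)|=\prod_i|\mathrm{Aut}(\mathbf w_i,\mathbf k_i)|$, where $\mathrm{Aut}(\mathbf w_i,\mathbf k_i)$ is the group of permutations of $\{1,\dots,l_i\}$ stabilizing $((w_{i1},k_{i1}),\dots,(w_{il_i},k_{il_i}))$. -/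

import Mathlib

open scoped ContDiff

noncomputable section

namespace TropVertex

/-! ### The lattice and the plane -/

/-- The inclusion of the lattice `M = ℤ²` in the plane `M_ℝ = ℝ²`. -/
def toPlane (u : ℤ × ℤ) : ℝ × ℝ := ((u.1 : ℝ), (u.2 : ℝ))

/-- The index of a nonzero lattice vector `u`: the positive integer `w` with `u = w u'`,
`u'` primitive. -/
def index (u : ℤ × ℤ) : ℕ := Int.gcd u.1 u.2

/-- A lattice vector is primitive if its index is one (in particular it is nonzero). -/
def IsPrimitive (u : ℤ × ℤ) : Prop := index u = 1

/-- The wedge product `⋀² M ≅ ℤ`. -/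
def wedge (u v : ℤ × ℤ) : ℤ := u.1 * v.2 - u.2 * v.1

/-- The wedge product on `M_ℝ`. -/
def wedgeR (u v : ℝ × ℝ) : ℝ := u.1 * v.2 - u.2 * v.1

/-- The pairing `⟨m, ν⟩` of `m ∈ M` with `ν ∈ N = Hom(M, ℤ) = ℤ²` (dual basis). -/
def pairing (m ν : ℤ × ℤ) : ℤ := m.1 * ν.1 + m.2 * ν.2

/-! ### The completed ring, logarithm and automorphisms -/

/-- The ring `𝕜[M] ⊗̂ R` for `R = 𝕜⟦t₁, …, tₙ⟧`, i.e. the limit of the rings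
`𝕜[M] ⊗ R / 𝔪_R^r`: since `n` is finite these are the power series in `t₁, …, tₙ` with
coefficients in the group ring `𝕜[M]` of Laurent polynomials. -/
abbrev CRing (𝕜 : Type*) [Field 𝕜] (n : ℕ) : Type _ :=
  MvPowerSeries (Fin n) (AddMonoidAlgebra 𝕜 (ℤ × ℤ))

section Ring

variable {𝕜 : Type*} [Field 𝕜] {n : ℕ}

/-- The monomial `z^m`. -/
def zpow (𝕜 : Type*) [Field 𝕜] (n : ℕ) (m : ℤ × ℤ) : CRing 𝕜 n :=
  MvPowerSeries.C (AddMonoidAlgebra.single m 1)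

/-- The coefficient in `𝕜` of `t^α z^m`. -/
def coef (α : Fin n →₀ ℕ) (m : ℤ × ℤ) (a : CRing 𝕜 n) : 𝕜 :=
  (MvPowerSeries.coeff α a).coeff m

/-- Congruence modulo `𝔪_R^r`: equality of the coefficients of all `t^α` with `|α| < r`. -/
def CongrMod (r : ℕ) (a b : CRing 𝕜 n) : Prop :=
  ∀ α : Fin n →₀ ℕ, α.degree < r → MvPowerSeries.coeff α a = MvPowerSeries.coeff α b

/-- The logarithm `∑_{j ≥ 1} (-1)^(j+1) (f - 1)^j / j` of a series `f ≡ 1` modulo `𝔪_R`.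
The terms with `j > |α|` do not contribute to the coefficient of `t^α`. -/
def log (f : CRing 𝕜 n) : CRing 𝕜 n := fun α =>
  ∑ j ∈ Finset.Icc 1 α.degree,
    ((-1 : 𝕜) ^ (j + 1) / (j : 𝕜)) • MvPowerSeries.coeff α ((f - 1) ^ j)

/-- The derivation `∂_ν` over `R`, with `∂_ν (z^m) = ⟨m, ν⟩ z^m`. -/
def partialD (ν : ℤ × ℤ) (a : CRing 𝕜 n) : CRing 𝕜 n := fun α =>
  (MvPowerSeries.coeff α a).coeff.sum fun m c =>
    AddMonoidAlgebra.single m (((pairing m ν : ℤ) : 𝕜) * c)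

/-- `exp (g ∂_ν) (a) = ∑_{i ≥ 0} (g ∂_ν)^i (a) / i!` for `g ∈ 𝔪_R (𝕜[M] ⊗̂ R)`.
The terms with `i > |α|` do not contribute to the coefficient of `t^α`. -/
def expD (g : CRing 𝕜 n) (ν : ℤ × ℤ) (a : CRing 𝕜 n) : CRing 𝕜 n := fun α =>
  ∑ i ∈ Finset.range (α.degree + 1),
    ((Nat.factorial i : 𝕜)⁻¹) •
      MvPowerSeries.coeff α ((fun b : CRing 𝕜 n => g * partialD ν b)^[i] a)

/-- `f ∈ 𝕜[z^u] ⊗̂ R` and `f ≡ 1` modulo `z^u 𝔪_R`: only monomials `t^α z^{ju}` with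
`α ≠ 0` and `j ≥ 1` occur in `f - 1`. -/
def IsWallFunction (u : ℤ × ℤ) (f : CRing 𝕜 n) : Prop :=
  ∀ α m, coef α m (f - 1) ≠ 0 → α ≠ 0 ∧ ∃ j : ℕ, 0 < j ∧ m = j • u

end Ring

/-! ### Scattering diagrams -/

/-- A line `base + ℝ dir` or a ray `base + ℝ≥0 dir`, together with its function. The direction is
taken primitive, so that a ray is determined by its support (and conversely). -/
structure Wall (𝕜 : Type*) [Field 𝕜] (n : ℕ) where
  /-- `true` for a ray, `false` for a line -/
  isRay : Bool
  /-- the initial point of a ray, some point of a line -/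
  base : ℝ × ℝ
  /-- the direction -/
  dir : ℤ × ℤ
  dir_primitive : IsPrimitive dir
  /-- the attached function -/
  func : CRing 𝕜 n
  func_mem : IsWallFunction dir func

section Diagrams

variable {𝕜 : Type*} [Field 𝕜] {n : ℕ}

/-- The support of a line or ray. -/
def Wall.support (d : Wall 𝕜 n) : Set (ℝ × ℝ) :=
  {x | ∃ s : ℝ, (d.isRay = true → 0 ≤ s) ∧ x = d.base + s • toPlane d.dir}

/-- The ray `ℝ≥0 dir` from the origin in the direction of the wall; this is the support of a ray
whose initial point is the origin. -/
def Wall.directionRay (d : Wall 𝕜 n) : Set (ℝ × ℝ) :=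
  {x | ∃ s : ℝ, 0 ≤ s ∧ x = s • toPlane d.dir}

/-- The primitive `ν ∈ N` that annihilates the direction of the wall and is positive on the
velocity vector `v` (which is transverse to the wall). -/
def Wall.normal (d : Wall 𝕜 n) (v : ℝ × ℝ) : ℤ × ℤ :=
  if 0 < wedgeR (toPlane d.dir) v then (-d.dir.2, d.dir.1) else (d.dir.2, -d.dir.1)

/-- The automorphism `exp (log f_d ∂_ν)` attached to crossing the wall with velocity `v`. -/
def Wall.theta (d : Wall 𝕜 n) (v : ℝ × ℝ) : CRing 𝕜 n → CRing 𝕜 n :=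
  expD (log d.func) (d.normal v)

/-- A scattering diagram: for every `r`, only finitely many functions are `≢ 1` modulo `𝔪_R^r`. -/
def IsScatteringDiagram (D : Set (Wall 𝕜 n)) : Prop :=
  ∀ r : ℕ, {d ∈ D | ¬ CongrMod r d.func 1}.Finite

/-- `Sing D`: initial points of rays and isolated (zero-dimensional) intersections. -/
def Sing (D : Set (Wall 𝕜 n)) : Set (ℝ × ℝ) :=
  {x | (∃ d ∈ D, d.isRay = true ∧ x = d.base) ∨
    ∃ d₁ ∈ D, ∃ d₂ ∈ D, d₁.support ∩ d₂.support = {x}}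

/-- The velocity of a path parametrized by `[0, 1]`. -/
def velocity (γ : ℝ → ℝ × ℝ) (t : ℝ) : ℝ × ℝ := derivWithin γ (Set.Icc 0 1) t

/-- The paths for which the path ordered product is defined: smooth immersions of `[0, 1]` in the
complement of `Sing D`, with endpoints off the diagram, transverse to all walls. -/
structure IsAdmissiblePath (D : Set (Wall 𝕜 n)) (γ : ℝ → ℝ × ℝ) : Prop where
  smooth : ContDiffOn ℝ ∞ γ (Set.Icc 0 1)
  immersion : ∀ t ∈ Set.Icc (0 : ℝ) 1, velocity γ t ≠ 0
  avoids_sing : ∀ t ∈ Set.Icc (0 : ℝ) 1, γ t ∉ Sing D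
  start_off : ∀ d ∈ D, γ 0 ∉ d.support
  end_off : ∀ d ∈ D, γ 1 ∉ d.support
  transverse : ∀ t ∈ Set.Icc (0 : ℝ) 1, ∀ d ∈ D, γ t ∈ d.support →
    wedgeR (toPlane d.dir) (velocity γ t) ≠ 0

/-- `L` lists, without repetition and in the order of time, all crossings `(t, d)` of the path `γ`
with walls whose function is `≢ 1` modulo `𝔪_R^r`. -/
structure IsCrossingList (D : Set (Wall 𝕜 n)) (γ : ℝ → ℝ × ℝ) (r : ℕ)
    (L : List (ℝ × Wall 𝕜 n)) : Prop where
  nodup : L.Nodup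
  sorted : L.Pairwise fun x y => x.1 ≤ y.1
  mem_iff : ∀ x : ℝ × Wall 𝕜 n, x ∈ L ↔
    x.1 ∈ Set.Ioo (0 : ℝ) 1 ∧ x.2 ∈ D ∧ ¬ CongrMod r x.2.func 1 ∧ γ x.1 ∈ x.2.support

/-- The composition `θ_{d_s} ∘ ⋯ ∘ θ_{d_1}` over a list of crossings (the first one is applied
first). -/
def crossingProduct (γ : ℝ → ℝ × ℝ) (L : List (ℝ × Wall 𝕜 n)) (a : CRing 𝕜 n) : CRing 𝕜 n :=
  L.foldl (fun b x => x.2.theta (velocity γ x.1) b) a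

/-- `Θ` is the path ordered product `θ_{γ, D} = lim_r θ^r_{γ, D}`. -/
def IsPathOrderedProduct (D : Set (Wall 𝕜 n)) (γ : ℝ → ℝ × ℝ)
    (Θ : CRing 𝕜 n → CRing 𝕜 n) : Prop :=
  ∀ (r : ℕ) (L : List (ℝ × Wall 𝕜 n)), IsCrossingList D γ r L →
    ∀ a, CongrMod r (Θ a) (crossingProduct γ L a)

/-- `S` is a diagram `Scatter(D)`: a scattering diagram containing `D`, obtained from `D` by adding
rays only, for which the path ordered product is the identity along every closed loop for which it
is defined. -/
structure IsScatter (D S : Set (Wall 𝕜 n)) : Prop where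
  isScatteringDiagram : IsScatteringDiagram S
  subset : D ⊆ S
  isRay_of_new : ∀ d ∈ S, d ∉ D → d.isRay = true
  consistent : ∀ γ : ℝ → ℝ × ℝ, IsAdmissiblePath S γ → γ 0 = γ 1 → IsPathOrderedProduct S γ id

/-- The diagram has at most one ray in any given direction. -/
def AtMostOneRayPerDirection (S : Set (Wall 𝕜 n)) : Prop :=
  ∀ d₁ ∈ S, ∀ d₂ ∈ S, d₁.isRay = true → d₂.isRay = true → d₁.dir = d₂.dir → d₁ = d₂

end Diagrams

/-- The data of a standard scattering diagram: lines `ℝ mᵢ` through the origin, `mᵢ` primitive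
(repetitions allowed), whose function involves no other variable than `tᵢ`. -/
structure StandardDiagram (𝕜 : Type*) [Field 𝕜] (n : ℕ) where
  /-- the directions -/
  m : Fin n → ℤ × ℤ
  m_primitive : ∀ i, IsPrimitive (m i)
  /-- the functions -/
  f : Fin n → CRing 𝕜 n
  f_mem : ∀ i, IsWallFunction (m i) (f i)
  f_var : ∀ i α, MvPowerSeries.coeff α (f i) ≠ 0 → ∀ j, j ≠ i → α j = 0

section Standard

variable {𝕜 : Type*} [Field 𝕜] {n : ℕ}

/-- The line `(ℝ mᵢ, fᵢ)`. -/
def StandardDiagram.line (D : StandardDiagram 𝕜 n) (i : Fin n) : Wall 𝕜 n where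
  isRay := false
  base := 0
  dir := D.m i
  dir_primitive := D.m_primitive i
  func := D.f i
  func_mem := D.f_mem i

/-- The scattering diagram `{(ℝ mᵢ, fᵢ)}`. -/
def StandardDiagram.walls (D : StandardDiagram 𝕜 n) : Set (Wall 𝕜 n) := Set.range D.line

/-- The coefficients `a_{ijw}` in `log fᵢ = ∑_{j ≥ 1} ∑_{w ≥ 1} w a_{ijw} z^{w mᵢ} tᵢ^j`. -/
def StandardDiagram.a (D : StandardDiagram 𝕜 n) (i : Fin n) (j w : ℕ) : 𝕜 :=
  coef (Finsupp.single i j) (w • D.m i) (log (D.f i)) / (w : 𝕜)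

end Standard

/-! ### Weight vectors -/

/-- A weight vector `0 < w₁ ≤ w₂ ≤ ⋯ ≤ w_l` (of length `l ≥ 0`). -/
structure WeightVector where
  /-- the length -/
  length : ℕ
  /-- the entries -/
  entry : Fin length → ℕ
  entry_pos : ∀ j, 0 < entry j
  entry_mono : Monotone entry

/-- The size `|𝐰ᵢ|`. -/
def WeightVector.size (w : WeightVector) : ℕ := ∑ j, w.entry j

/-- `m_out = ∑ᵢ |𝐰ᵢ| mᵢ`. -/
def outVec {n : ℕ} (m : Fin n → ℤ × ℤ) (w : Fin n → WeightVector) : ℤ × ℤ :=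
  ∑ i, (w i).size • m i

/-- Vectors `𝐤ᵢ` of positive integers, of the length of `𝐰ᵢ`, with `k_j ≤ k_{j+1}` whenever
`w_j = w_{j+1}`. -/
def IsExponentVector (w : WeightVector) (κ : Fin w.length → ℕ) : Prop :=
  (∀ j, 0 < κ j) ∧
    ∀ j j' : Fin w.length, (j : ℕ) + 1 = (j' : ℕ) → w.entry j = w.entry j' → κ j ≤ κ j'

/-- `|Aut(𝐰ᵢ, 𝐤ᵢ)|`: the number of permutations stabilizing `((w₁, k₁), …, (w_l, k_l))`. -/
def autCard (w : WeightVector) (κ : Fin w.length → ℕ) : ℕ :=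
  Nat.card {σ : Equiv.Perm (Fin w.length) //
    ∀ j, w.entry (σ j) = w.entry j ∧ κ (σ j) = κ j}

/-! ### Rational tropical curves -/

/-- A parameterized rational tropical curve `h : Γ → M_ℝ` with at least one vertex, whose unbounded
edges are labelled by `E`.

An edge of weight `w` leaving the vertex `V` in the primitive direction `m` is recorded by the
nonzero lattice vector `w m`; thus `w` is its index. As `Γ` is a tree, its bounded edges form a
simple graph on the set of vertices. The map `h` is determined by the positions of the vertices:
it maps bounded edges to segments and unbounded edges to rays. -/
structure TropCurve (E : Type) [Fintype E] where
  /-- number of vertices of `Γ` -/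
  numVerts : ℕ
  /-- the bounded edges -/
  graph : SimpleGraph (Fin numVerts)
  isTree : graph.IsTree
  /-- the vertex of an unbounded edge -/
  endVertex : E → Fin numVerts
  /-- weight times primitive direction of the bounded edge from the first vertex to the second;
  meaningful for adjacent vertices only -/
  edgeVec : Fin numVerts → Fin numVerts → ℤ × ℤ
  /-- weight times primitive direction of an unbounded edge -/
  endVec : E → ℤ × ℤ
  /-- positions of the vertices -/
  pos : Fin numVerts → ℝ × ℝ
  edgeVec_ne : ∀ u v, graph.Adj u v → edgeVec u v ≠ 0
  edgeVec_symm : ∀ u v, graph.Adj u v → edgeVec v u = - edgeVec u v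
  endVec_ne : ∀ e, endVec e ≠ 0
  /-- the bounded edge from `u` to `v` is embedded, in the direction of its vector -/
  pos_edge : ∀ u v, graph.Adj u v → ∃ s : ℝ, 0 < s ∧ pos v = pos u + s • toPlane (edgeVec u v)
  /-- there are no divalent vertices (and univalent ones do not belong to `Γ`) -/
  valence : ∀ v, 3 ≤ Nat.card ({u // graph.Adj v u} ⊕ {e // endVertex e = v})
  /-- the balancing condition -/
  balanced : ∀ v, (∑ᶠ u : {u // graph.Adj v u}, edgeVec v u.1) +
    (∑ᶠ e : {e // endVertex e = v}, endVec e.1) = 0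

namespace TropCurve

variable {E : Type} [Fintype E]

/-- The edges adjacent to the vertex `v`. -/
abbrev Star (Γ : TropCurve E) (v : Fin Γ.numVerts) : Type :=
  {u // Γ.graph.Adj v u} ⊕ {e // Γ.endVertex e = v}

/-- Weight times primitive direction of an edge emanating from `v`. -/
def starVec (Γ : TropCurve E) (v : Fin Γ.numVerts) : Γ.Star v → ℤ × ℤ :=
  Sum.elim (fun u => Γ.edgeVec v u.1) (fun e => Γ.endVec e.1)

/-- All vertices of `Γ` are trivalent. -/
def IsTrivalent (Γ : TropCurve E) : Prop := ∀ v, Nat.card (Γ.Star v) = 3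

/-- The multiplicity of a vertex. At a trivalent vertex, `w₁ w₂ |m₁ ∧ m₂|` has the same value for
any two of the three edges (and vanishes for twice the same edge); it is the maximum below. -/
def vertexMult (Γ : TropCurve E) (v : Fin Γ.numVerts) : ℕ :=
  ⨆ x : Γ.Star v × Γ.Star v, (wedge (Γ.starVec v x.1) (Γ.starVec v x.2)).natAbs

/-- The multiplicity of a (trivalent) tropical curve. -/
def mult (Γ : TropCurve E) : ℕ := ∏ v, Γ.vertexMult v

/-- Isomorphism of parameterized tropical curves, respecting the labels of the unbounded edges. -/
def Iso (Γ Γ' : TropCurve E) : Prop :=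
  ∃ φ : Fin Γ.numVerts ≃ Fin Γ'.numVerts,
    (∀ u v, Γ'.graph.Adj (φ u) (φ v) ↔ Γ.graph.Adj u v) ∧
    (∀ u v, Γ.graph.Adj u v → Γ'.edgeVec (φ u) (φ v) = Γ.edgeVec u v) ∧
    (∀ e, Γ'.endVertex e = φ (Γ.endVertex e)) ∧
    (∀ e, Γ'.endVec e = Γ.endVec e) ∧
    (∀ v, Γ'.pos (φ v) = Γ.pos v)

theorem Iso.refl (Γ : TropCurve E) : Iso Γ Γ :=
  ⟨Equiv.refl _, by simp⟩

theorem Iso.symm {Γ Γ' : TropCurve E} (h : Iso Γ Γ') : Iso Γ' Γ := by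
  obtain ⟨φ, h1, h2, h3, h4, h5⟩ := h
  refine ⟨φ.symm, fun u v => ?_, fun u v huv => ?_, fun e => ?_, fun e => (h4 e).symm, fun v => ?_⟩
  · rw [← h1]; simp
  · have := h2 (φ.symm u) (φ.symm v) (by rw [← h1]; simpa using huv)
    simpa using this.symm
  · rw [h3]; simp
  · have := h5 (φ.symm v)
    simpa using this.symm

theorem Iso.trans {Γ Γ' Γ'' : TropCurve E} (h : Iso Γ Γ') (h' : Iso Γ' Γ'') : Iso Γ Γ'' := by
  obtain ⟨φ, h1, h2, h3, h4, h5⟩ := h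
  obtain ⟨ψ, g1, g2, g3, g4, g5⟩ := h'
  refine ⟨φ.trans ψ, fun u v => ?_, fun u v huv => ?_, fun e => ?_, fun e => ?_, fun v => ?_⟩
  · simp [g1, h1]
  · simp only [Equiv.trans_apply]
    rw [g2 _ _ ((h1 u v).2 huv), h2 _ _ huv]
  · simp [g3, h3]
  · rw [g4, h4]
  · simp [g5, h5]

instance setoid (E : Type) [Fintype E] : Setoid (TropCurve E) :=
  ⟨Iso, Iso.refl, Iso.symm, Iso.trans⟩

theorem Iso.mult_eq {Γ Γ' : TropCurve E} (h : Iso Γ Γ') : Γ.mult = Γ'.mult := by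
  obtain ⟨φ, h1, h2, h3, h4, h5⟩ := h
  unfold mult
  refine Fintype.prod_equiv φ _ _ fun v => ?_
  unfold vertexMult
  let ψ₁ : {u // Γ.graph.Adj v u} ≃ {u // Γ'.graph.Adj (φ v) u} :=
    φ.subtypeEquiv fun u => (h1 v u).symm
  let ψ₂ : {e // Γ.endVertex e = v} ≃ {e // Γ'.endVertex e = φ v} :=
    (Equiv.refl E).subtypeEquiv fun e => by simp [h3]
  let ψ : Γ.Star v ≃ Γ'.Star (φ v) := Equiv.sumCongr ψ₁ ψ₂
  have hψ : ∀ x, Γ'.starVec (φ v) (ψ x) = Γ.starVec v x := by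
    rintro (u | e)
    · exact h2 v u.1 u.2
    · exact h4 e.1
  refine Equiv.iSup_congr (Equiv.prodCongr ψ ψ) fun x => ?_
  simp [hψ]

end TropCurve

/-- A rational tropical curve: an isomorphism class of parameterized ones. -/
def TropClass (E : Type) [Fintype E] : Type := Quotient (TropCurve.setoid E)

/-- The multiplicity of a tropical curve. -/
def TropClass.mult {E : Type} [Fintype E] (c : TropClass E) : ℕ :=
  Quotient.lift (s := TropCurve.setoid E) TropCurve.mult (fun _ _ h => h.mult_eq) c

/-! ### Tropical counts -/

/-- The labels of the incoming unbounded edges `E_{ij}`. -/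
abbrev InEdge {n : ℕ} (w : Fin n → WeightVector) : Type := (i : Fin n) × Fin (w i).length

/-- A choice of the points `m_{ij} ∈ M_ℝ`, i.e. of lines `𝔡_{ij} = m_{ij} + ℝ mᵢ`. -/
abbrev LineConfig {n : ℕ} (w : Fin n → WeightVector) : Type := InEdge w → ℝ × ℝ

/-- The conditions on the curves that are counted. The unbounded edges are the `E_{ij}`, labelled
`some ⟨i, j⟩`, and `E_out`, labelled `none`. The edge `E_{ij}` has weight `w_{ij}`, the unbounded
direction `-mᵢ` and is mapped into `𝔡_{ij}`; the edge `E_out` points in the direction of `m_out`. -/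
structure IsCounted {n : ℕ} (m : Fin n → ℤ × ℤ) (w : Fin n → WeightVector) (p : LineConfig w)
    (Γ : TropCurve (Option (InEdge w))) : Prop where
  in_vec : ∀ x : InEdge w, Γ.endVec (some x) = -((w x.1).entry x.2 • m x.1)
  in_line : ∀ x : InEdge w, ∃ s : ℝ,
    Γ.pos (Γ.endVertex (some x)) = p x + s • toPlane (m x.1)
  out_dir : ∃ s : ℝ, 0 < s ∧ toPlane (Γ.endVec none) = s • toPlane (outVec m w)

/-- The set of tropical curves that are counted. -/
def countedCurves {n : ℕ} (m : Fin n → ℤ × ℤ) (w : Fin n → WeightVector) (p : LineConfig w) :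
    Set (TropClass (Option (InEdge w))) :=
  {c | ∃ Γ, IsCounted m w p Γ ∧ Quotient.mk (TropCurve.setoid _) Γ = c}

/-- `c` is the number of the tropical curves above, counted with multiplicity, for a general choice
of the lines: outside finitely many proper affine subspaces of the space of choices there are
finitely many curves, all of them trivalent, and the sum of their multiplicities is `c`. -/
def IsTropicalCount {n : ℕ} (m : Fin n → ℤ × ℤ) (w : Fin n → WeightVector) (c : ℕ) : Prop :=
  ∃ B : Set (AffineSubspace ℝ (LineConfig w)), B.Finite ∧ ⊤ ∉ B ∧
    ∀ p : LineConfig w, (∀ H ∈ B, p ∉ H) →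
      (countedCurves m w p).Finite ∧
      (∀ Γ, IsCounted m w p Γ → Γ.IsTrivalent) ∧
      ∑ᶠ x ∈ countedCurves m w p, x.mult = c

open Classical in
/-- The number `N^trop_𝐦(𝐰)`. (The value `0` is used if the count for general lines did not
exist.) -/
def Ntrop {n : ℕ} (m : Fin n → ℤ × ℤ) (w : Fin n → WeightVector) : ℕ :=
  if h : ∃ c, IsTropicalCount m w c then h.choose else 0

/-! ### The terms of the formula -/

section Formula

variable {𝕜 : Type*} [Field 𝕜] {n : ℕ}

/-- The index set of the double sum for the ray `d`: pairs of an `n`-tuple `𝐰` of weight vectors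
with `0 ≠ ∑ᵢ |𝐰ᵢ| mᵢ` on the ray in the direction of `d`, and an `n`-tuple `𝐤` of vectors. -/
def TermIndex (D : StandardDiagram 𝕜 n) (d : Wall 𝕜 n) : Type :=
  (w : {w : Fin n → WeightVector //
      outVec D.m w ≠ 0 ∧ toPlane (outVec D.m w) ∈ d.directionRay}) ×
    {κ : (i : Fin n) → Fin (w.1 i).length → ℕ // ∀ i, IsExponentVector (w.1 i) (κ i)}

/-- The summand
`w_out(𝐰) N^trop_𝐦(𝐰) / |Aut(𝐰, 𝐤)| ⬝ (∏_{i,j} a_{i k_{ij} w_{ij}} tᵢ^{k_{ij}}) ⬝ z^{∑ᵢ |𝐰ᵢ| mᵢ}`. -/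
def term (D : StandardDiagram 𝕜 n) (w : Fin n → WeightVector)
    (κ : (i : Fin n) → Fin (w i).length → ℕ) : CRing 𝕜 n :=
  (((index (outVec D.m w) : 𝕜) * (Ntrop D.m w : 𝕜)) / ((∏ i, autCard (w i) (κ i) : ℕ) : 𝕜)) •
    ((∏ i, ∏ j, D.a i (κ i j) ((w i).entry j) • (MvPowerSeries.X i : CRing 𝕜 n) ^ κ i j) *
      zpow 𝕜 n (outVec D.m w))

end Formula

end TropVertex

end

noncomputable section

namespace TropVertex

/-! ### Ordered products -/

section OrderedProducts

/-! Fix a monomial t^α and introduce α_i variables u_e of square zero for every i. Under the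
substitution t_i = ∑ u_e the coefficient of t^α, times α!, becomes the coefficient of the product of
all u_e, and the substitution is multiplicative (`sqPart_mul`). A wall automorphism turns into the
exponential of a nilpotent operator, a combination of operators u_I z^v ∂_v (`sqMap_expD`). Two of
these have product zero if they share a variable; otherwise their commutator is (v ∧ w) u_(I ∪ J)
z^(v+w) ∂_(v+w) (`wallOp_commutator`), and its coefficient is, up to sign, the multiplicity of a
tropical vertex.

The logarithms of the f_i now split into finitely many elementary terms (`Leaf`). Each term gets a
line of its own, which is moved to general position by choosing its moment. A set T of terms spawns
a wall on the line whose vector and moment are the sums over T. For general moments, the lines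
through a common point are those of J, K and J ∪ K for some disjoint J and K, whenever two disjoint
sets are involved at all (`IsGeneric.eq_or_eq_or_eq`). At such a point the coefficient of J ∪ K has
to jump by the product of the coefficients of J and K and the multiplicity. So the coefficient at a
point of the line of T counts binary trees with leaves T whose root has already been passed
(`countBefore_eq`).

That this is consistent is seen by sweeping the plane with the lines alpha = s, to which no wall is
parallel because √2 is irrational. The ordered product over the walls met by such a line can change
only at intersection points, and there the jump makes up for the commutator (`group_prod_eq`,
`sweep_prod_eq`). Comparing very negative and very positive s gives an identity for a loop at
infinity: the elementary lines occur on both sides, and the rays carry the full tree counts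
(`prod_exp_wallSum`).

A consistent diagram satisfies an identity of the same shape, since a large circle crosses every
relevant wall close to the direction of that wall (`IsScatter.loopProduct`). In this identity the
lines determine the rays: by induction on the number of variables, two solutions differ to leading
order by the sum of the differences of their rays, because the lines cancel (`loopProduct_unique`).
Hence the rays of the diagram are given by tree counts (`wallCoeff_ray`). The same uniqueness,
applied to two general choices of moments, shows that the tree counts do not depend on the choice
(`treeCount_eq_of_isGeneric`).

Tree counts are tropical counts. By balancing, the edge of a curve that collects the ends I lies on
the line of I, so general moments force trivalence, and a curve seen from its out edge is a binary
tree; conversely every good tree is realized by exactly one curve up to isomorphism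
(`count_realized`). Finally, sets of elementary terms are sorted by weights and numbers of
variables. A set of type (𝐰, 𝐤) has |Aut(𝐰, 𝐤)| labellings, which produces the denominator
(`sum_labellings`). The factor w_out appears because ∂_v is w_out times the derivation of the
primitive direction. -/

theorem filter_eq_append_filter_ne {ι β : Type*} [LinearOrder β] (key : ι → β) (b : β)
    (L : List ι) (hb : ∀ a ∈ L, b ≤ key a) (hL : L.Pairwise fun x y => key x ≤ key y) :
    L.filter (fun a => key a = b) ++ L.filter (fun a => ¬ key a = b) = L := by
  induction L with
  | nil => rfl
  | cons a L ih =>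
    rw [List.pairwise_cons] at hL
    have ih' := ih (fun x hx => hb x (List.mem_cons_of_mem _ hx)) hL.2
    by_cases h : key a = b
    · simp [h] at ih' ⊢
      exact ih'
    · have hlt : b < key a := lt_of_le_of_ne (hb a (by simp)) (Ne.symm h)
      have h1 : L.filter (fun a => key a = b) = [] := by
        rw [List.filter_eq_nil_iff]
        intro x hx
        have := hL.1 x hx
        simpa using (lt_of_lt_of_le hlt this).ne'
      rw [h1] at ih'
      simp only [List.nil_append] at ih'
      simp [h, h1]
      intro x hx
      exact (lt_of_lt_of_le hlt (hL.1 x hx)).ne'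

/-- A product over a list sorted by a key is the product over the keys of the products over the
fibres. -/
theorem prod_map_eq_prod_fibers {ι A β : Type*} [Monoid A] [LinearOrder β] (key : ι → β)
    (f : ι → A) (K : List β) (hK : K.Pairwise (· < ·)) (L : List ι) (hmem : ∀ a ∈ L, key a ∈ K)
    (hL : L.Pairwise fun x y => key x ≤ key y) :
    (L.map f).prod =
      (K.map fun b => ((L.filter fun a => key a = b).map f).prod).prod := by
  induction K generalizing L with
  | nil =>
    have : L = [] := List.eq_nil_iff_forall_not_mem.2 fun a ha => by simpa using hmem a ha
    simp [this]
  | cons b K ih =>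
    rw [List.pairwise_cons] at hK
    have hb : ∀ a ∈ L, b ≤ key a := fun a ha => by
      rcases List.mem_cons.1 (hmem a ha) with h | h
      · exact h.ge
      · exact (hK.1 _ h).le
    conv_lhs => rw [← filter_eq_append_filter_ne key b L hb hL]
    rw [List.map_append, List.prod_append, List.map_cons, List.prod_cons]
    congr 1
    rw [ih hK.2 (L.filter fun a => ¬ key a = b)]
    · congr 1
      refine List.map_congr_left fun c hc => ?_
      rw [List.filter_filter]
      congr 2
      refine List.filter_congr fun a _ => ?_
      have : c ≠ b := (hK.1 c hc).ne'
      by_cases h : key a = c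
      · simp [h, this]
      · simp [h]
    · intro a ha
      rw [List.mem_filter] at ha
      rcases List.mem_cons.1 (hmem a ha.1) with h | h
      · simp [h] at ha
      · exact h
    · exact hL.sublist List.filter_sublist

/-- Nothing beyond first order survives, so the order of the factors is irrelevant. This is the
situation of walls any two of which share a variable. -/
theorem prod_one_add_of_mul_eq_zero {ι A : Type*} [Ring A] (x : ι → A) (L : List ι)
    (hL : L.Pairwise fun a b => x a * x b = 0) :
    (L.map fun a => 1 + x a).prod = 1 + (L.map x).sum := by
  induction L with
  | nil => simp
  | cons a L ih =>
    rw [List.pairwise_cons] at hL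
    have h0 : x a * (L.map x).sum = 0 := by
      rw [← List.sum_map_mul_left]
      exact List.sum_eq_zero fun y hy => by
        obtain ⟨b, hb, rfl⟩ := List.mem_map.1 hy
        exact hL.1 b hb
    have e : ∀ y s : A, (1 + y) * (1 + s) = 1 + (y + s) + y * s := fun y s => by noncomm_ring
    rw [List.map_cons, List.prod_cons, ih hL.2, List.map_cons, List.sum_cons, e, h0, add_zero]

variable {A : Type*} [Ring A] [Module ℚ A]

theorem exp_eq_one_add {x : A} (h : x * x = 0) : IsNilpotent.exp x = 1 + x := by
  rw [IsNilpotent.exp_eq_sum (k := 2) (by rw [pow_two, h])]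
  simp [Finset.sum_range_succ]

theorem isNilpotent_list_sum {ι A : Type*} [Ring A] (z : ι → A) (L : List ι)
    (hn : ∀ a ∈ L, IsNilpotent (z a)) (hc : ∀ a ∈ L, ∀ b ∈ L, Commute (z a) (z b)) :
    IsNilpotent (L.map z).sum := by
  induction L with
  | nil => simp
  | cons a L ih =>
    rw [List.map_cons, List.sum_cons]
    refine Commute.isNilpotent_add ?_ (hn a (by simp)) (ih (fun b hb => hn b (by simp [hb]))
      fun b hb c hc' => hc b (by simp [hb]) c (by simp [hc']))
    refine Commute.list_sum_right _ _ fun y hy => ?_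
    obtain ⟨b, hb, rfl⟩ := List.mem_map.1 hy
    exact hc a (by simp) b (by simp [hb])

theorem prod_exp_eq_exp_sum {ι : Type*} (z : ι → A) (L : List ι)
    (hn : ∀ a ∈ L, IsNilpotent (z a)) (hc : ∀ a ∈ L, ∀ b ∈ L, Commute (z a) (z b)) :
    (L.map fun a => IsNilpotent.exp (z a)).prod = IsNilpotent.exp (L.map z).sum := by
  induction L with
  | nil => simp [IsNilpotent.exp_zero]
  | cons a L ih =>
    have h1 : ∀ b ∈ L, IsNilpotent (z b) := fun b hb => hn b (by simp [hb])
    have h2 : ∀ b ∈ L, ∀ c ∈ L, Commute (z b) (z c) :=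
      fun b hb c hc' => hc b (by simp [hb]) c (by simp [hc'])
    rw [List.map_cons, List.prod_cons, ih h1 h2, List.map_cons, List.sum_cons,
      IsNilpotent.exp_add_of_commute _ (hn a (by simp)) (isNilpotent_list_sum z L h1 h2)]
    refine Commute.list_sum_right _ _ fun y hy => ?_
    obtain ⟨b, hb, rfl⟩ := List.mem_map.1 hy
    exact hc a (by simp) b (by simp [hb])

end OrderedProducts

/-! ### Products of exponentials in a filtered ring -/

section Filtration

variable {A : Type*} [Ring A] [Module ℚ A]

/-- A descending multiplicative filtration that reaches zero. -/
structure IsNilFiltration (N : ℕ → Submodule ℚ A) : Prop where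
  anti : Antitone N
  one_mem : (1 : A) ∈ N 0
  mul_mem : ∀ {j k : ℕ} {a b : A}, a ∈ N j → b ∈ N k → a * b ∈ N (j + k)
  exists_eq_bot : ∃ M, N M = ⊥

namespace IsNilFiltration

variable {N : ℕ → Submodule ℚ A} (hN : IsNilFiltration N)
include hN

theorem pow_mem {z : A} (hz : z ∈ N 1) (i : ℕ) : z ^ i ∈ N i := by
  induction i with
  | zero => simpa using hN.one_mem
  | succ i ih => rw [pow_succ]; exact hN.mul_mem ih hz

theorem isNilpotent {z : A} (hz : z ∈ N 1) : IsNilpotent z := by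
  obtain ⟨M, hM⟩ := hN.exists_eq_bot
  refine ⟨M, ?_⟩
  have := hN.pow_mem hz M
  rwa [hM, Submodule.mem_bot] at this

/-- Telescoping: from the second power on, each summand has a factor of order k and at least one
further factor of order 1. -/
theorem pow_sub_pow_mem {k : ℕ} {z z' : A} (hz : z ∈ N 1) (hz' : z' ∈ N 1) (h : z - z' ∈ N k)
    (i : ℕ) : z ^ (i + 2) - z' ^ (i + 2) ∈ N (k + 1) := by
  have key : ∀ j : ℕ, z ^ (j + 1) - z' ^ (j + 1) ∈ N k → 
      z ^ (j + 2) - z' ^ (j + 2) ∈ N (k + 1) := fun j hj => by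
    have : z ^ (j + 2) - z' ^ (j + 2) =
        z ^ (j + 1) * (z - z') + (z ^ (j + 1) - z' ^ (j + 1)) * z' := by
      rw [pow_succ z (j + 1), pow_succ z' (j + 1)]; noncomm_ring
    rw [this]
    refine add_mem ?_ (hN.mul_mem hj hz')
    rw [add_comm k 1]
    exact hN.mul_mem (hN.anti (by omega) (hN.pow_mem hz (j + 1))) h
  induction i with
  | zero => exact key 0 (by simpa using h)
  | succ i ih => exact key (i + 1) (hN.anti (by omega) ih)

/-- Only the linear terms of the exponentials differ in order k; differences of higher powers gain
another order. -/
theorem exp_sub_exp_mem {k : ℕ} {z z' : A} (hz : z ∈ N 1) (hz' : z' ∈ N 1) (h : z - z' ∈ N k) :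
    IsNilpotent.exp z - IsNilpotent.exp z' - (z - z') ∈ N (k + 1) := by
  obtain ⟨M, hM⟩ := hN.exists_eq_bot
  have hzero : ∀ y ∈ N 1, y ^ (M + 2) = 0 := fun y hy => by
    have := hN.anti (show M ≤ M + 2 by omega) (hN.pow_mem hy (M + 2))
    rwa [hM, Submodule.mem_bot] at this
  rw [IsNilpotent.exp_eq_sum (hzero z hz), IsNilpotent.exp_eq_sum (hzero z' hz'),
    Finset.sum_range_succ', Finset.sum_range_succ', Finset.sum_range_succ', Finset.sum_range_succ']
  have : ∀ a b c : A, ∀ d d' : A, a + d + c - (b + d' + c) - (d - d') = a - b := by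
    intros; abel
  simp only [zero_add, pow_one, pow_zero, Nat.factorial_one, Nat.factorial_zero, Nat.cast_one,
    inv_one, one_smul]
  rw [this, ← Finset.sum_sub_distrib]
  refine Submodule.sum_mem _ fun i _ => ?_
  rw [← smul_sub]
  exact Submodule.smul_mem _ _ (hN.pow_sub_pow_mem hz hz' h i)

theorem exp_sub_one_mem {z : A} (hz : z ∈ N 1) : IsNilpotent.exp z - 1 ∈ N 1 := by
  have := hN.exp_sub_exp_mem (k := 0) hz (Submodule.zero_mem _)
    (hN.anti (Nat.zero_le 1) (by simpa using hz))
  rw [IsNilpotent.exp_zero, sub_zero] at this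
  have h2 := add_mem this hz
  rwa [sub_add_cancel] at h2

theorem prod_exp_sub_one_mem {ι : Type*} (z : ι → A) (L : List ι) (hz : ∀ a ∈ L, z a ∈ N 1) :
    (L.map fun a => IsNilpotent.exp (z a)).prod - 1 ∈ N 1 := by
  induction L with
  | nil => simp
  | cons a L ih =>
    rw [List.map_cons, List.prod_cons]
    set P := (L.map fun a => IsNilpotent.exp (z a)).prod
    have h1 := ih fun b hb => hz b (by simp [hb])
    have h2 := hN.exp_sub_one_mem (hz a (by simp))
    have : IsNilpotent.exp (z a) * P - 1 = (IsNilpotent.exp (z a) - 1) * (P - 1)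
        + (IsNilpotent.exp (z a) - 1) + (P - 1) := by noncomm_ring
    rw [this]
    exact add_mem (add_mem (hN.anti (by omega) (hN.mul_mem h2 h1)) h2) h1

/-- Two ordered products of exponentials whose exponents agree up to order `k` differ by the sum of
the differences of the exponents, up to order `k + 1`. -/
theorem prod_exp_sub_prod_exp_mem {ι : Type*} {k : ℕ} (z z' : ι → A) (L : List ι)
    (hz : ∀ a ∈ L, z a ∈ N 1) (hz' : ∀ a ∈ L, z' a ∈ N 1) (h : ∀ a ∈ L, z a - z' a ∈ N k) :
    (L.map fun a => IsNilpotent.exp (z a)).prod - (L.map fun a => IsNilpotent.exp (z' a)).prod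
      - (L.map fun a => z a - z' a).sum ∈ N (k + 1) := by
  induction L with
  | nil => simp
  | cons a L ih =>
    have hz1 : ∀ b ∈ L, z b ∈ N 1 := fun b hb => hz b (by simp [hb])
    have hz1' : ∀ b ∈ L, z' b ∈ N 1 := fun b hb => hz' b (by simp [hb])
    have hL : ∀ b ∈ L, z b - z' b ∈ N k := fun b hb => h b (by simp [hb])
    have ih := ih hz1 hz1' hL
    have hP := hN.prod_exp_sub_one_mem z L hz1
    have he := hN.exp_sub_exp_mem (hz a (by simp)) (hz' a (by simp)) (h a (by simp))
    have he' := hN.exp_sub_one_mem (hz' a (by simp))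
    have hd := h a (by simp)
    have hS : (L.map fun a => z a - z' a).sum ∈ N k :=
      list_sum_mem fun y hy => by
        obtain ⟨b, hb, rfl⟩ := List.mem_map.1 hy
        exact hL b hb
    simp only [List.map_cons, List.prod_cons, List.sum_cons]
    set P := (L.map fun a => IsNilpotent.exp (z a)).prod
    set P' := (L.map fun a => IsNilpotent.exp (z' a)).prod
    set S := (L.map fun a => z a - z' a).sum
    set x := IsNilpotent.exp (z a)
    set x' := IsNilpotent.exp (z' a)
    set d := z a - z' a
    have hxx : x - x' ∈ N k := by
      have := add_mem (hN.anti (Nat.le_succ k) he) hd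
      rwa [sub_add_cancel] at this
    have hPP : P - P' ∈ N k := by
      have := add_mem (hN.anti (Nat.le_succ k) ih) hS
      rwa [sub_add_cancel] at this
    -- Beyond the two errors already controlled, only products of a factor of order k with a factor
    -- of order 1 remain.
    have e : x * P - x' * P' - (d + S) = (x - x' - d) + (P - P' - S) + (x - x') * (P - 1)
        + (x' - 1) * (P - P') := by noncomm_ring
    rw [e]
    refine add_mem (add_mem (add_mem he ih) (hN.mul_mem hxx hP)) ?_
    rw [add_comm k 1]
    exact hN.mul_mem he' hPP

end IsNilFiltration

end Filtration

/-! ### Linear coordinates on the plane -/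

/-- A linear form on the plane that vanishes at no nonzero lattice vector. -/
def alpha (x : ℝ × ℝ) : ℝ := √2 * x.1 - x.2

/-- A linear form on the plane, independent of `alpha`. -/
def beta (x : ℝ × ℝ) : ℝ := x.1 + √2 * x.2

theorem sqrt_two_mul_self : √2 * √2 = (2 : ℝ) := Real.mul_self_sqrt (by norm_num)

theorem alpha_add (x y : ℝ × ℝ) : alpha (x + y) = alpha x + alpha y := by
  simp [alpha]; ring

theorem beta_add (x y : ℝ × ℝ) : beta (x + y) = beta x + beta y := by
  simp [beta]; ring

theorem alpha_smul (s : ℝ) (x : ℝ × ℝ) : alpha (s • x) = s * alpha x := by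
  simp [alpha]; ring

theorem beta_smul (s : ℝ) (x : ℝ × ℝ) : beta (s • x) = s * beta x := by
  simp [beta]; ring

/-- The determinant of (alpha, beta) is √2 · √2 + 1 = 3. -/
theorem three_mul_wedgeR (x y : ℝ × ℝ) :
    3 * wedgeR x y = alpha x * beta y - beta x * alpha y := by
  simp only [alpha, beta, wedgeR]
  linear_combination (-x.1 * y.2 + x.2 * y.1) * sqrt_two_mul_self

theorem toPlane_add (u v : ℤ × ℤ) : toPlane (u + v) = toPlane u + toPlane v := by
  simp [toPlane]

theorem toPlane_neg (u : ℤ × ℤ) : toPlane (-u) = -toPlane u := by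
  simp [toPlane]

theorem toPlane_nsmul (k : ℕ) (u : ℤ × ℤ) : toPlane (k • u) = (k : ℝ) • toPlane u := by
  simp [toPlane]

theorem wedgeR_toPlane (u v : ℤ × ℤ) : wedgeR (toPlane u) (toPlane v) = (wedge u v : ℝ) := by
  simp [wedgeR, toPlane, wedge]

/-- Irrationality of √2. Consequently the sweep lines alpha = s are transverse to every wall, and
each wall points to a definite side. -/
theorem alpha_toPlane_ne_zero {u : ℤ × ℤ} (hu : u ≠ 0) : alpha (toPlane u) ≠ 0 := by
  intro h
  simp only [alpha, toPlane] at h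
  by_cases h1 : u.1 = 0
  · rw [h1] at h
    simp at h
    exact hu (Prod.ext h1 h)
  · have h1' : (u.1 : ℝ) ≠ 0 := by exact_mod_cast h1
    have : √2 = ((u.2 / u.1 : ℚ) : ℝ) := by
      push_cast
      field_simp
      linarith
    exact irrational_sqrt_two ⟨_, this.symm⟩

/-- The slope of a vector in the coordinates `alpha`, `beta`. -/
def slope (x : ℝ × ℝ) : ℝ := beta x / alpha x

theorem slope_smul {s : ℝ} (hs : s ≠ 0) (x : ℝ × ℝ) : slope (s • x) = slope x := by
  rw [slope, slope, alpha_smul, beta_smul, mul_div_mul_left _ _ hs]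

theorem three_mul_wedgeR_eq_slope {x y : ℝ × ℝ} (hx : alpha x ≠ 0) (hy : alpha y ≠ 0) :
    3 * wedgeR x y = alpha x * alpha y * (slope y - slope x) := by
  rw [three_mul_wedgeR, slope, slope]
  field_simp

theorem wedge_eq_zero_of_slope_eq {u v : ℤ × ℤ} (hu : u ≠ 0) (hv : v ≠ 0)
    (h : slope (toPlane u) = slope (toPlane v)) : wedge u v = 0 := by
  have := three_mul_wedgeR_eq_slope (alpha_toPlane_ne_zero hu) (alpha_toPlane_ne_zero hv)
  rw [h, wedgeR_toPlane] at this
  have h3 : (wedge u v : ℝ) = 0 := by linarith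
  exact_mod_cast h3

theorem slope_eq_of_wedge_eq_zero {u v : ℤ × ℤ} (hu : u ≠ 0) (hv : v ≠ 0)
    (h : wedge u v = 0) : slope (toPlane u) = slope (toPlane v) := by
  have h1 := alpha_toPlane_ne_zero hu
  have h2 := alpha_toPlane_ne_zero hv
  have := three_mul_wedgeR_eq_slope h1 h2
  rw [wedgeR_toPlane, h] at this
  simp [h1, h2] at this
  linarith

theorem wedge_comm (u v : ℤ × ℤ) : wedge u v = - wedge v u := by simp [wedge]; ring

theorem wedge_self (u : ℤ × ℤ) : wedge u u = 0 := by unfold wedge; ring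

theorem wedge_add_left (u v w : ℤ × ℤ) : wedge (u + v) w = wedge u w + wedge v w := by
  simp [wedge]; ring

theorem wedge_add_right (u v w : ℤ × ℤ) : wedge u (v + w) = wedge u v + wedge u w := by
  simp [wedge]; ring

theorem wedge_zero_left (u : ℤ × ℤ) : wedge 0 u = 0 := by simp [wedge]

theorem wedge_zero_right (u : ℤ × ℤ) : wedge u 0 = 0 := by simp [wedge]

/-! ### The operators `u_I z^v ∂` -/

section Operators

variable {E : Type*} [DecidableEq E] (𝕜 : Type*) [Field 𝕜]

/-- The `𝕜`-linear functions that model `𝕜[u_e]/(u_e²) ⊗ 𝕜[M]`. -/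
abbrev SqModule (E 𝕜 : Type*) : Type _ := Finset E → ℤ × ℤ → 𝕜

/-- The operator `u_I z^v ∂`, where `∂ z^m = (v ∧ m) z^m`. -/
def wallOp (I : Finset E) (v : ℤ × ℤ) : Module.End 𝕜 (SqModule E 𝕜) where
  toFun f A m := if I ⊆ A then ((wedge v m : ℤ) : 𝕜) * f (A \ I) (m - v) else 0
  map_add' f g := by
    ext A m
    by_cases h : I ⊆ A <;> simp [h, mul_add]
  map_smul' c f := by
    ext A m
    by_cases h : I ⊆ A <;> simp [h, mul_left_comm]

variable {𝕜}

theorem wallOp_apply (I : Finset E) (v : ℤ × ℤ) (f : SqModule E 𝕜) (A : Finset E) (m : ℤ × ℤ) :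
    wallOp 𝕜 I v f A m =
      if I ⊆ A then ((wedge v m : ℤ) : 𝕜) * f (A \ I) (m - v) else 0 := rfl

theorem wallOp_mul_of_not_disjoint {I J : Finset E} (h : ¬ Disjoint I J) (v w : ℤ × ℤ) :
    wallOp 𝕜 I v * wallOp 𝕜 J w = 0 := by
  ext f A m
  rw [Module.End.mul_apply, wallOp_apply, wallOp_apply]
  have : ¬ J ⊆ A \ I := fun hJ => h (by
    rw [Finset.disjoint_left]
    intro x hx hxJ
    exact (Finset.mem_sdiff.1 (hJ hxJ)).2 hx)
  simp [this]

theorem wallOp_mul_apply {I J : Finset E} (h : Disjoint I J) (v w : ℤ × ℤ) (f : SqModule E 𝕜)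
    (A : Finset E) (m : ℤ × ℤ) :
    (wallOp 𝕜 I v * wallOp 𝕜 J w) f A m = if I ∪ J ⊆ A then
      ((wedge v m * wedge w (m - v) : ℤ) : 𝕜) * f (A \ (I ∪ J)) (m - (v + w)) else 0 := by
  rw [Module.End.mul_apply, wallOp_apply, wallOp_apply]
  have e : J ⊆ A \ I ↔ J ⊆ A :=
    ⟨fun hJ => hJ.trans Finset.sdiff_subset, fun hJ => Finset.subset_sdiff.2 ⟨hJ, h.symm⟩⟩
  simp only [e, Finset.union_subset_iff]
  have e2 : (A \ I) \ J = A \ (I ∪ J) := by rw [sdiff_sdiff]; rfl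
  rw [e2, sub_sub]
  by_cases h1 : I ⊆ A <;> by_cases h2 : J ⊆ A <;> simp [h1, h2, mul_assoc]

/-- This is the bracket of the Lie algebra of the tropical vertex group. It rests on the identity (v
∧ m)(w ∧ (m - v)) - (w ∧ m)(v ∧ (m - w)) = (v ∧ w)((v + w) ∧ m). -/
theorem wallOp_commutator {I J : Finset E} (h : Disjoint I J) (v w : ℤ × ℤ) :
    wallOp 𝕜 I v * wallOp 𝕜 J w - wallOp 𝕜 J w * wallOp 𝕜 I v =
      (wedge v w) • wallOp 𝕜 (I ∪ J) (v + w) := by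
  ext f A m
  rw [LinearMap.sub_apply, Pi.sub_apply, Pi.sub_apply, wallOp_mul_apply h, wallOp_mul_apply h.symm,
    Finset.union_comm J I, add_comm w v, LinearMap.smul_apply, Pi.smul_apply, Pi.smul_apply,
    wallOp_apply]
  by_cases h1 : I ∪ J ⊆ A
  · simp only [h1, if_true]
    rw [← sub_mul, zsmul_eq_mul, ← mul_assoc]
    congr 1
    norm_cast
    simp only [wedge, Prod.fst_sub, Prod.snd_sub, Prod.fst_add, Prod.snd_add]
    ring
  · simp [h1]

variable (E 𝕜) [CharZero 𝕜]

/-- The operators that lower the subset by at least `k` elements. -/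
def loweringFiltration (k : ℕ) : Submodule ℚ (Module.End 𝕜 (SqModule E 𝕜)) where
  carrier := {T | ∀ (A : Finset E) (f : SqModule E 𝕜),
    (∀ B ⊆ A, B.card + k ≤ A.card → f B = 0) → T f A = 0}
  add_mem' {S T} hS hT A f hf := by
    rw [LinearMap.add_apply, Pi.add_apply, hS A f hf, hT A f hf, add_zero]
  zero_mem' A f _ := rfl
  smul_mem' q T hT A f hf := by
    rw [LinearMap.smul_apply, Pi.smul_apply, hT A f hf, smul_zero]

variable {E 𝕜}

theorem wallOp_mem {k : ℕ} {I : Finset E} (hI : k ≤ I.card) (v : ℤ × ℤ) :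
    wallOp 𝕜 I v ∈ loweringFiltration E 𝕜 k := by
  intro A f hf
  ext m
  rw [wallOp_apply]
  split_ifs with h
  · rw [hf (A \ I) Finset.sdiff_subset]
    · simp
    · have := Finset.card_sdiff_add_card_eq_card h
      omega
  · rfl

theorem sub_smul_operator (a b : 𝕜) (T : Module.End 𝕜 (SqModule E 𝕜)) :
    a • T - b • T = (a - b) • T := by
  refine LinearMap.ext fun f => ?_
  simp [sub_smul]

theorem smul_mem_loweringFiltration {k : ℕ} {T : Module.End 𝕜 (SqModule E 𝕜)} (c : 𝕜)
    (hT : T ∈ loweringFiltration E 𝕜 k) : c • T ∈ loweringFiltration E 𝕜 k := by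
  intro A f hf
  rw [LinearMap.smul_apply, Pi.smul_apply, hT A f hf, smul_zero]

theorem isNilFiltration [Fintype E] : IsNilFiltration (loweringFiltration E 𝕜) where
  anti j k hjk T hT A f hf := hT A f fun B hB h => hf B hB (by omega)
  one_mem A f hf := hf A subset_rfl (by omega)
  mul_mem {j k S T} hS hT A f hf := by
    rw [Module.End.mul_apply]
    exact hS A _ fun B hB h => hT B f fun C hC h' => hf C (hC.trans hB) (by omega)
  exists_eq_bot := by
    -- No set of labels can lose more than `Fintype.card E` elements.
    refine ⟨Fintype.card E + 1, ?_⟩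
    rw [Submodule.eq_bot_iff]
    intro T hT
    refine LinearMap.ext fun f => funext fun A => ?_
    rw [hT A f fun B _ h => by
      have := Finset.card_le_univ A
      omega]
    rfl

/-- The monomial `z^m`. -/
def monomialVec (m : ℤ × ℤ) : SqModule E 𝕜 :=
  fun A m' => if A = ∅ ∧ m' = m then 1 else 0

end Operators

/-! ### Uniqueness in the loop identity -/

section Uniqueness

variable {E : Type*} [Fintype E] [DecidableEq E] {𝕜 : Type*} [Field 𝕜] [CharZero 𝕜]

/-- The sign of `alpha` at a lattice vector. -/
def orient (v : ℤ × ℤ) : ℤ := if 0 < alpha (toPlane v) then 1 else -1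

/-- The exponent for the walls of slope `b` on the side of the plane given by the sign of `alpha`
(`true` for positive). The lines `l` are crossed on both sides and the rays `X` on the side to
which they point. -/
def sideExponent (P : Finset (ℤ × ℤ)) (l X : Finset E → ℤ × ℤ → 𝕜) (side : Bool) (b : ℝ) :
    Module.End 𝕜 (SqModule E 𝕜) :=
  ∑ I ∈ Finset.univ.erase ∅, ∑ v ∈ P with slope (toPlane v) = b,
    ((orient v : 𝕜) * (l I v + if decide (0 < alpha (toPlane v)) = side then X I v else 0)) •
      wallOp 𝕜 I v

/-- The path ordered product along a loop at infinity; `K` lists the slopes in descending order. -/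
def loopProduct (K : List ℝ) (P : Finset (ℤ × ℤ)) (l X : Finset E → ℤ × ℤ → 𝕜) :
    Module.End 𝕜 (SqModule E 𝕜) :=
  (K.map fun b => IsNilpotent.exp (-sideExponent P l X false b)).prod *
    (K.map fun b => IsNilpotent.exp (sideExponent P l X true b)).prod

theorem sideExponent_mem (P : Finset (ℤ × ℤ)) (l X : Finset E → ℤ × ℤ → 𝕜) (side : Bool)
    (b : ℝ) : sideExponent P l X side b ∈ loweringFiltration E 𝕜 1 :=
  Submodule.sum_mem _ fun _ hI => Submodule.sum_mem _ fun _ _ =>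
    smul_mem_loweringFiltration _ (wallOp_mem
      (Finset.card_pos.2 (Finset.nonempty_iff_ne_empty.2 (Finset.ne_of_mem_erase hI))) _)

theorem loopProduct_eq (K : List ℝ) (P : Finset (ℤ × ℤ)) (l X : Finset E → ℤ × ℤ → 𝕜) :
    loopProduct K P l X = ((K.map (Prod.mk false) ++ K.map (Prod.mk true)).map fun y : Bool × ℝ =>
      IsNilpotent.exp (cond y.1 (sideExponent P l X true y.2)
        (-sideExponent P l X false y.2))).prod := by
  simp [loopProduct, Function.comp_def]

theorem sideExponent_sub_mem {k : ℕ} (P : Finset (ℤ × ℤ)) (l X X' : Finset E → ℤ × ℤ → 𝕜)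
    (h : ∀ I : Finset E, I.Nonempty → I.card < k → ∀ v ∈ P, X I v = X' I v) (side : Bool)
    (b : ℝ) : sideExponent P l X side b - sideExponent P l X' side b ∈
      loweringFiltration E 𝕜 k := by
  unfold sideExponent
  rw [← Finset.sum_sub_distrib]
  refine Submodule.sum_mem _ fun I hI => ?_
  rw [← Finset.sum_sub_distrib]
  refine Submodule.sum_mem _ fun v hv => ?_
  rw [sub_smul_operator]
  by_cases hk : I.card < k
  · rw [h I (Finset.nonempty_iff_ne_empty.2 (Finset.ne_of_mem_erase hI)) hk v
      (Finset.mem_filter.1 hv).1, sub_self, zero_smul]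
    exact Submodule.zero_mem _
  · exact smul_mem_loweringFiltration _ (wallOp_mem (not_lt.1 hk) _)

/-- The lines cancel in each difference. A ray occurs on one side only: for positive alpha with
orientation 1, for negative alpha with orientation -1, which the minus sign in front of the second
difference undoes. -/
theorem sum_sideExponent_sub (K : List ℝ) (hK : K.Nodup) (P : Finset (ℤ × ℤ))
    (hKP : ∀ v ∈ P, slope (toPlane v) ∈ K) (l X X' : Finset E → ℤ × ℤ → 𝕜) :
    (K.map fun b => (sideExponent P l X true b - sideExponent P l X' true b) -
      (sideExponent P l X false b - sideExponent P l X' false b)).sum =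
    ∑ I ∈ Finset.univ.erase ∅, ∑ v ∈ P, (X I v - X' I v) • wallOp 𝕜 I v := by
  classical
  have h1 : ∀ b, (sideExponent P l X true b - sideExponent P l X' true b) -
      (sideExponent P l X false b - sideExponent P l X' false b) =
      ∑ I ∈ Finset.univ.erase ∅, ∑ v ∈ P with slope (toPlane v) = b,
        (X I v - X' I v) • wallOp 𝕜 I v := by
    intro b
    simp only [sideExponent, ← Finset.sum_sub_distrib, sub_smul_operator]
    refine Finset.sum_congr rfl fun I _ => Finset.sum_congr rfl fun v _ => ?_
    congr 1
    by_cases h : 0 < alpha (toPlane v)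
    · simp [h, orient]
    · simp [h, orient]
      ring
  simp only [h1]
  rw [← List.sum_toFinset _ hK, Finset.sum_comm]
  refine Finset.sum_congr rfl fun I _ => ?_
  rw [Finset.sum_fiberwise_of_maps_to]
  intro v hv
  simpa using hKP v hv

theorem exists_wedge_ne_zero {v : ℤ × ℤ} (hv : v ≠ 0) : ∃ m, wedge v m ≠ 0 := by
  by_cases h : v.1 = 0
  · refine ⟨(1, 0), ?_⟩
    have : v.2 ≠ 0 := fun h2 => hv (Prod.ext h h2)
    simpa [wedge] using this
  · exact ⟨(0, 1), by simpa [wedge] using h⟩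

/-- The rays are determined by the lines, if the loop at infinity acts trivially. -/
theorem loopProduct_unique (K : List ℝ) (hK : K.Nodup) (P : Finset (ℤ × ℤ)) (hP : 0 ∉ P)
    (hKP : ∀ v ∈ P, slope (toPlane v) ∈ K) (l X X' : Finset E → ℤ × ℤ → 𝕜)
    (h : ∀ m, loopProduct K P l X (monomialVec m) = monomialVec m)
    (h' : ∀ m, loopProduct K P l X' (monomialVec m) = monomialVec m) :
    ∀ I : Finset E, I.Nonempty → ∀ v ∈ P, X I v = X' I v := by
  -- Induction on the order: once the rays agree on sets with fewer than k labels, the two loop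
  -- products differ in order k by the sum of the differences of the rays.
  suffices key : ∀ k, ∀ I : Finset E, I.Nonempty → I.card < k → ∀ v ∈ P, X I v = X' I v from
    fun I hI => key _ I hI (Nat.lt_succ_self _)
  intro k
  induction k with
  | zero => intro I _ h; omega
  | succ k ih =>
  intro I hI hIk v hv
  rcases Nat.lt_succ_iff_lt_or_eq.1 hIk with hlt | heq
  · exact ih I hI hlt v hv
  have hF := isNilFiltration (E := E) (𝕜 := 𝕜)
  have hd := hF.prod_exp_sub_prod_exp_mem (k := k)
    (fun y : Bool × ℝ => cond y.1 (sideExponent P l X true y.2) (-sideExponent P l X false y.2))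
    (fun y : Bool × ℝ => cond y.1 (sideExponent P l X' true y.2) (-sideExponent P l X' false y.2))
    (K.map (Prod.mk false) ++ K.map (Prod.mk true))
    (by
      rintro ⟨_ | _, b⟩ _
      · exact Submodule.neg_mem _ (sideExponent_mem _ _ _ _ _)
      · exact sideExponent_mem _ _ _ _ _)
    (by
      rintro ⟨_ | _, b⟩ _
      · exact Submodule.neg_mem _ (sideExponent_mem _ _ _ _ _)
      · exact sideExponent_mem _ _ _ _ _)
    (by
      rintro ⟨_ | _, b⟩ _
      · simp only [cond_false]
        rw [neg_sub_neg]
        exact sideExponent_sub_mem _ _ _ _ (fun I hI hk v hv => (ih I hI hk v hv).symm) _ _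
      · exact sideExponent_sub_mem _ _ _ _ ih _ _)
  rw [← loopProduct_eq, ← loopProduct_eq] at hd
  have hs : ((K.map (Prod.mk false) ++ K.map (Prod.mk true)).map fun y : Bool × ℝ =>
      (cond y.1 (sideExponent P l X true y.2) (-sideExponent P l X false y.2)) -
      (cond y.1 (sideExponent P l X' true y.2) (-sideExponent P l X' false y.2))).sum =
      ∑ I ∈ Finset.univ.erase ∅, ∑ v ∈ P, (X I v - X' I v) • wallOp 𝕜 I v := by
    rw [← sum_sideExponent_sub K hK P hKP l X X', List.map_append, List.sum_append, List.map_map,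
      List.map_map, ← List.sum_map_add]
    congr 1
    refine List.map_congr_left fun b _ => ?_
    simp only [Function.comp, cond_true, cond_false]
    abel
  rw [hs] at hd
  have hv0 : v ≠ 0 := fun h0 => hP (h0 ▸ hv)
  -- The wall operator of v kills monomials parallel to v, so a monomial transverse to v is needed
  -- to detect it.
  obtain ⟨m, hm⟩ := exists_wedge_ne_zero hv0
  -- The error of order k + 1 vanishes at I, because the k-element set I has no subset that is
  -- smaller by k + 1.
  have hev := hd I (monomialVec m) (fun B _ hB => by omega)
  simp only [LinearMap.sub_apply, h m, h' m, sub_self, zero_sub, neg_eq_zero, Pi.neg_apply] at hev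
  -- The coefficient of u_I z^(v+m) isolates the wall (I, v): a proper subset of I leaves labels
  -- over, where `monomialVec m` is zero, and another vector gives another exponent.
  have hev2 := congrFun hev (v + m)
  rw [LinearMap.sum_apply, Finset.sum_apply, Finset.sum_apply] at hev2
  rw [Finset.sum_eq_single I] at hev2
  · rw [LinearMap.sum_apply, Finset.sum_apply, Finset.sum_apply, Finset.sum_eq_single v] at hev2
    · rw [LinearMap.smul_apply, Pi.smul_apply, Pi.smul_apply, wallOp_apply] at hev2
      simp [monomialVec, wedge_add_right, wedge_self, hm] at hev2
      exact sub_eq_zero.1 hev2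
    · intro w _ hw
      rw [LinearMap.smul_apply, Pi.smul_apply, Pi.smul_apply, wallOp_apply]
      have : v + m - w ≠ m := fun h => hw (by
        have : v - w = 0 := by rw [← sub_eq_zero] at h; rw [← h]; abel
        exact (sub_eq_zero.1 this).symm)
      simp [monomialVec, this]
    · exact fun h => absurd hv h
  · intro J _ hJ
    rw [LinearMap.sum_apply, Finset.sum_apply, Finset.sum_apply]
    refine Finset.sum_eq_zero fun w _ => ?_
    rw [LinearMap.smul_apply, Pi.smul_apply, Pi.smul_apply, wallOp_apply]
    split_ifs with hJI
    · have : I \ J ≠ ∅ := fun h0 => hJ (Finset.Subset.antisymm hJI (Finset.sdiff_eq_empty_iff_subset.1 h0))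
      simp [monomialVec, this]
    · simp
  · intro hI'
    exact absurd (Finset.mem_erase.2 ⟨hI.ne_empty, Finset.mem_univ I⟩) hI'

end Uniqueness

/-! ### Moments -/

section Moments

variable {E : Type*} [DecidableEq E] (v : E → ℤ × ℤ) (μ : E → ℝ)

/-- The vector of the edge that collects the ends in `I`. -/
def vecSum (I : Finset E) : ℤ × ℤ := ∑ e ∈ I, v e

/-- The moment of the edge that collects the ends in `I`. -/
def momSum (I : Finset E) : ℝ := ∑ e ∈ I, μ e

/-- The affine function that vanishes on the line supporting the edge that collects the ends in
`I`. -/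
def lineForm (I : Finset E) (x : ℝ × ℝ) : ℝ := wedgeR (toPlane (vecSum v I)) x - momSum μ I

/-- The intersection point of the lines of `I` and `J`. -/
def crossing (I J : Finset E) : ℝ × ℝ :=
  ((wedge (vecSum v I) (vecSum v J) : ℝ))⁻¹ •
    (momSum μ I • toPlane (vecSum v J) - momSum μ J • toPlane (vecSum v I))

variable {v μ}

theorem vecSum_union {I J : Finset E} (h : Disjoint I J) :
    vecSum v (I ∪ J) = vecSum v I + vecSum v J := Finset.sum_union h

theorem momSum_union {I J : Finset E} (h : Disjoint I J) :
    momSum μ (I ∪ J) = momSum μ I + momSum μ J := Finset.sum_union h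

theorem wedgeR_add_left (x y z : ℝ × ℝ) : wedgeR (x + y) z = wedgeR x z + wedgeR y z := by
  simp [wedgeR]; ring

theorem wedgeR_add_right (x y z : ℝ × ℝ) : wedgeR x (y + z) = wedgeR x y + wedgeR x z := by
  simp [wedgeR]; ring

theorem wedgeR_smul_right (s : ℝ) (x y : ℝ × ℝ) : wedgeR x (s • y) = s * wedgeR x y := by
  simp [wedgeR]; ring

/-- Consequently the line of I ∪ J passes through the intersection of the lines of I and J, as it
must for an edge that leaves a vertex at which I and J come together. -/
theorem lineForm_union {I J : Finset E} (h : Disjoint I J) (x : ℝ × ℝ) :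
    lineForm v μ (I ∪ J) x = lineForm v μ I x + lineForm v μ J x := by
  simp only [lineForm, vecSum_union h, momSum_union h, toPlane_add, wedgeR_add_left]
  ring

theorem vecSum_empty : vecSum v ∅ = 0 := Finset.sum_empty

theorem nonempty_of_vecSum_ne_zero {I : Finset E} (h : vecSum v I ≠ 0) : I.Nonempty := by
  rw [Finset.nonempty_iff_ne_empty]
  rintro rfl
  exact h vecSum_empty

theorem lineForm_crossing_left {I J : Finset E} (h : wedge (vecSum v I) (vecSum v J) ≠ 0) :
    lineForm v μ I (crossing v μ I J) = 0 := by
  have h' : (wedge (vecSum v I) (vecSum v J) : ℝ) ≠ 0 := by exact_mod_cast h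
  have e : wedgeR (toPlane (vecSum v I)) (momSum μ I • toPlane (vecSum v J)
      - momSum μ J • toPlane (vecSum v I)) =
      momSum μ I * (wedge (vecSum v I) (vecSum v J) : ℝ) := by
    simp [wedgeR, wedge, toPlane]; ring
  rw [lineForm, crossing, wedgeR_smul_right, e]
  field_simp
  ring

theorem crossing_comm (I J : Finset E) : crossing v μ I J = crossing v μ J I := by
  rw [crossing, crossing, wedge_comm, Int.cast_neg, inv_neg, neg_smul, ← smul_neg, neg_sub]

theorem lineForm_crossing_right {I J : Finset E} (h : wedge (vecSum v I) (vecSum v J) ≠ 0) :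
    lineForm v μ J (crossing v μ I J) = 0 := by
  rw [crossing_comm]
  exact lineForm_crossing_left (by rw [wedge_comm]; exact neg_ne_zero.2 h)

theorem eq_of_wedgeR_eq {x y p q : ℝ × ℝ} (h : wedgeR p q ≠ 0) (hp : wedgeR p x = wedgeR p y)
    (hq : wedgeR q x = wedgeR q y) : x = y := by
  simp only [wedgeR] at *
  refine Prod.ext (mul_left_cancel₀ h ?_) (mul_left_cancel₀ h ?_)
  · linear_combination q.1 * hp - p.1 * hq
  · linear_combination q.2 * hp - p.2 * hq

theorem eq_crossing {I J : Finset E} (h : wedge (vecSum v I) (vecSum v J) ≠ 0) {x : ℝ × ℝ}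
    (hI : lineForm v μ I x = 0) (hJ : lineForm v μ J x = 0) : x = crossing v μ I J := by
  have h1 := lineForm_crossing_left (μ := μ) h
  have h2 := lineForm_crossing_right (μ := μ) h
  refine eq_of_wedgeR_eq (p := toPlane (vecSum v I)) (q := toPlane (vecSum v J)) ?_ ?_ ?_
  · rw [wedgeR_toPlane]; exact_mod_cast h
  · simp only [lineForm] at *; linarith
  · simp only [lineForm] at *; linarith

variable (v μ)

/-- The moments are generic if no three lines meet in a point, and no two lines coincide, unless
this is forced by a linear relation. -/
structure IsGeneric : Prop where
  concurrent : ∀ J K A : Finset E,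
    (∃ e, (wedge (vecSum v K) (vecSum v A) : ℝ) * (if e ∈ J then 1 else 0) +
      (wedge (vecSum v A) (vecSum v J) : ℝ) * (if e ∈ K then 1 else 0) +
      (wedge (vecSum v J) (vecSum v K) : ℝ) * (if e ∈ A then 1 else 0) ≠ 0) →
    (wedge (vecSum v K) (vecSum v A) : ℝ) * momSum μ J +
      (wedge (vecSum v A) (vecSum v J) : ℝ) * momSum μ K +
      (wedge (vecSum v J) (vecSum v K) : ℝ) * momSum μ A ≠ 0
  parallel : ∀ J K : Finset E,
    (∃ e, alpha (toPlane (vecSum v K)) * (if e ∈ J then 1 else 0) -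
      alpha (toPlane (vecSum v J)) * (if e ∈ K then 1 else 0) ≠ 0) →
    alpha (toPlane (vecSum v K)) * momSum μ J - alpha (toPlane (vecSum v J)) * momSum μ K ≠ 0

variable {v μ}

/-- Concurrence is a linear relation between the moments, so by genericity all its coefficients
vanish. As J and K are not parallel, the indicator function of A is then a combination of those of J
and K, which are disjoint; so A contains all or nothing of each, and nothing else. -/
theorem IsGeneric.eq_or_eq_or_eq (hg : IsGeneric v μ) {J K A : Finset E} (hd : Disjoint J K)
    (hJ : J.Nonempty) (hK : K.Nonempty) (hA : A.Nonempty)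
    (h : wedge (vecSum v J) (vecSum v K) ≠ 0) {x : ℝ × ℝ} (hxJ : lineForm v μ J x = 0)
    (hxK : lineForm v μ K x = 0) (hxA : lineForm v μ A x = 0) :
    A = J ∨ A = K ∨ A = J ∪ K := by
  have h' : (wedge (vecSum v J) (vecSum v K) : ℝ) ≠ 0 := by exact_mod_cast h
  -- With the moments written as wedge products with x, this is the linear relation between three
  -- vectors of the plane.
  have h0 : (wedge (vecSum v K) (vecSum v A) : ℝ) * momSum μ J +
      (wedge (vecSum v A) (vecSum v J) : ℝ) * momSum μ K +
      (wedge (vecSum v J) (vecSum v K) : ℝ) * momSum μ A = 0 := by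
    simp only [lineForm, sub_eq_zero] at hxJ hxK hxA
    rw [← hxJ, ← hxK, ← hxA]
    simp only [wedgeR, wedge, toPlane]
    push_cast
    ring
  have hall : ∀ e, (wedge (vecSum v K) (vecSum v A) : ℝ) * (if e ∈ J then 1 else 0) +
      (wedge (vecSum v A) (vecSum v J) : ℝ) * (if e ∈ K then 1 else 0) +
      (wedge (vecSum v J) (vecSum v K) : ℝ) * (if e ∈ A then 1 else 0) = 0 := by
    by_contra hne
    push Not at hne
    exact hg.concurrent J K A hne h0
  have hJA : ∀ e ∈ J, ∀ e' ∈ J, e ∈ A → e' ∈ A := by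
    intro e he e' he' heA
    by_contra heA'
    have h1 := hall e
    have h2 := hall e'
    have hK1 : e ∉ K := Finset.disjoint_left.1 hd he
    have hK2 : e' ∉ K := Finset.disjoint_left.1 hd he'
    simp [he, he', hK1, hK2, heA, heA'] at h1 h2
    simp [h2] at h1
    exact h h1
  have hKA : ∀ e ∈ K, ∀ e' ∈ K, e ∈ A → e' ∈ A := by
    intro e he e' he' heA
    by_contra heA'
    have h1 := hall e
    have h2 := hall e'
    have hK1 : e ∉ J := Finset.disjoint_right.1 hd he
    have hK2 : e' ∉ J := Finset.disjoint_right.1 hd he'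
    simp [he, he', hK1, hK2, heA, heA'] at h1 h2
    simp [h2] at h1
    exact h h1
  have hsub : ∀ e ∈ A, e ∈ J ∨ e ∈ K := by
    intro e heA
    by_contra hne
    push Not at hne
    have h1 := hall e
    simp [hne.1, hne.2, heA] at h1
    exact h h1
  obtain ⟨j, hj⟩ := hJ
  obtain ⟨k, hk⟩ := hK
  obtain ⟨a, ha⟩ := hA
  by_cases hjA : j ∈ A <;> by_cases hkA : k ∈ A
  · right; right
    ext e
    rw [Finset.mem_union]
    exact ⟨hsub e, fun he => he.elim (fun h => hJA j hj e h hjA) fun h => hKA k hk e h hkA⟩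
  · left
    ext e
    refine ⟨fun he => (hsub e he).resolve_right fun heK => hkA (hKA e heK k hk he),
      fun he => hJA j hj e he hjA⟩
  · right; left
    ext e
    refine ⟨fun he => (hsub e he).resolve_left fun heK => hjA (hJA e heK j hj he),
      fun he => hKA k hk e he hkA⟩
  · exfalso
    rcases hsub a ha with h | h
    · exact hjA (hJA a h j hj ha)
    · exact hkA (hKA a h k hk ha)

/-- For parallel vectors, alpha measures their ratio. A common point would impose the corresponding
linear relation on the moments, and its coefficients do not all vanish for distinct sets. -/
theorem IsGeneric.false_of_parallel (hg : IsGeneric v μ) {J K : Finset E} (hne : J ≠ K)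
    (hJ : vecSum v J ≠ 0) (hK : vecSum v K ≠ 0) (h : wedge (vecSum v J) (vecSum v K) = 0)
    {x : ℝ × ℝ} (hxJ : lineForm v μ J x = 0) (hxK : lineForm v μ K x = 0) : False := by
  have aJ := alpha_toPlane_ne_zero hJ
  have aK := alpha_toPlane_ne_zero hK
  refine hg.parallel J K ?_ ?_
  · obtain ⟨e, he⟩ : ∃ e, ¬ (e ∈ J ↔ e ∈ K) := by
      by_contra hcon
      push Not at hcon
      exact hne (Finset.ext hcon)
    refine ⟨e, ?_⟩
    by_cases h1 : e ∈ J <;> by_cases h2 : e ∈ K <;> simp_all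
  · simp only [lineForm, sub_eq_zero] at hxJ hxK
    rw [← hxJ, ← hxK]
    have h3 : wedgeR (toPlane (vecSum v J)) (toPlane (vecSum v K)) = 0 := by
      rw [wedgeR_toPlane, h, Int.cast_zero]
    have h4 := three_mul_wedgeR (toPlane (vecSum v J)) x
    have h5 := three_mul_wedgeR (toPlane (vecSum v K)) x
    have h6 := three_mul_wedgeR (toPlane (vecSum v J)) (toPlane (vecSum v K))
    rw [h3] at h6
    linear_combination (1/3) * alpha (toPlane (vecSum v K)) * h4 -
      (1/3) * alpha (toPlane (vecSum v J)) * h5 - (alpha x / 3) * h6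

end Moments

/-! ### Binary trees and their tropical counts -/

/-- Rooted binary trees with labelled leaves. -/
inductive BTree (E : Type*) : Type _
  | leaf : E → BTree E
  | node : BTree E → BTree E → BTree E

section Trees

variable {E : Type*} [DecidableEq E] (v : E → ℤ × ℤ) (μ : E → ℝ)

namespace BTree

/-- The labels of the leaves. -/
def leaves : BTree E → Finset E
  | leaf e => {e}
  | node l r => l.leaves ∪ r.leaves

/-- The product over the inner vertices of the multiplicities. -/
def mult : BTree E → ℕ
  | leaf _ => 1
  | node l r => (wedge (vecSum v l.leaves) (vecSum v r.leaves)).natAbs * (l.mult * r.mult)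

/-- On the line of the out edge, the root vertex lies before the point `x`. -/
def IsBefore : BTree E → ℝ × ℝ → Prop
  | leaf _, _ => True
  -- At the point root + s (v_l + v_r) this form has the value s (v_l ∧ v_r), and in a good tree v_l
  -- ∧ v_r is positive.
  | node l _, x => 0 < lineForm v μ l.leaves x

/-- The tree is realized by a tropical curve. -/
def IsGood : BTree E → Prop
  | leaf _ => True
  | node l r => Disjoint l.leaves r.leaves ∧
      -- The sign, besides excluding parallel branches, fixes their order, so that a curve has only
      -- one tree.
      0 < wedge (vecSum v l.leaves) (vecSum v r.leaves) ∧ l.IsGood ∧ r.IsGood ∧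
      l.IsBefore v μ (crossing v μ l.leaves r.leaves) ∧
      r.IsBefore v μ (crossing v μ l.leaves r.leaves)

variable {v μ}

theorem leaves_nonempty (T : BTree E) : T.leaves.Nonempty := by
  induction T with
  | leaf e => exact Finset.singleton_nonempty e
  | node l r hl _ => exact hl.mono Finset.subset_union_left

theorem finite_isGood (I : Finset E) : {T : BTree E | T.IsGood v μ ∧ T.leaves = I}.Finite := by
  induction I using Finset.strongInduction with
  | H I ih =>
  have h1 : (BTree.leaf '' (I : Set E)).Finite := I.finite_toSet.image _
  have h2 : (⋃ J ∈ {J | J ∈ I.powerset ∧ J ≠ I ∧ I \ J ≠ I},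
      Set.image2 BTree.node {T : BTree E | T.IsGood v μ ∧ T.leaves = J}
        {T : BTree E | T.IsGood v μ ∧ T.leaves = I \ J}).Finite := by
    refine Set.Finite.biUnion (I.powerset.finite_toSet.subset fun J hJ => hJ.1) fun J hJ => ?_
    refine Set.Finite.image2 _ (ih J ?_) (ih (I \ J) ?_)
    · exact (Finset.mem_powerset.1 hJ.1).ssubset_of_ne hJ.2.1
    · exact Finset.sdiff_subset.ssubset_of_ne hJ.2.2
  refine (h1.union h2).subset ?_
  rintro (e | ⟨l, r⟩) ⟨hg, hI⟩
  · left
    exact ⟨e, by rw [← hI]; simp [leaves], rfl⟩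
  · right
    have hd := hg.1
    have hI' : I = l.leaves ∪ r.leaves := hI.symm
    have hr : I \ l.leaves = r.leaves := by
      rw [hI', Finset.union_sdiff_cancel_left hd]
    simp only [Set.mem_iUnion]
    refine ⟨l.leaves, ⟨Finset.mem_powerset.2 (hI' ▸ Finset.subset_union_left), ?_, ?_⟩,
      l, ⟨hg.2.2.1, rfl⟩, r, ⟨hg.2.2.2.1, hr.symm⟩, rfl⟩
    · intro h
      rw [h, sdiff_self] at hr
      exact r.leaves_nonempty.ne_empty hr.symm
    · intro h
      obtain ⟨x, hx⟩ := l.leaves_nonempty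
      have hxI : x ∈ I := by rw [hI']; exact Finset.mem_union_left _ hx
      have : x ∈ I \ l.leaves := by rw [h]; exact hxI
      exact (Finset.mem_sdiff.1 this).2 hx

end BTree

/-- The good trees with set of leaves `I`. -/
def treeSet (I : Finset E) : Finset (BTree E) := (BTree.finite_isGood (v := v) (μ := μ) I).toFinset

open Classical in
/-- The number of trees with leaves in `I` whose root is before `x`, counted with multiplicity. -/
def countBefore (I : Finset E) (x : ℝ × ℝ) : ℕ :=
  ∑ T ∈ treeSet v μ I with T.IsBefore v μ x, T.mult v

/-- The tropical count for the ends in `I`. -/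
def treeCount (I : Finset E) : ℕ :=
  ∑ J ∈ I.powerset with 0 < wedge (vecSum v J) (vecSum v (I \ J)),
    (wedge (vecSum v J) (vecSum v (I \ J))).natAbs *
      (countBefore v μ J (crossing v μ J (I \ J)) *
        countBefore v μ (I \ J) (crossing v μ J (I \ J)))

variable {v μ}

theorem mem_treeSet {I : Finset E} {T : BTree E} :
    T ∈ treeSet v μ I ↔ T.IsGood v μ ∧ T.leaves = I := by
  simp [treeSet]

theorem node_mem_treeSet {I : Finset E} {l r : BTree E} :
    BTree.node l r ∈ treeSet v μ I ↔ ∃ J ∈ I.powerset.filter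
      (fun J => 0 < wedge (vecSum v J) (vecSum v (I \ J))), l ∈ treeSet v μ J ∧
        r ∈ treeSet v μ (I \ J) ∧ l.IsBefore v μ (crossing v μ J (I \ J)) ∧
        r.IsBefore v μ (crossing v μ J (I \ J)) := by
  simp only [mem_treeSet, Finset.mem_filter, Finset.mem_powerset]
  constructor
  · rintro ⟨⟨hd, hw, hl, hr, hbl, hbr⟩, hI⟩
    have hr' : I \ l.leaves = r.leaves := by
      rw [← hI]; exact Finset.union_sdiff_cancel_left hd
    exact ⟨l.leaves, ⟨hI ▸ Finset.subset_union_left, hr' ▸ hw⟩, ⟨hl, rfl⟩, ⟨hr, hr'.symm⟩,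
      hr' ▸ hbl, hr' ▸ hbr⟩
  · rintro ⟨J, ⟨hJ, hw⟩, ⟨hl, rfl⟩, ⟨hr, hr'⟩, hbl, hbr⟩
    rw [← hr'] at hw hbl hbr
    refine ⟨⟨?_, hw, hl, hr, hbl, hbr⟩, ?_⟩
    · rw [hr']; exact Finset.disjoint_sdiff
    · simp only [BTree.leaves]; rw [hr']; exact Finset.union_sdiff_of_subset hJ

open Classical in
-- A tree is a leaf or consists of two branches, and the leaves of the left branch determine those
-- of the right one. All recursions for the counts come from this decomposition.
theorem sum_treeSet (I : Finset E) (f : BTree E → ℕ) :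
    ∑ T ∈ treeSet v μ I, f T = (∑ e ∈ I with I = {e}, f (.leaf e)) +
      ∑ J ∈ I.powerset with 0 < wedge (vecSum v J) (vecSum v (I \ J)),
        ∑ l ∈ treeSet v μ J with l.IsBefore v μ (crossing v μ J (I \ J)),
        ∑ r ∈ treeSet v μ (I \ J) with r.IsBefore v μ (crossing v μ J (I \ J)),
          f (.node l r) := by
  have e : treeSet v μ I = (I.filter (fun e => I = {e})).image BTree.leaf ∪
      (I.powerset.filter (fun J => 0 < wedge (vecSum v J) (vecSum v (I \ J)))).biUnion fun J =>
        (((treeSet v μ J).filter (fun l => l.IsBefore v μ (crossing v μ J (I \ J)))) ×ˢ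
        ((treeSet v μ (I \ J)).filter (fun l => l.IsBefore v μ (crossing v μ J (I \ J))))).image
          fun p => BTree.node p.1 p.2 := by
    ext T
    cases T with
    | leaf e =>
      simp only [mem_treeSet, Finset.mem_union, Finset.mem_image, Finset.mem_filter,
        Finset.mem_biUnion]
      constructor
      · rintro ⟨-, h⟩
        exact Or.inl ⟨e, ⟨by rw [← h]; simp [BTree.leaves], h.symm⟩, rfl⟩
      · rintro (⟨e', ⟨-, h⟩, h'⟩ | ⟨_, _, _, _, h'⟩)
        · cases h'
          exact ⟨trivial, h.symm⟩
        · cases h'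
    | node l r =>
      rw [node_mem_treeSet]
      simp only [Finset.mem_union, Finset.mem_image, Finset.mem_biUnion]
      constructor
      · rintro ⟨J, hJ, hl, hr, hbl, hbr⟩
        exact Or.inr ⟨J, hJ, (l, r), by simp [hl, hr, hbl, hbr], rfl⟩
      · rintro (⟨_, _, h⟩ | ⟨J, hJ, ⟨l', r'⟩, h, h'⟩)
        · cases h
        · cases h'
          simp at h
          exact ⟨J, hJ, h.1.1, h.2.1, h.1.2, h.2.2⟩
  rw [e, Finset.sum_union, Finset.sum_image, Finset.sum_biUnion]
  · congr 1
    refine Finset.sum_congr rfl fun J _ => ?_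
    rw [Finset.sum_image, Finset.sum_product]
    rintro ⟨a, b⟩ _ ⟨c, d⟩ _ h
    simpa using h
  · intro J _ J' _ hne
    rw [Function.onFun, Finset.disjoint_left]
    intro T hT hT'
    obtain ⟨⟨l, r⟩, h, rfl⟩ := Finset.mem_image.1 hT
    obtain ⟨⟨l', r'⟩, h', h''⟩ := Finset.mem_image.1 hT'
    cases h''
    simp only [Finset.mem_product, Finset.mem_filter, mem_treeSet] at h h'
    exact hne (h.1.1.2.symm.trans h'.1.1.2)
  · intro a _ b _ h
    simpa using h
  · rw [Finset.disjoint_left]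
    intro T hT hT'
    obtain ⟨e, _, rfl⟩ := Finset.mem_image.1 hT
    obtain ⟨J, _, h⟩ := Finset.mem_biUnion.1 hT'
    obtain ⟨_, _, h⟩ := Finset.mem_image.1 h
    cases h

theorem sum_filter_eq_singleton (I : Finset E) :
    (∑ e ∈ I with I = {e}, 1) = if I.card = 1 then 1 else 0 := by
  split_ifs with h
  · obtain ⟨e, rfl⟩ := Finset.card_eq_one.1 h
    rw [Finset.sum_filter]
    simp
  · rw [Finset.sum_filter]
    refine Finset.sum_eq_zero fun e _ => ?_
    rw [if_neg]
    rintro rfl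
    simp at h

/-- Along the line of I the count is a step function: a single end contributes everywhere, and a
splitting of I contributes only beyond the crossing of its two lines. -/
theorem countBefore_eq (I : Finset E) (x : ℝ × ℝ) :
    countBefore v μ I x = (if I.card = 1 then 1 else 0) +
      ∑ J ∈ I.powerset with 0 < wedge (vecSum v J) (vecSum v (I \ J)),
        if 0 < lineForm v μ J x then (wedge (vecSum v J) (vecSum v (I \ J))).natAbs *
        (countBefore v μ J (crossing v μ J (I \ J)) *
          countBefore v μ (I \ J) (crossing v μ J (I \ J))) else 0 := by
  classical
  rw [countBefore, Finset.sum_filter, sum_treeSet, ← sum_filter_eq_singleton]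
  congr 1
  · exact Finset.sum_congr rfl fun e _ => by simp [BTree.IsBefore, BTree.mult]
  · refine Finset.sum_congr rfl fun J _ => ?_
    rw [countBefore, countBefore, Finset.sum_mul_sum, Finset.mul_sum]
    split_ifs with h
    · refine Finset.sum_congr rfl fun l hl => ?_
      rw [Finset.mul_sum]
      refine Finset.sum_congr rfl fun r hr => ?_
      have h1 := (mem_treeSet.1 (Finset.mem_filter.1 hl).1).2
      have h2 := (mem_treeSet.1 (Finset.mem_filter.1 hr).1).2
      simp [BTree.IsBefore, BTree.mult, h1, h2, h]
    · refine Finset.sum_eq_zero fun l hl => Finset.sum_eq_zero fun r hr => ?_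
      have h1 := (mem_treeSet.1 (Finset.mem_filter.1 hl).1).2
      simp [BTree.IsBefore, h1, h]

/-- The leaf is the only tree that `treeCount` leaves out. -/
theorem sum_mult_treeSet {I : Finset E} (hI : I.card ≠ 1) :
    ∑ T ∈ treeSet v μ I, T.mult v = treeCount v μ I := by
  classical
  have h0 : (∑ e ∈ I with I = {e}, (BTree.leaf e).mult v) = 0 := by
    simp only [BTree.mult]
    rw [sum_filter_eq_singleton, if_neg hI]
  rw [sum_treeSet, h0, zero_add, treeCount]
  refine Finset.sum_congr rfl fun J _ => ?_
  rw [countBefore, countBefore, Finset.sum_mul_sum, Finset.mul_sum]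
  refine Finset.sum_congr rfl fun l hl => ?_
  rw [Finset.mul_sum]
  refine Finset.sum_congr rfl fun r hr => ?_
  have h1 := (mem_treeSet.1 (Finset.mem_filter.1 hl).1).2
  have h2 := (mem_treeSet.1 (Finset.mem_filter.1 hr).1).2
  simp [BTree.mult, h1, h2]

end Trees

/-! ### Walls in general position and the ordered product over a sweep line -/

section Sweep

variable {E : Type*} [Fintype E] [DecidableEq E] (v : E → ℤ × ℤ) (μ : E → ℝ)

/-! ### Points on the lines -/

/-- The `beta`-coordinate of the point of the line of `I` with `alpha = s`. -/
def lineHeight (I : Finset E) (s : ℝ) : ℝ :=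
  (3 * momSum μ I + beta (toPlane (vecSum v I)) * s) / alpha (toPlane (vecSum v I))

/-- The point with given coordinates `alpha`, `beta`. -/
def ofCoords (a b : ℝ) : ℝ × ℝ := ((√2 * a + b) / 3, (√2 * b - a) / 3)

/-- The point of the line of `I` with `alpha = s`. -/
def linePoint (I : Finset E) (s : ℝ) : ℝ × ℝ := ofCoords s (lineHeight v μ I s)

variable {v μ}

theorem alpha_ofCoords (a b : ℝ) : alpha (ofCoords a b) = a := by
  simp only [alpha, ofCoords]
  linear_combination (a / 3) * sqrt_two_mul_self

theorem beta_ofCoords (a b : ℝ) : beta (ofCoords a b) = b := by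
  simp only [beta, ofCoords]
  linear_combination (b / 3) * sqrt_two_mul_self

theorem lineForm_linePoint {I : Finset E} (hI : vecSum v I ≠ 0) (s : ℝ) :
    lineForm v μ I (linePoint v μ I s) = 0 := by
  have h := alpha_toPlane_ne_zero hI
  have hh : alpha (toPlane (vecSum v I)) * lineHeight v μ I s =
      3 * momSum μ I + beta (toPlane (vecSum v I)) * s := mul_div_cancel₀ _ h
  have h3 := three_mul_wedgeR (toPlane (vecSum v I)) (linePoint v μ I s)
  rw [linePoint, alpha_ofCoords, beta_ofCoords, hh] at h3
  rw [lineForm, linePoint]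
  linarith

/-- The form of J is affine along the line of I and vanishes at the crossing. Increasing alpha by
one moves the point by v_I / α(v_I), which explains the second factor. -/
theorem lineForm_eq_mul (J I : Finset E) (hI : vecSum v I ≠ 0)
    (h : wedge (vecSum v J) (vecSum v I) ≠ 0) (s : ℝ) :
    lineForm v μ J (linePoint v μ I s) = (s - alpha (crossing v μ J I)) *
      (wedge (vecSum v J) (vecSum v I) / alpha (toPlane (vecSum v I))) := by
  have ha := alpha_toPlane_ne_zero hI
  have h1 := lineForm_crossing_left (μ := μ) h
  have h2 := lineForm_crossing_right (μ := μ) h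
  have h3 := lineForm_linePoint (μ := μ) hI s
  have hs : alpha (linePoint v μ I s) = s := alpha_ofCoords _ _
  set x := linePoint v μ I s
  set y := crossing v μ J I
  simp only [lineForm] at *
  have e1 := three_mul_wedgeR (toPlane (vecSum v J)) x
  have e2 := three_mul_wedgeR (toPlane (vecSum v J)) y
  have e3 := three_mul_wedgeR (toPlane (vecSum v I)) x
  have e4 := three_mul_wedgeR (toPlane (vecSum v I)) y
  have e5 := three_mul_wedgeR (toPlane (vecSum v J)) (toPlane (vecSum v I))
  rw [wedgeR_toPlane] at e5
  rw [hs] at e1 e3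
  field_simp
  linear_combination (alpha (toPlane (vecSum v I)) / 3) * e1 -
    (alpha (toPlane (vecSum v I)) / 3) * e2 + alpha (toPlane (vecSum v I)) * h1 -
    (alpha (toPlane (vecSum v J)) / 3) * e3 + (alpha (toPlane (vecSum v J)) / 3) * e4
    + alpha (toPlane (vecSum v J)) * h3 - alpha (toPlane (vecSum v J)) * h2 -
    ((s - alpha y) / 3) * e5

/-- Both heights are affine in s, with the slopes of the two vectors, and they agree at the
crossing. -/
theorem lineHeight_sub {I J : Finset E} (hI : vecSum v I ≠ 0) (hJ : vecSum v J ≠ 0)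
    (h : wedge (vecSum v I) (vecSum v J) ≠ 0) (s : ℝ) :
    lineHeight v μ I s - lineHeight v μ J s =
      (slope (toPlane (vecSum v I)) - slope (toPlane (vecSum v J))) *
        (s - alpha (crossing v μ I J)) := by
  have aI := alpha_toPlane_ne_zero hI
  have aJ := alpha_toPlane_ne_zero hJ
  have h1 := lineForm_crossing_left (μ := μ) h
  have h2 := lineForm_crossing_right (μ := μ) h
  simp only [lineForm] at h1 h2
  have e1 := three_mul_wedgeR (toPlane (vecSum v I)) (crossing v μ I J)
  have e2 := three_mul_wedgeR (toPlane (vecSum v J)) (crossing v μ I J)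
  have f1 : lineHeight v μ I s = beta (crossing v μ I J) +
      slope (toPlane (vecSum v I)) * (s - alpha (crossing v μ I J)) := by
    rw [lineHeight, slope]
    field_simp
    linear_combination e1 - 3 * h1
  have f2 : lineHeight v μ J s = beta (crossing v μ I J) +
      slope (toPlane (vecSum v J)) * (s - alpha (crossing v μ I J)) := by
    rw [lineHeight, slope]
    field_simp
    linear_combination e2 - 3 * h2
  rw [f1, f2]
  ring

theorem lineHeight_sub_of_parallel {I J : Finset E} (hI : vecSum v I ≠ 0) (hJ : vecSum v J ≠ 0)
    (h : wedge (vecSum v I) (vecSum v J) = 0) (s s' : ℝ) :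
    lineHeight v μ I s - lineHeight v μ J s = lineHeight v μ I s' - lineHeight v μ J s' := by
  have h1 := slope_eq_of_wedge_eq_zero hI hJ h
  have : ∀ K : Finset E, ∀ t, lineHeight v μ K t = 3 * momSum μ K / alpha (toPlane (vecSum v K)) +
      slope (toPlane (vecSum v K)) * t := fun K t => by
    rw [lineHeight, slope]; ring
  rw [this, this, this I, this J, h1]
  ring

/-! ### Sweeping the plane with a line -/

/-- The commutation relations of the operators attached to the sets of ends. -/
structure IsWallFamily {A : Type*} [Ring A] (v : E → ℤ × ℤ) (e : Finset E → A) : Prop where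
  mul_of_not_disjoint : ∀ I J, ¬ Disjoint I J → e I * e J = 0
  commutator : ∀ I J, Disjoint I J →
    e I * e J - e J * e I = wedge (vecSum v I) (vecSum v J) • e (I ∪ J)

variable {A : Type*} [Ring A]

variable (v μ) in
/-- The exponent of the wall of `I` at its intersection with the line `alpha = s`. -/
def wallExponent (e : Finset E → A) (s : ℝ) (I : Finset E) : A :=
  (orient (vecSum v I) * (countBefore v μ I (linePoint v μ I s) : ℤ)) • e I

variable (v μ) in
/-- The list of all walls, sorted by descending height on the line `alpha = s`. -/
structure IsSweepList (s : ℝ) (L : List (Finset E)) : Prop where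
  nodup : L.Nodup
  mem_iff : ∀ I, I ∈ L ↔ vecSum v I ≠ 0
  sorted : L.Pairwise fun I J => -lineHeight v μ I s ≤ -lineHeight v μ J s

variable (v μ) in
theorem exists_isSweepList (s : ℝ) : ∃ L, IsSweepList v μ s L := by
  classical
  let r : Finset E → Finset E → Prop := fun I J => -lineHeight v μ I s ≤ -lineHeight v μ J s
  have : Std.Total r := ⟨fun a b => le_total _ _⟩
  have : IsTrans (Finset E) r := ⟨fun a b c => le_trans⟩
  refine ⟨(Finset.univ.filter fun I : Finset E => vecSum v I ≠ 0).toList.insertionSort r,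
    ?_, fun I => ?_, List.pairwise_insertionSort r _⟩
  · exact (List.perm_insertionSort r _).nodup_iff.2 (Finset.nodup_toList _)
  · rw [(List.perm_insertionSort r _).mem_iff]
    simp

theorem countBefore_congr {I : Finset E} {x y : ℝ × ℝ}
    (h : ∀ J ⊆ I, 0 < wedge (vecSum v J) (vecSum v (I \ J)) →
      (0 < lineForm v μ J x ↔ 0 < lineForm v μ J y)) :
    countBefore v μ I x = countBefore v μ I y := by
  rw [countBefore_eq, countBefore_eq]
  congr 1
  refine Finset.sum_congr rfl fun J hJ => ?_
  rw [Finset.mem_filter, Finset.mem_powerset] at hJ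
  simp only [h J hJ.1 hJ.2]

theorem wedge_sdiff {I J : Finset E} (h : J ⊆ I) :
    wedge (vecSum v J) (vecSum v I) = wedge (vecSum v J) (vecSum v (I \ J)) := by
  conv_lhs => rw [← Finset.union_sdiff_of_subset h, vecSum_union Finset.disjoint_sdiff,
    wedge_add_right, wedge_self, zero_add]

/-- The form of I is the sum of the forms of J and I \ J, so the three lines are concurrent. -/
theorem crossing_sdiff {I J : Finset E} (h : J ⊆ I)
    (hw : wedge (vecSum v J) (vecSum v (I \ J)) ≠ 0) :
    crossing v μ J (I \ J) = crossing v μ J I := by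
  refine eq_crossing (by rwa [wedge_sdiff h]) (lineForm_crossing_left hw) ?_
  have := lineForm_union (v := v) (μ := μ) (Finset.disjoint_sdiff (s := J) (t := I))
    (crossing v μ J (I \ J))
  rwa [Finset.union_sdiff_of_subset h, lineForm_crossing_left hw, lineForm_crossing_right hw,
    add_zero] at this

/-- In terms of the sweep parameter: a splitting has been passed when s lies beyond its critical
value, on the side to which the wall points. -/
theorem lineForm_linePoint_pos_iff {I J : Finset E} (h : J ⊆ I)
    (hw : 0 < wedge (vecSum v J) (vecSum v (I \ J))) (s : ℝ) :
    0 < lineForm v μ J (linePoint v μ I s) ↔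
      0 < (s - alpha (crossing v μ J (I \ J))) * alpha (toPlane (vecSum v I)) := by
  have hw' : 0 < wedge (vecSum v J) (vecSum v I) := by rwa [wedge_sdiff h]
  have hI : vecSum v I ≠ 0 := by
    intro h0
    rw [h0, wedge_zero_right] at hw'
    exact lt_irrefl _ hw'
  have ha := alpha_toPlane_ne_zero hI
  rw [lineForm_eq_mul J I hI hw'.ne', crossing_sdiff h hw.ne']
  have hwR : (0 : ℝ) < wedge (vecSum v J) (vecSum v I) := by exact_mod_cast hw'
  have : (s - alpha (crossing v μ J I)) *
      (wedge (vecSum v J) (vecSum v I) / alpha (toPlane (vecSum v I))) =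
      ((s - alpha (crossing v μ J I)) * alpha (toPlane (vecSum v I))) *
      (wedge (vecSum v J) (vecSum v I) / alpha (toPlane (vecSum v I)) ^ 2) := by
    field_simp
  rw [this]
  exact mul_pos_iff_of_pos_right (by positivity)

/-- Since m annihilates j and k, its position is irrelevant. Only the relative order of j and k
matters, and the sorting hypothesis excludes that k precedes j. -/
theorem prod_one_add_of_perm_three {ι : Type*} (x : ι → A) (R : ι → ι → Prop) {j k m : ι}
    (hmj : x m * x j = 0) (hmk : x m * x k = 0) (hjm : x j * x m = 0) (hkm : x k * x m = 0)
    (hR : ¬ R k j) {L : List ι} (hL : L.Perm [j, k, m]) (hLR : L.Pairwise R) :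
    (L.map fun a => 1 + x a).prod = 1 + x j + x k + x m + x j * x k := by
  have h3 : ∀ a b c : ι, ([a, b, c].map fun a => 1 + x a).prod =
      1 + x a + x b + x c + x a * x b + x a * x c + x b * x c + x a * (x b * x c) := by
    intro a b c
    simp only [List.map_cons, List.map_nil, List.prod_cons, List.prod_nil, mul_one]
    noncomm_ring
  have hperm : L = [j, k, m] ∨ L = [j, m, k] ∨ L = [m, j, k] ∨ L = [k, j, m] ∨ L = [k, m, j] ∨
      L = [m, k, j] := by
    have := List.mem_permutations'.2 hL
    simp [List.permutations'] at this
    tauto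
  rcases hperm with rfl | rfl | rfl | rfl | rfl | rfl
  · rw [h3, hjm, hkm]; simp
  · rw [h3, hjm, hmk]; simp only [mul_zero, add_zero]; abel
  · rw [h3, hmj, hmk, ← mul_assoc, hmj]; simp only [zero_mul, add_zero]; abel
  · simp [hR] at hLR
  · simp [hR] at hLR
  · simp [hR] at hLR

variable {e : Finset E → A}

/-- The product over the walls through a point, before and after sweeping over that point. -/
theorem group_prod_eq (hg : IsGeneric v μ) (he : IsWallFamily v e) {s₁ s₀ s₂ : ℝ}
    (h10 : s₁ < s₀) (h02 : s₀ < s₂)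
    (hcrit : ∀ I J : Finset E, wedge (vecSum v I) (vecSum v J) ≠ 0 →
      alpha (crossing v μ I J) = s₀ ∨ alpha (crossing v μ I J) < s₁ ∨
        s₂ < alpha (crossing v μ I J))
    {F₁ F₂ : List (Finset E)} (hperm : F₁.Perm F₂) (hnd : F₁.Nodup) (b : ℝ)
    (hF : ∀ I, I ∈ F₁ ↔ vecSum v I ≠ 0 ∧ lineHeight v μ I s₀ = b)
    (hs₁ : F₁.Pairwise fun I J => -lineHeight v μ I s₁ ≤ -lineHeight v μ J s₁)
    (hs₂ : F₂.Pairwise fun I J => -lineHeight v μ I s₂ ≤ -lineHeight v μ J s₂) :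
    (F₁.map fun I => 1 + wallExponent v μ e s₁ I).prod =
      (F₂.map fun I => 1 + wallExponent v μ e s₂ I).prod := by
  have hpt : ∀ I ∈ F₁, linePoint v μ I s₀ = ofCoords s₀ b := fun I hI => by
    rw [linePoint, ((hF I).1 hI).2]
  have hform : ∀ I ∈ F₁, lineForm v μ I (ofCoords s₀ b) = 0 := fun I hI => by
    rw [← hpt I hI]; exact lineForm_linePoint ((hF I).1 hI).1 s₀
  have hmem : ∀ I, vecSum v I ≠ 0 → lineForm v μ I (ofCoords s₀ b) = 0 → I ∈ F₁ := by
    intro I hI h0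
    refine (hF I).2 ⟨hI, ?_⟩
    have h1 := three_mul_wedgeR (toPlane (vecSum v I)) (ofCoords s₀ b)
    rw [alpha_ofCoords, beta_ofCoords] at h1
    rw [lineForm] at h0
    rw [lineHeight, div_eq_iff (alpha_toPlane_ne_zero hI)]
    linarith
  -- splits whose crossing is not at the critical point
  have hsplit : ∀ I ∈ F₁, ∀ J ⊆ I, 0 < wedge (vecSum v J) (vecSum v (I \ J)) →
      ¬ (J ∈ F₁ ∧ I \ J ∈ F₁) → ∀ s s', s₁ ≤ s → s ≤ s₂ → s₁ ≤ s' → s' ≤ s₂ →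
      (0 < lineForm v μ J (linePoint v μ I s) ↔ 0 < lineForm v μ J (linePoint v μ I s')) := by
    intro I hI J hJ hw hn s s' h1 h2 h1' h2'
    rw [lineForm_linePoint_pos_iff hJ hw, lineForm_linePoint_pos_iff hJ hw]
    rcases hcrit J (I \ J) hw.ne' with h | h | h
    · exfalso
      refine hn ?_
      have hx : crossing v μ J (I \ J) = ofCoords s₀ b := by
        have hIx : linePoint v μ I s₀ = crossing v μ J I := by
          have hw' : wedge (vecSum v J) (vecSum v I) ≠ 0 := by rw [wedge_sdiff hJ]; exact hw.ne'
          refine eq_crossing hw' ?_ (lineForm_linePoint ((hF I).1 hI).1 s₀)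
          rw [lineForm_eq_mul J I ((hF I).1 hI).1 hw', ← crossing_sdiff hJ hw.ne', h]
          simp
        rw [crossing_sdiff hJ hw.ne', ← hIx, hpt I hI]
      constructor
      · refine hmem J (fun h0 => ?_) (hx ▸ lineForm_crossing_left hw.ne')
        rw [h0, wedge_zero_left] at hw; exact lt_irrefl _ hw
      · refine hmem _ (fun h0 => ?_) (hx ▸ lineForm_crossing_right hw.ne')
        rw [h0, wedge_zero_right] at hw; exact lt_irrefl _ hw
    · rw [mul_pos_iff_of_pos_left (by linarith), mul_pos_iff_of_pos_left (by linarith)]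
    · rw [← neg_mul_neg, ← neg_mul_neg (s' - _), mul_pos_iff_of_pos_left (by linarith),
        mul_pos_iff_of_pos_left (by linarith)]
  have hconst : ∀ I ∈ F₁, (∀ J ⊆ I, 0 < wedge (vecSum v J) (vecSum v (I \ J)) →
      ¬ (J ∈ F₁ ∧ I \ J ∈ F₁)) → ∀ s s', s₁ ≤ s → s ≤ s₂ → s₁ ≤ s' → s' ≤ s₂ →
      countBefore v μ I (linePoint v μ I s) = countBefore v μ I (linePoint v μ I s') :=
    fun I hI h s s' h1 h2 h1' h2' => countBefore_congr fun J hJ hw =>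
      hsplit I hI J hJ hw (h J hJ hw) s s' h1 h2 h1' h2'
  have hxne : ∀ (s s' : ℝ) (I J : Finset E), ¬ Disjoint I J →
      wallExponent v μ e s I * wallExponent v μ e s' J = 0 := by
    intro s s' I J h
    rw [wallExponent, wallExponent, smul_mul_smul_comm, he.mul_of_not_disjoint I J h, smul_zero]
  -- Either two disjoint sets meet at the point, and then genericity leaves just J, K and J ∪ K; or
  -- all products vanish and no coefficient changes.
  by_cases hdis : ∃ J ∈ F₁, ∃ K ∈ F₁, Disjoint J K
  · -- two disjoint sets
    have hne' : ∃ J ∈ F₁, ∃ K ∈ F₁, Disjoint J K ∧ 0 < wedge (vecSum v J) (vecSum v K) := by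
      obtain ⟨J, hJ, K, hK, hd⟩ := hdis
      have hJK : J ≠ K := by
        rintro rfl
        exact (nonempty_of_vecSum_ne_zero ((hF J).1 hJ).1).ne_empty (disjoint_self.1 hd)
      rcases lt_trichotomy (wedge (vecSum v J) (vecSum v K)) 0 with h | h | h
      · exact ⟨K, hK, J, hJ, hd.symm, by rw [wedge_comm]; omega⟩
      · exact (hg.false_of_parallel hJK ((hF J).1 hJ).1 ((hF K).1 hK).1 h (hform J hJ)
          (hform K hK)).elim
      · exact ⟨J, hJ, K, hK, hd, h⟩
    obtain ⟨J, hJ, K, hK, hd, hw⟩ := hne'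
    have hJ0 := ((hF J).1 hJ).1
    have hK0 := ((hF K).1 hK).1
    have hJne := nonempty_of_vecSum_ne_zero hJ0
    have hKne := nonempty_of_vecSum_ne_zero hK0
    have hMw : wedge (vecSum v J) (vecSum v (J ∪ K)) = wedge (vecSum v J) (vecSum v K) := by
      rw [vecSum_union hd, wedge_add_right, wedge_self, zero_add]
    have hM0 : vecSum v (J ∪ K) ≠ 0 := by
      intro h0
      rw [h0, wedge_zero_right] at hMw
      omega
    have hM : J ∪ K ∈ F₁ := hmem _ hM0 (by
      rw [lineForm_union hd, hform J hJ, hform K hK, add_zero])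
    have hall : ∀ I, I ∈ F₁ ↔ I = J ∨ I = K ∨ I = J ∪ K := by
      intro I
      constructor
      · intro hI
        exact hg.eq_or_eq_or_eq hd hJne hKne (nonempty_of_vecSum_ne_zero ((hF I).1 hI).1) hw.ne'
          (hform J hJ) (hform K hK) (hform I hI)
      · rintro (rfl | rfl | rfl) <;> assumption
    have hJK : J ≠ K := by
      rintro rfl
      exact hJne.ne_empty (disjoint_self.1 hd)
    have hJM : J ≠ J ∪ K := fun h => by
      have : K ⊆ J := by rw [h]; exact Finset.subset_union_right
      exact hKne.ne_empty (disjoint_self.1 (hd.mono_left this))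
    have hKM : K ≠ J ∪ K := fun h => by
      have : J ⊆ K := by rw [h]; exact Finset.subset_union_left
      exact hJne.ne_empty (disjoint_self.1 (hd.mono_right this))
    have hp : F₁.Perm [J, K, J ∪ K] := by
      rw [List.perm_ext_iff_of_nodup hnd (by simp [hJK, hJM, hKM])]
      intro I
      rw [hall]
      simp
    have hp2 := hperm.symm.trans hp
    have hp' : F₁.Perm [K, J, J ∪ K] := hp.trans (List.Perm.swap _ _ _)
    have hp2' : F₂.Perm [K, J, J ∪ K] := hp2.trans (List.Perm.swap _ _ _)
    have nJM : ¬ Disjoint J (J ∪ K) := fun h =>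
      hJne.ne_empty (disjoint_self.1 (h.mono_right Finset.subset_union_left))
    have nKM : ¬ Disjoint K (J ∪ K) := fun h =>
      hKne.ne_empty (disjoint_self.1 (h.mono_right Finset.subset_union_right))
    -- No splitting of J takes place at the point: it would need a proper part of J among the walls
    -- through the point, and these are J, K and J ∪ K. The same holds for K.
    have cJ : countBefore v μ J (linePoint v μ J s₁) = countBefore v μ J (crossing v μ J K) ∧
        countBefore v μ J (linePoint v μ J s₂) = countBefore v μ J (crossing v μ J K) := by
      have hx : crossing v μ J K = linePoint v μ J s₀ := by
        rw [hpt J hJ]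
        exact (eq_crossing hw.ne' (hform J hJ) (hform K hK)).symm
      have hno : ∀ I ⊆ J, 0 < wedge (vecSum v I) (vecSum v (J \ I)) →
          ¬ (I ∈ F₁ ∧ J \ I ∈ F₁) := by
        rintro I hIJ hwI ⟨hI, hI'⟩
        rcases (hall I).1 hI with rfl | rfl | rfl
        · simp [vecSum_empty, wedge_zero_right] at hwI
        · exact hKne.ne_empty (disjoint_self.1 (hd.mono_left hIJ))
        · exact hJM (Finset.Subset.antisymm Finset.subset_union_left hIJ)
      rw [hx]
      exact ⟨hconst J hJ hno _ _ le_rfl (by linarith) (by linarith) (by linarith),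
        hconst J hJ hno _ _ (by linarith) le_rfl (by linarith) (by linarith)⟩
    have cK : countBefore v μ K (linePoint v μ K s₁) = countBefore v μ K (crossing v μ J K) ∧
        countBefore v μ K (linePoint v μ K s₂) = countBefore v μ K (crossing v μ J K) := by
      have hx : crossing v μ J K = linePoint v μ K s₀ := by
        rw [hpt K hK]
        exact (eq_crossing hw.ne' (hform J hJ) (hform K hK)).symm
      have hno : ∀ I ⊆ K, 0 < wedge (vecSum v I) (vecSum v (K \ I)) →
          ¬ (I ∈ F₁ ∧ K \ I ∈ F₁) := by
        rintro I hIJ hwI ⟨hI, hI'⟩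
        rcases (hall I).1 hI with rfl | rfl | rfl
        · exact hJne.ne_empty (disjoint_self.1 (hd.mono_right hIJ))
        · simp [vecSum_empty, wedge_zero_right] at hwI
        · exact hKM (Finset.Subset.antisymm Finset.subset_union_right hIJ)
      rw [hx]
      exact ⟨hconst K hK hno _ _ le_rfl (by linarith) (by linarith) (by linarith),
        hconst K hK hno _ _ (by linarith) le_rfl (by linarith) (by linarith)⟩
    have hMJ : (J ∪ K) \ J = K := Finset.union_sdiff_cancel_left hd
    have aM := alpha_toPlane_ne_zero hM0
    have hcr : alpha (crossing v μ J K) = s₀ := by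
      rw [← eq_crossing hw.ne' (hform J hJ) (hform K hK), alpha_ofCoords]
    -- Only the splitting J | K of J ∪ K has its crossing at the point, so a single term jumps. It
    -- appears if the wall points towards larger alpha and disappears otherwise.
    have cM : (countBefore v μ (J ∪ K) (linePoint v μ (J ∪ K) s₂) : ℤ) -
        countBefore v μ (J ∪ K) (linePoint v μ (J ∪ K) s₁) =
        orient (vecSum v (J ∪ K)) * (wedge (vecSum v J) (vecSum v K) *
          (countBefore v μ J (crossing v μ J K) * countBefore v μ K (crossing v μ J K))) := by
      rw [countBefore_eq, countBefore_eq]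
      push_cast
      rw [add_sub_add_left_eq_sub, ← Finset.sum_sub_distrib, Finset.sum_eq_single J]
      · have c1 := lineForm_linePoint_pos_iff (v := v) (μ := μ)
          (Finset.subset_union_left (s₁ := J) (s₂ := K)) (by rwa [hMJ]) s₁
        have c2 := lineForm_linePoint_pos_iff (v := v) (μ := μ)
          (Finset.subset_union_left (s₁ := J) (s₂ := K)) (by rwa [hMJ]) s₂
        rw [hMJ, hcr] at c1 c2
        rw [mul_pos_iff_of_pos_left (by linarith)] at c2
        simp only [c1, c2, hMJ, abs_of_pos hw]
        rcases lt_or_gt_of_ne aM with h | h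
        · have h2 : 0 < (s₁ - s₀) * alpha (toPlane (vecSum v (J ∪ K))) :=
            mul_pos_of_neg_of_neg (by linarith) h
          simp [orient, h2, h.not_gt]
        · have h2 : ¬ 0 < (s₁ - s₀) * alpha (toPlane (vecSum v (J ∪ K))) :=
            not_lt.2 (mul_nonpos_of_nonpos_of_nonneg (by linarith) h.le)
          simp [orient, h2, h]
      · intro I hI hIJ
        rw [Finset.mem_filter, Finset.mem_powerset] at hI
        have := hsplit _ hM I hI.1 hI.2 (by
          rintro ⟨hI1, hI2⟩
          rcases (hall I).1 hI1 with rfl | rfl | rfl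
          · exact hIJ rfl
          · have h2 := hI.2
            rw [Finset.union_sdiff_cancel_right hd, wedge_comm] at h2
            omega
          · simp [vecSum_empty, wedge_zero_right] at hI) s₁ s₂ le_rfl (by linarith) (by linarith)
            le_rfl
        simp only [this, sub_self]
      · intro hnot
        exfalso
        refine hnot (Finset.mem_filter.2 ⟨Finset.mem_powerset.2 Finset.subset_union_left, ?_⟩)
        rwa [hMJ]
    have eJ : wallExponent v μ e s₁ J = wallExponent v μ e s₂ J := by
      rw [wallExponent, wallExponent, cJ.1, cJ.2]
    have eK : wallExponent v μ e s₁ K = wallExponent v μ e s₂ K := by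
      rw [wallExponent, wallExponent, cK.1, cK.2]
    have oM : orient (vecSum v (J ∪ K)) * orient (vecSum v (J ∪ K)) = 1 := by
      unfold orient; split_ifs <;> rfl
    have eM : wallExponent v μ e s₂ (J ∪ K) - wallExponent v μ e s₁ (J ∪ K) =
        (wedge (vecSum v J) (vecSum v K) * (countBefore v μ J (crossing v μ J K) *
          countBefore v μ K (crossing v μ J K)) : ℤ) • e (J ∪ K) := by
      rw [wallExponent, wallExponent, ← sub_smul, ← mul_sub, cM, ← mul_assoc, oM, one_mul]
    -- Up to the sign of the two orientations, the commutator equals the jump of the exponent of J ∪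
    -- K.
    have eC : wallExponent v μ e s₂ J * wallExponent v μ e s₂ K -
        wallExponent v μ e s₂ K * wallExponent v μ e s₂ J =
        (orient (vecSum v J) * orient (vecSum v K) * (wedge (vecSum v J) (vecSum v K) *
        (countBefore v μ J (crossing v μ J K) * countBefore v μ K (crossing v μ J K))) : ℤ) •
          e (J ∪ K) := by
      rw [wallExponent, wallExponent, cJ.2, cK.2, smul_mul_smul_comm, smul_mul_smul_comm,
        mul_comm (orient (vecSum v K) * _), ← smul_sub, he.commutator J K hd, smul_smul]
      congr 1
      ring
    have hdiff := lineHeight_sub (μ := μ) hJ0 hK0 hw.ne'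
    have h3w := three_mul_wedgeR_eq_slope (alpha_toPlane_ne_zero hJ0) (alpha_toPlane_ne_zero hK0)
    rw [wedgeR_toPlane] at h3w
    have hwR : (0 : ℝ) < wedge (vecSum v J) (vecSum v K) := by exact_mod_cast hw
    have hd1 := hdiff s₁
    have hd2 := hdiff s₂
    rw [hcr] at hd1 hd2
    -- If J and K point to opposite sides, K is the upper line before the critical value, otherwise
    -- J is; afterwards the two have changed places. The product of the orientations gives the
    -- commutator the sign that fits this exchange.
    rcases lt_or_gt_of_ne (mul_ne_zero (alpha_toPlane_ne_zero hJ0) (alpha_toPlane_ne_zero hK0))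
      with hs | hs
    · have ho : orient (vecSum v J) * orient (vecSum v K) = -1 := by
        unfold orient
        rcases mul_neg_iff.1 hs with h | h
        · simp [h.1, h.2.not_gt]
        · simp [h.1.not_gt, h.2]
      have hsl : slope (toPlane (vecSum v K)) - slope (toPlane (vecSum v J)) < 0 := by
        by_contra hcon
        have := mul_nonpos_of_nonpos_of_nonneg hs.le (not_lt.1 hcon)
        linarith
      have h1 : lineHeight v μ J s₁ < lineHeight v μ K s₁ := by
        have := mul_neg_of_pos_of_neg (a := slope (toPlane (vecSum v J)) -
          slope (toPlane (vecSum v K))) (b := s₁ - s₀) (by linarith) (by linarith)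
        linarith
      have h2 : lineHeight v μ K s₂ < lineHeight v μ J s₂ := by
        have := mul_pos (a := slope (toPlane (vecSum v J)) -
          slope (toPlane (vecSum v K))) (b := s₂ - s₀) (by linarith) (by linarith)
        linarith
      rw [prod_one_add_of_perm_three (wallExponent v μ e s₁)
        (fun I J => -lineHeight v μ I s₁ ≤ -lineHeight v μ J s₁) (hxne _ _ _ _ fun h => nKM h.symm)
        (hxne _ _ _ _ fun h => nJM h.symm) (hxne _ _ _ _ nKM) (hxne _ _ _ _ nJM)
        (not_le.2 (neg_lt_neg h1)) hp' hs₁,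
        prod_one_add_of_perm_three (wallExponent v μ e s₂)
        (fun I J => -lineHeight v μ I s₂ ≤ -lineHeight v μ J s₂) (hxne _ _ _ _ fun h => nJM h.symm)
        (hxne _ _ _ _ fun h => nKM h.symm) (hxne _ _ _ _ nJM) (hxne _ _ _ _ nKM)
        (not_le.2 (neg_lt_neg h2)) hp2 hs₂, eJ, eK]
      rw [ho, neg_one_mul, neg_smul, ← eM] at eC
      have eC' := sub_eq_iff_eq_add.1 eC
      rw [eC']
      abel
    · have ho : orient (vecSum v J) * orient (vecSum v K) = 1 := by
        unfold orient
        rcases mul_pos_iff.1 hs with h | h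
        · simp [h.1, h.2]
        · simp [h.1.not_gt, h.2.not_gt]
      have hsl : 0 < slope (toPlane (vecSum v K)) - slope (toPlane (vecSum v J)) := by
        by_contra hcon
        have := mul_nonpos_of_nonneg_of_nonpos hs.le (not_lt.1 hcon)
        linarith
      have h1 : lineHeight v μ K s₁ < lineHeight v μ J s₁ := by
        have := mul_pos_of_neg_of_neg (a := slope (toPlane (vecSum v J)) -
          slope (toPlane (vecSum v K))) (b := s₁ - s₀) (by linarith) (by linarith)
        linarith
      have h2 : lineHeight v μ J s₂ < lineHeight v μ K s₂ := by
        have := mul_neg_of_neg_of_pos (a := slope (toPlane (vecSum v J)) -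
          slope (toPlane (vecSum v K))) (b := s₂ - s₀) (by linarith) (by linarith)
        linarith
      rw [prod_one_add_of_perm_three (wallExponent v μ e s₁)
        (fun I J => -lineHeight v μ I s₁ ≤ -lineHeight v μ J s₁) (hxne _ _ _ _ fun h => nJM h.symm)
        (hxne _ _ _ _ fun h => nKM h.symm) (hxne _ _ _ _ nJM) (hxne _ _ _ _ nKM)
        (not_le.2 (neg_lt_neg h1)) hp hs₁,
        prod_one_add_of_perm_three (wallExponent v μ e s₂)
        (fun I J => -lineHeight v μ I s₂ ≤ -lineHeight v μ J s₂) (hxne _ _ _ _ fun h => nKM h.symm)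
        (hxne _ _ _ _ fun h => nJM h.symm) (hxne _ _ _ _ nKM) (hxne _ _ _ _ nJM)
        (not_le.2 (neg_lt_neg h2)) hp2' hs₂, eJ, eK]
      rw [ho, one_mul, ← eM] at eC
      have eC' := sub_eq_iff_eq_add.1 eC
      rw [eC']
      abel
  -- Without disjoint sets there are neither products nor splittings at the point, so both sides are
  -- one plus the same sum.
  · push Not at hdis
    have hdis2 : ∀ J ∈ F₂, ∀ K ∈ F₂, ¬ Disjoint J K := fun J hJ K hK =>
      hdis J (hperm.mem_iff.2 hJ) K (hperm.mem_iff.2 hK)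
    rw [prod_one_add_of_mul_eq_zero, prod_one_add_of_mul_eq_zero]
    · congr 1
      rw [(hperm.map _).sum_eq]
      congr 1
      refine List.map_congr_left fun I hI => ?_
      have hI' := hperm.mem_iff.2 hI
      rw [wallExponent, wallExponent, hconst I hI' (fun J hJ hw hJJ =>
        hdis J hJJ.1 _ hJJ.2 Finset.disjoint_sdiff) s₁ s₂ le_rfl (by linarith) (by linarith) le_rfl]
    · exact List.pairwise_of_forall_mem_list fun J hJ K hK => hxne _ _ _ _ (hdis2 J hJ K hK)
    · exact List.pairwise_of_forall_mem_list fun J hJ K hK => hxne _ _ _ _ (hdis J hJ K hK)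

end Sweep

/-! ### Independence of the sweep line, and the loop at infinity -/

section SweepGlobal

variable {E : Type*} [Fintype E] [DecidableEq E] {v : E → ℤ × ℤ} {μ : E → ℝ}
variable {A : Type*} [Ring A] {e : Finset E → A}

/-- The difference of two heights is affine in s. Its sign cannot change unless s passes the
crossing, and at the crossing it is zero; parallel lines keep their distance. -/
theorem lineHeight_le_of_le {I J : Finset E} (hI : vecSum v I ≠ 0) (hJ : vecSum v J ≠ 0)
    {s s' : ℝ} (hc : wedge (vecSum v I) (vecSum v J) ≠ 0 → alpha (crossing v μ I J) = s' ∨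
      0 < (s - alpha (crossing v μ I J)) * (s' - alpha (crossing v μ I J)))
    (h : lineHeight v μ J s ≤ lineHeight v μ I s) : lineHeight v μ J s' ≤ lineHeight v μ I s' := by
  by_cases hw : wedge (vecSum v I) (vecSum v J) = 0
  · have := lineHeight_sub_of_parallel (μ := μ) hI hJ hw s s'
    linarith
  · have h1 := lineHeight_sub (μ := μ) hI hJ hw s
    have h2 := lineHeight_sub (μ := μ) hI hJ hw s'
    rcases hc hw with hc | hc
    · rw [hc, sub_self, mul_zero] at h2
      linarith
    · have h3 : 0 ≤ (slope (toPlane (vecSum v I)) - slope (toPlane (vecSum v J))) *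
          (s - alpha (crossing v μ I J)) := by linarith
      have h4 : 0 ≤ (slope (toPlane (vecSum v I)) - slope (toPlane (vecSum v J))) *
          (s' - alpha (crossing v μ I J)) := by
        rcases mul_pos_iff.1 hc with h | h
        · exact mul_nonneg (nonneg_of_mul_nonneg_left h3 h.1) h.2.le
        · exact mul_nonneg_of_nonpos_of_nonpos (nonpos_of_mul_nonneg_left h3 h.1) h.2.le
      linarith

/-- Both lists are also weakly sorted by height at s₀. Therefore only walls meeting at a common
point of the line alpha = s₀ can change places, and these groups are treated one at a time by
`group_prod_eq`. -/
theorem sweep_prod_eq_of_critical (hg : IsGeneric v μ) (he : IsWallFamily v e) {s₁ s₀ s₂ : ℝ}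
    (h10 : s₁ < s₀) (h02 : s₀ < s₂)
    (hcrit : ∀ I J : Finset E, wedge (vecSum v I) (vecSum v J) ≠ 0 →
      alpha (crossing v μ I J) = s₀ ∨ alpha (crossing v μ I J) < s₁ ∨
        s₂ < alpha (crossing v μ I J))
    {L₁ L₂ : List (Finset E)} (h₁ : IsSweepList v μ s₁ L₁) (h₂ : IsSweepList v μ s₂ L₂) :
    (L₁.map fun I => 1 + wallExponent v μ e s₁ I).prod =
      (L₂.map fun I => 1 + wallExponent v μ e s₂ I).prod := by
  set key : Finset E → ℝ := fun I => -lineHeight v μ I s₀ with hkey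
  set K : List ℝ := (Finset.univ.image key).sort (· ≤ ·) with hKdef
  have hK : K.Pairwise (· < ·) := Finset.sortedLT_sort _ |>.pairwise
  have hmemK : ∀ I, key I ∈ K := fun I => by
    rw [hKdef, Finset.mem_sort]; exact Finset.mem_image_of_mem _ (Finset.mem_univ _)
  have hp : L₁.Perm L₂ := (List.perm_ext_iff_of_nodup h₁.nodup h₂.nodup).2 fun I => by
    rw [h₁.mem_iff, h₂.mem_iff]
  have hs₁ : L₁.Pairwise fun I J => key I ≤ key J := by
    refine h₁.sorted.imp_of_mem fun {I J} hI hJ h => ?_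
    refine neg_le_neg (lineHeight_le_of_le ((h₁.mem_iff I).1 hI) ((h₁.mem_iff J).1 hJ)
      (fun hw => ?_) (neg_le_neg_iff.1 h))
    rcases hcrit I J hw with h | h | h
    · exact Or.inl h
    · exact Or.inr (mul_pos (by linarith) (by linarith))
    · exact Or.inr (mul_pos_of_neg_of_neg (by linarith) (by linarith))
  have hs₂ : L₂.Pairwise fun I J => key I ≤ key J := by
    refine h₂.sorted.imp_of_mem fun {I J} hI hJ h => ?_
    refine neg_le_neg (lineHeight_le_of_le ((h₂.mem_iff I).1 hI) ((h₂.mem_iff J).1 hJ)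
      (fun hw => ?_) (neg_le_neg_iff.1 h))
    rcases hcrit I J hw with h | h | h
    · exact Or.inl h
    · exact Or.inr (mul_pos (by linarith) (by linarith))
    · exact Or.inr (mul_pos_of_neg_of_neg (by linarith) (by linarith))
  rw [prod_map_eq_prod_fibers key _ K hK L₁ (fun I _ => hmemK I) hs₁,
    prod_map_eq_prod_fibers key _ K hK L₂ (fun I _ => hmemK I) hs₂]
  congr 1
  refine List.map_congr_left fun b _ => ?_
  refine group_prod_eq hg he h10 h02 hcrit (hp.filter _) (h₁.nodup.filter _) (-b) (fun I => ?_)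
    (h₁.sorted.filter _) (h₂.sorted.filter _)
  rw [List.mem_filter, h₁.mem_iff, hkey]
  simp [neg_eq_iff_eq_neg]

variable (v μ) in
/-- The values of `alpha` at the intersection points of the lines. -/
def criticalValues : Finset ℝ :=
  (Finset.univ.filter fun p : Finset E × Finset E =>
    wedge (vecSum v p.1) (vecSum v p.2) ≠ 0).image fun p => alpha (crossing v μ p.1 p.2)

theorem alpha_crossing_mem {I J : Finset E} (h : wedge (vecSum v I) (vecSum v J) ≠ 0) :
    alpha (crossing v μ I J) ∈ criticalValues v μ :=
  Finset.mem_image.2 ⟨(I, J), by simpa using h, rfl⟩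

/-- Induction on the number of critical values between s and s', passing one of them at a time. -/
theorem sweep_prod_eq (hg : IsGeneric v μ) (he : IsWallFamily v e) {s s' : ℝ} (hss' : s < s')
    (hs : s ∉ criticalValues v μ) (hs' : s' ∉ criticalValues v μ)
    {L L' : List (Finset E)} (hL : IsSweepList v μ s L) (hL' : IsSweepList v μ s' L') :
    (L.map fun I => 1 + wallExponent v μ e s I).prod =
      (L'.map fun I => 1 + wallExponent v μ e s' I).prod := by
  suffices key : ∀ k : ℕ, ∀ s s' : ℝ, s < s' → s ∉ criticalValues v μ → s' ∉ criticalValues v μ →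
      ((criticalValues v μ).filter fun c => s < c ∧ c < s').card ≤ k →
      ∀ L L' : List (Finset E), IsSweepList v μ s L → IsSweepList v μ s' L' →
      (L.map fun I => 1 + wallExponent v μ e s I).prod =
        (L'.map fun I => 1 + wallExponent v μ e s' I).prod from
    key _ s s' hss' hs hs' le_rfl L L' hL hL'
  intro k
  induction k with
  | zero =>
    intro s s' hss' hs hs' hk L L' hL hL'
    rw [Nat.le_zero, Finset.card_eq_zero] at hk
    refine sweep_prod_eq_of_critical hg he (s₀ := (s + s') / 2) (by linarith) (by linarith)
      (fun I J hw => Or.inr ?_) hL hL'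
    have hm := alpha_crossing_mem (μ := μ) hw
    by_contra hcon
    push Not at hcon
    have : alpha (crossing v μ I J) ∈ (criticalValues v μ).filter fun c => s < c ∧ c < s' :=
      Finset.mem_filter.2 ⟨hm, lt_of_le_of_ne hcon.1 fun h => hs (h ▸ hm),
        lt_of_le_of_ne hcon.2 fun h => hs' (h ▸ hm)⟩
    rw [hk] at this
    simp at this
  | succ k ih =>
    intro s s' hss' hs hs' hk L L' hL hL'
    by_cases hemp : ((criticalValues v μ).filter fun c => s < c ∧ c < s') = ∅
    · exact ih s s' hss' hs hs' (by rw [hemp]; simp) L L' hL hL'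
    have hne := Finset.nonempty_iff_ne_empty.2 hemp
    set s₀ := Finset.min' _ hne with hs₀
    have hmin := Finset.min'_mem _ hne
    rw [← hs₀, Finset.mem_filter] at hmin
    have hDne : (insert s' ((criticalValues v μ).filter fun c => s₀ < c)).Nonempty :=
      Finset.insert_nonempty _ _
    -- The next critical value after s₀, or s' if that comes earlier; the midpoint t of s₀ and d is
    -- then not critical.
    set d := Finset.min' _ hDne with hd
    have hdmem := Finset.min'_mem _ hDne
    have hd0 : s₀ < d := by
      rw [← hd, Finset.mem_insert, Finset.mem_filter] at hdmem
      rcases hdmem with h | h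
      · rw [h]; exact hmin.2.2
      · exact h.2
    have hds' : d ≤ s' := Finset.min'_le _ _ (Finset.mem_insert_self _ _)
    have hdC : ∀ c ∈ criticalValues v μ, s₀ < c → d ≤ c := fun c hc h =>
      Finset.min'_le _ _ (Finset.mem_insert_of_mem (Finset.mem_filter.2 ⟨hc, h⟩))
    set t := (s₀ + d) / 2 with ht
    have ht1 : s₀ < t := by rw [ht]; linarith
    have ht2 : t < d := by rw [ht]; linarith
    have htC : t ∉ criticalValues v μ := fun h => absurd (hdC t h ht1) (by linarith)
    obtain ⟨M, hM⟩ := exists_isSweepList v μ t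
    rw [sweep_prod_eq_of_critical hg he hmin.2.1 ht1 (fun I J hw => ?_) hL hM]
    · refine ih t s' (by linarith) htC hs' ?_ M L' hM hL'
      have hlt : ((criticalValues v μ).filter fun c => t < c ∧ c < s') ⊂
          ((criticalValues v μ).filter fun c => s < c ∧ c < s') := by
        refine Finset.ssubset_iff_subset_ne.2 ⟨fun c hc => ?_, fun h => ?_⟩
        · rw [Finset.mem_filter] at hc ⊢
          exact ⟨hc.1, by linarith [hmin.2.1], hc.2.2⟩
        · have : s₀ ∈ (criticalValues v μ).filter fun c => t < c ∧ c < s' := by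
            rw [h]; exact Finset.mem_filter.2 hmin
          rw [Finset.mem_filter] at this
          linarith [this.2.1]
      have := Finset.card_lt_card hlt
      omega
    · have hm := alpha_crossing_mem (μ := μ) hw
      rcases lt_trichotomy (alpha (crossing v μ I J)) s₀ with h | h | h
      · right; left
        by_contra hcon
        have h1 : s < alpha (crossing v μ I J) :=
          lt_of_le_of_ne (not_lt.1 hcon) fun h => hs (h ▸ hm)
        have := Finset.min'_le _ _ (show alpha (crossing v μ I J) ∈
          (criticalValues v μ).filter fun c => s < c ∧ c < s' from
          Finset.mem_filter.2 ⟨hm, h1, by linarith [hmin.2.2]⟩)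
        rw [← hs₀] at this
        linarith
      · exact Or.inl h
      · exact Or.inr (Or.inr (by linarith [hdC _ hm h]))

/-! ### The walls at infinity -/

variable (v μ) in
/-- The exponent for the walls of slope `b` on one side of the plane at infinity. -/
def wallSum (e : Finset E → A) (side : Bool) (b : ℝ) : A :=
  ∑ I with vecSum v I ≠ 0 ∧ slope (toPlane (vecSum v I)) = b,
    (orient (vecSum v I) * ((if I.card = 1 then 1 else 0) +
      if decide (0 < alpha (toPlane (vecSum v I))) = side then treeCount v μ I else 0 : ℕ)) • e I

/-- Beyond all crossings every splitting is decided at once: all have been passed on the side to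
which the wall points, none on the other side. A single end is a full line and counts on both sides.
-/
theorem countBefore_linePoint {I : Finset E} (hI : vecSum v I ≠ 0) {s : ℝ} {side : Bool}
    (hs : ∀ c ∈ criticalValues v μ, cond side (c < s) (s < c)) :
    countBefore v μ I (linePoint v μ I s) = (if I.card = 1 then 1 else 0) +
      if decide (0 < alpha (toPlane (vecSum v I))) = side then treeCount v μ I else 0 := by
  rw [countBefore_eq]
  congr 1
  have ha := alpha_toPlane_ne_zero hI
  have key : ∀ J ∈ I.powerset.filter (fun J => 0 < wedge (vecSum v J) (vecSum v (I \ J))),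
      (0 < lineForm v μ J (linePoint v μ I s) ↔
        decide (0 < alpha (toPlane (vecSum v I))) = side) := by
    intro J hJ
    rw [Finset.mem_filter, Finset.mem_powerset] at hJ
    rw [lineForm_linePoint_pos_iff hJ.1 hJ.2]
    have hc := hs _ (alpha_crossing_mem (μ := μ) hJ.2.ne')
    cases side with
    | true =>
      rw [cond_true] at hc
      rw [mul_pos_iff_of_pos_left (by linarith), decide_eq_true_iff]
    | false =>
      rw [cond_false] at hc
      rw [← neg_mul_neg, mul_pos_iff_of_pos_left (by linarith), decide_eq_false_iff_not, not_lt,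
        neg_pos]
      exact ⟨le_of_lt, fun h => lt_of_le_of_ne h ha⟩
  split_ifs with h
  · rw [treeCount]
    exact Finset.sum_congr rfl fun J hJ => if_pos ((key J hJ).2 h)
  · exact Finset.sum_eq_zero fun J hJ => if_neg fun h' => h ((key J hJ).1 h')

theorem IsWallFamily.commute (he : IsWallFamily v e) {I J : Finset E}
    (h : wedge (vecSum v I) (vecSum v J) = 0) (m n : ℤ) : Commute (m • e I) (n • e J) := by
  refine Commute.smul_left (Commute.smul_right ?_ n) m
  by_cases hd : Disjoint I J
  · have := he.commutator I J hd
    rw [h, zero_smul] at this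
    exact sub_eq_zero.1 this
  · rw [Commute, SemiconjBy, he.mul_of_not_disjoint I J hd,
      he.mul_of_not_disjoint J I fun h => hd h.symm]

variable [Module ℚ A]

/-- Parallel walls commute and their exponents have square zero, so each factor 1 + x is exp x and
the exponents add up. -/
theorem fiber_prod_eq_exp (he : IsWallFamily v e) {s : ℝ} {side : Bool}
    (hs : ∀ c ∈ criticalValues v μ, cond side (c < s) (s < c)) {L : List (Finset E)}
    (hL : IsSweepList v μ s L) (b : ℝ) :
    ((L.filter fun I => slope (toPlane (vecSum v I)) = b).map
      fun I => 1 + wallExponent v μ e s I).prod = IsNilpotent.exp (wallSum v μ e side b) ∧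
    IsNilpotent (wallSum v μ e side b) := by
  set F := L.filter fun I => slope (toPlane (vecSum v I)) = b with hF
  have hmem : ∀ I, I ∈ F ↔ vecSum v I ≠ 0 ∧ slope (toPlane (vecSum v I)) = b := fun I => by
    rw [hF, List.mem_filter, hL.mem_iff]; simp
  have hsq : ∀ I ∈ F, wallExponent v μ e s I * wallExponent v μ e s I = 0 := by
    intro I hI
    have hne := nonempty_of_vecSum_ne_zero ((hmem I).1 hI).1
    rw [wallExponent, smul_mul_smul_comm, he.mul_of_not_disjoint I I fun h =>
      hne.ne_empty (disjoint_self.1 h), smul_zero]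
  have hcomm : ∀ I ∈ F, ∀ J ∈ F, Commute (wallExponent v μ e s I) (wallExponent v μ e s J) := by
    intro I hI J hJ
    rw [hmem] at hI hJ
    exact he.commute (wedge_eq_zero_of_slope_eq hI.1 hJ.1 (hI.2.trans hJ.2.symm)) _ _
  have hnil : ∀ I ∈ F, IsNilpotent (wallExponent v μ e s I) := fun I hI =>
    ⟨2, by rw [pow_two, hsq I hI]⟩
  have hsum : (F.map (wallExponent v μ e s)).sum = wallSum v μ e side b := by
    rw [← List.sum_toFinset _ (hL.nodup.filter _), wallSum]
    refine Finset.sum_congr ?_ fun I hI => ?_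
    · ext I
      rw [List.mem_toFinset, hmem]
      simp
    · rw [wallExponent, countBefore_linePoint (Finset.mem_filter.1 hI).2.1 hs]
  rw [← hsum]
  refine ⟨?_, isNilpotent_list_sum _ _ hnil hcomm⟩
  rw [← prod_exp_eq_exp_sum _ _ hnil hcomm]
  congr 1
  exact List.map_congr_left fun I hI => (exp_eq_one_add (hsq I hI)).symm

theorem prod_exp_neg_mul_prod_exp_reverse {ι : Type*} (z : ι → A) (K : List ι)
    (hz : ∀ a ∈ K, IsNilpotent (z a)) :
    (K.map fun a => IsNilpotent.exp (-z a)).prod *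
      (K.reverse.map fun a => IsNilpotent.exp (z a)).prod = 1 := by
  induction K with
  | nil => simp
  | cons a K ih =>
    rw [List.map_cons, List.prod_cons, List.reverse_cons, List.map_append, List.prod_append]
    have h := ih fun b hb => hz b (by simp [hb])
    calc _ = IsNilpotent.exp (-z a) * ((K.map fun a => IsNilpotent.exp (-z a)).prod *
          (K.reverse.map fun a => IsNilpotent.exp (z a)).prod) * IsNilpotent.exp (z a) := by
          simp [mul_assoc]
      _ = 1 := by rw [h, mul_one, IsNilpotent.exp_neg_mul_exp_self (hz a (by simp))]

/-- The path ordered product along a loop at infinity is trivial. -/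
theorem prod_exp_wallSum (hg : IsGeneric v μ) (he : IsWallFamily v e) (K : List ℝ)
    (hK : K.Pairwise (· > ·)) (hKv : ∀ I, vecSum v I ≠ 0 → slope (toPlane (vecSum v I)) ∈ K) :
    (K.map fun b => IsNilpotent.exp (-wallSum v μ e false b)).prod *
      (K.map fun b => IsNilpotent.exp (wallSum v μ e true b)).prod = 1 := by
  obtain ⟨s', hs'⟩ : ∃ s', ∀ c ∈ criticalValues v μ, c < s' := by
    obtain ⟨M, hM⟩ := (criticalValues v μ).finite_toSet.bddAbove
    exact ⟨M + 1, fun c hc => lt_of_le_of_lt (hM hc) (by linarith)⟩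
  obtain ⟨s₁, hs₁⟩ : ∃ s₁, ∀ c ∈ criticalValues v μ, s₁ < c := by
    obtain ⟨M, hM⟩ := (criticalValues v μ).finite_toSet.bddBelow
    exact ⟨M - 1, fun c hc => lt_of_lt_of_le (by linarith) (hM hc)⟩
  -- The second entry secures s < s' even if there is no critical value.
  set s := min s₁ (s' - 1) with hsdef
  have hs : ∀ c ∈ criticalValues v μ, s < c := fun c hc =>
    lt_of_le_of_lt (min_le_left _ _) (hs₁ c hc)
  have hss' : s < s' := lt_of_le_of_lt (min_le_right _ _) (by linarith)
  obtain ⟨L, hL⟩ := exists_isSweepList v μ s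
  obtain ⟨L', hL'⟩ := exists_isSweepList v μ s'
  have hprod := sweep_prod_eq (e := e) hg he hss' (fun h => lt_irrefl _ (hs s h))
    (fun h => lt_irrefl _ (hs' s' h)) hL hL'
  have hK' : (K.map fun b => -b).Pairwise (· < ·) := by
    rw [List.pairwise_map]
    exact hK.imp fun h => neg_lt_neg h
  have hKr : K.reverse.Pairwise (· < ·) := by
    rw [List.pairwise_reverse]
    exact hK
  -- Beyond all crossings, descending height means descending slope for large alpha and ascending
  -- slope for small alpha. The product on the small side therefore runs through K backwards, and
  -- its inverse is the first factor of the loop.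
  have hsort' : L'.Pairwise fun I J =>
      -slope (toPlane (vecSum v I)) ≤ -slope (toPlane (vecSum v J)) := by
    refine hL'.sorted.imp_of_mem fun {I J} hI hJ h => ?_
    rw [hL'.mem_iff] at hI hJ
    by_cases hw : wedge (vecSum v I) (vecSum v J) = 0
    · rw [slope_eq_of_wedge_eq_zero hI hJ hw]
    · have h1 := lineHeight_sub (μ := μ) hI hJ hw s'
      have h2 := hs' _ (alpha_crossing_mem (μ := μ) hw)
      have h3 := nonneg_of_mul_nonneg_left (a := slope (toPlane (vecSum v I)) -
        slope (toPlane (vecSum v J))) (b := s' - alpha (crossing v μ I J)) (by linarith)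
        (by linarith)
      linarith
  have hsort : L.Pairwise fun I J =>
      slope (toPlane (vecSum v I)) ≤ slope (toPlane (vecSum v J)) := by
    refine hL.sorted.imp_of_mem fun {I J} hI hJ h => ?_
    rw [hL.mem_iff] at hI hJ
    by_cases hw : wedge (vecSum v I) (vecSum v J) = 0
    · rw [slope_eq_of_wedge_eq_zero hI hJ hw]
    · have h1 := lineHeight_sub (μ := μ) hI hJ hw s
      have h2 := hs _ (alpha_crossing_mem (μ := μ) hw)
      have h3 := nonpos_of_mul_nonneg_left (a := slope (toPlane (vecSum v I)) -
        slope (toPlane (vecSum v J))) (b := s - alpha (crossing v μ I J)) (by linarith)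
        (by linarith)
      linarith
  rw [prod_map_eq_prod_fibers (fun I => slope (toPlane (vecSum v I))) _ K.reverse hKr L
    (fun I hI => List.mem_reverse.2 (hKv I ((hL.mem_iff I).1 hI))) hsort,
    prod_map_eq_prod_fibers (fun I => -slope (toPlane (vecSum v I))) _ _ hK' L'
    (fun I hI => List.mem_map.2 ⟨_, hKv I ((hL'.mem_iff I).1 hI), rfl⟩) hsort', List.map_map]
    at hprod
  have e1 : (K.reverse.map fun b => ((L.filter fun I => slope (toPlane (vecSum v I)) = b).map
      fun I => 1 + wallExponent v μ e s I).prod) =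
      K.reverse.map fun b => IsNilpotent.exp (wallSum v μ e false b) :=
    List.map_congr_left fun b _ => (fiber_prod_eq_exp (side := false) he hs hL b).1
  have e2 : (K.map ((fun b => ((L'.filter fun I => -slope (toPlane (vecSum v I)) = b).map
      fun I => 1 + wallExponent v μ e s' I).prod) ∘ fun b => -b)) =
      K.map fun b => IsNilpotent.exp (wallSum v μ e true b) := by
    refine List.map_congr_left fun b _ => ?_
    rw [← (fiber_prod_eq_exp (side := true) he hs' hL' b).1]
    simp only [Function.comp, neg_inj]
  rw [e1, e2] at hprod
  rw [← hprod]
  exact prod_exp_neg_mul_prod_exp_reverse _ _ fun b _ =>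
    (fiber_prod_eq_exp (side := false) he hs hL b).2

end SweepGlobal

/-! ### The tropical solution of the loop identity -/

section TropicalSolution

variable {F : Type*} [Fintype F] [DecidableEq F] {v : F → ℤ × ℤ} {μ : F → ℝ}
  {E : Type*} [Fintype E] [DecidableEq E] {𝕜 : Type*} [Field 𝕜] [CharZero 𝕜]

variable (v) in
/-- The line part, when the operators of the walls are `y T • wallOp (s T) (vecSum v T)`. -/
def tropLines (s : Finset F → Finset E) (y : Finset F → 𝕜) (I : Finset E) (u : ℤ × ℤ) : 𝕜 :=
  ∑ T with s T = I ∧ vecSum v T = u, if T.card = 1 then y T else 0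

variable (v μ) in
/-- The ray part, when the operators of the walls are `y T • wallOp (s T) (vecSum v T)`. -/
def tropRays (s : Finset F → Finset E) (y : Finset F → 𝕜) (I : Finset E) (u : ℤ × ℤ) : 𝕜 :=
  ∑ T with s T = I ∧ vecSum v T = u, (treeCount v μ T : 𝕜) * y T

/-- Regroups a sum over sets T of elementary walls by their labels and vectors. It identifies the
exponents at infinity from the sweep with those in the uniqueness statement. -/
theorem sideExponent_tropical (s : Finset F → Finset E) (y : Finset F → 𝕜)
    (hsy : ∀ T, s T = ∅ → y T = 0) (P : Finset (ℤ × ℤ)) (hP0 : 0 ∉ P)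
    (hP : ∀ T, y T ≠ 0 → vecSum v T ≠ 0 → vecSum v T ∈ P) (side : Bool) (b : ℝ) :
    sideExponent P (tropLines v s y) (tropRays v μ s y) side b =
      wallSum v μ (fun T => y T • wallOp 𝕜 (s T) (vecSum v T)) side b := by
  set g : Finset F → 𝕜 := fun T => ((orient (vecSum v T) *
    ((if T.card = 1 then 1 else 0) + if decide (0 < alpha (toPlane (vecSum v T))) = side then
      treeCount v μ T else 0 : ℕ) : ℤ) : 𝕜) * y T with hg
  have h1 : ∀ I u, ((orient u : 𝕜) * (tropLines v s y I u +
      if decide (0 < alpha (toPlane u)) = side then tropRays v μ s y I u else 0)) •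
      wallOp 𝕜 I u = ∑ T, if s T = I ∧ vecSum v T = u then g T • wallOp 𝕜 (s T) (vecSum v T)
        else 0 := by
    intro I u
    rw [← Finset.sum_filter]
    have h2 : ∀ T ∈ Finset.univ.filter (fun T => s T = I ∧ vecSum v T = u),
        g T • wallOp 𝕜 (s T) (vecSum v T) = g T • wallOp 𝕜 I u := by
      intro T hT
      rw [Finset.mem_filter] at hT
      rw [hT.2.1, hT.2.2]
    rw [Finset.sum_congr rfl h2]
    have h3 : (orient u : 𝕜) * (tropLines v s y I u +
        if decide (0 < alpha (toPlane u)) = side then tropRays v μ s y I u else 0) =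
        ∑ T with s T = I ∧ vecSum v T = u, g T := by
      rw [tropLines, tropRays]
      split_ifs with hside
      · rw [← Finset.sum_add_distrib, Finset.mul_sum]
        refine Finset.sum_congr rfl fun T hT => ?_
        rw [Finset.mem_filter] at hT
        rw [hg]
        simp only [hT.2.2, hside, if_true]
        split_ifs <;> push_cast <;> ring
      · rw [add_zero, Finset.mul_sum]
        refine Finset.sum_congr rfl fun T hT => ?_
        rw [Finset.mem_filter] at hT
        rw [hg]
        simp only [hT.2.2, hside, if_false]
        split_ifs <;> push_cast <;> ring
    rw [h3]
    refine LinearMap.ext fun f => ?_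
    simp [Finset.sum_smul]
  unfold sideExponent wallSum
  simp only [h1]
  have hcomm : ∀ I : Finset E, (∑ u ∈ P with slope (toPlane u) = b, ∑ T : Finset F,
      if s T = I ∧ vecSum v T = u then g T • wallOp 𝕜 (s T) (vecSum v T) else 0) =
      ∑ T : Finset F, ∑ u ∈ P with slope (toPlane u) = b,
      if s T = I ∧ vecSum v T = u then g T • wallOp 𝕜 (s T) (vecSum v T) else 0 :=
    fun I => Finset.sum_comm
  simp only [hcomm]
  rw [Finset.sum_comm, Finset.sum_filter]
  refine Finset.sum_congr rfl fun T _ => ?_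
  by_cases hy : y T = 0
  · have : g T = 0 := by rw [hg]; simp [hy]
    simp [this, hy]
  have hsT : s T ∈ Finset.univ.erase ∅ :=
    Finset.mem_erase.2 ⟨fun h => hy (hsy T h), Finset.mem_univ _⟩
  rw [Finset.sum_eq_single (s T)]
  · by_cases hv : vecSum v T ≠ 0 ∧ slope (toPlane (vecSum v T)) = b
    · rw [if_pos hv, Finset.sum_eq_single (vecSum v T)]
      · rw [if_pos ⟨rfl, rfl⟩, hg]
        refine LinearMap.ext fun f => ?_
        simp only [LinearMap.smul_apply]
        rw [mul_smul, Int.cast_smul_eq_zsmul]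
      · intro u _ hu
        rw [if_neg fun h => hu h.2.symm]
      · intro hn
        exact absurd (Finset.mem_filter.2 ⟨hP T hy hv.1, hv.2⟩) hn
    · rw [if_neg hv]
      refine Finset.sum_eq_zero fun u hu => ?_
      rw [Finset.mem_filter] at hu
      rw [if_neg]
      rintro ⟨-, rfl⟩
      exact hv ⟨fun h => hP0 (h ▸ hu.1), hu.2⟩
  · intro I _ hI
    exact Finset.sum_eq_zero fun u _ => if_neg fun h => hI h.1.symm
  · intro h
    exact absurd hsT h

/-- The tropical counts solve the loop identity. -/
theorem loopProduct_tropical (hg : IsGeneric v μ) (s : Finset F → Finset E) (y : Finset F → 𝕜)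
    (hsy : ∀ T, s T = ∅ → y T = 0) (P : Finset (ℤ × ℤ)) (hP0 : 0 ∉ P)
    (hP : ∀ T, y T ≠ 0 → vecSum v T ≠ 0 → vecSum v T ∈ P)
    (he : IsWallFamily v fun T => y T • wallOp 𝕜 (s T) (vecSum v T))
    (K : List ℝ) (hK : K.Pairwise (· > ·))
    (hKv : ∀ T, vecSum v T ≠ 0 → slope (toPlane (vecSum v T)) ∈ K) :
    loopProduct K P (tropLines v s y) (tropRays v μ s y) = 1 := by
  unfold loopProduct
  simp only [sideExponent_tropical s y hsy P hP0 hP]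
  exact prod_exp_wallSum hg he K hK hKv

/-- The tropical counts do not depend on the moments. -/
theorem treeCount_eq_of_isGeneric {μ' : F → ℝ} (hg : IsGeneric v μ) (hg' : IsGeneric v μ')
    (T : Finset F) (hT : vecSum v T ≠ 0) : treeCount v μ T = treeCount v μ' T := by
  -- Every end is given a variable of its own and the coefficient 1. The rays of the loop identity
  -- are then the tree counts themselves, and they are determined by the lines, which do not involve
  -- the moments. The value 0 at the empty set discards the operator without labels.
  set s : Finset F → Finset F := id
  set y : Finset F → ℚ := fun T => if T = ∅ then 0 else 1 with hy
  set P : Finset (ℤ × ℤ) := (Finset.univ.image (vecSum v)).erase 0 with hPdef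
  set K : List ℝ := (P.image fun u => slope (toPlane u)).sort (· ≥ ·) with hKdef
  have hK : K.Pairwise (· > ·) := (Finset.sortedGT_sort _).pairwise
  have hsy : ∀ T, s T = ∅ → y T = 0 := fun T h => if_pos h
  have hP : ∀ T, vecSum v T ≠ 0 → vecSum v T ∈ P := fun T h =>
    Finset.mem_erase.2 ⟨h, Finset.mem_image_of_mem _ (Finset.mem_univ _)⟩
  have hKP : ∀ u ∈ P, slope (toPlane u) ∈ K := fun u hu =>
    (Finset.mem_sort _).2 (Finset.mem_image_of_mem (fun u => slope (toPlane u)) hu)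
  have he : IsWallFamily v fun T => y T • wallOp ℚ (s T) (vecSum v T) := by
    constructor
    · intro I J h
      rw [smul_mul_smul_comm, show wallOp ℚ (s I) (vecSum v I) * wallOp ℚ (s J) (vecSum v J) = 0
        from wallOp_mul_of_not_disjoint h _ _, smul_zero]
    · intro I J h
      by_cases hI : I = ∅
      · subst hI; simp [hy, vecSum_empty, wedge_zero_left]
      by_cases hJ : J = ∅
      · subst hJ; simp [hy, vecSum_empty, wedge_zero_right]
      have hIJ : I ∪ J ≠ ∅ := fun h => hI (Finset.union_eq_empty.1 h).1
      have := wallOp_commutator (𝕜 := ℚ) h (vecSum v I) (vecSum v J)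
      simp only [hy, hI, hJ, hIJ, if_false, one_smul, s, id]
      rw [vecSum_union h]
      exact this
  have h0 : (0 : ℤ × ℤ) ∉ P := by simp [hPdef]
  have h1 := loopProduct_tropical (𝕜 := ℚ) hg s y hsy P h0 (fun T _ => hP T) he K hK
    fun T hT => hKP _ (hP T hT)
  have h2 := loopProduct_tropical (𝕜 := ℚ) hg' s y hsy P h0 (fun T _ => hP T) he K hK
    fun T hT => hKP _ (hP T hT)
  have hTne := nonempty_of_vecSum_ne_zero hT
  have key := loopProduct_unique K (hK.imp fun h => ne_of_gt h) P h0 hKP _ _ _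
    (fun m => by rw [h1]; rfl) (fun m => by rw [h2]; rfl) T hTne _ (hP T hT)
  have e : ∀ μ : F → ℝ, tropRays v μ s y T (vecSum v T) = treeCount v μ T := by
    intro μ
    rw [tropRays, Finset.sum_eq_single T]
    · simp [hy, hTne.ne_empty]
    · intro T' h h'
      exact absurd (Finset.mem_filter.1 h).2.1 h'
    · simp [s]
  rw [e, e] at key
  exact_mod_cast key

end TropicalSolution

/-! ### Rooted trees -/

/-- The function `par` sends a vertex to its parent in the tree `G` with root `r`. -/
structure IsRooting {V : Type*} (G : SimpleGraph V) (r : V) (par : V → Option V)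
    (height : V → ℕ) : Prop where
  par_eq_none : ∀ u, par u = none ↔ u = r
  height_lt : ∀ u p, par u = some p → height u < height p
  adj_iff : ∀ u c, G.Adj u c ↔ par u = some c ∨ par c = some u

section Rooting

variable {V : Type*} {G : SimpleGraph V} {r : V} {par : V → Option V} {height : V → ℕ}

/-- The parent is the neighbour closer to the root, and the height is a bound minus the distance to
the root, so that it grows towards the root. -/
theorem exists_isRooting [Finite V] (hG : G.IsTree) (r : V) :
    ∃ par height, IsRooting G r par height := by
  classical
  have hc := hG.1
  have key : ∀ u, u ≠ r → ∃ p, G.Adj u p ∧ G.dist r u = G.dist r p + 1 := by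
    intro u hu
    obtain ⟨w, hw, hl⟩ := hc.exists_path_of_dist r u
    have hn : ¬ w.Nil := fun h => hu h.eq.symm
    refine ⟨w.penultimate, (w.adj_penultimate hn).symm, ?_⟩
    rcases hG.dist_eq_dist_add_one_of_adj r (w.adj_penultimate hn) with h | h
    · exfalso
      have h1 : G.dist r w.penultimate ≤ w.dropLast.length := SimpleGraph.dist_le _
      have h2 := SimpleGraph.Walk.length_dropLast_add_one hn
      omega
    · exact h
  -- Two closer neighbours would give two paths from the root to u.
  have uniq : ∀ u p p', G.Adj u p → G.dist r u = G.dist r p + 1 → G.Adj u p' →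
      G.dist r u = G.dist r p' + 1 → p = p' := by
    intro u p p' h1 h2 h3 h4
    obtain ⟨w, hw, hl⟩ := hc.exists_path_of_dist r p
    obtain ⟨w', hw', hl'⟩ := hc.exists_path_of_dist r p'
    have e1 : (w.concat h1.symm).IsPath :=
      SimpleGraph.Walk.isPath_of_length_eq_dist _ (by simp; omega)
    have e2 : (w'.concat h3.symm).IsPath :=
      SimpleGraph.Walk.isPath_of_length_eq_dist _ (by simp; omega)
    have e3 := (hG.existsUnique_path r u).unique e1 e2
    have := congrArg SimpleGraph.Walk.penultimate e3
    simpa using this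
  obtain ⟨N, hN⟩ : ∃ N, ∀ u, G.dist r u ≤ N := by
    obtain ⟨N, hN⟩ := (Set.finite_range (G.dist r)).bddAbove
    exact ⟨N, fun u => hN ⟨u, rfl⟩⟩
  choose p hp using key
  refine ⟨fun u => if h : u = r then none else some (p u h), fun u => N - G.dist r u,
    ⟨fun u => ?_, fun u q h => ?_, fun u c => ?_⟩⟩
  · by_cases h : u = r <;> simp [h]
  · by_cases hu : u = r
    · simp [hu] at h
    · simp only [hu, dite_false, Option.some.injEq] at h
      have h1 := (hp u hu).2
      have h2 := hN u
      rw [h] at h1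
      omega
  · have aux : ∀ u c, G.Adj u c → G.dist r u = G.dist r c + 1 →
        (if h : u = r then none else some (p u h)) = some c := by
      intro u c h1 h2
      have hu : u ≠ r := by
        rintro rfl
        simp at h2
      simp only [hu, dite_false, Option.some.injEq]
      exact uniq u _ _ (hp u hu).1 (hp u hu).2 h1 h2
    have aux' : ∀ u c, (if h : u = r then none else some (p u h)) = some c → G.Adj u c := by
      intro u c h
      by_cases hu : u = r
      · simp [hu] at h
      · simp only [hu, dite_false, Option.some.injEq] at h
        rw [← h]
        exact (hp u hu).1
    constructor
    · intro h
      rcases hG.dist_eq_dist_add_one_of_adj r h with h' | h'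
      · exact Or.inl (aux _ _ h h')
      · exact Or.inr (aux _ _ h.symm h')
    · rintro (h | h)
      · exact aux' _ _ h
      · exact (aux' _ _ h).symm

theorem IsRooting.reachable (h : IsRooting G r par height) [Finite V] (u : V) :
    G.Reachable u r := by
  obtain ⟨N, hN⟩ : ∃ N, ∀ u, height u ≤ N := by
    obtain ⟨N, hN⟩ := (Set.finite_range height).bddAbove
    exact ⟨N, fun u => hN ⟨u, rfl⟩⟩
  induction hk : N - height u using Nat.strong_induction_on generalizing u with
  | _ k ih =>
  rcases hp : par u with _ | p
  · rw [(h.par_eq_none u).1 hp]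
  · have h1 := h.height_lt u p hp
    have h2 := hN p
    exact (((h.adj_iff u p).2 (Or.inl hp)).reachable).trans (ih (N - height p) (by omega) p rfl)

/-- Every edge joins a vertex other than the root to its parent, so a connected graph on V has at
most |V| - 1 edges here. -/
theorem IsRooting.isTree (h : IsRooting G r par height) [Finite V] : G.IsTree := by
  classical
  have := Fintype.ofFinite V
  have hc : G.Connected :=
    { preconnected := fun u v => (h.reachable u).trans (h.reachable v).symm
      nonempty := ⟨r⟩ }
  rw [SimpleGraph.isTree_iff_connected_and_card]
  refine ⟨hc, le_antisymm ?_ hc.card_vert_le_card_edgeSet_add_one⟩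
  let g : {u : V // u ≠ r} → G.edgeSet := fun u =>
    ⟨s(u.1, (par u.1).getD r), by
      rcases hp : par u.1 with _ | p
      · exact absurd ((h.par_eq_none _).1 hp) u.2
      · simpa [hp] using (h.adj_iff u.1 p).2 (Or.inl hp)⟩
  have hg : Function.Surjective g := by
    rintro ⟨e, he⟩
    induction e using Sym2.ind with
    | _ u c =>
    have ne : ∀ u p, par u = some p → u ≠ r := by
      intro u p hp hu
      rw [(h.par_eq_none u).2 hu] at hp
      cases hp
    rcases (h.adj_iff u c).1 he with hp | hp
    · exact ⟨⟨u, ne u c hp⟩, Subtype.ext (by simp [g, hp])⟩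
    · exact ⟨⟨c, ne c u hp⟩, Subtype.ext (by simp [g, hp, Sym2.eq_swap])⟩
  have h1 := Nat.card_le_card_of_surjective g hg
  have h2 : Nat.card {u : V // u ≠ r} + 1 = Nat.card V := by
    rw [Nat.card_eq_fintype_card, Nat.card_eq_fintype_card, Fintype.card_subtype_compl,
      Fintype.card_subtype_eq]
    have : 0 < Fintype.card V := Fintype.card_pos_iff.2 ⟨r⟩
    omega
  omega

/-- Induction downwards from the root. If the second rooting reversed the edge from u to its parent
p, it would make u the parent of p; as the rootings agree at p, this contradicts the heights of the
first. -/
theorem IsRooting.unique (h : IsRooting G r par height) {par' : V → Option V} {height' : V → ℕ}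
    (h' : IsRooting G r par' height') [Finite V] (u : V) : par u = par' u := by
  obtain ⟨N, hN⟩ : ∃ N, ∀ u, height u ≤ N := by
    obtain ⟨N, hN⟩ := (Set.finite_range height).bddAbove
    exact ⟨N, fun u => hN ⟨u, rfl⟩⟩
  induction hk : N - height u using Nat.strong_induction_on generalizing u with
  | _ k ih =>
  rcases hp : par u with _ | p
  · exact ((h'.par_eq_none u).2 ((h.par_eq_none u).1 hp)).symm
  · have h1 := h.height_lt u p hp
    have h2 := hN p
    rcases (h'.adj_iff u p).1 ((h.adj_iff u p).2 (Or.inl hp)) with h3 | h3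
    · exact h3.symm
    · have h4 := ih (N - height p) (by omega) p rfl
      rw [h3] at h4
      have := h.height_lt p u h4
      omega

end Rooting

/-! ### Branches of a rooted tree with ends -/

section Branches

variable {V E : Type*}

/-- The vertex at which the edge towards the root that starts with `x` arrives. -/
def upper (par : V → Option V) (endV : Option E → V) : V ⊕ E → Option V :=
  Sum.elim par fun e => some (endV (some e))

/-- The branch at `x` is trivalent and its combinatorial type is the tree. -/
def IsBranch (q : V ⊕ E → Option V) : BTree E → V ⊕ E → Prop
  | .leaf e, x => x = .inr e
  | .node l r, x => ∃ u y z, x = .inl u ∧ y ≠ z ∧ (∀ w, q w = some u ↔ w = y ∨ w = z) ∧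
      IsBranch q l y ∧ IsBranch q r z

/-- The tree `t` is a subtree of the second tree. -/
def BTree.IsSubtree {E : Type*} (t : BTree E) : BTree E → Prop
  | .leaf e => t = .leaf e
  | .node l r => t = .node l r ∨ t.IsSubtree l ∨ t.IsSubtree r

theorem BTree.IsSubtree.refl (t : BTree E) : t.IsSubtree t := by
  cases t <;> simp [IsSubtree]

theorem BTree.IsSubtree.trans {s t T : BTree E} (h : s.IsSubtree t) (h' : t.IsSubtree T) :
    s.IsSubtree T := by
  induction T with
  | leaf e => rw [IsSubtree] at h'; subst h'; exact h
  | node l r hl hr =>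
    rcases h' with rfl | h' | h'
    · exact h
    · exact Or.inr (Or.inl (hl h'))
    · exact Or.inr (Or.inr (hr h'))

theorem BTree.IsSubtree.left (l r : BTree E) : l.IsSubtree (.node l r) :=
  Or.inr (Or.inl (IsSubtree.refl l))

theorem BTree.IsSubtree.right (l r : BTree E) : r.IsSubtree (.node l r) :=
  Or.inr (Or.inr (IsSubtree.refl r))

variable {q : V ⊕ E → Option V} {height : V → ℕ}

theorem IsBranch.exists_of_isSubtree {T t : BTree E} {x : V ⊕ E} (h : IsBranch q T x)
    (ht : t.IsSubtree T) : ∃ y, IsBranch q t y := by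
  induction T generalizing x with
  | leaf e => rw [BTree.IsSubtree] at ht; subst ht; exact ⟨x, h⟩
  | node l r hl hr =>
    rcases ht with rfl | ht | ht
    · exact ⟨x, h⟩
    · obtain ⟨u, y, z, -, -, -, h1, h2⟩ := h
      exact hl h1 ht
    · obtain ⟨u, y, z, -, -, -, h1, h2⟩ := h
      exact hr h2 ht

theorem IsBranch.eq {T : BTree E} {x y : V ⊕ E} (hx : IsBranch q T x) (hy : IsBranch q T y) :
    x = y := by
  induction T generalizing x y with
  | leaf e => rw [IsBranch] at hx hy; rw [hx, hy]
  | node l r hl hr =>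
    obtain ⟨u, a, b, rfl, -, h1, h2, -⟩ := hx
    obtain ⟨u', a', b', rfl, -, h1', h2', -⟩ := hy
    have e := hl h2 h2'
    have h3 := (h1 a).2 (Or.inl rfl)
    have h4 := (h1' a').2 (Or.inl rfl)
    rw [e, h4] at h3
    rw [Option.some.inj h3]

/-- The end `e` lies above `x`. -/
def IsAbove (q : V ⊕ E → Option V) : V ⊕ E → V ⊕ E → Prop :=
  Relation.ReflTransGen fun x y => (q x).map Sum.inl = some y

theorem IsAbove.total {a x y : V ⊕ E} (h : IsAbove q a x) (h' : IsAbove q a y) :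
    IsAbove q x y ∨ IsAbove q y x := by
  refine Relation.ReflTransGen.total_of_right_unique ?_ h h'
  intro a b c h1 h2
  exact Option.some.inj (h1.symm.trans h2)

theorem IsAbove.height_le (hq : ∀ u p, q (.inl u) = some p → height u < height p) {u : V}
    {x : V ⊕ E} (h : IsAbove q (.inl u) x) : ∃ p, x = .inl p ∧ height u ≤ height p := by
  induction h with
  | refl => exact ⟨u, rfl, le_rfl⟩
  | tail _ h2 ih =>
    obtain ⟨p, rfl, hp⟩ := ih
    obtain ⟨p', h3, rfl⟩ := Option.map_eq_some_iff.1 h2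
    exact ⟨p', rfl, hp.trans (hq _ _ h3).le⟩

/-- The vertices on the way from a to the root form a chain, and of two children of u neither can
lie strictly on the way from the other, by their heights. -/
theorem eq_of_isAbove (hq : ∀ u p, q (.inl u) = some p → height u < height p) {u : V}
    {a y z : V ⊕ E} (hy : IsAbove q a y) (hz : IsAbove q a z) (hyu : q y = some u)
    (hzu : q z = some u) : y = z := by
  have aux : ∀ y z, q y = some u → q z = some u → IsAbove q y z → y = z := by
    intro y z hyu hzu h
    rcases Relation.ReflTransGen.cases_head h with h | ⟨c, h1, h2⟩
    · exact h
    · simp only [hyu, Option.map_some, Option.some.injEq] at h1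
      subst h1
      obtain ⟨p, rfl, hp⟩ := IsAbove.height_le hq h2
      have := hq _ _ hzu
      omega
  rcases hy.total hz with h | h
  · exact aux y z hyu hzu h
  · exact (aux z y hzu hyu h).symm

variable [DecidableEq E]

theorem IsBranch.isAbove {T : BTree E} {x : V ⊕ E} (h : IsBranch q T x) {e : E}
    (he : e ∈ T.leaves) : IsAbove q (.inr e) x := by
  induction T generalizing x with
  | leaf e' =>
    rw [IsBranch] at h
    simp only [BTree.leaves, Finset.mem_singleton] at he
    rw [h, he]
    exact Relation.ReflTransGen.refl
  | node l r hl hr =>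
    obtain ⟨u, y, z, rfl, -, h1, h2, h3⟩ := h
    rw [BTree.leaves, Finset.mem_union] at he
    rcases he with he | he
    · exact (hl h2 he).tail (by simp [(h1 y).2 (Or.inl rfl)])
    · exact (hr h3 he).tail (by simp [(h1 z).2 (Or.inr rfl)])

theorem IsBranch.mem_leaves {T : BTree E} {x : V ⊕ E} (h : IsBranch q T x) {e : E}
    (he : IsAbove q (.inr e) x) : e ∈ T.leaves := by
  induction T generalizing x with
  | leaf e' =>
    rw [IsBranch] at h
    subst h
    rcases Relation.ReflTransGen.cases_tail he with h | ⟨c, h1, h2⟩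
    · simpa [BTree.leaves] using h.symm
    · obtain ⟨p, h3, h4⟩ := Option.map_eq_some_iff.1 h2
      cases h4
  | node l r hl hr =>
    obtain ⟨u, y, z, rfl, -, h1, h2, h3⟩ := h
    rcases Relation.ReflTransGen.cases_tail he with h | ⟨c, h4, h5⟩
    · cases h
    · obtain ⟨p, h6, h7⟩ := Option.map_eq_some_iff.1 h5
      cases h7
      rw [BTree.leaves, Finset.mem_union]
      rcases (h1 c).1 h6 with rfl | rfl
      · exact Or.inl (hl h2 h4)
      · exact Or.inr (hr h3 h4)

theorem disjoint_leaves (hq : ∀ u p, q (.inl u) = some p → height u < height p) {T T' : BTree E}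
    {y z : V ⊕ E} (hT : IsBranch q T y) (hT' : IsBranch q T' z) {u : V} (hy : q y = some u)
    (hz : q z = some u) (hne : y ≠ z) : Disjoint T.leaves T'.leaves := by
  rw [Finset.disjoint_left]
  intro e he he'
  exact hne (eq_of_isAbove hq (hT.isAbove he) (hT'.isAbove he') hy hz)

/-- The branches at a vertex are determined up to their order, and the sign condition in `IsGood`
fixes the order. -/
theorem IsBranch.unique {v : E → ℤ × ℤ} {μ : E → ℝ} {T T' : BTree E} {x : V ⊕ E}
    (hT : IsBranch q T x) (hT' : IsBranch q T' x) (hg : T.IsGood v μ) (hg' : T'.IsGood v μ) :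
    T = T' := by
  induction T generalizing T' x with
  | leaf e =>
    rw [IsBranch] at hT
    subst hT
    cases T' with
    | leaf e' => rw [IsBranch] at hT'; cases hT'; rfl
    | node l r => obtain ⟨_, _, _, h, _⟩ := hT'; cases h
  | node l r hl hr =>
    cases T' with
    | leaf e' => rw [IsBranch] at hT'; subst hT'; obtain ⟨_, _, _, h, _⟩ := hT; cases h
    | node l' r' =>
      obtain ⟨u, y, z, rfl, hne, h1, h2, h3⟩ := hT
      obtain ⟨u', y', z', h, hne', h1', h2', h3'⟩ := hT'
      cases h
      obtain ⟨-, hw, hgl, hgr, -⟩ := hg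
      obtain ⟨-, hw', hgl', hgr', -⟩ := hg'
      have hy := (h1' y).1 ((h1 y).2 (Or.inl rfl))
      have hz := (h1' z).1 ((h1 z).2 (Or.inr rfl))
      rcases hy with rfl | rfl
      · rcases hz with rfl | rfl
        · exact absurd rfl hne
        · rw [hl h2 h2' hgl hgl', hr h3 h3' hgr hgr']
      · rcases hz with rfl | rfl
        · rw [hl h2 h3' hgl hgr', hr h3 h2' hgr hgl', wedge_comm] at hw
          omega
        · exact absurd rfl hne

/-- Descending from the root: a vertex labelled by a node passes its two branches on to its
children. -/
theorem IsBranch.exists_label {par : V → Option V} {endV : Option E → V} {G : SimpleGraph V}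
    [Finite V] (hr : IsRooting G (endV none) par height) {T : BTree E}
    (hT : IsBranch (upper par endV) T (.inl (endV none))) (x : V ⊕ E) :
    ∃ t : BTree E, t.IsSubtree T ∧ IsBranch (upper par endV) t x := by
  have step : ∀ x u, upper par endV x = some u →
      (∃ t : BTree E, t.IsSubtree T ∧ IsBranch (upper par endV) t (.inl u)) →
      ∃ t : BTree E, t.IsSubtree T ∧ IsBranch (upper par endV) t x := by
    rintro x u hx ⟨t, ht, hb⟩
    cases t with
    | leaf e => rw [IsBranch] at hb; cases hb
    | node l r =>
      obtain ⟨u', y, z, h, -, h1, h2, h3⟩ := hb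
      cases h
      rcases (h1 x).1 hx with rfl | rfl
      · exact ⟨l, (BTree.IsSubtree.left l r).trans ht, h2⟩
      · exact ⟨r, (BTree.IsSubtree.right l r).trans ht, h3⟩
  have hV : ∀ u, ∃ t : BTree E, t.IsSubtree T ∧ IsBranch (upper par endV) t (.inl u) := by
    obtain ⟨N, hN⟩ : ∃ N, ∀ u, height u ≤ N := by
      obtain ⟨N, hN⟩ := (Set.finite_range height).bddAbove
      exact ⟨N, fun u => hN ⟨u, rfl⟩⟩
    intro u
    induction hk : N - height u using Nat.strong_induction_on generalizing u with
    | _ k ih =>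
    rcases hp : par u with _ | p
    · rw [(hr.par_eq_none u).1 hp]
      exact ⟨T, .refl T, hT⟩
    · have h1 := hr.height_lt u p hp
      have h2 := hN p
      exact step _ p hp (ih (N - height p) (by omega) p rfl)
  rcases x with u | e
  · exact hV u
  · exact step _ _ rfl (hV _)

theorem IsBranch.leaves_eq_univ [Fintype E] {par : V → Option V} {endV : Option E → V}
    {G : SimpleGraph V} [Finite V] (hr : IsRooting G (endV none) par height) {T : BTree E}
    (hT : IsBranch (upper par endV) T (.inl (endV none))) : T.leaves = Finset.univ := by
  refine Finset.eq_univ_iff_forall.2 fun e => hT.mem_leaves ?_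
  have hV : ∀ u, IsAbove (upper par endV) (.inl u) (.inl (endV none)) := by
    obtain ⟨N, hN⟩ : ∃ N, ∀ u, height u ≤ N := by
      obtain ⟨N, hN⟩ := (Set.finite_range height).bddAbove
      exact ⟨N, fun u => hN ⟨u, rfl⟩⟩
    intro u
    induction hk : N - height u using Nat.strong_induction_on generalizing u with
    | _ k ih =>
    rcases hp : par u with _ | p
    · rw [(hr.par_eq_none u).1 hp]
      exact Relation.ReflTransGen.refl
    · have h1 := hr.height_lt u p hp
      have h2 := hN p
      exact Relation.ReflTransGen.head (by simp [upper, hp])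
        (ih (N - height p) (by omega) p rfl)
  exact Relation.ReflTransGen.head (by simp [upper]) (hV (endV (some e)))

end Branches

/-! ### The star of a vertex -/

section Star

variable {V E : Type*} {G : SimpleGraph V} {par : V → Option V} {height : V → ℕ}
  (endV : Option E → V) (edgeVec : V → V → ℤ × ℤ) (endVec : Option E → ℤ × ℤ)

/-- The vector of the edge that leads from `x` towards the root. -/
def upperVec (par : V → Option V) : V ⊕ E → ℤ × ℤ :=
  Sum.elim (fun u => (par u).elim (endVec none) (edgeVec u)) fun e => - endVec (some e)

/-- The star of u consists of one edge towards the root, which is the out edge if u is the root, and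
of the edges arriving from the children and ends, whose vectors are reversed when seen from u. -/
theorem exists_starEquiv (h : IsRooting G (endV none) par height)
    (hs : ∀ u v, G.Adj u v → edgeVec v u = - edgeVec u v) (u : V) :
    ∃ f : Option {x : V ⊕ E // upper par endV x = some u} ≃
        {c // G.Adj u c} ⊕ {e // endV e = u},
      Sum.elim (fun c => edgeVec u c.1) (fun e => endVec e.1) (f none) =
        upperVec edgeVec endVec par (.inl u) ∧
      ∀ x, Sum.elim (fun c => edgeVec u c.1) (fun e => endVec e.1) (f (some x)) =
        - upperVec edgeVec endVec par x.1 := by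
  obtain ⟨s, hs1, hs2, hs3⟩ : ∃ s : {c // G.Adj u c} ⊕ {e // endV e = u},
      Sum.elim (fun c => edgeVec u c.1) (fun e => endVec e.1) s =
        upperVec edgeVec endVec par (.inl u) ∧ (∀ c, s = .inl c ↔ par u = some c.1) ∧
        (∀ e, s = .inr e ↔ e.1 = none) := by
    rcases hp : par u with _ | p
    · have hu := (h.par_eq_none u).1 hp
      refine ⟨.inr ⟨none, hu.symm⟩, by simp [upperVec, hp], by simp, fun e => ?_⟩
      rw [Sum.inr.injEq, Subtype.ext_iff, eq_comm]
    · refine ⟨.inl ⟨p, (h.adj_iff u p).2 (Or.inl hp)⟩, by simp [upperVec, hp], fun c => ?_, ?_⟩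
      · rw [Sum.inl.injEq, Subtype.ext_iff, Option.some.injEq]
      · rintro ⟨e, he⟩
        simp only [reduceCtorEq, false_iff]
        rintro rfl
        have := (h.par_eq_none u).2 he.symm
        rw [hp] at this
        cases this
  let g : {x : V ⊕ E // upper par endV x = some u} → {c // G.Adj u c} ⊕ {e // endV e = u} :=
    fun x => match x with
      | ⟨.inl c, hc⟩ => .inl ⟨c, (h.adj_iff u c).2 (Or.inr hc)⟩
      | ⟨.inr e, he⟩ => .inr ⟨some e, Option.some.inj he⟩
  have hbij : Function.Bijective (fun o : Option _ => o.elim s g) := by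
    constructor
    · have aux : ∀ x, s ≠ g x := by
        rintro ⟨c | e, hx⟩ hsx
        · have h1 : par u = some c := (hs2 _).1 hsx
          have h2 := h.height_lt _ _ h1
          have h3 := h.height_lt c u hx
          omega
        · have := (hs3 _).1 hsx
          cases this
      rintro (_ | x) (_ | y) hxy
      · rfl
      · exact absurd hxy (aux y)
      · exact absurd hxy.symm (aux x)
      · obtain ⟨x | x, hx⟩ := x <;> obtain ⟨y | y, hy⟩ := y <;> simp [g] at hxy <;> simp [hxy]
    · rintro (⟨c, hc⟩ | ⟨e, he⟩)
      · rcases (h.adj_iff u c).1 hc with h1 | h1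
        · exact ⟨none, (hs2 _).2 h1⟩
        · exact ⟨some ⟨.inl c, h1⟩, rfl⟩
      · rcases e with _ | e
        · exact ⟨none, (hs3 _).2 rfl⟩
        · exact ⟨some ⟨.inr e, by simp [upper, he]⟩, rfl⟩
  refine ⟨Equiv.ofBijective _ hbij, hs1, ?_⟩
  rintro ⟨c | e, hx⟩
  · have hc : par c = some u := hx
    change edgeVec u c = - upperVec edgeVec endVec par (.inl c)
    simp only [upperVec, Sum.elim_inl, hc, Option.elim_some]
    rw [hs u c ((h.adj_iff u c).2 (Or.inr hc)), neg_neg]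
  · change endVec (some e) = - upperVec edgeVec endVec par (.inr e)
    simp [upperVec]

theorem finsum_star [Finite V] [Finite E] (h : IsRooting G (endV none) par height)
    (hs : ∀ u v, G.Adj u v → edgeVec v u = - edgeVec u v) (u : V) :
    (∑ᶠ c : {c // G.Adj u c}, edgeVec u c.1) + (∑ᶠ e : {e // endV e = u}, endVec e.1) =
      upperVec edgeVec endVec par (.inl u) -
        ∑ᶠ x : {x : V ⊕ E // upper par endV x = some u}, upperVec edgeVec endVec par x.1 := by
  classical
  have := Fintype.ofFinite V
  have := Fintype.ofFinite E
  obtain ⟨f, hf, hf'⟩ := exists_starEquiv endV edgeVec endVec h hs u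
  rw [finsum_eq_sum_of_fintype, finsum_eq_sum_of_fintype, finsum_eq_sum_of_fintype]
  have := Fintype.sum_sum_type
    (Sum.elim (fun c : {c // G.Adj u c} => edgeVec u c.1)
      (fun e : {e // endV e = u} => endVec e.1))
  simp only [Sum.elim_inl, Sum.elim_inr] at this
  rw [← this, ← Equiv.sum_comp f, Fintype.sum_option, hf]
  simp only [hf']
  rw [Finset.sum_neg_distrib, sub_eq_add_neg]

theorem card_star [Finite V] [Finite E] (h : IsRooting G (endV none) par height) (u : V) :
    Nat.card ({c // G.Adj u c} ⊕ {e // endV e = u}) =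
      Nat.card {x : V ⊕ E // upper par endV x = some u} + 1 := by
  classical
  have := Fintype.ofFinite V
  have := Fintype.ofFinite E
  obtain ⟨f, -, -⟩ := exists_starEquiv endV (fun _ _ => 0) (fun _ => 0) h (by simp) u
  rw [← Nat.card_congr f, Nat.card_eq_fintype_card, Nat.card_eq_fintype_card,
    Fintype.card_option]

end Star

/-! ### Curves with given ends -/

section Curves

variable {E : Type} [Fintype E]

/-- The incoming unbounded edges of the curve have the vectors `v` and the moments `μ`. -/
structure IsRealized (v : E → ℤ × ℤ) (μ : E → ℝ) (Γ : TropCurve (Option E)) : Prop where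
  in_vec : ∀ e, Γ.endVec (some e) = - v e
  in_line : ∀ e, wedgeR (toPlane (v e)) (Γ.pos (Γ.endVertex (some e))) = μ e

theorem finsum_subtype_pair {X A : Type*} [AddCommMonoid A] {p : X → Prop} {y z : X} (hne : y ≠ z)
    (h : ∀ w, p w ↔ w = y ∨ w = z) (f : X → A) : ∑ᶠ x : {x // p x}, f x.1 = f y + f z := by
  have e : {x | p x} = {y, z} := by ext w; simp [h]
  have := finsum_set_coe_eq_finsum_mem (f := f) {x | p x}
  rw [← finsum_mem_pair hne, ← e]
  exact this

theorem card_subtype_pair {X : Type*} {p : X → Prop} {y z : X} (hne : y ≠ z)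
    (h : ∀ w, p w ↔ w = y ∨ w = z) : Nat.card {x // p x} = 2 := by
  have e : {x | p x} = {y, z} := by ext w; simp [h]
  change Nat.card ({x | p x} : Set X) = 2
  rw [e, Nat.card_coe_set_eq, Set.ncard_pair hne]

variable {v : E → ℤ × ℤ} {μ : E → ℝ} {Γ : TropCurve (Option E)}
  {par : Fin Γ.numVerts → Option (Fin Γ.numVerts)} {height : Fin Γ.numVerts → ℕ}

theorem upperVec_ne_zero (hr : IsRooting Γ.graph (Γ.endVertex none) par height)
    (x : Fin Γ.numVerts ⊕ E) : upperVec Γ.edgeVec Γ.endVec par x ≠ 0 := by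
  rcases x with u | e
  · rcases hp : par u with _ | p
    · simpa [upperVec, hp] using Γ.endVec_ne none
    · simpa [upperVec, hp] using Γ.edgeVec_ne u p ((hr.adj_iff u p).2 (Or.inl hp))
  · simpa [upperVec] using Γ.endVec_ne (some e)

theorem upperVec_eq_add (hr : IsRooting Γ.graph (Γ.endVertex none) par height)
    {u : Fin Γ.numVerts} {y z : Fin Γ.numVerts ⊕ E} (hne : y ≠ z)
    (h : ∀ w, upper par Γ.endVertex w = some u ↔ w = y ∨ w = z) :
    upperVec Γ.edgeVec Γ.endVec par (.inl u) =
      upperVec Γ.edgeVec Γ.endVec par y + upperVec Γ.edgeVec Γ.endVec par z := by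
  have h1 := finsum_star Γ.endVertex Γ.edgeVec Γ.endVec hr Γ.edgeVec_symm u
  rw [Γ.balanced u, finsum_subtype_pair hne h] at h1
  exact (sub_eq_zero.1 h1.symm)

variable [DecidableEq E]

/-- Balancing, applied from the ends towards the root. -/
theorem IsRealized.upperVec_eq (hΓ : IsRealized v μ Γ)
    (hr : IsRooting Γ.graph (Γ.endVertex none) par height) {T : BTree E}
    {x : Fin Γ.numVerts ⊕ E} (hb : IsBranch (upper par Γ.endVertex) T x) :
    upperVec Γ.edgeVec Γ.endVec par x = vecSum v T.leaves := by
  induction T generalizing x with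
  | leaf e =>
    rw [IsBranch] at hb
    subst hb
    simp [upperVec, hΓ.in_vec, vecSum, BTree.leaves]
  | node l r hl hr' =>
    obtain ⟨u, y, z, rfl, hne, h1, h2, h3⟩ := hb
    rw [upperVec_eq_add hr hne h1, hl h2, hr' h3, BTree.leaves, vecSum_union]
    exact disjoint_leaves (height := height) (fun u p h => hr.height_lt u p h) h2 h3
      ((h1 y).2 (Or.inl rfl)) ((h1 z).2 (Or.inr rfl)) hne

theorem IsRealized.pos_upper (hr : IsRooting Γ.graph (Γ.endVertex none) par height)
    {u c : Fin Γ.numVerts} (h : par c = some u) :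
    ∃ s : ℝ, 0 < s ∧ Γ.pos u =
      Γ.pos c + s • toPlane (upperVec Γ.edgeVec Γ.endVec par (.inl c : _ ⊕ E)) := by
  obtain ⟨s, hs, h'⟩ := Γ.pos_edge c u ((hr.adj_iff c u).2 (Or.inl h))
  exact ⟨s, hs, by simpa [upperVec, h] using h'⟩

/-- Moments are conserved at vertices: if the arriving edges lie on their lines, so does the
departing one, since the forms add, and moving along an edge does not change its own form. -/
theorem IsRealized.lineForm_eq_zero (hΓ : IsRealized v μ Γ)
    (hr : IsRooting Γ.graph (Γ.endVertex none) par height) {T : BTree E}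
    {x : Fin Γ.numVerts ⊕ E} (hb : IsBranch (upper par Γ.endVertex) T x) {u : Fin Γ.numVerts}
    (hu : upper par Γ.endVertex x = some u) : lineForm v μ T.leaves (Γ.pos u) = 0 := by
  induction T generalizing x u with
  | leaf e =>
    rw [IsBranch] at hb
    subst hb
    simp only [upper, Sum.elim_inr, Option.some.injEq] at hu
    subst hu
    simp [lineForm, BTree.leaves, vecSum, momSum, hΓ.in_line]
  | node l r hl hr' =>
    have hb' := hb
    obtain ⟨c, y, z, rfl, hne, h1, h2, h3⟩ := hb
    have hd := disjoint_leaves (height := height) (fun u p h => hr.height_lt u p h) h2 h3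
      ((h1 y).2 (Or.inl rfl)) ((h1 z).2 (Or.inr rfl)) hne
    obtain ⟨s, -, hs⟩ := IsRealized.pos_upper hr hu
    have e1 := hl h2 ((h1 y).2 (Or.inl rfl))
    have e2 := hr' h3 ((h1 z).2 (Or.inr rfl))
    have e3 : lineForm v μ (BTree.node l r).leaves (Γ.pos c) = 0 := by
      rw [BTree.leaves, lineForm_union hd, e1, e2, add_zero]
    rw [hs, hΓ.upperVec_eq hr hb']
    rw [lineForm] at e3 ⊢
    rw [wedgeR_add_right, wedgeR_smul_right, wedgeR_toPlane, wedge_self]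
    simpa using e3

/-- The edge from the root of the branch to the next vertex has positive length s, and the form of
the left branch increases along it by s times a positive wedge product. -/
theorem IsRealized.isBefore (hΓ : IsRealized v μ Γ)
    (hr : IsRooting Γ.graph (Γ.endVertex none) par height) {T : BTree E} (hT : T.IsGood v μ)
    {x : Fin Γ.numVerts ⊕ E} (hb : IsBranch (upper par Γ.endVertex) T x) {u : Fin Γ.numVerts}
    (hu : upper par Γ.endVertex x = some u) : T.IsBefore v μ (Γ.pos u) := by
  cases T with
  | leaf e => trivial
  | node l r =>
    have hb' := hb
    obtain ⟨c, y, z, rfl, hne, h1, h2, h3⟩ := hb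
    obtain ⟨s, hs0, hs⟩ := IsRealized.pos_upper hr hu
    have e1 := hΓ.lineForm_eq_zero hr h2 ((h1 y).2 (Or.inl rfl))
    have hw : (0 : ℝ) < (wedge (vecSum v l.leaves) (vecSum v r.leaves) : ℤ) := by
      exact_mod_cast hT.2.1
    rw [BTree.IsBefore, hs, hΓ.upperVec_eq hr hb', BTree.leaves, vecSum_union hT.1, lineForm,
      wedgeR_add_right, wedgeR_smul_right, wedgeR_toPlane, wedge_add_right, wedge_self, zero_add]
    rw [lineForm] at e1
    have := mul_pos hs0 hw
    linarith

theorem IsRealized.pos_eq_crossing (hΓ : IsRealized v μ Γ)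
    (hr : IsRooting Γ.graph (Γ.endVertex none) par height) {l r : BTree E}
    {u : Fin Γ.numVerts} (hb : IsBranch (upper par Γ.endVertex) (.node l r) (.inl u))
    (hw : wedge (vecSum v l.leaves) (vecSum v r.leaves) ≠ 0) :
    Γ.pos u = crossing v μ l.leaves r.leaves := by
  obtain ⟨c, y, z, h, hne, h1, h2, h3⟩ := hb
  cases h
  exact eq_crossing hw (hΓ.lineForm_eq_zero hr h2 ((h1 y).2 (Or.inl rfl)))
    (hΓ.lineForm_eq_zero hr h3 ((h1 z).2 (Or.inr rfl)))

/-- Induction on the height. All edges arriving at a vertex lie on lines through its position and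
collect pairwise disjoint sets of ends; genericity forbids two parallel lines and a third line
through the point. The valence condition provides two arriving edges, so there are exactly two. -/
theorem IsRealized.exists_isBranch (hg : IsGeneric v μ) (hΓ : IsRealized v μ Γ)
    (hr : IsRooting Γ.graph (Γ.endVertex none) par height) (x : Fin Γ.numVerts ⊕ E) :
    ∃ T : BTree E, T.IsGood v μ ∧ IsBranch (upper par Γ.endVertex) T x := by
  have main : ∀ k u, height u = k → ∃ T : BTree E, T.IsGood v μ ∧
      IsBranch (upper par Γ.endVertex) T (.inl u) := by
    intro k
    induction k using Nat.strong_induction_on with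
    | _ k ih =>
    intro u hk
    have kid : ∀ y, upper par Γ.endVertex y = some u →
        ∃ T : BTree E, T.IsGood v μ ∧ IsBranch (upper par Γ.endVertex) T y := by
      rintro (c | e) hy
      · exact ih _ (hk ▸ hr.height_lt c u hy) c rfl
      · exact ⟨.leaf e, trivial, rfl⟩
    have nonpar : ∀ y z, upper par Γ.endVertex y = some u → upper par Γ.endVertex z = some u →
        y ≠ z → ∀ T T' : BTree E, IsBranch (upper par Γ.endVertex) T y →
        IsBranch (upper par Γ.endVertex) T' z → Disjoint T.leaves T'.leaves ∧
        wedge (vecSum v T.leaves) (vecSum v T'.leaves) ≠ 0 := by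
      intro y z hy hz hne T T' hT hT'
      have hd := disjoint_leaves (height := height) (fun u p h => hr.height_lt u p h) hT hT'
        hy hz hne
      refine ⟨hd, fun h0 => ?_⟩
      refine hg.false_of_parallel ?_ ?_ ?_ h0 (hΓ.lineForm_eq_zero hr hT hy)
        (hΓ.lineForm_eq_zero hr hT' hz)
      · intro h
        rw [h, Finset.disjoint_self_iff_empty] at hd
        exact T'.leaves_nonempty.ne_empty hd
      · rw [← hΓ.upperVec_eq hr hT]; exact upperVec_ne_zero hr y
      · rw [← hΓ.upperVec_eq hr hT']; exact upperVec_ne_zero hr z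
    have hcard := Γ.valence u
    rw [card_star Γ.endVertex hr u] at hcard
    obtain ⟨⟨y, hy⟩, ⟨z, hz⟩, hyz⟩ := Finite.one_lt_card_iff_nontrivial.1
      (show 1 < Nat.card {x : Fin Γ.numVerts ⊕ E // upper par Γ.endVertex x = some u} by omega)
    have hne : y ≠ z := fun h => hyz (Subtype.ext h)
    obtain ⟨Ty, hTy, hby⟩ := kid y hy
    obtain ⟨Tz, hTz, hbz⟩ := kid z hz
    obtain ⟨hd, hw⟩ := nonpar y z hy hz hne Ty Tz hby hbz
    have hall : ∀ w, upper par Γ.endVertex w = some u ↔ w = y ∨ w = z := by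
      refine fun w => ⟨fun hwu => ?_, by rintro (rfl | rfl) <;> assumption⟩
      by_contra! hcon
      obtain ⟨Tw, hTw, hbw⟩ := kid w hwu
      obtain ⟨hd1, -⟩ := nonpar w y hwu hy hcon.1 Tw Ty hbw hby
      obtain ⟨hd2, -⟩ := nonpar w z hwu hz hcon.2 Tw Tz hbw hbz
      obtain ⟨e, he⟩ := Tw.leaves_nonempty
      have n1 := Finset.disjoint_left.1 hd1 he
      have n2 := Finset.disjoint_left.1 hd2 he
      rcases hg.eq_or_eq_or_eq hd Ty.leaves_nonempty Tz.leaves_nonempty Tw.leaves_nonempty hw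
        (hΓ.lineForm_eq_zero hr hby hy) (hΓ.lineForm_eq_zero hr hbz hz)
        (hΓ.lineForm_eq_zero hr hbw hwu) with h | h | h
      · exact n1 (h ▸ he)
      · exact n2 (h ▸ he)
      · rw [h, Finset.mem_union] at he
        exact he.elim n1 n2
    -- The case of a positive wedge product, stated for both orders of the branches because the sign
    -- is not known in advance.
    have fin : ∀ y z (Ty Tz : BTree E), upper par Γ.endVertex y = some u →
        upper par Γ.endVertex z = some u → y ≠ z → Ty.IsGood v μ → Tz.IsGood v μ →
        IsBranch (upper par Γ.endVertex) Ty y → IsBranch (upper par Γ.endVertex) Tz z →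
        Disjoint Ty.leaves Tz.leaves → 0 < wedge (vecSum v Ty.leaves) (vecSum v Tz.leaves) →
        (∀ w, upper par Γ.endVertex w = some u ↔ w = y ∨ w = z) →
        ∃ T : BTree E, T.IsGood v μ ∧ IsBranch (upper par Γ.endVertex) T (.inl u) := by
      intro y z Ty Tz hy hz hne hTy hTz hby hbz hd hw hall
      have hb : IsBranch (upper par Γ.endVertex) (.node Ty Tz) (.inl u) :=
        ⟨u, y, z, rfl, hne, hall, hby, hbz⟩
      have hp := hΓ.pos_eq_crossing hr hb hw.ne'
      refine ⟨.node Ty Tz, ⟨hd, hw, hTy, hTz, ?_, ?_⟩, hb⟩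
      · rw [← hp]; exact hΓ.isBefore hr hTy hby hy
      · rw [← hp]; exact hΓ.isBefore hr hTz hbz hz
    rcases lt_or_gt_of_ne hw with h | h
    · refine fin z y Tz Ty hz hy hne.symm hTz hTy hbz hby hd.symm ?_
        fun w => (hall w).trans or_comm
      rw [wedge_comm]; omega
    · exact fin y z Ty Tz hy hz hne hTy hTz hby hbz hd h hall
  rcases x with u | e
  · exact main _ u rfl
  · exact ⟨.leaf e, trivial, rfl⟩

/-- The tree is the combinatorial type of the curve. -/
def HasType (Γ : TropCurve (Option E)) (T : BTree E) : Prop :=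
  ∃ par height, IsRooting Γ.graph (Γ.endVertex none) par height ∧
    IsBranch (upper par Γ.endVertex) T (.inl (Γ.endVertex none))

theorem IsRealized.exists_hasType (hg : IsGeneric v μ) (hΓ : IsRealized v μ Γ) :
    ∃ T : BTree E, T.IsGood v μ ∧ HasType Γ T := by
  obtain ⟨par, height, hr⟩ := exists_isRooting Γ.isTree (Γ.endVertex none)
  obtain ⟨T, hT, hb⟩ := hΓ.exists_isBranch hg hr (.inl (Γ.endVertex none))
  exact ⟨T, hT, par, height, hr, hb⟩

theorem HasType.leaves_eq {T : BTree E} (h : HasType Γ T) : T.leaves = Finset.univ := by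
  obtain ⟨par, height, hr, hb⟩ := h
  exact hb.leaves_eq_univ hr

theorem HasType.exists_eq_node {T : BTree E} (h : HasType Γ T) : ∃ l r, T = .node l r := by
  obtain ⟨par, height, hr, hb⟩ := h
  cases T with
  | leaf e => rw [IsBranch] at hb; cases hb
  | node l r => exact ⟨l, r, rfl⟩

theorem IsRealized.isTrivalent (hg : IsGeneric v μ) (hΓ : IsRealized v μ Γ) :
    Γ.IsTrivalent := by
  intro u
  obtain ⟨par, height, hr⟩ := exists_isRooting Γ.isTree (Γ.endVertex none)
  obtain ⟨T, hT, hb⟩ := hΓ.exists_isBranch hg hr (.inl u)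
  rw [TropCurve.Star, card_star Γ.endVertex hr u]
  cases T with
  | leaf e => rw [IsBranch] at hb; cases hb
  | node l r =>
    obtain ⟨c, y, z, h, hne, h1, -⟩ := hb
    cases h
    rw [card_subtype_pair hne h1]

theorem IsBranch.map {V V' : Type*} {q : V ⊕ E → Option V} {q' : V' ⊕ E → Option V'}
    (φ : V ≃ V') (hq : ∀ x, q' (x.map φ id) = (q x).map φ) {T : BTree E} {x : V ⊕ E}
    (h : IsBranch q T x) : IsBranch q' T (x.map φ id) := by
  have hinj : Function.Injective (Sum.map φ id : V ⊕ E → V' ⊕ E) :=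
    φ.injective.sumMap Function.injective_id
  have hsurj : Function.Surjective (Sum.map φ id : V ⊕ E → V' ⊕ E) :=
    φ.surjective.sumMap Function.surjective_id
  induction T generalizing x with
  | leaf e => rw [IsBranch] at h; subst h; rfl
  | node l r hl hr =>
    obtain ⟨u, y, z, rfl, hne, h1, h2, h3⟩ := h
    refine ⟨φ u, y.map φ id, z.map φ id, rfl, fun h => hne (hinj h), fun w => ?_, hl h2, hr h3⟩
    obtain ⟨w, rfl⟩ := hsurj w
    rw [hq, hinj.eq_iff, hinj.eq_iff, ← h1, Option.map_eq_some_iff]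
    constructor
    · rintro ⟨a, h, h'⟩
      rw [h, φ.injective h']
    · exact fun h => ⟨u, h, rfl⟩

/-- An isomorphism carries the rooting along, and rootings and good trees are unique. -/
theorem HasType.eq_of_iso {Γ' : TropCurve (Option E)} {T T' : BTree E} (h : HasType Γ T)
    (h' : HasType Γ' T') (hT : T.IsGood v μ) (hT' : T'.IsGood v μ) (hi : Γ.Iso Γ') : T = T' := by
  obtain ⟨φ, h1, h2, h3, h4, h5⟩ := hi
  obtain ⟨par, height, hr, hb⟩ := h
  obtain ⟨par', height', hr', hb'⟩ := h'
  have hr'' : IsRooting Γ'.graph (Γ'.endVertex none) (fun u => (par (φ.symm u)).map φ)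
      (fun u => height (φ.symm u)) := by
    refine ⟨fun u => ?_, fun u p h => ?_, fun u c => ?_⟩
    · rw [Option.map_eq_none_iff, hr.par_eq_none, h3, Equiv.symm_apply_eq]
    · obtain ⟨p', h6, rfl⟩ := Option.map_eq_some_iff.1 h
      simpa using hr.height_lt _ _ h6
    · have := h1 (φ.symm u) (φ.symm c)
      simp only [Equiv.apply_symm_apply] at this
      rw [this, hr.adj_iff, Option.map_eq_some_iff, Option.map_eq_some_iff]
      constructor
      · rintro (h | h)
        · exact Or.inl ⟨_, h, by simp⟩
        · exact Or.inr ⟨_, h, by simp⟩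
      · rintro (⟨a, h, rfl⟩ | ⟨a, h, rfl⟩)
        · exact Or.inl (by simpa using h)
        · exact Or.inr (by simpa using h)
  have hb2 : IsBranch (upper par' Γ'.endVertex) T (Sum.map φ id (.inl (Γ.endVertex none))) := by
    refine hb.map φ ?_
    rintro (u | e)
    · simp only [Sum.map_inl, upper, Sum.elim_inl]
      rw [hr'.unique hr'']
      simp
    · simp [upper, h3]
  rw [Sum.map_inl, ← h3] at hb2
  exact hb2.unique hb' hT hT'

/-- Vertices of the two curves correspond if they carry the same subtree. The subtree determines the
edge vectors as sums over its leaves, and the position as a crossing. -/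
theorem HasType.iso {Γ' : TropCurve (Option E)} {T : BTree E} (h : HasType Γ T)
    (h' : HasType Γ' T) (hT : T.IsGood v μ) (hΓ : IsRealized v μ Γ) (hΓ' : IsRealized v μ Γ') :
    Γ.Iso Γ' := by
  have good : ∀ {T t : BTree E}, T.IsGood v μ → t.IsSubtree T → t.IsGood v μ := by
    intro T t hT ht
    induction T with
    | leaf e => rw [BTree.IsSubtree] at ht; subst ht; exact hT
    | node l r hl hr =>
      rcases ht with rfl | ht | ht
      · exact hT
      · exact hl hT.2.2.1 ht
      · exact hr hT.2.2.2.1 ht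
  obtain ⟨par, height, hr, hb⟩ := h
  obtain ⟨par', height', hr', hb'⟩ := h'
  have ex : ∀ u : Fin Γ.numVerts, ∃ u' : Fin Γ'.numVerts, ∃ t : BTree E, t.IsSubtree T ∧
      IsBranch (upper par Γ.endVertex) t (.inl u) ∧
      IsBranch (upper par' Γ'.endVertex) t (.inl u') := by
    intro u
    obtain ⟨t, ht, htb⟩ := hb.exists_label hr (.inl u)
    obtain ⟨y, hy⟩ := hb'.exists_of_isSubtree ht
    cases t with
    | leaf e => rw [IsBranch] at htb; cases htb
    | node l r =>
      have hy' := hy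
      obtain ⟨u', -, -, rfl, -⟩ := hy'
      exact ⟨u', _, ht, htb, hy⟩
  have ex' : ∀ u' : Fin Γ'.numVerts, ∃ u : Fin Γ.numVerts, ∃ t : BTree E, t.IsSubtree T ∧
      IsBranch (upper par Γ.endVertex) t (.inl u) ∧
      IsBranch (upper par' Γ'.endVertex) t (.inl u') := by
    intro u
    obtain ⟨t, ht, htb⟩ := hb'.exists_label hr' (.inl u)
    obtain ⟨y, hy⟩ := hb.exists_of_isSubtree ht
    cases t with
    | leaf e => rw [IsBranch] at htb; cases htb
    | node l r =>
      have hy' := hy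
      obtain ⟨u', -, -, rfl, -⟩ := hy'
      exact ⟨u', _, ht, hy, htb⟩
  choose f t ht h1 h2 using ex
  choose g t' ht' h1' h2' using ex'
  have gf : ∀ u, g (f u) = u := by
    intro u
    have := IsBranch.unique (h2 u) (h2' (f u)) (good hT (ht u))
      (good hT (ht' (f u)))
    have h3 := h1 u
    rw [this] at h3
    exact Sum.inl_injective ((h1' (f u)).eq h3)
  have fg : ∀ u, f (g u) = u := by
    intro u
    have := IsBranch.unique (h1 (g u)) (h1' u) (good hT (ht (g u)))
      (good hT (ht' u))
    have h3 := h2' u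
    rw [← this] at h3
    exact Sum.inl_injective ((h2 (g u)).eq h3)
  let φ : Fin Γ.numVerts ≃ Fin Γ'.numVerts := ⟨f, g, gf, fg⟩
  have key : ∀ x u, upper par Γ.endVertex x = some u →
      upper par' Γ'.endVertex (Sum.map f id x) = some (f u) := by
    intro x u hx
    have b1 := h1 u
    have b2 := h2 u
    cases htu : t u with
    | leaf e => rw [htu, IsBranch] at b1; cases b1
    | node l r =>
      have g1 := ht u
      rw [htu] at b1 b2 g1
      obtain ⟨_, y, z, h, hne, a1, a2, a3⟩ := b1
      cases h
      obtain ⟨_, y', z', h, hne', a1', a2', a3'⟩ := b2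
      have hu : f u = _ := Sum.inl_injective h
      rw [← hu] at a1'
      rw [a1']
      have aux : ∀ (s : BTree E) y', s.IsSubtree T → IsBranch (upper par Γ.endVertex) s x →
          IsBranch (upper par' Γ'.endVertex) s y' → Sum.map f id x = y' := by
        intro s y' hs b b'
        rcases x with c | e
        · have := IsBranch.unique b (h1 c) (good hT hs) (good hT (ht c))
          subst this
          exact (h2 c).eq b'
        · cases s with
          | leaf e' => rw [IsBranch] at b b'; rw [b']; cases b; rfl
          | node l r => obtain ⟨_, _, _, h, _⟩ := b; cases h
      rcases (a1 x).1 hx with rfl | rfl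
      · exact Or.inl (aux l y' ((BTree.IsSubtree.left l r).trans g1) a2 a2')
      · exact Or.inr (aux r z' ((BTree.IsSubtree.right l r).trans g1) a3 a3')
  have hroot : f (Γ.endVertex none) = Γ'.endVertex none := by
    have := IsBranch.unique hb (h1 _) hT (good hT (ht _))
    rw [this] at hb'
    exact Sum.inl_injective ((h2 _).eq hb')
  have hpar : ∀ u, par' (f u) = (par u).map f := by
    intro u
    rcases hp : par u with _ | p
    · rw [(hr.par_eq_none u).1 hp, hroot]
      exact (hr'.par_eq_none _).2 rfl
    · exact key (.inl u) p hp
  have finj : Function.Injective f := φ.injective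
  have hvec : ∀ u, upperVec Γ'.edgeVec Γ'.endVec par' (.inl (f u) : _ ⊕ E) =
      upperVec Γ.edgeVec Γ.endVec par (.inl u) := by
    intro u
    rw [hΓ.upperVec_eq hr (h1 u), hΓ'.upperVec_eq hr' (h2 u)]
  have hedge : ∀ u p, par u = some p → Γ'.edgeVec (f u) (f p) = Γ.edgeVec u p := by
    intro u p hp
    have := hvec u
    simpa [upperVec, hpar, hp] using this
  refine ⟨φ, fun u c => ?_, fun u c huc => ?_, fun e => ?_, fun e => ?_, fun u => ?_⟩
  · change Γ'.graph.Adj (f u) (f c) ↔ _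
    rw [hr'.adj_iff, hr.adj_iff, hpar, hpar, Option.map_eq_some_iff, Option.map_eq_some_iff]
    simp only [finj.eq_iff, exists_eq_right]
  · change Γ'.edgeVec (f u) (f c) = _
    rcases (hr.adj_iff u c).1 huc with h | h
    · exact hedge u c h
    · have a := (hr.adj_iff c u).2 (Or.inl h)
      have a' : Γ'.graph.Adj (f c) (f u) := (hr'.adj_iff _ _).2 (Or.inl (by rw [hpar, h]; rfl))
      rw [Γ.edgeVec_symm _ _ a, Γ'.edgeVec_symm _ _ a', hedge c u h]
  · rcases e with _ | e
    · exact hroot.symm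
    · have := key (.inr e) (Γ.endVertex (some e)) rfl
      exact Option.some.inj this
  · rcases e with _ | e
    · have := hvec (Γ.endVertex none)
      have h6 : par (Γ.endVertex none) = none := (hr.par_eq_none _).2 rfl
      simpa [upperVec, hpar, h6] using this
    · rw [hΓ.in_vec, hΓ'.in_vec]
  · change Γ'.pos (f u) = Γ.pos u
    have b1 := h1 u
    have b2 := h2 u
    have g1 := good hT (ht u)
    cases htu : t u with
    | leaf e => rw [htu, IsBranch] at b1; cases b1
    | node l r =>
      rw [htu] at b1 b2 g1
      rw [hΓ.pos_eq_crossing hr b1 g1.2.1.ne', hΓ'.pos_eq_crossing hr' b2 g1.2.1.ne']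

end Curves

/-! ### The curve of a tree -/

namespace BTree

variable {E : Type*}

open Classical in
/-- The subtrees that are not leaves. -/
def nodes : BTree E → Finset (BTree E)
  | leaf _ => ∅
  | node l r => insert (node l r) (l.nodes ∪ r.nodes)

/-- The number of leaves. -/
def numLeaves : BTree E → ℕ
  | leaf _ => 1
  | node l r => l.numLeaves + r.numLeaves

theorem numLeaves_pos (T : BTree E) : 0 < T.numLeaves := by
  induction T with
  | leaf e => simp [numLeaves]
  | node l r hl _ => simp only [numLeaves]; omega

theorem IsSubtree.numLeaves_le {t T : BTree E} (h : t.IsSubtree T) :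
    t.numLeaves ≤ T.numLeaves := by
  induction T with
  | leaf e => rw [IsSubtree] at h; rw [h]
  | node l r hl hr =>
    rcases h with rfl | h | h
    · exact le_rfl
    · exact (hl h).trans (by simp [numLeaves])
    · exact (hr h).trans (by simp [numLeaves])

theorem mem_nodes {t T : BTree E} : t ∈ T.nodes ↔ t.IsSubtree T ∧ ∃ l r, t = .node l r := by
  induction T with
  | leaf e =>
    simp only [nodes, Finset.notMem_empty, IsSubtree, false_iff]
    rintro ⟨rfl, _, _, h⟩
    cases h
  | node l r hl hr =>
    simp only [nodes, Finset.mem_insert, Finset.mem_union, hl, hr, IsSubtree]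
    constructor
    · rintro (rfl | ⟨h, h'⟩ | ⟨h, h'⟩)
      · exact ⟨Or.inl rfl, l, r, rfl⟩
      · exact ⟨Or.inr (Or.inl h), h'⟩
      · exact ⟨Or.inr (Or.inr h), h'⟩
    · rintro ⟨rfl | h | h, h'⟩
      · exact Or.inl rfl
      · exact Or.inr (Or.inl ⟨h, h'⟩)
      · exact Or.inr (Or.inr ⟨h, h'⟩)

/-- The tree `s` is one of the two branches at the root of `t`. -/
def IsKid (s t : BTree E) : Prop := ∃ a, t = node s a ∨ t = node a s

theorem IsKid.numLeaves_lt {s t : BTree E} (h : s.IsKid t) : s.numLeaves < t.numLeaves := by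
  obtain ⟨a, rfl | rfl⟩ := h <;> have := a.numLeaves_pos <;> simp only [numLeaves] <;> omega

theorem IsKid.isSubtree {s t : BTree E} (h : s.IsKid t) : s.IsSubtree t := by
  obtain ⟨a, rfl | rfl⟩ := h
  · exact .left s a
  · exact .right a s

theorem IsSubtree.exists_isKid {s T : BTree E} (h : s.IsSubtree T) (hne : s ≠ T) :
    ∃ t ∈ T.nodes, s.IsKid t := by
  induction T with
  | leaf e => exact absurd h hne
  | node l r hl hr =>
    rcases h with h | h | h
    · exact absurd h hne
    · by_cases h' : s = l
      · exact ⟨_, mem_nodes.2 ⟨.refl _, l, r, rfl⟩, r, Or.inl (by rw [h'])⟩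
      · obtain ⟨t, ht, hst⟩ := hl h h'
        exact ⟨t, by simp [nodes, ht], hst⟩
    · by_cases h' : s = r
      · exact ⟨_, mem_nodes.2 ⟨.refl _, l, r, rfl⟩, l, Or.inr (by rw [h'])⟩
      · obtain ⟨t, ht, hst⟩ := hr h h'
        exact ⟨t, by simp [nodes, ht], hst⟩

variable [DecidableEq E]

theorem IsSubtree.leaves_subset {t T : BTree E} (h : t.IsSubtree T) : t.leaves ⊆ T.leaves := by
  induction T with
  | leaf e => rw [IsSubtree] at h; rw [h]
  | node l r hl hr =>
    rcases h with rfl | h | h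
    · exact subset_rfl
    · exact (hl h).trans Finset.subset_union_left
    · exact (hr h).trans Finset.subset_union_right

theorem isSubtree_leaf {e : E} {T : BTree E} (h : e ∈ T.leaves) : (leaf e).IsSubtree T := by
  induction T with
  | leaf e' => rw [leaves, Finset.mem_singleton] at h; rw [h]; exact .refl _
  | node l r hl hr =>
    rw [leaves, Finset.mem_union] at h
    rcases h with h | h
    · exact Or.inr (Or.inl (hl h))
    · exact Or.inr (Or.inr (hr h))

variable {v : E → ℤ × ℤ} {μ : E → ℝ}

theorem IsGood.isSubtree {T t : BTree E} (hT : T.IsGood v μ) (ht : t.IsSubtree T) :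
    t.IsGood v μ := by
  induction T with
  | leaf e => rw [IsSubtree] at ht; subst ht; exact hT
  | node l r hl hr =>
    rcases ht with rfl | ht | ht
    · exact hT
    · exact hl hT.2.2.1 ht
    · exact hr hT.2.2.2.1 ht

/-- Branches of a good tree have disjoint leaves, so a given subtree occurs in only one place. -/
theorem IsGood.eq_of_isKid {T s t t' : BTree E} (hT : T.IsGood v μ) (ht : t ∈ T.nodes)
    (ht' : t' ∈ T.nodes) (h : s.IsKid t) (h' : s.IsKid t') : t = t' := by
  classical
  induction T with
  | leaf e => simp [nodes] at ht
  | node l r hl hr =>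
    have noboth : ∀ {a : BTree E}, a.IsSubtree l → a.IsSubtree r → False := by
      intro a ha hb
      obtain ⟨e, he⟩ := a.leaves_nonempty
      exact Finset.disjoint_left.1 hT.1 (ha.leaves_subset he) (hb.leaves_subset he)
    have root : ∀ {t'}, s.IsKid (node l r) → t' ∈ l.nodes ∪ r.nodes → s.IsKid t' → False := by
      intro t' h ht' h'
      have hlr : s = l ∨ s = r := by
        obtain ⟨a, ha | ha⟩ := h <;> cases ha <;> simp
      rcases Finset.mem_union.1 ht' with h1 | h1
      · have h2 := (mem_nodes.1 h1).1
        rcases hlr with rfl | rfl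
        · have := h2.numLeaves_le
          have := h'.numLeaves_lt
          omega
        · exact noboth (h'.isSubtree.trans h2) (.refl s)
      · have h2 := (mem_nodes.1 h1).1
        rcases hlr with rfl | rfl
        · exact noboth (.refl s) (h'.isSubtree.trans h2)
        · have := h2.numLeaves_le
          have := h'.numLeaves_lt
          omega
    rw [nodes, Finset.mem_insert] at ht ht'
    rcases ht with rfl | ht <;> rcases ht' with rfl | ht'
    · rfl
    · exact (root h ht' h').elim
    · exact (root h' ht h).elim
    · rcases Finset.mem_union.1 ht with h1 | h1 <;> rcases Finset.mem_union.1 ht' with h2 | h2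
      · exact hl hT.2.2.1 h1 h2
      · exact (noboth (h.isSubtree.trans (mem_nodes.1 h1).1)
          (h'.isSubtree.trans (mem_nodes.1 h2).1)).elim
      · exact (noboth (h'.isSubtree.trans (mem_nodes.1 h2).1)
          (h.isSubtree.trans (mem_nodes.1 h1).1)).elim
      · exact hr hT.2.2.2.1 h1 h2

theorem IsGood.prod_nodes {T : BTree E} (hT : T.IsGood v μ) {f : BTree E → ℕ}
    (hf : ∀ l r, f (.node l r) = (wedge (vecSum v l.leaves) (vecSum v r.leaves)).natAbs) :
    ∏ t ∈ T.nodes, f t = T.mult v := by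
  classical
  induction T with
  | leaf e => simp [nodes, mult]
  | node l r hl hr =>
    have noboth : ∀ {a : BTree E}, a.IsSubtree l → a.IsSubtree r → False := by
      intro a ha hb
      obtain ⟨e, he⟩ := a.leaves_nonempty
      exact Finset.disjoint_left.1 hT.1 (ha.leaves_subset he) (hb.leaves_subset he)
    rw [nodes, mult, ← hl hT.2.2.1, ← hr hT.2.2.2.1, ← hf, ← Finset.prod_union,
      ← Finset.prod_insert]
    · intro h
      have lr := r.numLeaves_pos
      have ll := l.numLeaves_pos
      rcases Finset.mem_union.1 h with h | h
      · have := (mem_nodes.1 h).1.numLeaves_le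
        rw [numLeaves] at this
        omega
      · have := (mem_nodes.1 h).1.numLeaves_le
        rw [numLeaves] at this
        omega
    · rw [Finset.disjoint_left]
      exact fun a ha hb => noboth (mem_nodes.1 ha).1 (mem_nodes.1 hb).1

theorem IsGood.vecSum_ne_zero {l r : BTree E} (h : (node l r).IsGood v μ) :
    vecSum v (node l r).leaves ≠ 0 := by
  intro h0
  have := h.2.1
  rw [leaves, vecSum_union h.1] at h0
  have h1 : wedge (vecSum v l.leaves) (vecSum v l.leaves + vecSum v r.leaves) =
    wedge (vecSum v l.leaves) (vecSum v r.leaves) := by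
    rw [wedge_add_right, wedge_self, zero_add]
  rw [h0, wedge_zero_right] at h1
  omega

/-- The position of the root. -/
def rootPos (v : E → ℤ × ℤ) (μ : E → ℝ) : BTree E → ℝ × ℝ
  | leaf _ => 0
  | node l r => crossing v μ l.leaves r.leaves

/-- The root of t lies on the line of s, since it is the crossing of the lines of the two branches,
and `IsBefore` puts it ahead of the root of s. The length c is obtained by comparing the values of
the form of the left branch of s. -/
theorem IsGood.rootPos_eq {s t : BTree E} (ht : t.IsGood v μ) (h : s.IsKid t)
    (hs : ∃ l r, s = node l r) : ∃ c : ℝ, 0 < c ∧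
      t.rootPos v μ = s.rootPos v μ + c • toPlane (vecSum v s.leaves) := by
  have hgs := ht.isSubtree h.isSubtree
  have h1 : lineForm v μ s.leaves (t.rootPos v μ) = 0 := by
    obtain ⟨a, rfl | rfl⟩ := h
    · exact lineForm_crossing_left ht.2.1.ne'
    · exact lineForm_crossing_right ht.2.1.ne'
  have h2 : s.IsBefore v μ (t.rootPos v μ) := by
    obtain ⟨a, rfl | rfl⟩ := h
    · exact ht.2.2.2.2.1
    · exact ht.2.2.2.2.2
  obtain ⟨l, r, rfl⟩ := hs
  have hw : (0 : ℝ) < wedge (vecSum v l.leaves) (vecSum v r.leaves) := by exact_mod_cast hgs.2.1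
  have h3 := lineForm_crossing_left (μ := μ) hgs.2.1.ne'
  have h4 : lineForm v μ (node l r).leaves (rootPos v μ (node l r)) = 0 := by
    rw [leaves, lineForm_union hgs.1, rootPos, h3, lineForm_crossing_right hgs.2.1.ne', add_zero]
  have hlu : wedge (vecSum v l.leaves) (vecSum v (node l r).leaves) =
      wedge (vecSum v l.leaves) (vecSum v r.leaves) := by
    rw [leaves, vecSum_union hgs.1, wedge_add_right, wedge_self, zero_add]
  refine ⟨lineForm v μ l.leaves (t.rootPos v μ) / wedge (vecSum v l.leaves) (vecSum v r.leaves),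
    div_pos h2 hw, ?_⟩
  refine eq_of_wedgeR_eq (p := toPlane (vecSum v l.leaves))
    (q := toPlane (vecSum v (node l r).leaves)) ?_ ?_ ?_
  · rw [wedgeR_toPlane, hlu]; exact hw.ne'
  · rw [wedgeR_add_right, wedgeR_smul_right, wedgeR_toPlane, hlu, div_mul_cancel₀ _ hw.ne']
    change lineForm v μ l.leaves (rootPos v μ (node l r)) = 0 at h3
    rw [lineForm] at h3 ⊢
    linarith
  · rw [wedgeR_add_right, wedgeR_smul_right, wedgeR_toPlane, wedge_self, Int.cast_zero, mul_zero,
      add_zero]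
    rw [lineForm] at h1 h4
    linarith

end BTree

/-! ### The tropical curve realizing a good tree, and the bijection of curves with trees -/

section Model

variable {E : Type} [Fintype E] [DecidableEq E] (v : E → ℤ × ℤ) (μ : E → ℝ) (T : BTree E)

/-- The subtree at a vertex. -/
def subtreeAt (i : Fin T.nodes.card) : BTree E := (T.nodes.equivFin.symm i).1

open Classical in
/-- The vertex at which the edge of a subtree arrives. -/
def parentIn (s : BTree E) : Option (Fin T.nodes.card) :=
  if h : ∃ i, s.IsKid (subtreeAt T i) then some h.choose else none

variable {T} {v μ}

theorem subtreeAt_mem (i : Fin T.nodes.card) : subtreeAt T i ∈ T.nodes :=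
  (T.nodes.equivFin.symm i).2

theorem exists_subtreeAt {t : BTree E} (h : t ∈ T.nodes) : ∃ i, subtreeAt T i = t :=
  ⟨T.nodes.equivFin ⟨t, h⟩, by simp [subtreeAt]⟩

theorem subtreeAt_injective : Function.Injective (subtreeAt T) := fun i j h => by
  simpa [subtreeAt, Subtype.ext_iff] using h

theorem parentIn_eq_some (hT : T.IsGood v μ) {s : BTree E} {i : Fin T.nodes.card} :
    parentIn T s = some i ↔ s.IsKid (subtreeAt T i) := by
  rw [parentIn]
  split_ifs with h
  · rw [Option.some.injEq]
    constructor
    · rintro rfl; exact h.choose_spec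
    · exact fun h' => subtreeAt_injective
        (hT.eq_of_isKid (subtreeAt_mem _) (subtreeAt_mem _) h.choose_spec h')
  · simp only [false_iff]
    exact fun h' => h ⟨i, h'⟩

theorem parentIn_eq_none {s : BTree E} (hs : s.IsSubtree T) : parentIn T s = none ↔ s = T := by
  rw [parentIn]
  split_ifs with h
  · simp only [reduceCtorEq, false_iff]
    rintro rfl
    obtain ⟨i, hi⟩ := h
    have := hi.numLeaves_lt
    have := (BTree.mem_nodes.1 (subtreeAt_mem i)).1.numLeaves_le
    omega
  · simp only [true_iff]
    by_contra hne
    obtain ⟨t, ht, hst⟩ := hs.exists_isKid hne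
    obtain ⟨i, rfl⟩ := exists_subtreeAt ht
    exact h ⟨i, hst⟩

variable (T) in
/-- The graph of inner vertices of a tree. -/
def treeGraph : SimpleGraph (Fin T.nodes.card) where
  Adj i j := (subtreeAt T i).IsKid (subtreeAt T j) ∨ (subtreeAt T j).IsKid (subtreeAt T i)
  symm := ⟨fun _ _ h => h.symm⟩
  loopless := ⟨fun i h => by
    rcases h with h | h <;> exact absurd h.numLeaves_lt (lt_irrefl _)⟩

theorem isRooting_treeGraph (hT : T.IsGood v μ) {root : Fin T.nodes.card}
    (hroot : subtreeAt T root = T) : IsRooting (treeGraph T) root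
      (fun i => parentIn T (subtreeAt T i)) fun i => (subtreeAt T i).numLeaves where
  par_eq_none u := by
    rw [parentIn_eq_none (BTree.mem_nodes.1 (subtreeAt_mem u)).1, ← subtreeAt_injective.eq_iff,
      hroot]
  height_lt u p h := ((parentIn_eq_some hT).1 h).numLeaves_lt
  adj_iff u c := by rw [parentIn_eq_some hT, parentIn_eq_some hT]; rfl

variable (T) in
/-- The subtree at a vertex or end. -/
def subtreeOf : Fin T.nodes.card ⊕ E → BTree E := Sum.elim (subtreeAt T) .leaf

theorem subtreeOf_injective : Function.Injective (subtreeOf T) := by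
  have aux : ∀ i e, subtreeAt T i ≠ .leaf e := by
    intro i e h
    obtain ⟨_, l, r, h'⟩ := BTree.mem_nodes.1 (subtreeAt_mem i)
    rw [h'] at h
    cases h
  rintro (i | e) (j | e') h
  · rw [subtreeAt_injective h]
  · exact absurd h (aux _ _)
  · exact absurd h.symm (aux _ _)
  · cases h; rfl

theorem exists_subtreeOf {t : BTree E} (h : t.IsSubtree T) : ∃ x, subtreeOf T x = t := by
  cases t with
  | leaf e => exact ⟨.inr e, rfl⟩
  | node l r =>
    obtain ⟨i, hi⟩ := exists_subtreeAt (BTree.mem_nodes.2 ⟨h, l, r, rfl⟩)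
    exact ⟨.inl i, hi⟩

variable (T) in
/-- The vertices of the ends. -/
def treeEnd (root : Fin T.nodes.card) (o : Option E) : Fin T.nodes.card :=
  o.elim root fun e => (parentIn T (.leaf e)).getD root

/-- The default value in `treeEnd` is never used: a leaf without parent would be the whole tree, but
the root vertex carries a node. -/
theorem upper_tree (hu : T.leaves = Finset.univ) {root : Fin T.nodes.card}
    (hroot : subtreeAt T root = T) (x : Fin T.nodes.card ⊕ E) :
    upper (fun i => parentIn T (subtreeAt T i)) (treeEnd T root) x =
      parentIn T (subtreeOf T x) := by
  rcases x with i | e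
  · rfl
  · simp only [upper, Sum.elim_inr, treeEnd, Option.elim_some, subtreeOf]
    rcases h : parentIn T (.leaf e) with _ | p
    · rw [parentIn_eq_none (BTree.isSubtree_leaf (hu ▸ Finset.mem_univ e))] at h
      obtain ⟨_, l, r, h'⟩ := BTree.mem_nodes.1 (subtreeAt_mem root)
      rw [hroot, ← h] at h'
      cases h'
    · rfl

theorem upper_tree_iff (hT : T.IsGood v μ) (hu : T.leaves = Finset.univ)
    {root : Fin T.nodes.card} (hroot : subtreeAt T root = T) {i : Fin T.nodes.card}
    {l r : BTree E} (hi : subtreeAt T i = .node l r) {y z : Fin T.nodes.card ⊕ E}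
    (hy : subtreeOf T y = l) (hz : subtreeOf T z = r) (w : Fin T.nodes.card ⊕ E) :
    upper (fun i => parentIn T (subtreeAt T i)) (treeEnd T root) w = some i ↔
      w = y ∨ w = z := by
  rw [upper_tree hu hroot, parentIn_eq_some hT, hi, ← subtreeOf_injective.eq_iff,
    ← subtreeOf_injective.eq_iff (a := w) (b := z), hy, hz, BTree.IsKid]
  constructor
  · rintro ⟨a, h | h⟩ <;> cases h <;> simp
  · rintro (rfl | rfl)
    · exact ⟨r, Or.inl rfl⟩
    · exact ⟨l, Or.inr rfl⟩

theorem BTree.IsGood.left_ne_right {l r : BTree E} (h : (BTree.node l r).IsGood v μ) : l ≠ r := by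
  rintro rfl
  obtain ⟨e, he⟩ := l.leaves_nonempty
  exact Finset.disjoint_left.1 h.1 he he

theorem exists_kids (hT : T.IsGood v μ) (hu : T.leaves = Finset.univ)
    {root : Fin T.nodes.card} (hroot : subtreeAt T root = T) (i : Fin T.nodes.card) :
    ∃ l r y z, subtreeAt T i = .node l r ∧ subtreeOf T y = l ∧ subtreeOf T z = r ∧ y ≠ z ∧
      ∀ w, upper (fun i => parentIn T (subtreeAt T i)) (treeEnd T root) w = some i ↔
      w = y ∨ w = z := by
  obtain ⟨hs, l, r, h⟩ := BTree.mem_nodes.1 (subtreeAt_mem i)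
  rw [h] at hs
  obtain ⟨y, hy⟩ := exists_subtreeOf ((BTree.IsSubtree.left l r).trans hs)
  obtain ⟨z, hz⟩ := exists_subtreeOf ((BTree.IsSubtree.right l r).trans hs)
  refine ⟨l, r, y, z, h, hy, hz, ?_, upper_tree_iff hT hu hroot h hy hz⟩
  rintro rfl
  exact (hT.isSubtree hs).left_ne_right (hy.symm.trans hz)

theorem isBranch_tree (hT : T.IsGood v μ) (hu : T.leaves = Finset.univ)
    {root : Fin T.nodes.card} (hroot : subtreeAt T root = T) (x : Fin T.nodes.card ⊕ E) :
    IsBranch (upper (fun i => parentIn T (subtreeAt T i)) (treeEnd T root)) (subtreeOf T x) x := by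
  induction hs : subtreeOf T x generalizing x with
  | leaf e => exact subtreeOf_injective hs
  | node l r hl hr =>
    rcases x with i | e
    · obtain ⟨l', r', y, z, h, hy, hz, hne, hk⟩ := exists_kids hT hu hroot i
      have h' : subtreeAt T i = .node l r := hs
      rw [h] at h'
      cases h'
      exact ⟨i, y, z, rfl, hne, hk, hl y hy, hr z hz⟩
    · cases hs

open Classical in
variable (T v) in
/-- The vectors of the bounded edges. -/
def treeEdgeVec (i j : Fin T.nodes.card) : ℤ × ℤ :=
  if (subtreeAt T i).IsKid (subtreeAt T j) then vecSum v (subtreeAt T i).leaves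
  else - vecSum v (subtreeAt T j).leaves

variable (T v) in
/-- The vectors of the unbounded edges. -/
def treeEndVec (o : Option E) : ℤ × ℤ := o.elim (vecSum v T.leaves) fun e => - v e

theorem treeEdgeVec_symm (i j : Fin T.nodes.card) (h : (treeGraph T).Adj i j) :
    treeEdgeVec v T j i = - treeEdgeVec v T i j := by
  by_cases h1 : (subtreeAt T i).IsKid (subtreeAt T j)
  · have h2 : ¬ (subtreeAt T j).IsKid (subtreeAt T i) := fun h2 =>
      absurd (h1.numLeaves_lt.trans h2.numLeaves_lt) (lt_irrefl _)
    rw [treeEdgeVec, treeEdgeVec, if_pos h1, if_neg h2]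
  · have h2 : (subtreeAt T j).IsKid (subtreeAt T i) := h.resolve_left h1
    rw [treeEdgeVec, treeEdgeVec, if_neg h1, if_pos h2, neg_neg]

theorem vecSum_subtreeAt_ne_zero (hT : T.IsGood v μ) (i : Fin T.nodes.card) :
    vecSum v (subtreeAt T i).leaves ≠ 0 := by
  obtain ⟨hs, l, r, h⟩ := BTree.mem_nodes.1 (subtreeAt_mem i)
  have := hT.isSubtree hs
  rw [h] at this ⊢
  exact this.vecSum_ne_zero

theorem upperVec_tree (hT : T.IsGood v μ) (x : Fin T.nodes.card ⊕ E) :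
    upperVec (treeEdgeVec v T) (treeEndVec v T) (fun i => parentIn T (subtreeAt T i)) x =
      vecSum v (subtreeOf T x).leaves := by
  rcases x with i | e
  · rcases hp : parentIn T (subtreeAt T i) with _ | p
    · have h := (parentIn_eq_none (BTree.mem_nodes.1 (subtreeAt_mem i)).1).1 hp
      rw [h] at hp
      simp [upperVec, hp, treeEndVec, subtreeOf, h]
    · have h := (parentIn_eq_some hT).1 hp
      simp [upperVec, hp, treeEdgeVec, subtreeOf, h]
  · simp [upperVec, treeEndVec, subtreeOf, BTree.leaves, vecSum]

/-- The tropical curve of a tree. -/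
def treeCurve (hT : T.IsGood v μ) (hu : T.leaves = Finset.univ) (hv : ∀ e, v e ≠ 0)
    {root : Fin T.nodes.card} (hroot : subtreeAt T root = T) : TropCurve (Option E) where
  numVerts := T.nodes.card
  graph := treeGraph T
  isTree := (isRooting_treeGraph hT hroot).isTree
  endVertex := treeEnd T root
  edgeVec := treeEdgeVec v T
  endVec := treeEndVec v T
  pos := fun i => (subtreeAt T i).rootPos v μ
  edgeVec_ne i j _ := by
    rw [treeEdgeVec]
    split_ifs
    · exact vecSum_subtreeAt_ne_zero hT i
    · exact neg_ne_zero.2 (vecSum_subtreeAt_ne_zero hT j)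
  edgeVec_symm := treeEdgeVec_symm
  endVec_ne o := by
    rcases o with _ | e
    · simpa [treeEndVec, hroot] using vecSum_subtreeAt_ne_zero hT root
    · simpa [treeEndVec] using hv e
  pos_edge i j h := by
    by_cases h1 : (subtreeAt T i).IsKid (subtreeAt T j)
    · rw [treeEdgeVec, if_pos h1]
      exact (hT.isSubtree (BTree.mem_nodes.1 (subtreeAt_mem j)).1).rootPos_eq h1
        (BTree.mem_nodes.1 (subtreeAt_mem i)).2
    · have h2 : (subtreeAt T j).IsKid (subtreeAt T i) := h.resolve_left h1
      obtain ⟨s, hs, h'⟩ := (hT.isSubtree (BTree.mem_nodes.1 (subtreeAt_mem i)).1).rootPos_eq h2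
        (BTree.mem_nodes.1 (subtreeAt_mem j)).2
      rw [treeEdgeVec, if_neg h1]
      exact ⟨s, hs, by rw [h', toPlane_neg, smul_neg, add_neg_cancel_right]⟩
  valence i := by
    obtain ⟨l, r, y, z, h, hy, hz, hne, hk⟩ := exists_kids hT hu hroot i
    rw [card_star (treeEnd T root) (isRooting_treeGraph hT hroot) i, card_subtype_pair hne hk]
  balanced i := by
    obtain ⟨l, r, y, z, h, hy, hz, hne, hk⟩ := exists_kids hT hu hroot i
    have hg := hT.isSubtree (BTree.mem_nodes.1 (subtreeAt_mem i)).1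
    rw [h] at hg
    rw [finsum_star (treeEnd T root) _ _ (isRooting_treeGraph hT hroot) treeEdgeVec_symm,
      finsum_subtype_pair hne hk, upperVec_tree hT, upperVec_tree hT,
      upperVec_tree hT, hy, hz, subtreeOf, Sum.elim_inl, h, BTree.leaves,
      vecSum_union hg.1, sub_self]

variable (hT : T.IsGood v μ) (hu : T.leaves = Finset.univ) (hv : ∀ e, v e ≠ 0)
    {root : Fin T.nodes.card} (hroot : subtreeAt T root = T)

theorem hasType_treeCurve : HasType (treeCurve hT hu hv hroot) T := by
  refine ⟨_, _, isRooting_treeGraph hT hroot, ?_⟩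
  have := isBranch_tree hT hu hroot (.inl root)
  simp only [subtreeOf, Sum.elim_inl, hroot] at this
  exact this

theorem isRealized_treeCurve : IsRealized v μ (treeCurve hT hu hv hroot) where
  in_vec e := rfl
  in_line e := by
    have h1 : treeEnd T root (some e) = (parentIn T (.leaf e)).getD root := rfl
    have h2 := upper_tree hu hroot (.inr e)
    have h3 : parentIn T (.leaf e) = some (treeEnd T root (some e)) := h2.symm
    have h4 := (parentIn_eq_some hT).1 h3
    have hg := hT.isSubtree (BTree.mem_nodes.1 (subtreeAt_mem (treeEnd T root (some e)))).1
    have h5 : lineForm v μ (BTree.leaf e).leaves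
        ((subtreeAt T (treeEnd T root (some e))).rootPos v μ) = 0 := by
      obtain ⟨a, h | h⟩ := h4 <;> rw [h] at hg ⊢
      · exact lineForm_crossing_left hg.2.1.ne'
      · exact lineForm_crossing_right hg.2.1.ne'
    change wedgeR (toPlane (v e)) ((subtreeAt T (treeEnd T root (some e))).rootPos v μ) = μ e
    simpa [lineForm, BTree.leaves, vecSum, momSum, sub_eq_zero] using h5

/-- The three vectors at the vertex are a + b, -a and -b, so every wedge product of two of them is
zero or ± a ∧ b. -/
theorem vertexMult_eq {Γ : TropCurve (Option E)}
    {par : Fin Γ.numVerts → Option (Fin Γ.numVerts)} {height : Fin Γ.numVerts → ℕ}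
    (hr : IsRooting Γ.graph (Γ.endVertex none) par height)
    {u : Fin Γ.numVerts} {y z : Fin Γ.numVerts ⊕ E} (hne : y ≠ z)
    (h : ∀ w, upper par Γ.endVertex w = some u ↔ w = y ∨ w = z) :
    Γ.vertexMult u = (wedge (upperVec Γ.edgeVec Γ.endVec par y)
      (upperVec Γ.edgeVec Γ.endVec par z)).natAbs := by
  obtain ⟨f, hf, hf'⟩ := exists_starEquiv Γ.endVertex Γ.edgeVec Γ.endVec hr Γ.edgeVec_symm u
  have hadd := upperVec_eq_add hr hne h
  have fin : Finite (Γ.Star u) := inferInstance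
  set a := upperVec Γ.edgeVec Γ.endVec par y with ha
  set b := upperVec Γ.edgeVec Γ.endVec par z with hb
  have vals : ∀ x, Γ.starVec u x = a + b ∨ Γ.starVec u x = -a ∨ Γ.starVec u x = -b := by
    intro x
    obtain ⟨o, rfl⟩ := f.surjective x
    rcases o with _ | ⟨w, hw⟩
    · exact Or.inl (hf.trans hadd)
    · right
      rcases (h w).1 hw with rfl | rfl
      · exact Or.inl (hf' _)
      · exact Or.inr (hf' _)
  have w1 := wedge_comm a b
  refine le_antisymm (ciSup_le' ?_) ?_
  · rintro ⟨p, p'⟩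
    have neg : ∀ x y, wedge (-x) y = - wedge x y := by intro x y; simp [wedge]; ring
    have neg' : ∀ x y, wedge x (-y) = - wedge x y := by intro x y; simp [wedge]; ring
    rcases vals p with h1 | h1 | h1 <;> rcases vals p' with h2 | h2 | h2 <;> rw [h1, h2] <;>
      simp only [wedge_add_left, wedge_add_right, wedge_self, neg, neg'] <;> omega
  · refine le_trans ?_ (le_ciSup (Set.finite_range _).bddAbove
      (f (some ⟨y, (h y).2 (Or.inl rfl)⟩), f (some ⟨z, (h z).2 (Or.inr rfl)⟩)))
    have e1 : Γ.starVec u (f (some ⟨y, (h y).2 (Or.inl rfl)⟩)) = -a := hf' _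
    have e2 : Γ.starVec u (f (some ⟨z, (h z).2 (Or.inr rfl)⟩)) = -b := hf' _
    rw [e1, e2]
    have : wedge (-a) (-b) = wedge a b := by simp [wedge]
    rw [this]

theorem mult_treeCurve : (treeCurve hT hu hv hroot).mult = T.mult v := by
  set f : BTree E → ℕ := fun t => match t with
    | .leaf _ => 1
    | .node l r => (wedge (vecSum v l.leaves) (vecSum v r.leaves)).natAbs with hf
  have h1 : ∀ i : Fin T.nodes.card, (treeCurve hT hu hv hroot).vertexMult i =
      f (subtreeAt T i) := by
    intro i
    obtain ⟨l, r, y, z, h, hy, hz, hne, hk⟩ := exists_kids hT hu hroot i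
    rw [h, vertexMult_eq (Γ := treeCurve hT hu hv hroot) (isRooting_treeGraph hT hroot) hne hk]
    have e1 := upperVec_tree hT y
    have e2 := upperVec_tree hT z
    rw [hy] at e1
    rw [hz] at e2
    change (wedge (upperVec (treeEdgeVec v T) (treeEndVec v T) _ y)
      (upperVec (treeEdgeVec v T) (treeEndVec v T) _ z)).natAbs = _
    rw [e1, e2]
  rw [TropCurve.mult, ← hT.prod_nodes (f := f) (fun _ _ => rfl), ← Finset.prod_coe_sort T.nodes f]
  exact Fintype.prod_equiv T.nodes.equivFin.symm _ (fun t : T.nodes => f t.1) h1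

/-! ### The number of curves -/

theorem exists_subtreeAt_eq_self {l r : BTree E} :
    ∃ root, subtreeAt (.node l r) root = .node l r :=
  exists_subtreeAt (BTree.mem_nodes.2 ⟨.refl _, l, r, rfl⟩)

/-- A single end has no splitting with positive wedge product, in accordance with the absence of
curves without vertices. -/
theorem treeCount_of_card_eq_one {I : Finset E} (hI : I.card = 1) : treeCount v μ I = 0 := by
  obtain ⟨e, rfl⟩ := Finset.card_eq_one.1 hI
  refine Finset.sum_eq_zero fun J hJ => ?_
  exfalso
  rw [Finset.mem_filter, Finset.mem_powerset, Finset.subset_singleton_iff] at hJ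
  rcases hJ with ⟨rfl | rfl, h⟩
  · rw [vecSum_empty, wedge_zero_left] at h
    exact lt_irrefl _ h
  · rw [sdiff_self, Finset.bot_eq_empty, vecSum_empty, wedge_zero_right] at h
    exact lt_irrefl _ h

/-- Curves up to isomorphism correspond to good trees that are not leaves, and multiplicities agree.
-/
theorem count_realized (hg : IsGeneric v μ) (hv : ∀ e, v e ≠ 0) :
    {c : TropClass (Option E) | ∃ Γ, IsRealized v μ Γ ∧ Quotient.mk (TropCurve.setoid (Option E)) Γ = c}.Finite ∧
    ∑ᶠ c ∈ {c : TropClass (Option E) | ∃ Γ, IsRealized v μ Γ ∧ Quotient.mk (TropCurve.setoid (Option E)) Γ = c},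
      TropClass.mult c = treeCount v μ Finset.univ := by
  classical
  set A : Finset (BTree E) := {T ∈ treeSet v μ Finset.univ | ∃ l r, T = .node l r} with hA
  have hA1 : ∀ T : A, T.1.IsGood v μ := fun T =>
    (mem_treeSet.1 (Finset.mem_filter.1 T.2).1).1
  have hA2 : ∀ T : A, T.1.leaves = Finset.univ := fun T =>
    (mem_treeSet.1 (Finset.mem_filter.1 T.2).1).2
  have hA3 : ∀ T : A, ∃ root, subtreeAt T.1 root = T.1 := fun T => by
    obtain ⟨l, r, h⟩ := (Finset.mem_filter.1 T.2).2
    rw [h]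
    exact exists_subtreeAt_eq_self
  choose root hroot using hA3
  let F : A → TropClass (Option E) := fun T =>
    Quotient.mk (TropCurve.setoid (Option E)) (treeCurve (hA1 T) (hA2 T) hv (hroot T))
  have hF : Function.Injective F := by
    intro T T' h
    have := Quotient.exact h
    exact Subtype.ext ((hasType_treeCurve (hA1 T) (hA2 T) hv (hroot T)).eq_of_iso
      (hasType_treeCurve (hA1 T') (hA2 T') hv (hroot T')) (hA1 T) (hA1 T') this)
  have hrange : {c : TropClass (Option E) | ∃ Γ, IsRealized v μ Γ ∧ Quotient.mk (TropCurve.setoid (Option E)) Γ = c} =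
      Set.range F := by
    ext c
    constructor
    · rintro ⟨Γ, hΓ, rfl⟩
      obtain ⟨T, hT, ht⟩ := hΓ.exists_hasType hg
      let T' : A := ⟨T, Finset.mem_filter.2 ⟨mem_treeSet.2 ⟨hT, ht.leaves_eq⟩,
        ht.exists_eq_node⟩⟩
      exact ⟨T', Quotient.sound ((hasType_treeCurve (hA1 T') (hA2 T') hv (hroot T')).iso ht hT
        (isRealized_treeCurve (hA1 T') (hA2 T') hv (hroot T')) hΓ)⟩
    · rintro ⟨T, rfl⟩
      exact ⟨_, isRealized_treeCurve (hA1 T) (hA2 T) hv (hroot T), rfl⟩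
  rw [hrange]
  refine ⟨Set.finite_range F, ?_⟩
  rw [finsum_mem_range hF, finsum_eq_sum_of_fintype]
  have h1 : ∀ T : A, (F T).mult = T.1.mult v := fun T => mult_treeCurve _ _ _ _
  simp only [h1]
  rw [Finset.sum_coe_sort A (fun T => T.mult v)]
  -- With one end the only good tree is the leaf, which is not a curve; both sides are then zero.
  by_cases hc : (Finset.univ : Finset E).card = 1
  · rw [treeCount_of_card_eq_one hc]
    refine Finset.sum_eq_zero fun T hT => ?_
    exfalso
    obtain ⟨h2, l, r, rfl⟩ := Finset.mem_filter.1 hT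
    obtain ⟨h3, h4⟩ := mem_treeSet.1 h2
    rw [← h4, BTree.leaves, Finset.card_union_of_disjoint h3.1] at hc
    have := l.leaves_nonempty.card_pos
    have := r.leaves_nonempty.card_pos
    omega
  · rw [← sum_mult_treeSet hc]
    refine Finset.sum_subset (Finset.filter_subset _ _) fun T hT hT' => ?_
    exfalso
    refine hT' (Finset.mem_filter.2 ⟨hT, ?_⟩)
    cases T with
    | leaf e => exact absurd (by rw [← (mem_treeSet.1 hT).2]; simp [BTree.leaves]) hc
    | node l r => exact ⟨l, r, rfl⟩

end Model

/-! ### General position -/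

/-- Proper affine subspaces are null sets for Haar measure, so finitely many do not cover the space.
-/
theorem exists_forall_notMem_affineSubspace {F : Type*} [NormedAddCommGroup F] [NormedSpace ℝ F]
    [FiniteDimensional ℝ F] {B : Set (AffineSubspace ℝ F)} (hB : B.Finite) (hB' : ⊤ ∉ B) :
    ∃ p : F, ∀ H ∈ B, p ∉ H := by
  borelize F
  let ν : MeasureTheory.Measure F := MeasureTheory.Measure.addHaar
  by_contra! hcon
  have h1 : (⋃ H ∈ B, (H : Set F)) = Set.univ := by
    ext p
    simpa using hcon p
  have h2 : ν (⋃ H ∈ B, (H : Set F)) = 0 := by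
    rw [MeasureTheory.measure_biUnion_null_iff hB.countable]
    intro H hH
    refine MeasureTheory.Measure.addHaar_affineSubspace ν H ?_
    rintro rfl
    exact hB' hH
  rw [h1] at h2
  exact (isOpen_univ.measure_pos ν Set.univ_nonempty).ne' h2

section Forms

variable {E : Type*} [Fintype E] [DecidableEq E] (v : E → ℤ × ℤ)

/-- The coefficients of the linear forms on the moments that do not vanish in general position. -/
def genericForms : Set (E → ℝ) :=
  (Set.range fun x : Finset E × Finset E × Finset E => fun e =>
    (wedge (vecSum v x.2.1) (vecSum v x.2.2) : ℝ) * (if e ∈ x.1 then 1 else 0) +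
      (wedge (vecSum v x.2.2) (vecSum v x.1) : ℝ) * (if e ∈ x.2.1 then 1 else 0) +
      (wedge (vecSum v x.1) (vecSum v x.2.1) : ℝ) * (if e ∈ x.2.2 then 1 else 0)) ∪
  Set.range fun x : Finset E × Finset E => fun e =>
    alpha (toPlane (vecSum v x.2)) * (if e ∈ x.1 then 1 else 0) -
      alpha (toPlane (vecSum v x.1)) * (if e ∈ x.2 then 1 else 0)

theorem finite_genericForms : (genericForms v).Finite :=
  (Set.finite_range _).union (Set.finite_range _)

variable {v}

theorem momSum_eq_sum (μ : E → ℝ) (J : Finset E) :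
    momSum μ J = ∑ e, (if e ∈ J then 1 else 0) * μ e := by
  simp [momSum, Finset.sum_ite_mem]

theorem isGeneric_of_forall {μ : E → ℝ}
    (h : ∀ c ∈ genericForms v, c ≠ 0 → ∑ e, c e * μ e ≠ 0) : IsGeneric v μ where
  concurrent J K A := by
    rintro ⟨e, he⟩
    have h1 := h _ (Or.inl ⟨(J, K, A), rfl⟩) fun h0 => he (congrFun h0 e)
    convert h1 using 1
    simp only [momSum_eq_sum, Finset.mul_sum, ← Finset.sum_add_distrib]
    exact Finset.sum_congr rfl fun e _ => by ring
  parallel J K := by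
    rintro ⟨e, he⟩
    have h1 := h _ (Or.inr ⟨(J, K), rfl⟩) fun h0 => he (congrFun h0 e)
    convert h1 using 1
    simp only [momSum_eq_sum, Finset.mul_sum, ← Finset.sum_sub_distrib]
    exact Finset.sum_congr rfl fun e _ => by ring

/-- In general position, up to a linear map onto the space of moments. -/
theorem exists_affineSubspaces {F : Type*} [AddCommGroup F] [Module ℝ F] (M : F →ₗ[ℝ] (E → ℝ))
    (hM : Function.Surjective M) : ∃ B : Set (AffineSubspace ℝ F), B.Finite ∧ ⊤ ∉ B ∧
      ∀ p, (∀ H ∈ B, p ∉ H) → IsGeneric v (M p) := by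
  let φ : (E → ℝ) → F →ₗ[ℝ] ℝ := fun c => (Fintype.linearCombination ℝ c).comp M
  have hφ : ∀ c p, φ c p = ∑ e, c e * M p e := by
    intro c p
    simp [φ, Fintype.linearCombination_apply, mul_comm]
  refine ⟨(fun c => (LinearMap.ker (φ c)).toAffineSubspace) '' {c ∈ genericForms v | c ≠ 0},
    ((finite_genericForms v).subset fun c hc => hc.1).image _, ?_, fun p hp => ?_⟩
  · rintro ⟨c, ⟨-, hc⟩, h⟩
    refine hc (funext fun e => ?_)
    obtain ⟨p, hp⟩ := hM (Pi.single e 1)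
    have h1 : p ∈ (LinearMap.ker (φ c)).toAffineSubspace := by
      simp only at h
      rw [h]; trivial
    have h2 : φ c p = 0 := h1
    rw [hφ, hp] at h2
    simpa [Pi.single_apply] using h2
  · refine isGeneric_of_forall fun c hc hc0 h0 => hp _ ⟨c, ⟨hc, hc0⟩, rfl⟩ ?_
    change φ c p = 0
    rw [hφ]
    exact h0

variable (v) in
theorem exists_isGeneric : ∃ μ : E → ℝ, IsGeneric v μ := by
  obtain ⟨B, hB, hB', h⟩ := exists_affineSubspaces (v := v) (LinearMap.id : (E → ℝ) →ₗ[ℝ] _)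
    Function.surjective_id
  obtain ⟨p, hp⟩ := exists_forall_notMem_affineSubspace hB hB'
  exact ⟨_, h p hp⟩

end Forms

/-! ### Relabelling -/

section Relabel

variable {E E' : Type*} [DecidableEq E] [DecidableEq E'] (ι : E ↪ E') (v : E' → ℤ × ℤ)
  (μ : E' → ℝ)

theorem vecSum_map (I : Finset E) : vecSum v (I.map ι) = vecSum (v ∘ ι) I :=
  Finset.sum_map _ _ _

theorem momSum_map (I : Finset E) : momSum μ (I.map ι) = momSum (μ ∘ ι) I :=
  Finset.sum_map _ _ _

theorem sum_powerset_map (I : Finset E) (f : Finset E' → ℕ) (p : Finset E' → Prop)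
    [DecidablePred p] : ∑ J ∈ (I.map ι).powerset with p J, f J =
      ∑ J ∈ I.powerset with p (J.map ι), f (J.map ι) := by
  refine (Finset.sum_bij (fun J _ => J.map ι) (fun J hJ => ?_) (fun J _ J' _ h => ?_)
    (fun J hJ => ?_) (fun J _ => rfl)).symm
  · simpa using hJ
  · exact Finset.map_injective ι h
  · simp only [Finset.mem_filter, Finset.mem_powerset] at hJ
    obtain ⟨J', hJ', rfl⟩ := Finset.subset_map_iff.1 hJ.1
    exact ⟨J', by simpa [hJ'] using hJ.2, rfl⟩

theorem sdiff_map (I J : Finset E) : I.map ι \ J.map ι = (I \ J).map ι := by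
  ext x
  simp only [Finset.mem_sdiff, Finset.mem_map]
  constructor
  · rintro ⟨⟨a, ha, rfl⟩, h⟩
    exact ⟨a, ⟨ha, fun h' => h ⟨a, h', rfl⟩⟩, rfl⟩
  · rintro ⟨a, ⟨ha, h'⟩, rfl⟩
    refine ⟨⟨a, ha, rfl⟩, ?_⟩
    rintro ⟨b, hb, h⟩
    exact h' (ι.injective h ▸ hb)

theorem crossing_map (I J : Finset E) :
    crossing v μ (I.map ι) (J.map ι) = crossing (v ∘ ι) (μ ∘ ι) I J := by
  simp only [crossing, vecSum_map, momSum_map]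

theorem countBefore_map (I : Finset E) (x : ℝ × ℝ) :
    countBefore v μ (I.map ι) x = countBefore (v ∘ ι) (μ ∘ ι) I x := by
  induction I using Finset.strongInduction generalizing x with
  | H I ih =>
  rw [countBefore_eq, countBefore_eq, Finset.card_map, sum_powerset_map]
  congr 1
  simp only [sdiff_map, vecSum_map, crossing_map, lineForm, momSum_map]
  refine Finset.sum_congr rfl fun J hJ => ?_
  simp only [Finset.mem_filter, Finset.mem_powerset] at hJ
  have h1 : J ⊂ I := by
    refine hJ.1.ssubset_of_ne ?_
    rintro rfl
    simp [vecSum_empty, wedge_zero_right] at hJ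
  have h2 : I \ J ⊂ I := by
    refine Finset.sdiff_subset.ssubset_of_ne ?_
    intro h
    have hd : Disjoint I J := Finset.sdiff_eq_self_iff_disjoint.1 h
    have : J = ∅ := Finset.disjoint_self_iff_empty _ |>.1 (hd.mono_left hJ.1)
    rw [this, vecSum_empty, wedge_zero_left] at hJ
    exact lt_irrefl _ hJ.2
  rw [ih J h1, ih _ h2]
  rfl

/-- The recursion looks only at subsets of I, so the count for some of the walls can be computed
within this set of walls alone. -/
theorem treeCount_map (I : Finset E) :
    treeCount v μ (I.map ι) = treeCount (v ∘ ι) (μ ∘ ι) I := by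
  rw [treeCount, treeCount, sum_powerset_map]
  simp only [sdiff_map, vecSum_map, crossing_map, countBefore_map]

variable {v μ}

theorem IsGeneric.comp (h : IsGeneric v μ) : IsGeneric (v ∘ ι) (μ ∘ ι) where
  concurrent J K A := by
    rintro ⟨e, he⟩
    have := h.concurrent (J.map ι) (K.map ι) (A.map ι) ⟨ι e, by
      simpa only [vecSum_map, Finset.mem_map' ι] using he⟩
    simpa only [vecSum_map, momSum_map] using this
  parallel J K := by
    rintro ⟨e, he⟩
    have := h.parallel (J.map ι) (K.map ι) ⟨ι e, by
      simpa only [vecSum_map, Finset.mem_map' ι] using he⟩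
    simpa only [vecSum_map, momSum_map] using this

end Relabel

/-! ### The tropical count -/

section Count

variable {n : ℕ} {m : Fin n → ℤ × ℤ} {w : Fin n → WeightVector}

/-- The vectors of the incoming edges, pointing inwards. -/
def inVec (m : Fin n → ℤ × ℤ) (w : Fin n → WeightVector) (x : InEdge w) : ℤ × ℤ :=
  (w x.1).entry x.2 • m x.1

/-- The moments of the incoming edges. -/
def moments (m : Fin n → ℤ × ℤ) (w : Fin n → WeightVector) : LineConfig w →ₗ[ℝ] (InEdge w → ℝ) where
  toFun p x := wedgeR (toPlane (inVec m w x)) (p x)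
  map_add' _ _ := funext fun _ => wedgeR_add_right _ _ _
  map_smul' _ _ := funext fun _ => wedgeR_smul_right _ _ _

theorem vecSum_inVec : vecSum (inVec m w) Finset.univ = outVec m w := by
  simp only [vecSum, outVec, WeightVector.size, inVec, Finset.sum_smul]
  rw [Fintype.sum_sigma]

theorem inVec_ne_zero (hm : ∀ i, m i ≠ 0) (x : InEdge w) : inVec m w x ≠ 0 :=
  smul_ne_zero ((w x.1).entry_pos x.2).ne' (hm x.1)

theorem exists_wedgeR_eq {u : ℤ × ℤ} (hu : u ≠ 0) (c : ℝ) : ∃ x, wedgeR (toPlane u) x = c := by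
  by_cases h : u.1 = 0
  · have h2 : (u.2 : ℝ) ≠ 0 := by
      intro h2
      exact hu (Prod.ext h (by exact_mod_cast h2))
    exact ⟨(-c / u.2, 0), by simp [wedgeR, toPlane]; field_simp⟩
  · have h1 : (u.1 : ℝ) ≠ 0 := by exact_mod_cast h
    exact ⟨(0, c / u.1), by simp [wedgeR, toPlane]; field_simp⟩

theorem moments_surjective (hm : ∀ i, m i ≠ 0) : Function.Surjective (moments m w) := by
  intro μ
  choose p hp using fun x : InEdge w => exists_wedgeR_eq (inVec_ne_zero (w := w) hm x) (μ x)
  exact ⟨p, funext hp⟩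

theorem exists_smul_of_wedgeR_eq_zero {u : ℤ × ℤ} (hu : u ≠ 0) {x : ℝ × ℝ}
    (h : wedgeR (toPlane u) x = 0) : ∃ s : ℝ, x = s • toPlane u := by
  simp only [wedgeR, toPlane] at h ⊢
  by_cases h1 : u.1 = 0
  · have h2 : (u.2 : ℝ) ≠ 0 := by
      intro h2
      exact hu (Prod.ext h1 (by exact_mod_cast h2))
    have h3 : x.1 = 0 := by
      simpa [h1, h2] using h
    exact ⟨x.2 / u.2, Prod.ext (by simp [h1, h3]) (by simp; field_simp)⟩
  · have h1' : (u.1 : ℝ) ≠ 0 := by exact_mod_cast h1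
    exact ⟨x.1 / u.1, Prod.ext (by simp; field_simp) (by simp; field_simp; linarith)⟩

theorem IsRealized.endVec_none {E : Type} [Fintype E] [DecidableEq E] {v : E → ℤ × ℤ} {μ : E → ℝ}
    (hg : IsGeneric v μ) {Γ : TropCurve (Option E)} (hΓ : IsRealized v μ Γ) :
    Γ.endVec none = vecSum v Finset.univ := by
  obtain ⟨par, height, hr⟩ := exists_isRooting Γ.isTree (Γ.endVertex none)
  obtain ⟨T, hT, hb⟩ := hΓ.exists_isBranch hg hr (.inl (Γ.endVertex none))
  have h1 := hΓ.upperVec_eq hr hb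
  rw [hb.leaves_eq_univ hr] at h1
  simpa [upperVec, (hr.par_eq_none _).2 rfl] using h1

/-- A line in direction m_i is given by the moment of any of its points. The condition on the out
edge is automatic, since by balancing its vector is the sum of the incoming ones. -/
theorem isCounted_iff (hm : ∀ i, m i ≠ 0) {p : LineConfig w}
    (hg : IsGeneric (inVec m w) (moments m w p)) {Γ : TropCurve (Option (InEdge w))} :
    IsCounted m w p Γ ↔ IsRealized (inVec m w) (moments m w p) Γ := by
  have key : ∀ (x : InEdge w) y, wedgeR (toPlane (inVec m w x)) y =
      ((w x.1).entry x.2 : ℝ) * wedgeR (toPlane (m x.1)) y := by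
    intro x y
    simp only [inVec, wedgeR, toPlane_nsmul, Prod.smul_fst, Prod.smul_snd, smul_eq_mul]
    ring
  constructor
  · intro h
    refine ⟨h.in_vec, fun x => ?_⟩
    obtain ⟨s, hs⟩ := h.in_line x
    rw [hs, wedgeR_add_right, wedgeR_smul_right, key x (toPlane (m x.1)), wedgeR_toPlane,
      wedge_self]
    simp [moments]
  · intro h
    refine ⟨h.in_vec, fun x => ?_, 1, one_pos, ?_⟩
    · have h1 := h.in_line x
      have h2 : wedgeR (toPlane (m x.1)) (Γ.pos (Γ.endVertex (some x)) - p x) = 0 := by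
        have h3 : ((w x.1).entry x.2 : ℝ) ≠ 0 := by exact_mod_cast ((w x.1).entry_pos x.2).ne'
        refine (mul_eq_zero.1 (?_ : ((w x.1).entry x.2 : ℝ) * _ = 0)).resolve_left h3
        rw [← key, sub_eq_add_neg, ← neg_one_smul ℝ (p x), wedgeR_add_right, wedgeR_smul_right, h1]
        simp [moments]
      obtain ⟨s, hs⟩ := exists_smul_of_wedgeR_eq_zero (hm x.1) h2
      exact ⟨s, by rw [← hs]; abel⟩
    · rw [h.endVec_none hg, vecSum_inVec, one_smul]

/-- Genericity of the moments excludes finitely many hyperplanes in the space of moments; their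
preimages are the subspaces to be avoided. The count does not depend on the moments, so an arbitrary
generic μ may represent it. -/
theorem isTropicalCount_treeCount (hm : ∀ i, m i ≠ 0) (hout : outVec m w ≠ 0)
    {μ : InEdge w → ℝ} (hμ : IsGeneric (inVec m w) μ) :
    IsTropicalCount m w (treeCount (inVec m w) μ Finset.univ) := by
  obtain ⟨B, hB, hB', h⟩ := exists_affineSubspaces (v := inVec m w) (moments m w)
    (moments_surjective hm)
  refine ⟨B, hB, hB', fun p hp => ?_⟩
  have hg := h p hp
  have e : countedCurves m w p = {c : TropClass (Option (InEdge w)) | ∃ Γ, IsRealized (inVec m w) (moments m w p) Γ ∧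
      Quotient.mk (TropCurve.setoid (Option (InEdge w))) Γ = c} := by
    simp only [countedCurves, isCounted_iff hm hg]
  have hc := count_realized hg (inVec_ne_zero hm)
  refine ⟨e ▸ hc.1, fun Γ hΓ => ((isCounted_iff hm hg).1 hΓ).isTrivalent hg, ?_⟩
  rw [e]
  refine hc.2.trans (treeCount_eq_of_isGeneric hg hμ Finset.univ ?_)
  rw [vecSum_inVec]
  exact hout

/-- Two finite families of proper subspaces have a common general point. -/
theorem IsTropicalCount.unique {c c' : ℕ} (h : IsTropicalCount m w c)
    (h' : IsTropicalCount m w c') : c = c' := by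
  obtain ⟨B, h1, h2, h3⟩ := h
  obtain ⟨B', h1', h2', h3'⟩ := h'
  obtain ⟨p, hp⟩ := exists_forall_notMem_affineSubspace (h1.union h1')
    (fun h => h.elim h2 h2')
  rw [← (h3 p fun H hH => hp H (Or.inl hH)).2.2, (h3' p fun H hH => hp H (Or.inr hH)).2.2]

theorem isTropicalCount_ntrop (hm : ∀ i, m i ≠ 0) (hout : outVec m w ≠ 0) :
    IsTropicalCount m w (Ntrop m w) := by
  obtain ⟨μ, hμ⟩ := exists_isGeneric (inVec m w)
  have h : ∃ c, IsTropicalCount m w c := ⟨_, isTropicalCount_treeCount hm hout hμ⟩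
  rw [Ntrop, dif_pos h]
  exact h.choose_spec

theorem ntrop_eq_treeCount (hm : ∀ i, m i ≠ 0) (hout : outVec m w ≠ 0) {μ : InEdge w → ℝ}
    (hμ : IsGeneric (inVec m w) μ) : Ntrop m w = treeCount (inVec m w) μ Finset.univ :=
  (isTropicalCount_ntrop hm hout).unique (isTropicalCount_treeCount hm hout hμ)

end Count

/-! ### Supports of series -/

section Support

variable {𝕜 : Type*} [Field 𝕜] {n : ℕ}

theorem coeff_mul_eq_sum (x y : AddMonoidAlgebra 𝕜 (ℤ × ℤ)) (m : ℤ × ℤ) :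
    (x * y).coeff m = x.coeff.sum fun v c => c * y.coeff (m - v) := by
  rw [AddMonoidAlgebra.coeff_mul]
  refine Finsupp.sum_congr fun v _ => ?_
  have : ∀ m₂, v + m₂ = m ↔ m₂ = m - v := fun m₂ => eq_sub_iff_add_eq'.symm
  simp only [this]
  rw [Finsupp.sum, Finset.sum_ite_eq']
  split_ifs with h
  · rfl
  · rw [Finsupp.notMem_support_iff.1 h, mul_zero]

theorem coef_smul (c : 𝕜) (α : Fin n →₀ ℕ) (m : ℤ × ℤ) (a : CRing 𝕜 n) :
    coef α m (c • a) = c * coef α m a := by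
  have : MvPowerSeries.coeff α (c • a) = c • MvPowerSeries.coeff α a := rfl
  simp [coef, this]

/-- All monomials of the series have exponents in `s`. -/
def IsSupportedOn (s : Set ((Fin n →₀ ℕ) × (ℤ × ℤ))) (a : CRing 𝕜 n) : Prop :=
  ∀ α m, coef α m a ≠ 0 → (α, m) ∈ s

variable {s : Set ((Fin n →₀ ℕ) × (ℤ × ℤ))}

theorem IsSupportedOn.mul (hs : ∀ x ∈ s, ∀ y ∈ s, x + y ∈ s) {a b : CRing 𝕜 n}
    (ha : IsSupportedOn s a) (hb : IsSupportedOn s b) : IsSupportedOn s (a * b) := by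
  intro α m h
  rw [coef, MvPowerSeries.coeff_mul, AddMonoidAlgebra.coeff_sum, Finsupp.finsetSum_apply] at h
  obtain ⟨⟨β, γ⟩, hβ, h1⟩ := Finset.exists_ne_zero_of_sum_ne_zero h
  rw [coeff_mul_eq_sum, Finsupp.sum] at h1
  obtain ⟨v, -, h2⟩ := Finset.exists_ne_zero_of_sum_ne_zero h1
  have h3 := hs _ (ha β v (left_ne_zero_of_mul h2)) _ (hb γ (m - v) (right_ne_zero_of_mul h2))
  have h4 : β + γ = α := Finset.HasAntidiagonal.mem_antidiagonal.1 hβ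
  simpa [h4] using h3

theorem IsSupportedOn.pow (hs : ∀ x ∈ s, ∀ y ∈ s, x + y ∈ s) {a : CRing 𝕜 n}
    (ha : IsSupportedOn s a) {j : ℕ} (hj : 1 ≤ j) : IsSupportedOn s (a ^ j) := by
  induction j, hj using Nat.le_induction with
  | base => simpa using ha
  | succ j _ ih => rw [pow_succ]; exact ih.mul hs ha

/-- Only positive powers of f - 1 occur, and their exponents stay in a set that is closed under
addition. Various choices of s give the restrictions on the monomials of log f used below. -/
theorem IsSupportedOn.log (hs : ∀ x ∈ s, ∀ y ∈ s, x + y ∈ s) {f : CRing 𝕜 n}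
    (hf : IsSupportedOn s (f - 1)) : IsSupportedOn s (log f) := by
  intro α m h
  have h0 : coef α m (TropVertex.log f) = ∑ j ∈ Finset.Icc 1 α.degree,
      ((-1 : 𝕜) ^ (j + 1) / (j : 𝕜)) * coef α m ((f - 1) ^ j) := by
    change AddMonoidAlgebra.coeff (∑ j ∈ Finset.Icc 1 α.degree,
      ((-1 : 𝕜) ^ (j + 1) / (j : 𝕜)) • MvPowerSeries.coeff α ((f - 1) ^ j)) m = _
    rw [AddMonoidAlgebra.coeff_sum, Finsupp.finsetSum_apply]
    rfl
  rw [h0] at h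
  obtain ⟨j, hj, h1⟩ := Finset.exists_ne_zero_of_sum_ne_zero h
  exact hf.pow hs (Finset.mem_Icc.1 hj).1 α m (right_ne_zero_of_mul h1)

theorem coef_log_ne_zero {u : ℤ × ℤ} {f : CRing 𝕜 n} (hf : IsWallFunction u f)
    {α : Fin n →₀ ℕ} {m : ℤ × ℤ} (h : coef α m (log f) ≠ 0) :
    α ≠ 0 ∧ ∃ j : ℕ, 0 < j ∧ m = j • u := by
  refine IsSupportedOn.log (s := {x | x.1 ≠ 0 ∧ ∃ j : ℕ, 0 < j ∧ x.2 = j • u}) ?_ hf α m h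
  rintro ⟨α, m⟩ ⟨h1, j, hj, h2⟩ ⟨β, m'⟩ ⟨h3, j', hj', h4⟩
  refine ⟨fun h0 => h1 ?_, j + j', by omega, ?_⟩
  · exact (add_eq_zero.1 h0).1
  · simp only at h2 h4
    simp [h2, h4, add_smul]

theorem log_eq_of_congrMod {r : ℕ} {f : CRing 𝕜 n} (hf : CongrMod r f 1) {α : Fin n →₀ ℕ}
    (hα : α.degree < r) (m : ℤ × ℤ) : coef α m (log f) = 0 := by
  by_contra h
  have := IsSupportedOn.log (s := {x | r ≤ x.1.degree}) ?_ ?_ α m h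
  · exact absurd hα (not_lt.2 this)
  · rintro ⟨α, m⟩ h1 ⟨β, m'⟩ _
    simp only [Set.mem_ofPred_eq, Prod.mk_add_mk, map_add] at *
    omega
  · intro α m h1
    by_contra h2
    refine h1 ?_
    have := hf α (not_le.1 h2)
    simp [coef, this]

theorem StandardDiagram.coef_log_ne_zero (D : StandardDiagram 𝕜 n) {i : Fin n}
    {α : Fin n →₀ ℕ} {m : ℤ × ℤ} (h : coef α m (log (D.f i)) ≠ 0) {j : Fin n} (hj : j ≠ i) :
    α j = 0 := by
  have := IsSupportedOn.log (s := {x | ∀ j, j ≠ i → x.1 j = 0}) ?_ ?_ α m h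
  · exact this j hj
  · rintro ⟨α, m⟩ h1 ⟨β, m'⟩ h2 j hj
    have h3 := h1 j hj
    have h4 := h2 j hj
    simp only at h3 h4
    simp [h3, h4]
  · intro α m h1 j hj
    by_cases h2 : MvPowerSeries.coeff α (D.f i) = 0
    · by_cases h3 : α = 0
      · simp [h3]
      · exfalso
        refine h1 ?_
        classical
        simp [coef, h2, MvPowerSeries.coeff_one, h3]
    · exact D.f_var i α h2 j hj

end Support

/-! ### Squarefree parts -/

section Squarefree

variable {𝕜 : Type*} [Field 𝕜] {n : ℕ} {E : Type*} [DecidableEq E] (blk : E → Fin n)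

/-- The exponent of the product of the variables with labels in `A`. -/
def blockDeg (A : Finset E) : Fin n →₀ ℕ := ∑ e ∈ A, Finsupp.single (blk e) 1

/-- The factorial of the multi-index `blockDeg blk A`. -/
def blockFact (A : Finset E) : ℕ := ∏ i, (blockDeg blk A i).factorial

/-- The coefficient of `∏ u_e`, `e ∈ A`, after the substitution `t_i = ∑ u_e` over the labels `e`
in the block `i`, where `u_e² = 0`. -/
def sqPart (b : CRing 𝕜 n) (A : Finset E) : AddMonoidAlgebra 𝕜 (ℤ × ℤ) :=
  blockFact blk A • MvPowerSeries.coeff (blockDeg blk A) b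

/-- The image of a series in the module over the squarefree monomials. -/
def sqMap (b : CRing 𝕜 n) : SqModule E 𝕜 := fun A m => (sqPart blk b A).coeff m

theorem blockDeg_insert {e : E} {A : Finset E} (h : e ∉ A) :
    blockDeg blk (insert e A) = blockDeg blk A + Finsupp.single (blk e) 1 := by
  rw [blockDeg, Finset.sum_insert h, add_comm]; rfl

theorem degree_blockDeg (A : Finset E) : (blockDeg blk A).degree = A.card := by
  simp [blockDeg, map_sum]

theorem blockFact_insert {e : E} {A : Finset E} (h : e ∉ A) :
    blockFact blk (insert e A) = blockFact blk A * (blockDeg blk A (blk e) + 1) := by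
  rw [blockFact, blockFact, blockDeg_insert blk h, ← Finset.mul_prod_erase _ _
    (Finset.mem_univ (blk e)), ← Finset.mul_prod_erase _ (fun i => (blockDeg blk A i).factorial)
    (Finset.mem_univ (blk e))]
  have : ∀ i ∈ Finset.univ.erase (blk e),
      ((blockDeg blk A + Finsupp.single (blk e) 1 : Fin n →₀ ℕ) i).factorial =
        (blockDeg blk A i).factorial := by
    intro i hi
    rw [Finsupp.add_apply, Finsupp.single_eq_of_ne (Finset.ne_of_mem_erase hi), add_zero]
  rw [Finset.prod_congr rfl this, Finsupp.add_apply, Finsupp.single_eq_same, Nat.factorial_succ]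
  ring

/-- Adding a label is differentiation by the variable of its block: the factor produced by
differentiation is the one by which the factorial grows. -/
theorem sqPart_insert (b : CRing 𝕜 n) {e : E} {A : Finset E} (h : e ∉ A) :
    sqPart blk b (insert e A) = sqPart blk (MvPowerSeries.pderiv _ (blk e) b) A := by
  rw [sqPart, sqPart, blockFact_insert blk h, blockDeg_insert blk h, MvPowerSeries.coeff_pderiv,
    mul_smul, ← Nat.cast_succ, ← nsmul_eq_mul']

/-- Multiplicativity of the substitution by square-zero variables. As labels are added by
differentiation, this is the iterated Leibniz rule. -/
theorem sqPart_mul (b c : CRing 𝕜 n) (A : Finset E) :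
    sqPart blk (b * c) A = ∑ B ∈ A.powerset, sqPart blk b B * sqPart blk c (A \ B) := by
  induction A using Finset.induction_on generalizing b c with
  | empty =>
    simp [sqPart, blockFact, blockDeg, MvPowerSeries.coeff_zero_eq_constantCoeff]
  | insert e A h ih =>
    have hadd : ∀ x y : CRing 𝕜 n, sqPart blk (x + y) A = sqPart blk x A + sqPart blk y A := by
      intro x y
      simp [sqPart]
    rw [sqPart_insert blk _ h, Derivation.leibniz, hadd, smul_eq_mul, smul_eq_mul, ih,
      mul_comm c, ih, Finset.sum_powerset_insert h]
    congr 1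
    · refine Finset.sum_congr rfl fun B hB => ?_
      have hB' := Finset.mem_powerset.1 hB
      rw [Finset.insert_sdiff_of_notMem _ (fun h' => h (hB' h')), sqPart_insert blk]
      exact fun h' => h (Finset.mem_sdiff.1 h').1
    · refine Finset.sum_congr rfl fun B hB => ?_
      have hB' := Finset.mem_powerset.1 hB
      rw [sqPart_insert blk _ (fun h' => h (hB' h')), Finset.insert_sdiff_insert,
        Finset.sdiff_insert_of_notMem h]

theorem coeff_partialD (ν : ℤ × ℤ) (a : CRing 𝕜 n) (α : Fin n →₀ ℕ) (m : ℤ × ℤ) :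
    (MvPowerSeries.coeff α (partialD ν a)).coeff m =
      ((pairing m ν : ℤ) : 𝕜) * (MvPowerSeries.coeff α a).coeff m := by
  change AddMonoidAlgebra.coeff ((MvPowerSeries.coeff α a).coeff.sum fun m c =>
    AddMonoidAlgebra.single m (((pairing m ν : ℤ) : 𝕜) * c)) m = _
  rw [AddMonoidAlgebra.coeff_finsuppSum, Finsupp.sum_apply]
  simp only [AddMonoidAlgebra.coeff_single, Finsupp.single_apply]
  rw [Finsupp.sum, Finset.sum_ite_eq']
  split_ifs with h
  · rfl
  · rw [Finsupp.notMem_support_iff.1 h, mul_zero]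

theorem sqMap_apply (b : CRing 𝕜 n) (A : Finset E) (m : ℤ × ℤ) :
    sqMap blk b A m = (blockFact blk A : 𝕜) * coef (blockDeg blk A) m b := by
  rw [sqMap, sqPart, coef, AddMonoidAlgebra.coeff_smul, Finsupp.smul_apply, nsmul_eq_mul]

theorem sqMap_partialD (ν : ℤ × ℤ) (b : CRing 𝕜 n) (A : Finset E) (m : ℤ × ℤ) :
    sqMap blk (partialD ν b) A m = ((pairing m ν : ℤ) : 𝕜) * sqMap blk b A m := by
  rw [sqMap_apply, sqMap_apply, coef, coeff_partialD, coef]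
  ring

theorem sqMap_mul (g b : CRing 𝕜 n) (P : Finset (ℤ × ℤ))
    (hP : ∀ I v, sqMap blk g I v ≠ 0 → v ∈ P) (A : Finset E) (m : ℤ × ℤ) :
    sqMap blk (g * b) A m =
      ∑ B ∈ A.powerset, ∑ v ∈ P, sqMap blk g B v * sqMap blk b (A \ B) (m - v) := by
  rw [sqMap, sqPart_mul, AddMonoidAlgebra.coeff_sum, Finsupp.finsetSum_apply]
  refine Finset.sum_congr rfl fun B _ => ?_
  rw [coeff_mul_eq_sum]
  exact Finsupp.sum_of_support_subset _ (fun v hv => hP B v (Finsupp.mem_support_iff.1 hv)) _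
    fun v _ => zero_mul _

theorem sqMap_zpow (m : ℤ × ℤ) : sqMap blk (zpow 𝕜 n m) = monomialVec (E := E) (𝕜 := 𝕜) m := by
  classical
  ext A m'
  rw [sqMap_apply, coef, zpow, MvPowerSeries.coeff_C, monomialVec]
  have h : blockDeg blk A = 0 ↔ A = ∅ := by
    rw [← Finsupp.degree_eq_zero_iff, degree_blockDeg, Finset.card_eq_zero]
  by_cases hA : A = ∅
  · subst hA
    simp [blockFact, blockDeg, Finsupp.single_apply, eq_comm]
  · rw [if_neg (fun h' => hA (h.1 h')), if_neg (fun h' => hA h'.1)]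
    simp

/-- Squarefree monomials have degree at most |E|, so everything of order r > |E| is invisible. -/
theorem sqMap_congr {r : ℕ} {a b : CRing 𝕜 n} (h : CongrMod r a b) [Fintype E]
    (hr : Fintype.card E < r) : sqMap blk a = sqMap blk b := by
  ext A m
  rw [sqMap_apply, sqMap_apply, coef, coef, h]
  rw [degree_blockDeg]
  exact (Finset.card_le_univ A).trans_lt hr

variable [Fintype E]

/-- The coefficients of the operator of a wall with logarithm `g`. -/
def wallCoeff (g : CRing 𝕜 n) (I : Finset E) (v : ℤ × ℤ) : 𝕜 := sqMap blk g I v / (index v : 𝕜)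

/-- The operator of a wall, in terms of its coefficients. -/
def wallOperator (P : Finset (ℤ × ℤ)) (c : Finset E → ℤ × ℤ → 𝕜) :
    Module.End 𝕜 (SqModule E 𝕜) :=
  ∑ I ∈ Finset.univ.erase ∅, ∑ v ∈ P, c I v • wallOp 𝕜 I v

theorem index_nsmul {u : ℤ × ℤ} (hu : IsPrimitive u) (j : ℕ) : index (j • u) = j := by
  have h1 : Int.gcd u.1 u.2 = 1 := hu
  have : index (j • u) = Int.gcd ((j : ℤ) * u.1) ((j : ℤ) * u.2) := by
    simp [index]
  rw [this, Int.gcd_mul_left, h1]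
  simp

theorem wedge_nsmul_left (j : ℕ) (u m : ℤ × ℤ) : wedge (j • u) m = j * wedge u m := by
  simp [wedge]; ring

variable [CharZero 𝕜]

/-- The derivation of the wall belongs to the primitive u, whereas `wallOp` differentiates along v =
j u. The division by the index j in `wallCoeff` compensates for this. -/
theorem sqMap_mul_partialD {g : CRing 𝕜 n} {u ν : ℤ × ℤ} (hu : IsPrimitive u) {ε : ℤ}
    (hν : ∀ m, pairing m ν = ε * wedge u m) (P : Finset (ℤ × ℤ))
    (hg : ∀ (I : Finset E) v, sqMap blk g I v ≠ 0 → I ≠ ∅ ∧ v ∈ P ∧ ∃ j : ℕ, 0 < j ∧ v = j • u)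
    (b : CRing 𝕜 n) : sqMap blk (g * partialD ν b) =
      ((ε : 𝕜) • wallOperator P (wallCoeff blk g)) (sqMap blk b) := by
  ext A m
  rw [sqMap_mul blk g _ P (fun I v h => (hg I v h).2.1), LinearMap.smul_apply, Pi.smul_apply,
    Pi.smul_apply, wallOperator, LinearMap.sum_apply, Finset.sum_apply, Finset.sum_apply,
    Finset.smul_sum]
  have h1 : ∀ I ∈ Finset.univ.erase (∅ : Finset E), (ε : 𝕜) • (∑ v ∈ P, wallCoeff blk g I v •
      wallOp 𝕜 I v) (sqMap blk b) A m = if I ⊆ A then ∑ v ∈ P, sqMap blk g I v *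
        sqMap blk (partialD ν b) (A \ I) (m - v) else 0 := by
    intro I _
    rw [LinearMap.sum_apply, Finset.sum_apply, Finset.sum_apply]
    split_ifs with h
    · rw [Finset.smul_sum]
      refine Finset.sum_congr rfl fun v _ => ?_
      rw [LinearMap.smul_apply, Pi.smul_apply, Pi.smul_apply, wallOp_apply, if_pos h,
        sqMap_partialD, hν, wallCoeff]
      by_cases h0 : sqMap blk g I v = 0
      · simp [h0]
      · obtain ⟨-, -, j, hj, rfl⟩ := hg I v h0
        rw [index_nsmul hu, wedge_nsmul_left]
        have hj' : (j : 𝕜) ≠ 0 := by exact_mod_cast hj.ne'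
        have hw : wedge u (m - j • u) = wedge u m := by
          simp [wedge]; ring
        rw [hw]
        simp only [smul_eq_mul]
        push_cast
        field_simp
    · rw [Finset.sum_eq_zero, smul_zero]
      intro v _
      rw [LinearMap.smul_apply, Pi.smul_apply, Pi.smul_apply, wallOp_apply, if_neg h, smul_zero]
  rw [Finset.sum_congr rfl h1, ← Finset.sum_filter]
  symm
  refine Finset.sum_subset (fun I hI => ?_) fun I hI hI' => ?_
  · exact Finset.mem_powerset.2 (Finset.mem_filter.1 hI).2
  · have hI0 : I = ∅ := by
      by_contra h
      exact hI' (Finset.mem_filter.2 ⟨Finset.mem_erase.2 ⟨h, Finset.mem_univ _⟩,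
        Finset.mem_powerset.1 hI⟩)
    refine Finset.sum_eq_zero fun v _ => ?_
    have : sqMap blk g I v = 0 := by
      by_contra h
      exact (hg I v h).1 hI0
    rw [this, zero_mul]

theorem wallOperator_mem (P : Finset (ℤ × ℤ)) (c : Finset E → ℤ × ℤ → 𝕜) :
    wallOperator P c ∈ loweringFiltration E 𝕜 1 :=
  Submodule.sum_mem _ fun _ hI => Submodule.sum_mem _ fun _ _ =>
    smul_mem_loweringFiltration _ (wallOp_mem
      (Finset.card_pos.2 (Finset.nonempty_iff_ne_empty.2 (Finset.ne_of_mem_erase hI))) _)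

/-- Each application of the operator removes a label. At A, powers beyond |A| contribute nothing, so
the truncation in `expD` agrees with the exponential of the nilpotent operator. -/
theorem sqMap_expD {g : CRing 𝕜 n} {u ν : ℤ × ℤ} (hu : IsPrimitive u) {ε : ℤ}
    (hν : ∀ m, pairing m ν = ε * wedge u m) (P : Finset (ℤ × ℤ))
    (hg : ∀ (I : Finset E) v, sqMap blk g I v ≠ 0 → I ≠ ∅ ∧ v ∈ P ∧ ∃ j : ℕ, 0 < j ∧ v = j • u)
    (b : CRing 𝕜 n) : sqMap blk (expD g ν b) =
      IsNilpotent.exp ((ε : 𝕜) • wallOperator P (wallCoeff blk g)) (sqMap blk b) := by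
  set Z := (ε : 𝕜) • wallOperator P (wallCoeff (E := E) blk g) with hZ
  have hF := isNilFiltration (E := E) (𝕜 := 𝕜)
  have hZ1 : Z ∈ loweringFiltration E 𝕜 1 :=
    smul_mem_loweringFiltration _ (wallOperator_mem _ _)
  have hpow : ∀ i, sqMap blk ((fun b : CRing 𝕜 n => g * partialD ν b)^[i] b) =
      (Z ^ i) (sqMap blk b) := by
    intro i
    induction i with
    | zero => rfl
    | succ i ih =>
      rw [Function.iterate_succ_apply', sqMap_mul_partialD blk hu hν P hg, ih, pow_succ']
      rfl
  have hvan : ∀ (A : Finset E) i, A.card < i → (Z ^ i) (sqMap blk b) A = 0 := by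
    intro A i hi
    exact hF.pow_mem hZ1 i A _ fun B _ h => by omega
  obtain ⟨M, hM⟩ := hF.isNilpotent hZ1
  ext A m
  have hM' : Z ^ (max M (A.card + 1)) = 0 := pow_eq_zero_of_le (le_max_left _ _) hM
  rw [IsNilpotent.exp_eq_sum hM', LinearMap.sum_apply, Finset.sum_apply, Finset.sum_apply]
  have h1 : sqMap blk (expD g ν b) A m = ∑ i ∈ Finset.range (A.card + 1),
      ((Nat.factorial i : 𝕜)⁻¹) * (Z ^ i) (sqMap blk b) A m := by
    have h2 : coef (blockDeg blk A) m (expD g ν b) =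
        ∑ i ∈ Finset.range ((blockDeg blk A).degree + 1), ((Nat.factorial i : 𝕜)⁻¹) *
          coef (blockDeg blk A) m ((fun b : CRing 𝕜 n => g * partialD ν b)^[i] b) := by
      change AddMonoidAlgebra.coeff (∑ i ∈ Finset.range ((blockDeg blk A).degree + 1),
        ((Nat.factorial i : 𝕜)⁻¹) • MvPowerSeries.coeff (blockDeg blk A)
          ((fun b : CRing 𝕜 n => g * partialD ν b)^[i] b)) m = _
      rw [AddMonoidAlgebra.coeff_sum, Finsupp.finsetSum_apply]
      rfl
    rw [sqMap_apply, h2, degree_blockDeg, Finset.mul_sum]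
    refine Finset.sum_congr rfl fun i _ => ?_
    rw [← hpow, sqMap_apply]
    ring
  rw [h1]
  refine (Finset.sum_subset (Finset.range_subset_range.2 (le_max_right M _)) fun i _ hi => ?_).trans
    (Finset.sum_congr rfl fun i _ => ?_)
  · rw [hvan A i (by simpa using hi)]
    simp
  · rw [LinearMap.smul_apply, Pi.smul_apply, Pi.smul_apply, Rat.smul_def]
    push_cast
    rfl

end Squarefree

/-! ### Large circles -/

section Circle

/-- A circle around the origin, starting at a point of irrational slope. -/
def bigCircle (ρ t : ℝ) : ℝ × ℝ :=
  ρ • (Real.sin (2 * Real.pi * t) • (√2, -1) - Real.cos (2 * Real.pi * t) • (1, √2))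

variable {ρ t t' : ℝ}

theorem bigCircle_fst : (bigCircle ρ t).1 =
    ρ * (Real.sin (2 * Real.pi * t) * √2 - Real.cos (2 * Real.pi * t)) := by
  simp [bigCircle]

theorem bigCircle_snd : (bigCircle ρ t).2 =
    ρ * (-Real.sin (2 * Real.pi * t) - Real.cos (2 * Real.pi * t) * √2) := by
  simp [bigCircle]

theorem alpha_bigCircle : alpha (bigCircle ρ t) = 3 * ρ * Real.sin (2 * Real.pi * t) := by
  have h := Real.mul_self_sqrt (show (0 : ℝ) ≤ 2 by norm_num)
  rw [alpha, bigCircle_fst, bigCircle_snd]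
  linear_combination ρ * Real.sin (2 * Real.pi * t) * h

theorem beta_bigCircle : beta (bigCircle ρ t) = -(3 * ρ * Real.cos (2 * Real.pi * t)) := by
  have h := Real.mul_self_sqrt (show (0 : ℝ) ≤ 2 by norm_num)
  rw [beta, bigCircle_fst, bigCircle_snd]
  linear_combination -ρ * Real.cos (2 * Real.pi * t) * h

theorem alpha_sq_add_beta_sq (x : ℝ × ℝ) :
    alpha x ^ 2 + beta x ^ 2 = 3 * (x.1 ^ 2 + x.2 ^ 2) := by
  have h := Real.mul_self_sqrt (show (0 : ℝ) ≤ 2 by norm_num)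
  rw [alpha, beta]
  linear_combination (x.1 ^ 2 + x.2 ^ 2) * h

theorem ext_alpha_beta {x y : ℝ × ℝ} (h : alpha x = alpha y) (h' : beta x = beta y) : x = y := by
  have h2 := Real.mul_self_sqrt (show (0 : ℝ) ≤ 2 by norm_num)
  rw [alpha, alpha] at h
  rw [beta, beta] at h'
  refine Prod.ext ?_ ?_
  · linear_combination (√2 * h + h') / 3 - (x.1 - y.1) / 3 * h2
  · linear_combination (√2 * h' - h) / 3 - (x.2 - y.2) / 3 * h2

theorem norm_bigCircle : (bigCircle ρ t).1 ^ 2 + (bigCircle ρ t).2 ^ 2 = 3 * ρ ^ 2 := by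
  have h := alpha_sq_add_beta_sq (bigCircle ρ t)
  rw [alpha_bigCircle, beta_bigCircle] at h
  have := Real.sin_sq_add_cos_sq (2 * Real.pi * t)
  linear_combination (-1/3) * h + 3 * ρ ^ 2 * this

theorem hasDerivAt_bigCircle (ρ t : ℝ) : HasDerivAt (bigCircle ρ)
    ((2 * Real.pi) • (-(bigCircle ρ t).2, (bigCircle ρ t).1)) t := by
  have h0 : HasDerivAt (fun t : ℝ => 2 * Real.pi * t) (2 * Real.pi) t := by
    simpa using (hasDerivAt_id t).const_mul (2 * Real.pi)
  have h1 := ((h0.sin.smul_const ((√2, -1) : ℝ × ℝ)).sub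
    (h0.cos.smul_const ((1, √2) : ℝ × ℝ))).const_smul ρ
  refine HasDerivAt.congr_deriv (f := bigCircle ρ) h1 ?_
  refine Prod.ext ?_ ?_
  · simp [bigCircle]; ring
  · simp [bigCircle]; ring

theorem contDiff_bigCircle (ρ : ℝ) : ContDiff ℝ ∞ (bigCircle ρ) := by
  unfold bigCircle
  fun_prop

theorem velocity_bigCircle (ht : t ∈ Set.Icc (0 : ℝ) 1) : velocity (bigCircle ρ) t =
    (2 * Real.pi) • (-(bigCircle ρ t).2, (bigCircle ρ t).1) :=
  (hasDerivAt_bigCircle ρ t).hasDerivWithinAt.derivWithin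
    (uniqueDiffOn_Icc (by norm_num) t ht)

theorem wedgeR_velocity (ht : t ∈ Set.Icc (0 : ℝ) 1) (u : ℝ × ℝ) :
    wedgeR u (velocity (bigCircle ρ) t) =
      2 * Real.pi * (u.1 * (bigCircle ρ t).1 + u.2 * (bigCircle ρ t).2) := by
  rw [velocity_bigCircle ht]
  simp [wedgeR]
  ring

theorem bigCircle_zero : bigCircle ρ 0 = (-ρ) • (1, √2) := by
  simp [bigCircle]

theorem bigCircle_one : bigCircle ρ 1 = bigCircle ρ 0 := by
  simp [bigCircle]

/-- The half with positive alpha is parametrized through the arc cosine of the normalized value of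
-beta; the other half is its antipode. -/
theorem exists_bigCircle_eq (hρ : 0 < ρ) {x : ℝ × ℝ} (hx : x.1 ^ 2 + x.2 ^ 2 = 3 * ρ ^ 2)
    (ha : alpha x ≠ 0) : ∃ t ∈ Set.Ioo (0 : ℝ) 1, bigCircle ρ t = x := by
  have pi := Real.pi_pos
  have pos : ∀ x : ℝ × ℝ, x.1 ^ 2 + x.2 ^ 2 = 3 * ρ ^ 2 → 0 < alpha x →
      ∃ t ∈ Set.Ioo (0 : ℝ) (1 / 2), bigCircle ρ t = x := by
    intro x hx ha
    have h1 := alpha_sq_add_beta_sq x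
    rw [hx] at h1
    set y := -beta x / (3 * ρ) with hy
    have hy1 : (1 : ℝ) - y ^ 2 = (alpha x / (3 * ρ)) ^ 2 := by
      rw [hy]; field_simp; linarith
    have hy2 : y ^ 2 < 1 := by
      have : 0 < (alpha x / (3 * ρ)) ^ 2 := by positivity
      linarith
    obtain ⟨hy3, hy4⟩ := abs_lt.1 ((sq_lt_one_iff_abs_lt_one y).1 hy2)
    have e : 2 * Real.pi * (Real.arccos y / (2 * Real.pi)) = Real.arccos y := by field_simp
    have hpos : 0 < Real.arccos y := Real.arccos_pos.2 hy4
    have hlt : Real.arccos y < Real.pi := by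
      refine lt_of_le_of_ne (Real.arccos_le_pi y) fun h => ?_
      rw [Real.arccos_eq_pi] at h
      linarith
    refine ⟨Real.arccos y / (2 * Real.pi), ⟨by positivity, ?_⟩, ext_alpha_beta ?_ ?_⟩
    · rw [div_lt_div_iff₀ (by positivity) (by norm_num)]
      linarith
    · rw [alpha_bigCircle, e, Real.sin_arccos, hy1, Real.sqrt_sq (by positivity)]
      field_simp
    · rw [beta_bigCircle, e, Real.cos_arccos hy3.le hy4.le, hy]
      field_simp
  rcases lt_or_gt_of_ne ha with h | h
  · obtain ⟨t, ht, h1⟩ := pos (-x) (by simpa using hx) (by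
      simp only [alpha, Prod.fst_neg, Prod.snd_neg] at h ⊢
      linarith)
    refine ⟨t + 1 / 2, ⟨by linarith [ht.1], by linarith [ht.2]⟩, ?_⟩
    have h2 : bigCircle ρ (t + 1 / 2) = -bigCircle ρ t := by
      have : 2 * Real.pi * (t + 1 / 2) = 2 * Real.pi * t + Real.pi := by ring
      rw [bigCircle, bigCircle, this, Real.sin_add_pi, Real.cos_add_pi, ← smul_neg]
      congr 1
      module
    rw [h2, h1, neg_neg]
  · obtain ⟨t, ht, h1⟩ := pos x hx h
    exact ⟨t, ⟨ht.1, by linarith [ht.2]⟩, h1⟩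

theorem alpha_bigCircle_pos_iff (hρ : 0 < ρ) (ht : t ∈ Set.Ioo (0 : ℝ) 1)
    (ha : alpha (bigCircle ρ t) ≠ 0) : 0 < alpha (bigCircle ρ t) ↔ t < 1 / 2 := by
  have pi := Real.pi_pos
  constructor
  · intro h
    by_contra h'
    have h1 : Real.sin (2 * Real.pi * t) ≤ 0 := by
      have : Real.sin (2 * Real.pi * t) = -Real.sin (2 * Real.pi * t - Real.pi) := by
        rw [Real.sin_sub_pi, neg_neg]
      rw [this, neg_nonpos]
      refine Real.sin_nonneg_of_nonneg_of_le_pi ?_ ?_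
      · nlinarith
      · nlinarith [ht.2]
    rw [alpha_bigCircle] at h
    nlinarith
  · intro h
    refine lt_of_le_of_ne ?_ ha.symm
    rw [alpha_bigCircle]
    have := Real.sin_nonneg_of_nonneg_of_le_pi (x := 2 * Real.pi * t) (by nlinarith [ht.1])
      (by nlinarith)
    positivity

/-- The slope at time t is -cot(2πt). Points with the same sign of alpha lie on the same open half
of the circle, where this function increases. -/
theorem slope_bigCircle_lt (hρ : 0 < ρ) (ht : t ∈ Set.Ioo (0 : ℝ) 1)
    (ht' : t' ∈ Set.Ioo (0 : ℝ) 1) (h : 0 < alpha (bigCircle ρ t) * alpha (bigCircle ρ t'))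
    (htt : t < t') : slope (bigCircle ρ t) < slope (bigCircle ρ t') := by
  have pi := Real.pi_pos
  have ha : alpha (bigCircle ρ t) ≠ 0 := left_ne_zero_of_mul h.ne'
  have ha' : alpha (bigCircle ρ t') ≠ 0 := right_ne_zero_of_mul h.ne'
  have h1 := alpha_bigCircle_pos_iff hρ ht ha
  have h2 := alpha_bigCircle_pos_iff hρ ht' ha'
  have hd : t' - t < 1 / 2 := by
    by_cases h3 : t' < 1 / 2
    · linarith [ht.1]
    · have : ¬ t < 1 / 2 := by
        intro h4
        have h5 := h1.2 h4
        exact h3 (h2.1 ((mul_pos_iff_of_pos_left h5).1 h))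
      linarith [ht'.2]
  have hs : 0 < Real.sin (2 * Real.pi * t' - 2 * Real.pi * t) := by
    refine Real.sin_pos_of_pos_of_lt_pi ?_ ?_ <;> nlinarith
  rw [Real.sin_sub] at hs
  rw [slope, slope, ← sub_pos, div_sub_div _ _ ha' ha]
  refine div_pos ?_ (by linarith [mul_comm (alpha (bigCircle ρ t)) (alpha (bigCircle ρ t'))])
  rw [alpha_bigCircle, alpha_bigCircle, beta_bigCircle, beta_bigCircle]
  have : 0 < 9 * ρ ^ 2 := by positivity
  nlinarith

end Circle

/-! ### Walls far from the origin -/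

section Far

theorem exists_far (b : ℝ × ℝ) {u : ℤ × ℤ} (hu : u ≠ 0) {δ : ℝ} (hδ : 0 < δ) :
    ∃ M : ℝ, 0 < M ∧ ∀ s : ℝ, M ≤ |s| →
      0 < s * (alpha (toPlane u) * alpha (b + s • toPlane u)) ∧
      |slope (b + s • toPlane u) - slope (toPlane u)| < δ ∧
      0 < s * ((toPlane u).1 * (b + s • toPlane u).1 + (toPlane u).2 * (b + s • toPlane u).2) := by
  have ha := alpha_toPlane_ne_zero hu
  set a := alpha (toPlane u)
  set p := toPlane u with hp
  have hA : 0 < p.1 ^ 2 + p.2 ^ 2 := by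
    have := alpha_sq_add_beta_sq p
    have h2 : 0 < a ^ 2 := by positivity
    nlinarith [sq_nonneg (beta p)]
  set A := p.1 ^ 2 + p.2 ^ 2
  set B := p.1 * b.1 + p.2 * b.2 with hB
  set C := a * beta b - beta p * alpha b with hC
  have ha2 : 0 < a ^ 2 := by positivity
  -- The three quotients dominate, in this order, the constant part of alpha along the line, the
  -- deviation of the slope by δ, and the constant part of the scalar product.
  refine ⟨1 + |a * alpha b| / a ^ 2 + |C| / δ / a ^ 2 + |B| / A, by positivity, fun s hs => ?_⟩
  have t1 : 0 ≤ |a * alpha b| / a ^ 2 := by positivity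
  have t2 : 0 ≤ |C| / δ / a ^ 2 := by positivity
  have t3 : 0 ≤ |B| / A := by positivity
  have hs0 : 0 < |s| := by linarith
  have hss : |s| * |s| = s * s := abs_mul_abs_self s
  have k1 : |a * alpha b| + |C| / δ < |s| * a ^ 2 := by
    have : |a * alpha b| / a ^ 2 + |C| / δ / a ^ 2 < |s| := by linarith
    rwa [← add_div, div_lt_iff₀ ha2] at this
  have k2 : |B| < |s| * A := by
    have : |B| / A < |s| := by linarith
    rwa [div_lt_iff₀ hA] at this
  have hCd : 0 ≤ |C| / δ := by positivity
  have al : alpha (b + s • p) = alpha b + s * a := by rw [alpha_add, alpha_smul]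
  have be : beta (b + s • p) = beta b + s * beta p := by rw [beta_add, beta_smul]
  have j1 : 0 < s * (a * alpha (b + s • p)) := by
    rw [al]
    have : |s * (a * alpha b)| ≤ |s| * |a * alpha b| := by rw [abs_mul]
    have h3 := neg_abs_le (s * (a * alpha b))
    have h4 : |s| * |a * alpha b| < |s| * (|s| * a ^ 2) := by
      refine mul_lt_mul_of_pos_left ?_ hs0
      linarith
    have h5 : |s| * (|s| * a ^ 2) = s * s * a ^ 2 := by rw [← mul_assoc, hss]
    nlinarith
  refine ⟨j1, ?_, ?_⟩
  · have hne : alpha (b + s • p) ≠ 0 := right_ne_zero_of_mul (right_ne_zero_of_mul j1.ne')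
    have e : slope (b + s • p) - slope p = C / (a * alpha (b + s • p)) := by
      rw [slope, slope]
      change _ / _ - beta p / a = _
      rw [div_sub_div _ _ hne ha, be, al, hC]
      rw [al] at hne
      field_simp
      ring
    rw [e, abs_div, div_lt_iff₀ (abs_pos.2 (mul_ne_zero ha hne))]
    have h6 : |s| * a ^ 2 - |a * alpha b| ≤ |a * alpha (b + s • p)| := by
      rw [al]
      have h7 : |s * a ^ 2| - |a * alpha b| ≤ |s * a ^ 2 + a * alpha b| := by
        have := abs_sub_abs_le_abs_sub (s * a ^ 2) (-(a * alpha b))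
        rwa [abs_neg, sub_neg_eq_add] at this
      rw [abs_mul, abs_of_pos ha2] at h7
      refine h7.trans (le_of_eq ?_)
      congr 1
      ring
    have h8 : |C| / δ < |a * alpha (b + s • p)| := by linarith
    rw [div_lt_iff₀ hδ] at h8
    linarith
  · have e : s * (p.1 * (b + s • p).1 + p.2 * (b + s • p).2) = s * B + s * s * A := by
      simp only [Prod.fst_add, Prod.snd_add, Prod.smul_fst, Prod.smul_snd, smul_eq_mul, hB]
      ring
    rw [e]
    have h3 := neg_abs_le (s * B)
    rw [abs_mul] at h3
    have h4 : |s| * |B| < |s| * (|s| * A) := mul_lt_mul_of_pos_left k2 hs0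
    have h5 : |s| * (|s| * A) = s * s * A := by rw [← mul_assoc, hss]
    linarith

/-- Points with parameter |s| < M stay in a bounded region, so a large circle meets the line only at
large parameters, and it encloses the base point. -/
theorem exists_radius_bound (b p : ℝ × ℝ) (M : ℝ) : ∃ ρ₀ : ℝ, 0 < ρ₀ ∧ ∀ ρ, ρ₀ ≤ ρ →
    b.1 ^ 2 + b.2 ^ 2 < 3 * ρ ^ 2 ∧ ∀ s : ℝ,
      (b + s • p).1 ^ 2 + (b + s • p).2 ^ 2 = 3 * ρ ^ 2 → M ≤ |s| := by
  set c : ℝ := 2 * (b.1 ^ 2 + b.2 ^ 2) + 2 * M ^ 2 * (p.1 ^ 2 + p.2 ^ 2)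
  have hc : 0 ≤ c := by positivity
  refine ⟨1 + c, by linarith, fun ρ hρ => ?_⟩
  have h1 : c < 3 * ρ ^ 2 := by nlinarith
  have h0 : 0 ≤ 2 * M ^ 2 * (p.1 ^ 2 + p.2 ^ 2) := by positivity
  refine ⟨?_, fun s hs => ?_⟩
  · have : 0 ≤ b.1 ^ 2 + b.2 ^ 2 := by positivity
    change 2 * (b.1 ^ 2 + b.2 ^ 2) + 2 * M ^ 2 * (p.1 ^ 2 + p.2 ^ 2) < _ at h1
    linarith
  · by_contra h
    have h2 : s ^ 2 ≤ M ^ 2 := by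
      have := not_le.1 h
      rw [← sq_abs s]
      exact pow_le_pow_left₀ (abs_nonneg s) this.le 2
    simp only [Prod.fst_add, Prod.snd_add, Prod.smul_fst, Prod.smul_snd, smul_eq_mul] at hs
    have h3 : s ^ 2 * (p.1 ^ 2 + p.2 ^ 2) ≤ M ^ 2 * (p.1 ^ 2 + p.2 ^ 2) :=
      mul_le_mul_of_nonneg_right h2 (by positivity)
    have h4 : 3 * ρ ^ 2 ≤ c := by
      rw [← hs]
      change _ ≤ 2 * (b.1 ^ 2 + b.2 ^ 2) + 2 * M ^ 2 * (p.1 ^ 2 + p.2 ^ 2)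
      nlinarith [sq_nonneg (b.1 - s * p.1), sq_nonneg (b.2 - s * p.2)]
    linarith

/-- For a base point inside the circle the quadratic equation for s has a negative constant term,
hence roots of opposite signs. -/
theorem existsUnique_pos_root {b p : ℝ × ℝ} {ρ : ℝ} (hp : 0 < p.1 ^ 2 + p.2 ^ 2)
    (h : b.1 ^ 2 + b.2 ^ 2 < 3 * ρ ^ 2) :
    ∃ s : ℝ, 0 < s ∧ (b + s • p).1 ^ 2 + (b + s • p).2 ^ 2 = 3 * ρ ^ 2 ∧
      ∀ s', 0 < s' → (b + s' • p).1 ^ 2 + (b + s' • p).2 ^ 2 = 3 * ρ ^ 2 → s' = s := by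
  set A := p.1 ^ 2 + p.2 ^ 2 with hA
  set B := p.1 * b.1 + p.2 * b.2 with hB
  set C := b.1 ^ 2 + b.2 ^ 2 - 3 * ρ ^ 2 with hC
  have hC0 : C < 0 := by linarith
  have key : ∀ s : ℝ, (b + s • p).1 ^ 2 + (b + s • p).2 ^ 2 = 3 * ρ ^ 2 ↔
      A * s ^ 2 + 2 * B * s + C = 0 := by
    intro s
    simp only [Prod.fst_add, Prod.snd_add, Prod.smul_fst, Prod.smul_snd, smul_eq_mul]
    constructor
    · intro h; rw [hA, hB, hC]; linarith
    · intro h; rw [hA, hB, hC] at h; linarith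
  simp only [key]
  have hAC : A * C < 0 := mul_neg_of_pos_of_neg hp hC0
  have hD : 0 ≤ B ^ 2 - A * C := by nlinarith [sq_nonneg B]
  have hsq := Real.sq_sqrt hD
  set R := √(B ^ 2 - A * C)
  have hR : B < R := by
    by_contra h'
    have := Real.sqrt_nonneg (B ^ 2 - A * C)
    have h2 : R ^ 2 ≤ B ^ 2 := pow_le_pow_left₀ this (not_lt.1 h') 2
    linarith
  refine ⟨(R - B) / A, div_pos (by linarith) hp, ?_, fun s' hs' h' => ?_⟩
  · field_simp
    nlinarith
  · by_contra hne
    have h1 : A * ((R - B) / A) = R - B := by field_simp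
    have hs : 0 < (R - B) / A := div_pos (by linarith) hp
    set s := (R - B) / A
    have h2 : A * s ^ 2 + 2 * B * s + C = 0 := by
      have : A * (A * s ^ 2 + 2 * B * s + C) = 0 := by
        linear_combination (A * s + R + B) * h1 + hsq
      exact (mul_eq_zero.1 this).resolve_left hp.ne'
    have h3 : (s' - s) * (A * (s' + s) + 2 * B) = 0 := by linear_combination h' - h2
    have h4 := (mul_eq_zero.1 h3).resolve_left (sub_ne_zero.2 hne)
    have h5 : A * (s * s') = C := by linear_combination s * h4 - h2
    have : 0 < A * (s * s') := by positivity
    linarith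

end Far

/-! ### Crossings of a large circle -/

section Crossings

variable {𝕜 : Type*} [Field 𝕜] {n : ℕ}

theorem IsPrimitive.ne_zero {u : ℤ × ℤ} (hu : IsPrimitive u) : u ≠ 0 := by
  rintro rfl
  simp [IsPrimitive, index] at hu

theorem Wall.dir_ne_zero (d : Wall 𝕜 n) : d.dir ≠ 0 := d.dir_primitive.ne_zero

theorem toPlane_norm_pos {u : ℤ × ℤ} (hu : u ≠ 0) :
    0 < (toPlane u).1 ^ 2 + (toPlane u).2 ^ 2 := by
  have h1 := alpha_sq_add_beta_sq (toPlane u)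
  have h2 : 0 < alpha (toPlane u) ^ 2 := by
    have := alpha_toPlane_ne_zero hu
    positivity
  nlinarith [sq_nonneg (beta (toPlane u))]

/-- The circle of radius `√3 ρ` crosses the walls in `F` far enough from the origin. -/
structure IsGoodRadius (F : Finset (Wall 𝕜 n)) (ρ : ℝ) : Prop where
  pos : 0 < ρ
  alpha_ne : ∀ d ∈ F, ∀ t ∈ Set.Ioo (0 : ℝ) 1, bigCircle ρ t ∈ d.support →
    alpha (bigCircle ρ t) ≠ 0
  alpha_mul_pos : ∀ d ∈ F, d.isRay = true → ∀ t ∈ Set.Ioo (0 : ℝ) 1,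
    bigCircle ρ t ∈ d.support → 0 < alpha (toPlane d.dir) * alpha (bigCircle ρ t)
  wedge_pos_iff : ∀ d ∈ F, ∀ t ∈ Set.Ioo (0 : ℝ) 1, bigCircle ρ t ∈ d.support →
    (0 < wedgeR (toPlane d.dir) (velocity (bigCircle ρ) t) ↔
      0 < alpha (toPlane d.dir) * alpha (bigCircle ρ t))
  exists_unique : ∀ d ∈ F, ∀ side : Bool,
    (d.isRay = true → decide (0 < alpha (toPlane d.dir)) = side) →
    ∃ t ∈ Set.Ioo (0 : ℝ) 1, bigCircle ρ t ∈ d.support ∧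
      decide (0 < alpha (bigCircle ρ t)) = side ∧ ∀ t' ∈ Set.Ioo (0 : ℝ) 1,
        bigCircle ρ t' ∈ d.support → decide (0 < alpha (bigCircle ρ t')) = side → t' = t
  slope_le : ∀ d ∈ F, ∀ d' ∈ F, ∀ t ∈ Set.Ioo (0 : ℝ) 1, ∀ t' ∈ Set.Ioo (0 : ℝ) 1,
    bigCircle ρ t ∈ d.support → bigCircle ρ t' ∈ d'.support → t ≤ t' →
    0 < alpha (bigCircle ρ t) * alpha (bigCircle ρ t') →
    slope (toPlane d.dir) ≤ slope (toPlane d'.dir)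

theorem exists_slope_gap (F : Finset (Wall 𝕜 n)) : ∃ δ : ℝ, 0 < δ ∧ ∀ d ∈ F, ∀ d' ∈ F,
    slope (toPlane d.dir) < slope (toPlane d'.dir) →
    slope (toPlane d.dir) + 2 * δ ≤ slope (toPlane d'.dir) := by
  have h : ∀ᶠ δ : ℝ in nhdsWithin 0 (Set.Ioi 0), ∀ d ∈ F, ∀ d' ∈ F,
      slope (toPlane d.dir) < slope (toPlane d'.dir) →
      slope (toPlane d.dir) + 2 * δ ≤ slope (toPlane d'.dir) := by
    rw [Filter.eventually_all_finset]
    intro d _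
    rw [Filter.eventually_all_finset]
    intro d' _
    by_cases hlt : slope (toPlane d.dir) < slope (toPlane d'.dir)
    · filter_upwards [Ioo_mem_nhdsGT (show (0 : ℝ) <
        (slope (toPlane d'.dir) - slope (toPlane d.dir)) / 2 by linarith)] with δ hδ _
      linarith [hδ.2]
    · exact Filter.Eventually.of_forall fun δ h => absurd h hlt
  obtain ⟨δ, h1, h2⟩ := (h.and self_mem_nhdsWithin).exists
  exact ⟨δ, h2, h1⟩

/-- Far out, a point of a wall has nearly the direction of the wall or its negative. Orientation,
side and the order of the slopes can therefore be read off from the direction, once the slopes are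
approximated to within half their smallest gap. -/
theorem eventually_isGoodRadius (F : Finset (Wall 𝕜 n)) :
    ∀ᶠ ρ in Filter.atTop, IsGoodRadius F ρ := by
  obtain ⟨δ, hδ, hgap⟩ := exists_slope_gap F
  have hfar : ∀ᶠ ρ : ℝ in Filter.atTop, ∀ d ∈ F, d.base.1 ^ 2 + d.base.2 ^ 2 < 3 * ρ ^ 2 ∧
      ∀ s : ℝ, (d.base + s • toPlane d.dir).1 ^ 2 + (d.base + s • toPlane d.dir).2 ^ 2 =
        3 * ρ ^ 2 →
      0 < s * (alpha (toPlane d.dir) * alpha (d.base + s • toPlane d.dir)) ∧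
      |slope (d.base + s • toPlane d.dir) - slope (toPlane d.dir)| < δ ∧
      0 < s * ((toPlane d.dir).1 * (d.base + s • toPlane d.dir).1 +
        (toPlane d.dir).2 * (d.base + s • toPlane d.dir).2) := by
    rw [Filter.eventually_all_finset]
    intro d _
    obtain ⟨M, hM, h1⟩ := exists_far d.base d.dir_ne_zero hδ
    obtain ⟨ρ₀, hρ₀, h2⟩ := exists_radius_bound d.base (toPlane d.dir) M
    filter_upwards [Filter.eventually_ge_atTop ρ₀] with ρ hρ
    exact ⟨(h2 ρ hρ).1, fun s hs => h1 s ((h2 ρ hρ).2 s hs)⟩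
  filter_upwards [hfar, Filter.eventually_gt_atTop 0] with ρ hρ hpos
  have hon : ∀ {d : Wall 𝕜 n} {t : ℝ}, d ∈ F → bigCircle ρ t ∈ d.support → ∃ s : ℝ,
      (d.isRay = true → 0 ≤ s) ∧ bigCircle ρ t = d.base + s • toPlane d.dir ∧
      0 < s * (alpha (toPlane d.dir) * alpha (bigCircle ρ t)) ∧
      |slope (bigCircle ρ t) - slope (toPlane d.dir)| < δ ∧
      0 < s * ((toPlane d.dir).1 * (bigCircle ρ t).1 + (toPlane d.dir).2 * (bigCircle ρ t).2) := by
    rintro d t hd ⟨s, hs, h⟩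
    have := (hρ d hd).2 s (by rw [← h]; exact norm_bigCircle)
    rw [← h] at this
    exact ⟨s, hs, h, this⟩
  refine ⟨hpos, ?_, ?_, ?_, ?_, ?_⟩
  · intro d hd t _ h
    obtain ⟨s, -, -, h1, -⟩ := hon hd h
    exact right_ne_zero_of_mul (right_ne_zero_of_mul h1.ne')
  · intro d hd hr t _ h
    obtain ⟨s, hs, -, h1, -⟩ := hon hd h
    exact pos_of_mul_pos_right h1 (hs hr)
  · intro d hd t ht h
    obtain ⟨s, hs, -, h1, -, h2⟩ := hon hd h
    have pi := Real.pi_pos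
    rw [wedgeR_velocity (Set.Ioo_subset_Icc_self ht), mul_pos_iff_of_pos_left (by positivity)]
    rcases mul_pos_iff.1 h1 with ⟨h3, h4⟩ | ⟨h3, h4⟩
    · exact ⟨fun _ => h4, fun _ => (mul_pos_iff_of_pos_left h3).1 h2⟩
    · refine ⟨fun h5 => ?_, fun h5 => absurd h5 (not_lt.2 h4.le)⟩
      exact absurd h2 (not_lt.2 (mul_neg_of_neg_of_pos h3 h5).le)
  · intro d hd side hside
    obtain ⟨hb, hs⟩ := hρ d hd
    have ha := alpha_toPlane_ne_zero d.dir_ne_zero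
    have hp := toPlane_norm_pos d.dir_ne_zero
    have fin : ∀ s : ℝ, (d.isRay = true → 0 ≤ s) → (d.base + s • toPlane d.dir).1 ^ 2 +
        (d.base + s • toPlane d.dir).2 ^ 2 = 3 * ρ ^ 2 →
        decide (0 < s * alpha (toPlane d.dir)) = side →
        (∀ s', 0 < s' * s → (d.base + s' • toPlane d.dir).1 ^ 2 +
        (d.base + s' • toPlane d.dir).2 ^ 2 = 3 * ρ ^ 2 → s' = s) →
        ∃ t ∈ Set.Ioo (0 : ℝ) 1, bigCircle ρ t ∈ d.support ∧
        decide (0 < alpha (bigCircle ρ t)) = side ∧ ∀ t' ∈ Set.Ioo (0 : ℝ) 1,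
        bigCircle ρ t' ∈ d.support → decide (0 < alpha (bigCircle ρ t')) = side → t' = t := by
      intro s hs0 hsn hsd huniq
      have h1 := (hs s hsn).1
      have hne : alpha (d.base + s • toPlane d.dir) ≠ 0 :=
        right_ne_zero_of_mul (right_ne_zero_of_mul h1.ne')
      have same : ∀ s : ℝ, 0 < s * (alpha (toPlane d.dir) * alpha (d.base + s • toPlane d.dir)) →
          (0 < alpha (d.base + s • toPlane d.dir) ↔ 0 < s * alpha (toPlane d.dir)) := by
        intro s h
        rw [← mul_assoc] at h
        constructor
        · exact fun h' => (pos_iff_pos_of_mul_pos h).2 h'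
        · exact fun h' => (pos_iff_pos_of_mul_pos h).1 h'
      obtain ⟨t, ht, h2⟩ := exists_bigCircle_eq hpos hsn hne
      have hside : decide (0 < alpha (bigCircle ρ t)) = side := by
        rw [h2, ← hsd]
        exact decide_eq_decide.2 (same s h1)
      refine ⟨t, ht, ⟨s, hs0, h2⟩, hside, ?_⟩
      rintro t' ht' ⟨s', hs', h3⟩ hside'
      have hsn' : (d.base + s' • toPlane d.dir).1 ^ 2 +
        (d.base + s' • toPlane d.dir).2 ^ 2 = 3 * ρ ^ 2 := by rw [← h3]; exact norm_bigCircle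
      have h4 := (hs s' hsn').1
      have h5 : 0 < s' * s := by
        rw [h3, ← hsd] at hside'
        have h6 := (same s' h4).symm.trans (decide_eq_decide.1 hside')
        have h7 : s' * alpha (toPlane d.dir) ≠ 0 :=
          mul_ne_zero (left_ne_zero_of_mul h4.ne') ha
        have h8 : s * alpha (toPlane d.dir) ≠ 0 :=
          mul_ne_zero (left_ne_zero_of_mul h1.ne') ha
        have h9 : 0 < (s' * alpha (toPlane d.dir)) * (s * alpha (toPlane d.dir)) := by
          by_cases h : 0 < s' * alpha (toPlane d.dir)
          · exact mul_pos h (h6.1 h)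
          · exact mul_pos_of_neg_of_neg (lt_of_le_of_ne (not_lt.1 h) h7)
              (lt_of_le_of_ne (not_lt.1 fun h' => h (h6.2 h')) h8)
        have h10 : (s' * alpha (toPlane d.dir)) * (s * alpha (toPlane d.dir)) =
          (s' * s) * alpha (toPlane d.dir) ^ 2 := by ring
        rw [h10] at h9
        exact pos_of_mul_pos_left h9 (sq_nonneg _)
      have h6 := huniq s' h5 hsn'
      have h7 : bigCircle ρ t' = bigCircle ρ t := by rw [h3, h2, h6]
      have hne' : alpha (bigCircle ρ t) ≠ 0 := by rw [h2]; exact hne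
      have h8 : 0 < alpha (bigCircle ρ t) * alpha (bigCircle ρ t) := mul_self_pos.2 hne'
      rcases lt_trichotomy t' t with h | h | h
      · have := slope_bigCircle_lt hpos ht' ht (by rw [h7]; exact h8) h
        rw [h7] at this
        exact absurd this (lt_irrefl _)
      · exact h
      · have := slope_bigCircle_lt hpos ht ht' (by rw [h7]; exact h8) h
        rw [h7] at this
        exact absurd this (lt_irrefl _)
    -- On the side to which the wall points, the crossing has a positive parameter; on the other
    -- side, which concerns lines only, it has a negative one.
    by_cases hm : decide (0 < alpha (toPlane d.dir)) = side
    · obtain ⟨s, h1, h2, h3⟩ := existsUnique_pos_root hp hb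
      refine fin s (fun _ => h1.le) h2 ?_ fun s' hs' h4 => h3 s' ?_ h4
      · rw [← hm]; exact decide_eq_decide.2 (mul_pos_iff_of_pos_left h1)
      · exact pos_of_mul_pos_left hs' h1.le
    · have hneg : ∀ s : ℝ, d.base + s • -toPlane d.dir = d.base + (-s) • toPlane d.dir := by
        intro s
        rw [smul_neg, neg_smul]
      obtain ⟨s, h1, h2, h3⟩ := existsUnique_pos_root (p := -toPlane d.dir) (by simpa using hp) hb
      simp only [hneg] at h2 h3
      refine fin (-s) (fun hr => absurd (hside hr) hm) h2 ?_ fun s' hs' h4 => ?_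
      · have : decide (0 < -s * alpha (toPlane d.dir)) = !decide (0 < alpha (toPlane d.dir)) := by
          rcases lt_or_gt_of_ne ha with h | h
          · have h5 := mul_pos_of_neg_of_neg (neg_lt_zero.2 h1) h
            simp only [decide_eq_true h5, decide_eq_false (not_lt.2 h.le), Bool.not_false]
          · have h5 := mul_neg_of_neg_of_pos (neg_lt_zero.2 h1) h
            simp only [decide_eq_false (not_lt.2 h5.le), decide_eq_true h, Bool.not_true]
        rw [this]
        revert hm
        cases decide (0 < alpha (toPlane d.dir)) <;> cases side <;> simp
      · have h5 : 0 < -s' := by nlinarith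
        have := h3 (-s') h5 (by rw [neg_neg]; exact h4)
        linarith
  · intro d hd d' hd' t ht t' ht' h h' htt hal
    by_contra hcon
    have hg := hgap d' hd' d hd (not_le.1 hcon)
    obtain ⟨_, -, -, -, h1, -⟩ := hon hd h
    obtain ⟨_, -, -, -, h2, -⟩ := hon hd' h'
    have h3 : slope (bigCircle ρ t) ≤ slope (bigCircle ρ t') := by
      rcases htt.lt_or_eq with hlt | rfl
      · exact (slope_bigCircle_lt hpos ht ht' hal hlt).le
      · exact le_rfl
    rw [abs_lt] at h1 h2
    linarith [h1.1, h2.2]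

/-! ### Admissible circles -/

theorem countable_of_mul_eq {a : ℝ} (ha : a ≠ 0) (c : ℝ) : {ρ : ℝ | a * ρ = c}.Countable := by
  refine Set.Subsingleton.countable ?_
  intro x hx y hy
  exact mul_left_cancel₀ ha (Eq.trans (show a * x = c from hx) (show a * y = c from hy).symm)

theorem countable_of_mul_sq_eq {a : ℝ} (ha : a ≠ 0) (c : ℝ) :
    {ρ : ℝ | 0 < ρ ∧ a * ρ ^ 2 = c}.Countable := by
  refine Set.Subsingleton.countable ?_
  intro x hx y hy
  have h : x ^ 2 = y ^ 2 := mul_left_cancel₀ ha (hx.2.trans hy.2.symm)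
  exact (pow_left_inj₀ hx.1.le hy.1.le two_ne_zero).1 h

theorem countable_sing {S : Set (Wall 𝕜 n)} (hS : S.Countable) : (Sing S).Countable := by
  have h1 : (Wall.base '' S).Countable := hS.image _
  have h2 : (⋃ d₁ ∈ S, ⋃ d₂ ∈ S, {x | d₁.support ∩ d₂.support = {x}}).Countable := by
    refine hS.biUnion fun d₁ _ => hS.biUnion fun d₂ _ => Set.Subsingleton.countable ?_
    intro x hx y hy
    have : ({x} : Set (ℝ × ℝ)) = {y} := Eq.trans (Eq.symm hx) hy
    simpa using this
  refine (h1.union h2).mono ?_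
  rintro x (⟨d, hd, -, rfl⟩ | ⟨d₁, h₁, d₂, h₂, h⟩)
  · exact Or.inl ⟨d, hd, rfl⟩
  · refine Or.inr ?_
    simp only [Set.mem_iUnion]
    exact ⟨d₁, h₁, d₂, h₂, h⟩

theorem wedgeR_eq_of_mem_support {d : Wall 𝕜 n} {x : ℝ × ℝ} (h : x ∈ d.support) :
    wedgeR (toPlane d.dir) x = wedgeR (toPlane d.dir) d.base := by
  obtain ⟨s, -, rfl⟩ := h
  rw [wedgeR_add_right, wedgeR_smul_right, wedgeR_toPlane, wedge_self]
  simp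

/-- A radius fails if the circle meets a singular point, starts on a wall, or touches the line of a
wall. Each of these conditions determines the radius, and there are countably many of them. -/
theorem countable_not_isAdmissiblePath {S : Set (Wall 𝕜 n)} (hS : S.Countable) :
    {ρ : ℝ | 0 < ρ ∧ ¬ IsAdmissiblePath S (bigCircle ρ)}.Countable := by
  have c1 : (⋃ x ∈ Sing S, {ρ : ℝ | 0 < ρ ∧ 3 * ρ ^ 2 = x.1 ^ 2 + x.2 ^ 2}).Countable :=
    (countable_sing hS).biUnion fun x _ => countable_of_mul_sq_eq (by norm_num) _
  have hne : ∀ d : Wall 𝕜 n, wedgeR (toPlane d.dir) (-(1, √2)) ≠ 0 := by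
    intro d h
    have h1 := alpha_toPlane_ne_zero d.dir_ne_zero
    apply h1
    simp only [wedgeR, alpha, Prod.fst_neg, Prod.snd_neg] at h ⊢
    linarith
  have c2 : (⋃ d ∈ S, {ρ : ℝ | wedgeR (toPlane d.dir) (-(1, √2)) * ρ =
      wedgeR (toPlane d.dir) d.base}).Countable :=
    hS.biUnion fun d _ => countable_of_mul_eq (hne d) _
  have c3 : (⋃ d ∈ S, {ρ : ℝ | 0 < ρ ∧ (3 * ((toPlane d.dir).1 ^ 2 + (toPlane d.dir).2 ^ 2)) *
      ρ ^ 2 = wedgeR (toPlane d.dir) d.base ^ 2}).Countable :=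
    hS.biUnion fun d _ => countable_of_mul_sq_eq
      (by have := toPlane_norm_pos d.dir_ne_zero; positivity) _
  refine ((c1.union c2).union c3).mono ?_
  rintro ρ ⟨hρ, hadm⟩
  by_contra hcon
  simp only [Set.mem_union, Set.mem_iUnion, not_or, not_exists] at hcon
  obtain ⟨⟨n1, n2⟩, n3⟩ := hcon
  have start : ∀ d ∈ S, bigCircle ρ 0 ∉ d.support := by
    intro d hd h
    refine n2 d hd ?_
    change _ = _
    rw [← wedgeR_eq_of_mem_support h, bigCircle_zero, neg_smul, ← smul_neg, wedgeR_smul_right,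
      mul_comm]
  have pi := Real.pi_pos
  refine hadm ⟨(contDiff_bigCircle ρ).contDiffOn, fun t ht h0 => ?_, fun t ht hs => ?_, start,
    by rw [bigCircle_one]; exact start, fun t ht d hd h h0 => ?_⟩
  · rw [velocity_bigCircle ht] at h0
    have h1 := (smul_eq_zero.1 h0).resolve_left (by positivity)
    have h2 := norm_bigCircle (ρ := ρ) (t := t)
    simp only [Prod.mk_eq_zero, neg_eq_zero] at h1
    rw [h1.1, h1.2] at h2
    have : 0 < 3 * ρ ^ 2 := by positivity
    linarith
  · exact n1 _ hs ⟨hρ, norm_bigCircle.symm⟩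
  · rw [wedgeR_velocity ht] at h0
    have h1 := (mul_eq_zero.1 h0).resolve_left (by positivity)
    refine n3 d hd ⟨hρ, ?_⟩
    rw [← wedgeR_eq_of_mem_support h]
    have h2 := norm_bigCircle (ρ := ρ) (t := t)
    simp only [wedgeR]
    set p := toPlane d.dir
    set x := bigCircle ρ t
    linear_combination (-(p.1 ^ 2 + p.2 ^ 2)) * h2 + (p.1 * x.1 + p.2 * x.2) * h1

/-- There are finitely many lines, and at most one ray for each of the countably many directions. -/
theorem IsScatter.countable {D : StandardDiagram 𝕜 n} {S : Set (Wall 𝕜 n)}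
    (hS : IsScatter D.walls S) (hdir : AtMostOneRayPerDirection S) : S.Countable := by
  have h1 : D.walls.Finite := Set.finite_range _
  have h2 : {d ∈ S | d.isRay = true}.Countable := by
    refine Set.MapsTo.countable_of_injOn (Set.mapsTo_image Wall.dir _) ?_ (Set.to_countable _)
    rintro d ⟨hd, hr⟩ d' ⟨hd', hr'⟩ h
    exact hdir d hd d' hd' hr hr' h
  refine (h1.countable.union h2).mono fun d hd => ?_
  by_cases h : d ∈ D.walls
  · exact Or.inl h
  · exact Or.inr ⟨hd, hS.isRay_of_new d hd h⟩

theorem exists_isGoodRadius {S : Set (Wall 𝕜 n)} (hS : S.Countable) (F : Finset (Wall 𝕜 n)) :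
    ∃ ρ, IsGoodRadius F ρ ∧ IsAdmissiblePath S (bigCircle ρ) := by
  obtain ⟨ρ₀, h⟩ := Filter.eventually_atTop.1 (eventually_isGoodRadius F)
  obtain ⟨ρ, h1, h2⟩ := ((countable_not_isAdmissiblePath hS).dense_compl ℝ).exists_mem_open
    isOpen_Ioi (Set.nonempty_Ioi (a := ρ₀))
  have hg := h ρ (le_of_lt h2)
  exact ⟨ρ, hg, by_contra fun hn => h1 ⟨hg.pos, hn⟩⟩

end Crossings

/-! ### The consistency of a diagram along a large circle -/

section Loop

variable {𝕜 : Type*} [Field 𝕜] {n : ℕ} {E : Type*} [DecidableEq E] (blk : E → Fin n)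

theorem index_pos {v : ℤ × ℤ} (hv : v ≠ 0) : 0 < index v := by
  rw [index, Int.gcd_pos_iff]
  by_contra h
  push Not at h
  exact hv (Prod.ext h.1 h.2)

theorem sqMap_log_ne_zero {u : ℤ × ℤ} {f : CRing 𝕜 n} (hf : IsWallFunction u f) {I : Finset E}
    {v : ℤ × ℤ} (h : sqMap blk (log f) I v ≠ 0) : I ≠ ∅ ∧ ∃ j : ℕ, 0 < j ∧ v = j • u := by
  rw [sqMap_apply] at h
  obtain ⟨h1, h2⟩ := coef_log_ne_zero hf (right_ne_zero_of_mul h)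
  refine ⟨?_, h2⟩
  rintro rfl
  exact h1 rfl

theorem sqMap_log_of_congrMod [Fintype E] {r : ℕ} {f : CRing 𝕜 n} (hf : CongrMod r f 1)
    (hr : Fintype.card E < r) (I : Finset E) (v : ℤ × ℤ) : sqMap blk (log f) I v = 0 := by
  rw [sqMap_apply, log_eq_of_congrMod hf, mul_zero]
  rw [degree_blockDeg]
  exact (Finset.card_le_univ I).trans_lt hr

variable [Fintype E]

theorem wallCoeff_log_ne_zero {u : ℤ × ℤ} {f : CRing 𝕜 n} (hf : IsWallFunction u f) {I : Finset E}
    {v : ℤ × ℤ} (h : wallCoeff blk (log f) I v ≠ 0) : I ≠ ∅ ∧ ∃ j : ℕ, 0 < j ∧ v = j • u :=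
  sqMap_log_ne_zero blk hf fun h0 => h (by rw [wallCoeff, h0, zero_div])

theorem pos_alpha_nsmul_iff {j : ℕ} (hj : 0 < j) (u : ℤ × ℤ) :
    0 < alpha (toPlane (j • u)) ↔ 0 < alpha (toPlane u) := by
  rw [toPlane_nsmul, alpha_smul]
  exact mul_pos_iff_of_pos_left (by exact_mod_cast hj)

theorem slope_nsmul {j : ℕ} (hj : 0 < j) (u : ℤ × ℤ) :
    slope (toPlane (j • u)) = slope (toPlane u) := by
  rw [toPlane_nsmul, slope_smul (by exact_mod_cast hj.ne')]

variable [CharZero 𝕜]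

theorem commute_wallOp {v w : ℤ × ℤ} (h : wedge v w = 0) (I J : Finset E) :
    Commute (wallOp 𝕜 I v) (wallOp 𝕜 J w) := by
  by_cases hd : Disjoint I J
  · have := wallOp_commutator (𝕜 := 𝕜) hd v w
    rw [h, zero_smul, sub_eq_zero] at this
    exact this
  · rw [Commute, SemiconjBy, wallOp_mul_of_not_disjoint hd,
      wallOp_mul_of_not_disjoint (fun h' => hd h'.symm)]

theorem commute_wallOperator {P : Finset (ℤ × ℤ)} {c c' : Finset E → ℤ × ℤ → 𝕜}
    (h : ∀ I v J w, c I v ≠ 0 → c' J w ≠ 0 → wedge v w = 0) :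
    Commute (wallOperator P c) (wallOperator P c') := by
  refine Commute.sum_left _ _ _ fun I _ => Commute.sum_left _ _ _ fun v _ =>
    Commute.sum_right _ _ _ fun J _ => Commute.sum_right _ _ _ fun w _ => ?_
  by_cases h1 : c I v = 0
  · rw [h1, zero_smul]; exact Commute.zero_left _
  by_cases h2 : c' J w = 0
  · rw [h2, zero_smul]; exact Commute.zero_right _
  exact ((commute_wallOp (h I v J w h1 h2) I J).smul_left _).smul_right _

/-- The sum of the coefficients of the walls in `F` that are rays (or that are lines). -/
def totalCoeff (F : Finset (Wall 𝕜 n)) (ray : Bool) (I : Finset E) (v : ℤ × ℤ) : 𝕜 :=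
  ∑ d ∈ F with d.isRay = ray, wallCoeff blk (log d.func) I v

theorem orient_mul_wallCoeff (d : Wall 𝕜 n) (side : Bool) (b : ℝ) (I : Finset E) (v : ℤ × ℤ) :
    (if slope (toPlane v) = b then (orient v : 𝕜) *
      ((if d.isRay = false then wallCoeff blk (log d.func) I v else 0) +
        if decide (0 < alpha (toPlane v)) = side then
          (if d.isRay = true then wallCoeff blk (log d.func) I v else 0) else 0) else 0) =
    if slope (toPlane d.dir) = b ∧ (d.isRay = true → decide (0 < alpha (toPlane d.dir)) = side)
      then (orient d.dir : 𝕜) * wallCoeff blk (log d.func) I v else 0 := by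
  by_cases h : wallCoeff blk (log d.func) I v = 0
  · simp [h]
  obtain ⟨-, j, hj, rfl⟩ := wallCoeff_log_ne_zero blk d.func_mem h
  rw [slope_nsmul hj, orient]
  simp only [pos_alpha_nsmul_iff hj]
  rw [← orient]
  cases d.isRay <;> by_cases h1 : slope (toPlane d.dir) = b <;>
    by_cases h2 : decide (0 < alpha (toPlane d.dir)) = side <;> simp [h1, h2]

/-- All exponents of a wall are positive multiples of its direction and share its slope and side, so
grouping monomials by slope amounts to grouping walls. -/
theorem sideExponent_totalCoeff (F : Finset (Wall 𝕜 n)) (P : Finset (ℤ × ℤ)) (side : Bool)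
    (b : ℝ) :
    sideExponent P (totalCoeff (E := E) blk F false) (totalCoeff blk F true) side b =
      ∑ d ∈ F with slope (toPlane d.dir) = b ∧
        (d.isRay = true → decide (0 < alpha (toPlane d.dir)) = side),
        (orient d.dir : 𝕜) • wallOperator P (wallCoeff blk (log d.func)) := by
  have h1 : ∀ I : Finset E, ∀ v, (if slope (toPlane v) = b then
      ((orient v : 𝕜) * (totalCoeff blk F false I v + if decide (0 < alpha (toPlane v)) = side then
        totalCoeff blk F true I v else 0)) else 0) = ∑ d ∈ F with slope (toPlane d.dir) = b ∧
        (d.isRay = true → decide (0 < alpha (toPlane d.dir)) = side),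
        (orient d.dir : 𝕜) * wallCoeff blk (log d.func) I v := by
    intro I v
    rw [Finset.sum_filter, ← Finset.sum_congr rfl fun d _ => orient_mul_wallCoeff blk d side b I v]
    simp only [totalCoeff, Finset.sum_filter]
    split_ifs with h2 h3
    · simp only [← Finset.mul_sum, ← Finset.sum_add_distrib]
    · simp only [← Finset.mul_sum, add_zero]
    · simp
  have h2 : sideExponent P (totalCoeff (E := E) blk F false) (totalCoeff blk F true) side b =
      ∑ I ∈ Finset.univ.erase ∅, ∑ v ∈ P, (if slope (toPlane v) = b then
      ((orient v : 𝕜) * (totalCoeff blk F false I v + if decide (0 < alpha (toPlane v)) = side then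
        totalCoeff blk F true I v else 0)) else 0) • wallOp 𝕜 I v := by
    refine Finset.sum_congr rfl fun I _ => ?_
    rw [Finset.sum_filter]
    refine Finset.sum_congr rfl fun v _ => ?_
    split_ifs <;> simp
  rw [h2]
  simp only [h1, wallOperator, Finset.smul_sum, Finset.sum_smul]
  rw [Finset.sum_comm]
  conv_rhs => rw [Finset.sum_comm]
  rw [Finset.sum_comm]
  refine Finset.sum_congr rfl fun I _ => ?_
  rw [Finset.sum_comm]
  refine Finset.sum_congr rfl fun d _ => Finset.sum_congr rfl fun v _ => ?_
  rw [smul_smul]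

/-! ### The crossings -/

/-- The crossings of the circle with the walls in `F` on one side. -/
def sideCrossings (F : Finset (Wall 𝕜 n)) (ρ : ℝ) (side : Bool) : Set (ℝ × Wall 𝕜 n) :=
  {x | x.1 ∈ Set.Ioo (0 : ℝ) 1 ∧ x.2 ∈ F ∧ bigCircle ρ x.1 ∈ x.2.support ∧
    decide (0 < alpha (bigCircle ρ x.1)) = side}

variable {F : Finset (Wall 𝕜 n)} {ρ : ℝ} {side : Bool}

omit [CharZero 𝕜] in
theorem IsGoodRadius.ray_side (hg : IsGoodRadius F ρ) {x : ℝ × Wall 𝕜 n}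
    (hx : x ∈ sideCrossings F ρ side) (hr : x.2.isRay = true) :
    decide (0 < alpha (toPlane x.2.dir)) = side := by
  rw [← hx.2.2.2]
  exact decide_eq_decide.2 (pos_iff_pos_of_mul_pos (hg.alpha_mul_pos x.2 hx.2.1 hr x.1 hx.1 hx.2.2.1))

omit [CharZero 𝕜] in
theorem IsGoodRadius.injOn (hg : IsGoodRadius F ρ) :
    Set.InjOn Prod.snd (sideCrossings F ρ side) := by
  rintro ⟨t, d⟩ hx ⟨t', d'⟩ hx' h
  obtain rfl : d = d' := h
  obtain ⟨t₀, -, -, -, h1⟩ := hg.exists_unique d hx.2.1 side fun hr => hg.ray_side hx hr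
  rw [h1 t hx.1 hx.2.2.1 hx.2.2.2, h1 t' hx'.1 hx'.2.2.1 hx'.2.2.2]

omit [CharZero 𝕜] in
theorem IsGoodRadius.image_snd (hg : IsGoodRadius F ρ) :
    Prod.snd '' sideCrossings F ρ side =
      {d | d ∈ F ∧ (d.isRay = true → decide (0 < alpha (toPlane d.dir)) = side)} := by
  ext d
  constructor
  · rintro ⟨x, hx, rfl⟩
    exact ⟨hx.2.1, hg.ray_side hx⟩
  · rintro ⟨hd, h⟩
    obtain ⟨t, ht, h1, h2, -⟩ := hg.exists_unique d hd side h
    exact ⟨(t, d), ⟨ht, hd, h1, h2⟩, rfl⟩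

omit [CharZero 𝕜] in
theorem IsGoodRadius.exists_list (hg : IsGoodRadius F ρ) (side : Bool) :
    ∃ L : List (ℝ × Wall 𝕜 n), L.Nodup ∧ (L.Pairwise fun x y => x.1 ≤ y.1) ∧
      ∀ x, x ∈ L ↔ x ∈ sideCrossings F ρ side := by
  classical
  have hfin : (sideCrossings F ρ side).Finite := by
    refine Set.Finite.of_finite_image ?_ hg.injOn
    rw [hg.image_snd]
    exact F.finite_toSet.subset fun d hd => hd.1
  let R : ℝ × Wall 𝕜 n → ℝ × Wall 𝕜 n → Prop := fun x y => x.1 ≤ y.1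
  have : Std.Total R := ⟨fun x y => le_total x.1 y.1⟩
  have : IsTrans _ R := ⟨fun x y z h h' => le_trans (α := ℝ) h h'⟩
  refine ⟨hfin.toFinset.toList.insertionSort R, ?_, List.pairwise_insertionSort R _, fun x => ?_⟩
  · exact ((List.perm_insertionSort R _).nodup_iff).2 (Finset.nodup_toList _)
  · rw [(List.perm_insertionSort R _).mem_iff]
    simp

omit [CharZero 𝕜] in
theorem Wall.pairing_normal (d : Wall 𝕜 n) (v : ℝ × ℝ) (m : ℤ × ℤ) :
    pairing m (d.normal v) = (if 0 < wedgeR (toPlane d.dir) v then 1 else -1) * wedge d.dir m := by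
  unfold Wall.normal pairing wedge
  split_ifs <;> simp <;> ring

/-- The exponent of a crossing of the circle. -/
def crossingExponent (P : Finset (ℤ × ℤ)) (ρ : ℝ) (x : ℝ × Wall 𝕜 n) :
    Module.End 𝕜 (SqModule E 𝕜) :=
  (((if 0 < wedgeR (toPlane x.2.dir) (velocity (bigCircle ρ) x.1) then 1 else -1 : ℤ)) : 𝕜) •
    wallOperator P (wallCoeff blk (log x.2.func))

theorem crossingExponent_mem (P : Finset (ℤ × ℤ)) (ρ : ℝ) (x : ℝ × Wall 𝕜 n) :
    crossingExponent (E := E) blk P ρ x ∈ loweringFiltration E 𝕜 1 :=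
  smul_mem_loweringFiltration _ (wallOperator_mem _ _)

/-- The first crossing is applied first and hence stands rightmost, which is why the list is
reversed. -/
theorem sqMap_crossingProduct (P : Finset (ℤ × ℤ)) (L : List (ℝ × Wall 𝕜 n))
    (hP : ∀ x ∈ L, ∀ (I : Finset E) v, sqMap blk (log x.2.func) I v ≠ 0 → v ∈ P) (a : CRing 𝕜 n) :
    sqMap blk (crossingProduct (bigCircle ρ) L a) =
      ((L.reverse.map fun x => IsNilpotent.exp (crossingExponent blk P ρ x)).prod)
        (sqMap (E := E) blk a) := by
  induction L generalizing a with
  | nil => rfl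
  | cons x L ih =>
    have h1 := ih (fun y hy => hP y (by simp [hy])) (x.2.theta (velocity (bigCircle ρ) x.1) a)
    rw [List.reverse_cons, List.map_append, List.prod_append, Module.End.mul_apply]
    refine h1.trans ?_
    congr 1
    simp only [List.map_cons, List.map_nil, List.prod_cons, List.prod_nil, mul_one]
    refine sqMap_expD blk x.2.dir_primitive (x.2.pairing_normal _) P (fun I v h => ?_) a
    obtain ⟨h2, h3⟩ := sqMap_log_ne_zero blk x.2.func_mem h
    exact ⟨h2, hP x (by simp) I v h, h3⟩

/-- The sign with which the walls on one side are crossed. -/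
def sideSign (side : Bool) : ℤ := if side then 1 else -1

/-- Running counterclockwise, the circle crosses a wall positively at a point lying in its direction
and negatively at one lying opposite. This sign is the product of the signs of alpha at the point
and at the direction. -/
theorem crossingExponent_eq (hg : IsGoodRadius F ρ) (P : Finset (ℤ × ℤ)) {x : ℝ × Wall 𝕜 n}
    (hx : x ∈ sideCrossings F ρ side) : crossingExponent (E := E) blk P ρ x =
      (sideSign side : 𝕜) • (orient x.2.dir : 𝕜) •
        wallOperator P (wallCoeff blk (log x.2.func)) := by
  rw [crossingExponent, smul_smul]
  congr 1
  rw [← Int.cast_mul]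
  congr 1
  have h1 := hg.wedge_pos_iff x.2 hx.2.1 x.1 hx.1 hx.2.2.1
  have h2 := hg.alpha_ne x.2 hx.2.1 x.1 hx.1 hx.2.2.1
  have h3 := alpha_toPlane_ne_zero x.2.dir_ne_zero
  rw [← hx.2.2.2]
  simp only [h1, sideSign, orient]
  rcases lt_or_gt_of_ne h2 with h | h <;> rcases lt_or_gt_of_ne h3 with h' | h'
  · simp [not_lt.2 h.le, not_lt.2 h'.le, mul_pos_of_neg_of_neg h' h]
  · simp [not_lt.2 h.le, h', not_lt.2 (mul_neg_of_pos_of_neg h' h).le]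
  · simp [not_lt.2 h'.le, h, not_lt.2 (mul_neg_of_neg_of_pos h' h).le]
  · simp [h, h']

/-- On one half of the circle the slope increases with time, so the reversed list runs through K in
its descending order. Crossings of equal slope belong to parallel walls, which commute, and their
exponents add up. -/
theorem prod_exp_crossingExponent (hg : IsGoodRadius F ρ) (P : Finset (ℤ × ℤ)) {K : List ℝ}
    (hK : K.Pairwise (· > ·)) (hKF : ∀ d ∈ F, slope (toPlane d.dir) ∈ K)
    {L : List (ℝ × Wall 𝕜 n)} (hnd : L.Nodup) (hL : L.Pairwise fun x y => x.1 ≤ y.1)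
    (hmem : ∀ x, x ∈ L ↔ x ∈ sideCrossings F ρ side) :
    (L.reverse.map fun x => IsNilpotent.exp (crossingExponent (E := E) blk P ρ x)).prod =
      (K.map fun b => IsNilpotent.exp ((sideSign side : 𝕜) •
        sideExponent P (totalCoeff (E := E) blk F false) (totalCoeff blk F true) side b)).prod := by
  classical
  have hF := isNilFiltration (E := E) (𝕜 := 𝕜)
  have hsort : L.reverse.Pairwise fun x y =>
      slope (toPlane y.2.dir) ≤ slope (toPlane x.2.dir) := by
    rw [List.pairwise_reverse]
    refine List.Pairwise.imp_of_mem ?_ hL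
    intro x y hx hy h
    have hx' := (hmem x).1 hx
    have hy' := (hmem y).1 hy
    refine hg.slope_le x.2 hx'.2.1 y.2 hy'.2.1 x.1 hx'.1 y.1 hy'.1 hx'.2.2.1 hy'.2.2.1 h ?_
    have h1 := hg.alpha_ne x.2 hx'.2.1 x.1 hx'.1 hx'.2.2.1
    have h2 := hg.alpha_ne y.2 hy'.2.1 y.1 hy'.1 hy'.2.2.1
    have h3 := decide_eq_decide.1 (hx'.2.2.2.trans hy'.2.2.2.symm)
    by_cases h4 : 0 < alpha (bigCircle ρ x.1)
    · exact mul_pos h4 (h3.1 h4)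
    · exact mul_pos_of_neg_of_neg (lt_of_le_of_ne (not_lt.1 h4) h1)
        (lt_of_le_of_ne (not_lt.1 fun h => h4 (h3.2 h)) h2)
  have hprod := prod_map_eq_prod_fibers (β := ℝᵒᵈ)
    (fun x : ℝ × Wall 𝕜 n => OrderDual.toDual (slope (toPlane x.2.dir)))
    (fun x => IsNilpotent.exp (crossingExponent (E := E) blk P ρ x)) (K.map OrderDual.toDual)
    (by rw [List.pairwise_map]; exact hK) L.reverse
    (fun x hx => List.mem_map_of_mem
      (hKF x.2 ((hmem x).1 (List.mem_reverse.1 hx)).2.1)) hsort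
  rw [hprod, List.map_map]
  congr 1
  refine List.map_congr_left fun b _ => ?_
  simp only [Function.comp_apply, EmbeddingLike.apply_eq_iff_eq]
  have hmem' : ∀ x, x ∈ L.reverse.filter (fun x => slope (toPlane x.2.dir) = b) ↔
      x ∈ sideCrossings F ρ side ∧ slope (toPlane x.2.dir) = b := by
    intro x
    simp [hmem]
  rw [prod_exp_eq_exp_sum]
  · congr 1
    rw [sideExponent_totalCoeff, Finset.smul_sum, ← List.sum_toFinset _
      ((List.nodup_reverse.2 hnd).filter _)]
    refine Finset.sum_bij (fun x _ => x.2) (fun x hx => ?_) (fun x hx y hy h => ?_)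
      (fun d hd => ?_) fun x hx => ?_
    · rw [List.mem_toFinset, hmem'] at hx
      exact Finset.mem_filter.2 ⟨hx.1.2.1, hx.2, hg.ray_side hx.1⟩
    · rw [List.mem_toFinset, hmem'] at hx hy
      exact hg.injOn hx.1 hy.1 h
    · rw [Finset.mem_filter] at hd
      obtain ⟨x, hx, rfl⟩ := (hg.image_snd (side := side)).symm.subset ⟨hd.1, hd.2.2⟩
      exact ⟨x, by rw [List.mem_toFinset, hmem']; exact ⟨hx, hd.2.1⟩, rfl⟩
    · rw [List.mem_toFinset, hmem'] at hx
      exact crossingExponent_eq blk hg P hx.1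
  · exact fun x _ => hF.isNilpotent (crossingExponent_mem blk P ρ x)
  · intro x hx y hy
    rw [hmem'] at hx hy
    refine ((commute_wallOperator fun I v J w h1 h2 => ?_).smul_left _).smul_right _
    obtain ⟨-, j, hj, rfl⟩ := wallCoeff_log_ne_zero blk x.2.func_mem h1
    obtain ⟨-, k, hk, rfl⟩ := wallCoeff_log_ne_zero blk y.2.func_mem h2
    have h3 := wedge_eq_zero_of_slope_eq x.2.dir_ne_zero y.2.dir_ne_zero (hx.2.trans hy.2.symm)
    rw [wedge_nsmul_left, wedge_comm, wedge_nsmul_left, wedge_comm, h3]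
    simp

/-- A consistent diagram acts trivially along the loop at infinity. -/
theorem IsScatter.loopProduct {D : StandardDiagram 𝕜 n} {S : Set (Wall 𝕜 n)}
    (hS : IsScatter D.walls S) (hdir : AtMostOneRayPerDirection S) {r : ℕ}
    (hr : Fintype.card E < r) (hF : ∀ d, d ∈ F ↔ d ∈ S ∧ ¬ CongrMod r d.func 1)
    (P : Finset (ℤ × ℤ)) (hP : ∀ d ∈ F, ∀ (I : Finset E) v, sqMap blk (log d.func) I v ≠ 0 → v ∈ P)
    {K : List ℝ} (hK : K.Pairwise (· > ·)) (hKF : ∀ d ∈ F, slope (toPlane d.dir) ∈ K)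
    (m : ℤ × ℤ) : TropVertex.loopProduct K P (totalCoeff (E := E) blk F false)
      (totalCoeff blk F true) (monomialVec m) = monomialVec m := by
  obtain ⟨ρ, hg, hadm⟩ := exists_isGoodRadius (hS.countable hdir) F
  obtain ⟨L₁, nd₁, so₁, me₁⟩ := hg.exists_list true
  obtain ⟨L₂, nd₂, so₂, me₂⟩ := hg.exists_list false
  have hhalf : ∀ x : ℝ × Wall 𝕜 n, ∀ side, x ∈ sideCrossings F ρ side →
      (decide (x.1 < 1 / 2) = side) := by
    intro x side hx
    rw [← hx.2.2.2]
    exact decide_eq_decide.2 (alpha_bigCircle_pos_iff hg.pos hx.1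
      (hg.alpha_ne x.2 hx.2.1 x.1 hx.1 hx.2.2.1)).symm
  -- The crossings with positive alpha are those before time 1/2, so they come first.
  have hlist : IsCrossingList S (bigCircle ρ) r (L₁ ++ L₂) := by
    refine ⟨?_, ?_, fun x => ?_⟩
    · rw [List.nodup_append']
      refine ⟨nd₁, nd₂, fun x h1 h2 => ?_⟩
      have h3 := ((me₁ x).1 h1).2.2.2
      have h4 := ((me₂ x).1 h2).2.2.2
      rw [h3] at h4
      exact absurd h4 (by simp)
    · rw [List.pairwise_append]
      refine ⟨so₁, so₂, fun x hx y hy => ?_⟩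
      have h1 := of_decide_eq_true (hhalf x true ((me₁ x).1 hx))
      have h2 := of_decide_eq_false (hhalf y false ((me₂ y).1 hy))
      linarith
    · rw [List.mem_append, me₁, me₂]
      constructor
      · rintro (h | h) <;> exact ⟨h.1, ((hF _).1 h.2.1).1, ((hF _).1 h.2.1).2, h.2.2.1⟩
      · rintro ⟨h1, h2, h3, h4⟩
        by_cases h5 : 0 < alpha (bigCircle ρ x.1)
        · exact Or.inl ⟨h1, (hF _).2 ⟨h2, h3⟩, h4, by simpa using h5⟩
        · exact Or.inr ⟨h1, (hF _).2 ⟨h2, h3⟩, h4, by simpa using h5⟩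
  have h1 := hS.consistent _ hadm (by rw [bigCircle_one]) r _ hlist (zpow 𝕜 n m)
  have h2 := sqMap_congr blk h1 hr
  rw [sqMap_crossingProduct blk P, List.reverse_append, List.map_append, List.prod_append,
    prod_exp_crossingExponent blk hg P hK hKF nd₁ so₁ me₁,
    prod_exp_crossingExponent blk hg P hK hKF nd₂ so₂ me₂, id, sqMap_zpow] at h2
  · rw [TropVertex.loopProduct]
    have hneg : ∀ T : Module.End 𝕜 (SqModule E 𝕜), (-1 : 𝕜) • T = -T := fun T => by
      ext f A m
      simp
    simpa [sideSign, hneg] using h2.symm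
  · intro x hx
    rcases List.mem_append.1 hx with h | h
    · exact hP _ ((me₁ x).1 h).2.1
    · exact hP _ ((me₂ x).1 h).2.1

end Loop

/-! ### Squarefree parts of products -/

section SquarefreeProduct

variable {𝕜 : Type*} [Field 𝕜] {n : ℕ} {E : Type*} [Fintype E] [DecidableEq E] (blk : E → Fin n)
  {X : Type*} [Fintype X] [DecidableEq X]

/-- The family consists of disjoint sets with union `A`. -/
def IsDisjointCover (A : Finset E) (g : X → Finset E) : Prop :=
  (∀ x y, x ≠ y → Disjoint (g x) (g y)) ∧ Finset.univ.biUnion g = A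

theorem sqPart_one (A : Finset E) : sqPart blk (1 : CRing 𝕜 n) A = if A = ∅ then 1 else 0 := by
  classical
  have h : blockDeg blk A = 0 ↔ A = ∅ := by
    rw [← Finsupp.degree_eq_zero_iff, degree_blockDeg, Finset.card_eq_zero]
  rw [sqPart, MvPowerSeries.coeff_one]
  by_cases hA : A = ∅
  · subst hA
    simp [blockFact, blockDeg]
  · simp [h, hA]

-- Iterated `sqPart_mul`: the labels are distributed among the factors. Factors outside s receive no
-- label, so that all distributions are functions on the same type.
open Classical in
theorem sqPart_prod (c : X → CRing 𝕜 n) (s : Finset X) (A : Finset E) :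
    sqPart blk (∏ x ∈ s, c x) A = ∑ g : X → Finset E with
      (∀ x, x ∉ s → g x = ∅) ∧ IsDisjointCover A g, ∏ x ∈ s, sqPart blk (c x) (g x) := by
  induction s using Finset.induction_on generalizing A with
  | empty =>
    rw [Finset.prod_empty, sqPart_one]
    by_cases hA : A = ∅
    · subst hA
      rw [if_pos rfl, Finset.sum_eq_single (fun _ => ∅)]
      · simp
      · intro g hg hne
        exact absurd (funext fun x => (Finset.mem_filter.1 hg).2.1 x (by simp)) hne
      · intro h
        refine absurd (Finset.mem_filter.2 ⟨Finset.mem_univ _, fun _ _ => rfl, by simp, ?_⟩) h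
        ext e
        simp
    · rw [if_neg hA, Finset.sum_eq_zero]
      intro g hg
      refine absurd ?_ hA
      have h := (Finset.mem_filter.1 hg).2
      rw [← h.2.2]
      ext e
      simp [h.1]
  | insert x₀ s hx ih =>
    rw [Finset.prod_insert hx, sqPart_mul]
    simp only [ih, Finset.mul_sum]
    rw [Finset.sum_sigma']
    refine Finset.sum_bij' (fun y _ => Function.update y.2 x₀ y.1)
      (fun g _ => ⟨g x₀, Function.update g x₀ ∅⟩) ?_ ?_ ?_ ?_ ?_
    · rintro ⟨B, g⟩ h
      simp only [Finset.mem_sigma, Finset.mem_powerset, Finset.mem_filter, Finset.mem_univ,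
        true_and] at h ⊢
      obtain ⟨hB, h1, h2, h3⟩ := h
      have hd : ∀ x, Disjoint B (g x) := fun x => by
        have : g x ⊆ A \ B := by
          rw [← h3]
          exact Finset.subset_biUnion_of_mem g (Finset.mem_univ x)
        exact (Finset.disjoint_sdiff.mono_right this)
      refine ⟨fun x hxs => ?_, fun x y hxy => ?_, ?_⟩
      · rw [Finset.mem_insert, not_or] at hxs
        rw [Function.update_of_ne hxs.1, h1 x hxs.2]
      · by_cases h4 : x = x₀
        · subst h4
          rw [Function.update_self, Function.update_of_ne hxy.symm]
          exact hd y
        · rw [Function.update_of_ne h4]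
          by_cases h5 : y = x₀
          · subst h5
            rw [Function.update_self]
            exact (hd x).symm
          · rw [Function.update_of_ne h5]
            exact h2 x y hxy
      · ext e
        simp only [Finset.mem_biUnion, Finset.mem_univ, true_and]
        constructor
        · rintro ⟨x, hx⟩
          by_cases h4 : x = x₀
          · subst h4
            rw [Function.update_self] at hx
            exact hB hx
          · rw [Function.update_of_ne h4] at hx
            have : e ∈ A \ B := by
              rw [← h3]
              exact Finset.mem_biUnion.2 ⟨x, Finset.mem_univ _, hx⟩
            exact (Finset.mem_sdiff.1 this).1
        · intro he
          by_cases h4 : e ∈ B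
          · exact ⟨x₀, by rwa [Function.update_self]⟩
          · have : e ∈ A \ B := Finset.mem_sdiff.2 ⟨he, h4⟩
            rw [← h3] at this
            obtain ⟨x, -, hx'⟩ := Finset.mem_biUnion.1 this
            refine ⟨x, ?_⟩
            rw [Function.update_of_ne]
            · exact hx'
            · rintro rfl
              rw [h1 _ hx] at hx'
              simp at hx'
    · intro g h
      simp only [Finset.mem_sigma, Finset.mem_powerset, Finset.mem_filter, Finset.mem_univ,
        true_and] at h ⊢
      obtain ⟨h1, h2, h3⟩ := h
      refine ⟨?_, fun x hxs => ?_, fun x y hxy => ?_, ?_⟩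
      · rw [← h3]
        exact Finset.subset_biUnion_of_mem g (Finset.mem_univ x₀)
      · by_cases h4 : x = x₀
        · subst h4
          rw [Function.update_self]
        · rw [Function.update_of_ne h4, h1]
          simp [h4, hxs]
      · by_cases h4 : x = x₀
        · subst h4
          rw [Function.update_self]
          exact Finset.disjoint_empty_left _
        · by_cases h5 : y = x₀
          · subst h5
            rw [Function.update_self]
            exact Finset.disjoint_empty_right _
          · rw [Function.update_of_ne h4, Function.update_of_ne h5]
            exact h2 x y hxy
      · ext e
        simp only [Finset.mem_biUnion, Finset.mem_univ, true_and, Finset.mem_sdiff, ← h3]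
        constructor
        · rintro ⟨x, hx'⟩
          by_cases h4 : x = x₀
          · subst h4
            simp at hx'
          · rw [Function.update_of_ne h4] at hx'
            exact ⟨⟨x, hx'⟩, Finset.disjoint_left.1 (h2 x x₀ h4) hx'⟩
        · rintro ⟨⟨x, hx'⟩, h4⟩
          refine ⟨x, ?_⟩
          rw [Function.update_of_ne]
          · exact hx'
          · rintro rfl
            exact h4 hx'
    · rintro ⟨B, g⟩ h
      simp only [Finset.mem_sigma, Finset.mem_filter] at h
      simp [← h.2.2.1 x₀ hx]
    · intro g h
      simp
    · rintro ⟨B, g⟩ h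
      rw [Finset.prod_insert hx, Function.update_self]
      congr 1
      refine Finset.prod_congr rfl fun x hxs => ?_
      rw [Function.update_of_ne]
      rintro rfl
      exact hx hxs

end SquarefreeProduct

/-! ### Labelled sets and their automorphisms -/

section Labelling

variable {n : ℕ} {F : Type*} [Fintype F] [DecidableEq F] (b : F → Fin n) (p q : F → ℕ)

/-- An injective labelling of elements of `F`, compatible with the blocks, the weights and the
exponents. -/
structure IsLabelling (w : Fin n → WeightVector) (κ : (i : Fin n) → Fin (w i).length → ℕ)
    (g : InEdge w → F) : Prop where
  injective : Function.Injective g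
  block : ∀ x, b (g x) = x.1
  weight : ∀ x, p (g x) = (w x.1).entry x.2
  exponent : ∀ x, q (g x) = κ x.1 x.2

/-- Pairs of a tuple of weight vectors and a compatible tuple of exponent vectors. -/
abbrev LabelType (n : ℕ) : Type :=
  (w : Fin n → WeightVector) ×
    {κ : (i : Fin n) → Fin (w i).length → ℕ // ∀ i, IsExponentVector (w i) (κ i)}

variable {b p q}

/-- The conditions on 𝐰 and 𝐤 say precisely that the pairs (w_j, k_j) are in lexicographic order, so
a type is a sorted list and is recovered from its multiset. -/
theorem IsExponentVector.monotone {w : WeightVector} {κ : Fin w.length → ℕ}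
    (h : IsExponentVector w κ) : Monotone fun j => toLex (w.entry j, κ j) := by
  obtain ⟨l, e, he, hm⟩ := w
  cases l with
  | zero => exact fun i => i.elim0
  | succ l =>
    rw [Fin.monotone_iff_le_succ]
    intro i
    rw [Prod.Lex.toLex_le_toLex]
    rcases (hm (Fin.castSucc_lt_succ (i := i)).le).lt_or_eq with h1 | h1
    · exact Or.inl h1
    · exact Or.inr ⟨h1, h.2 _ _ (by simp) h1⟩

theorem IsLabelling.map_filter {w : Fin n → WeightVector}
    {κ : (i : Fin n) → Fin (w i).length → ℕ} {g : InEdge w → F} (h : IsLabelling b p q w κ g)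
    (i : Fin n) : ((Finset.univ.image g).filter fun x => b x = i).val.map
      (fun x => toLex (p x, q x)) =
      (List.ofFn fun j => toLex ((w i).entry j, κ i j) : Multiset (ℕ ×ₗ ℕ)) := by
  have h1 : (Finset.univ.image g).filter (fun x => b x = i) =
      Finset.univ.map ⟨fun j => g ⟨i, j⟩, fun j j' hj => by
        simpa using h.injective hj⟩ := by
    ext x
    simp only [Finset.mem_filter, Finset.mem_image, Finset.mem_univ, true_and, Finset.mem_map]
    constructor
    · rintro ⟨⟨⟨i', j⟩, rfl⟩, hi⟩
      rw [h.block] at hi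
      subst hi
      exact ⟨j, rfl⟩
    · rintro ⟨j, rfl⟩
      exact ⟨⟨_, rfl⟩, h.block _⟩
  rw [h1, Finset.map_val, Multiset.map_map]
  have h2 : ((fun x => toLex (p x, q x)) ∘ fun j => g ⟨i, j⟩) =
      fun j => toLex ((w i).entry j, κ i j) := by
    funext j
    simp [h.weight, h.exponent]
  change Multiset.map ((fun x => toLex (p x, q x)) ∘ fun j => g ⟨i, j⟩) _ = _
  rw [h2, Fin.univ_val_map]

theorem sigma_eq_of_ofFn_eq {w w' : WeightVector} {κ : Fin w.length → ℕ} {κ' : Fin w'.length → ℕ}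
    (h : (List.ofFn fun j => toLex (w.entry j, κ j)) =
      List.ofFn fun j => toLex (w'.entry j, κ' j)) :
    (⟨w, κ⟩ : (w : WeightVector) × (Fin w.length → ℕ)) = ⟨w', κ'⟩ := by
  obtain ⟨l, e, he, hm⟩ := w
  obtain ⟨l', e', he', hm'⟩ := w'
  have hl : l = l' := by simpa using congrArg List.length h
  subst hl
  have h1 := List.ofFn_injective h
  have h2 : e = e' := funext fun j => congrArg (fun x => (ofLex x).1) (congrFun h1 j)
  subst h2
  have h3 : κ = κ' := funext fun j => congrArg (fun x => (ofLex x).2) (congrFun h1 j)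
  rw [h3]

/-- In each block the image determines the multiset of pairs (weight, exponent), and a sorted list
is determined by its multiset. -/
theorem IsLabelling.labelType_eq {x y : LabelType n} {g : InEdge x.1 → F} {g' : InEdge y.1 → F}
    (h : IsLabelling b p q x.1 x.2.1 g) (h' : IsLabelling b p q y.1 y.2.1 g')
    (hT : Finset.univ.image g = Finset.univ.image g') : x = y := by
  obtain ⟨w, κ, hκ⟩ := x
  obtain ⟨w', κ', hκ'⟩ := y
  have h1 : (fun i => (⟨w i, κ i⟩ : (w : WeightVector) × (Fin w.length → ℕ))) =
      fun i => ⟨w' i, κ' i⟩ := by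
    funext i
    refine sigma_eq_of_ofFn_eq (List.Perm.eq_of_pairwise (le := (· ≤ ·))
      (fun _ _ _ _ h1 h2 => le_antisymm h1 h2) ?_ ?_ ?_)
    · exact ((hκ i).monotone.sortedLE_ofFn).pairwise
    · exact ((hκ' i).monotone.sortedLE_ofFn).pairwise
    · rw [← Multiset.coe_eq_coe, ← h.map_filter i, ← h'.map_filter i, hT]
  have hw : w = w' := congrArg (fun f i => (f i).1) h1
  subst hw
  have hk : κ = κ' := by
    funext i
    have := congrFun h1 i
    simpa using this
  subst hk
  rfl

/-- Each block of T is sorted lexicographically by weight and exponent. -/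
theorem exists_isLabelling (hp : ∀ x, 0 < p x) (hq : ∀ x, 0 < q x) (T : Finset F) :
    ∃ x : LabelType n, ∃ g : InEdge x.1 → F, IsLabelling b p q x.1 x.2.1 g ∧
      Finset.univ.image g = T := by
  let Ti : Fin n → Finset F := fun i => T.filter fun x => b x = i
  let key : (i : Fin n) → Fin (Ti i).card → ℕ ×ₗ ℕ := fun i j =>
    toLex (p ((Ti i).equivFin.symm j).1, q ((Ti i).equivFin.symm j).1)
  let en : (i : Fin n) → Fin (Ti i).card → F := fun i j =>
    ((Ti i).equivFin.symm (Tuple.sort (key i) j)).1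
  have hmono : ∀ i, Monotone fun j => toLex (p (en i j), q (en i j)) := fun i =>
    Tuple.monotone_sort (key i)
  let w : Fin n → WeightVector := fun i =>
    { length := (Ti i).card
      entry := fun j => p (en i j)
      entry_pos := fun j => hp _
      entry_mono := fun j j' hj => Prod.Lex.monotone_fst _ _ (hmono i hj) }
  have hen : ∀ i j, en i j ∈ T ∧ b (en i j) = i := fun i j =>
    Finset.mem_filter.1 ((Ti i).equivFin.symm (Tuple.sort (key i) j)).2
  refine ⟨⟨w, fun i j => q (en i j), fun i => ⟨fun j => hq _, fun j j' hj he => ?_⟩⟩,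
    fun x => en x.1 x.2, ⟨?_, fun x => (hen _ _).2, fun x => rfl, fun x => rfl⟩, ?_⟩
  · have h1 := hmono i (show j ≤ j' from Fin.le_def.2 (by omega))
    simp only [Prod.Lex.toLex_le_toLex] at h1
    rcases h1 with h1 | h1
    · exact absurd he h1.ne
    · exact h1.2
  · rintro ⟨i, j⟩ ⟨i', j'⟩ h
    have hi : i = i' := by
      rw [← (hen i j).2, ← (hen i' j').2]
      exact congrArg b h
    subst hi
    have h1 := (Tuple.sort (key i)).injective ((Ti i).equivFin.symm.injective (Subtype.ext h))
    exact congrArg (Sigma.mk i) h1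
  · ext x
    simp only [Finset.mem_image, Finset.mem_univ, true_and]
    constructor
    · rintro ⟨y, rfl⟩
      exact (hen _ _).1
    · intro hx
      have hx' : x ∈ Ti (b x) := Finset.mem_filter.2 ⟨hx, rfl⟩
      refine ⟨⟨b x, (Tuple.sort (key (b x))).symm ((Ti (b x)).equivFin ⟨x, hx'⟩)⟩, ?_⟩
      simp [en]

/-- Labellings with the same image differ by a unique permutation in each block, which has to
preserve weights and exponents. -/
theorem IsLabelling.card_eq {w : Fin n → WeightVector}
    {κ : (i : Fin n) → Fin (w i).length → ℕ} {g : InEdge w → F} (h : IsLabelling b p q w κ g) :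
    Nat.card {g' : InEdge w → F // IsLabelling b p q w κ g' ∧
      Finset.univ.image g' = Finset.univ.image g} = ∏ i, autCard (w i) (κ i) := by
  unfold autCard
  rw [← Nat.card_pi]
  let Φ : ((i : Fin n) → {σ : Equiv.Perm (Fin (w i).length) //
      ∀ j, (w i).entry (σ j) = (w i).entry j ∧ κ i (σ j) = κ i j}) → InEdge w → F :=
    fun σ x => g ⟨x.1, (σ x.1).1 x.2⟩
  have hΦ : ∀ σ, IsLabelling b p q w κ (Φ σ) ∧
      Finset.univ.image (Φ σ) = Finset.univ.image g := by
    intro σ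
    refine ⟨⟨?_, fun x => h.block _, fun x => ?_, fun x => ?_⟩, ?_⟩
    · rintro ⟨i, j⟩ ⟨i', j'⟩ hx
      have h1 := h.injective hx
      obtain ⟨rfl, h2⟩ := Sigma.mk.inj h1
      have h3 := (σ i).1.injective (eq_of_heq h2)
      exact congrArg (Sigma.mk _) h3
    · exact (h.weight _).trans ((σ x.1).2 x.2).1
    · exact (h.exponent _).trans ((σ x.1).2 x.2).2
    · ext y
      simp only [Finset.mem_image, Finset.mem_univ, true_and]
      constructor
      · rintro ⟨x, rfl⟩
        exact ⟨_, rfl⟩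
      · rintro ⟨x, rfl⟩
        exact ⟨⟨x.1, (σ x.1).1.symm x.2⟩, by simp [Φ]⟩
  refine (Nat.card_congr (Equiv.ofBijective (fun σ => ⟨Φ σ, hΦ σ⟩) ⟨?_, ?_⟩)).symm
  · intro σ σ' hσ
    funext i
    refine Subtype.ext (Equiv.ext fun j => ?_)
    have h1 := h.injective (congrFun (congrArg Subtype.val hσ) ⟨i, j⟩)
    simpa using h1
  · rintro ⟨g', h', hT⟩
    have h1 : ∀ i j, ∃ j', g ⟨i, j'⟩ = g' ⟨i, j⟩ := by
      intro i j
      have h2 : g' ⟨i, j⟩ ∈ Finset.univ.image g := by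
        rw [← hT]
        exact Finset.mem_image_of_mem _ (Finset.mem_univ _)
      obtain ⟨⟨i', j'⟩, -, h3⟩ := Finset.mem_image.1 h2
      have h4 : i' = i := by
        have := congrArg b h3
        rwa [h.block, h'.block] at this
      subst h4
      exact ⟨j', h3⟩
    choose τ hτ using h1
    have hinj : ∀ i, Function.Injective (τ i) := by
      intro i j j' hj
      have h2 := hτ i j
      rw [hj, hτ i j'] at h2
      simpa using (h'.injective h2).symm
    refine ⟨fun i => ⟨Equiv.ofBijective (τ i) (Finite.injective_iff_bijective.1 (hinj i)),
      fun j => ⟨?_, ?_⟩⟩, ?_⟩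
    · have h2 := h.weight ⟨i, τ i j⟩
      rw [hτ, h'.weight] at h2
      exact h2.symm
    · have h2 := h.exponent ⟨i, τ i j⟩
      rw [hτ, h'.exponent] at h2
      exact h2.symm
    · refine Subtype.ext (funext fun x => ?_)
      exact hτ x.1 x.2

open Classical in
/-- A sum over subsets, in terms of labellings. -/
theorem sum_labellings {𝕜 : Type*} [Field 𝕜] [CharZero 𝕜] (hp : ∀ x, 0 < p x)
    (hq : ∀ x, 0 < q x) (f : Finset F → 𝕜) :
    (Function.support fun x : LabelType n => ∑ g : InEdge x.1 → F with
      IsLabelling b p q x.1 x.2.1 g, f (Finset.univ.image g)).Finite ∧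
    ∑ᶠ x : LabelType n, (∑ g : InEdge x.1 → F with IsLabelling b p q x.1 x.2.1 g,
      f (Finset.univ.image g)) / ((∏ i, autCard (x.1 i) (x.2.1 i) : ℕ) : 𝕜) = ∑ T, f T := by
  choose c g₀ hg₀ hT₀ using exists_isLabelling (b := b) hp hq
  -- Labellings are grouped by their image T. A set T has exactly one type c T, and |Aut| labellings
  -- of this type.
  have h1 : ∀ x : LabelType n, (∑ g : InEdge x.1 → F with IsLabelling b p q x.1 x.2.1 g,
      f (Finset.univ.image g)) = ((∏ i, autCard (x.1 i) (x.2.1 i) : ℕ) : 𝕜) *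
        ∑ T with c T = x, f T := by
    intro x
    rw [← Finset.sum_fiberwise_of_maps_to (g := fun g : InEdge x.1 → F => Finset.univ.image g)
      (t := Finset.univ.filter fun T => c T = x)]
    · rw [Finset.mul_sum]
      refine Finset.sum_congr rfl fun T hT => ?_
      obtain rfl := (Finset.mem_filter.1 hT).2
      have h2 := (hg₀ T).card_eq
      rw [Nat.card_eq_fintype_card, Fintype.card_subtype] at h2
      rw [Finset.sum_congr rfl fun g hg => by rw [(Finset.mem_filter.1 hg).2], Finset.sum_const,
        nsmul_eq_mul, Finset.filter_filter, ← h2, hT₀]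
    · intro g hg
      refine Finset.mem_filter.2 ⟨Finset.mem_univ _, ?_⟩
      exact (hg₀ _).labelType_eq (Finset.mem_filter.1 hg).2 (hT₀ _)
  have h2 : ∀ x : LabelType n, x ∉ Finset.univ.image c → ∑ T with c T = x, f T = 0 := by
    intro x hx
    refine Finset.sum_eq_zero fun T hT => absurd ?_ hx
    exact Finset.mem_image.2 ⟨T, Finset.mem_univ _, (Finset.mem_filter.1 hT).2⟩
  have haut : ∀ x : LabelType n, ((∏ i, autCard (x.1 i) (x.2.1 i) : ℕ) : 𝕜) ≠ 0 := by
    intro x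
    rw [Nat.cast_ne_zero, Finset.prod_ne_zero_iff]
    intro i _
    have : Nonempty {σ : Equiv.Perm (Fin (x.1 i).length) //
      ∀ j, (x.1 i).entry (σ j) = (x.1 i).entry j ∧ x.2.1 i (σ j) = x.2.1 i j} := ⟨⟨1, by simp⟩⟩
    exact Nat.card_pos.ne'
  refine ⟨(Finset.univ.image c).finite_toSet.subset fun x hx => ?_, ?_⟩
  · by_contra h
    exact hx (by simp only [h1, h2 x h, mul_zero])
  · simp only [h1, mul_div_cancel_left₀ _ (haut _)]
    rw [finsum_eq_sum_of_support_subset (s := Finset.univ.image c)]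
    · exact Finset.sum_fiberwise_of_maps_to
        (fun T _ => Finset.mem_image_of_mem _ (Finset.mem_univ _)) _
    · intro x hx
      by_contra h
      exact hx (h2 x h)

end Labelling

/-! ### The elementary walls -/

section Leaves

variable {𝕜 : Type*} [Field 𝕜] {n : ℕ} {E : Type*} [Fintype E] [DecidableEq E]
  (D : StandardDiagram 𝕜 n) (blk : E → Fin n)

theorem nsmul_left_injective {u : ℤ × ℤ} (hu : u ≠ 0) : Function.Injective fun j : ℕ => j • u := by
  intro j j' h
  simp only at h
  by_contra hne
  have h1 : ∀ a : ℤ, j * a = j' * a → a = 0 := by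
    intro a ha
    have h2 : ((j : ℤ) - j') * a = 0 := by linarith
    exact (mul_eq_zero.1 h2).resolve_left (by omega)
  refine hu (Prod.ext (h1 _ ?_) (h1 _ ?_))
  · simpa using congrArg Prod.fst h
  · simpa using congrArg Prod.snd h

theorem IsPrimitive.eq_of_nsmul_eq {u u' : ℤ × ℤ} (hu : IsPrimitive u) (hu' : IsPrimitive u')
    {j j' : ℕ} (hj : 0 < j) (h : j • u = j' • u') : u = u' := by
  have h1 : j = j' := by
    rw [← index_nsmul hu j, h, index_nsmul hu']
  subst h1
  have hj' : (j : ℤ) ≠ 0 := by exact_mod_cast hj.ne'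
  refine Prod.ext (mul_left_cancel₀ hj' ?_) (mul_left_cancel₀ hj' ?_)
  · simpa using congrArg Prod.fst h
  · simpa using congrArg Prod.snd h

/-- The coefficient in the logarithm of the function of the `i`-th line of a squarefree monomial. -/
def leafCoeff (x : Fin n × Finset E × ℕ) : 𝕜 :=
  wallCoeff blk (log (D.f x.1)) x.2.1 (x.2.2 • D.m x.1)

/-- The terms in the logarithms of the functions of the lines, after the squarefree
substitution. -/
def Leaf : Type _ := {x : Fin n × Finset E × ℕ // leafCoeff D blk x ≠ 0}

instance : DecidableEq (Leaf D blk) := Classical.decEq _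

/-- For each block and each set of labels the coefficient is a Laurent polynomial, so only finitely
many weights occur. -/
instance : Finite (Leaf D blk) := by
  classical
  have hfin : {x : Fin n × Finset E × (ℤ × ℤ) | sqMap blk (log (D.f x.1)) x.2.1 x.2.2 ≠ 0}.Finite := by
    have : {x : Fin n × Finset E × (ℤ × ℤ) | sqMap blk (log (D.f x.1)) x.2.1 x.2.2 ≠ 0} ⊆
        ⋃ i : Fin n, ⋃ J : Finset E, (fun v => (i, J, v)) ''
          ((sqPart blk (log (D.f i)) J).coeff.support : Set (ℤ × ℤ)) := by
      rintro ⟨i, J, v⟩ h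
      simp only [Set.mem_iUnion]
      exact ⟨i, J, v, Finsupp.mem_support_iff.2 h, rfl⟩
    exact (Set.finite_iUnion fun i => Set.finite_iUnion fun J =>
      (Finset.finite_toSet _).image _).subset this
  have := hfin.to_subtype
  refine Finite.of_injective (β := {x : Fin n × Finset E × (ℤ × ℤ) |
    sqMap blk (log (D.f x.1)) x.2.1 x.2.2 ≠ 0})
    (fun x => ⟨(x.1.1, x.1.2.1, x.1.2.2 • D.m x.1.1), fun h => x.2 ?_⟩) ?_
  · rw [leafCoeff, wallCoeff]
    simp only at h
    rw [h, zero_div]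
  · rintro ⟨⟨i, J, k⟩, hx⟩ ⟨⟨i', J', k'⟩, hx'⟩ h
    simp only [Subtype.mk.injEq, Prod.mk.injEq] at h
    obtain ⟨rfl, rfl, h⟩ := h
    have := nsmul_left_injective (D.m_primitive i).ne_zero h
    subst this
    rfl

instance : Fintype (Leaf D blk) := Fintype.ofFinite _

variable {D blk}

namespace Leaf

/-- The block of an elementary wall. -/
def block (x : Leaf D blk) : Fin n := x.1.1

/-- The labels of an elementary wall. -/
def labels (x : Leaf D blk) : Finset E := x.1.2.1

/-- The weight of an elementary wall. -/
def weight (x : Leaf D blk) : ℕ := x.1.2.2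

/-- The coefficient of an elementary wall. -/
def coeff (x : Leaf D blk) : 𝕜 := leafCoeff D blk x.1

/-- The direction of an elementary wall, times its weight. -/
def vec (x : Leaf D blk) : ℤ × ℤ := x.weight • D.m x.block

theorem ext {x y : Leaf D blk} (h : x.block = y.block) (h1 : x.labels = y.labels)
    (h2 : x.weight = y.weight) : x = y :=
  Subtype.ext (Prod.ext h (Prod.ext h1 h2))

theorem labels_ne_empty (x : Leaf D blk) : x.labels ≠ ∅ :=
  (wallCoeff_log_ne_zero blk (D.f_mem x.block) x.2).1

theorem weight_pos (x : Leaf D blk) : 0 < x.weight := by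
  obtain ⟨-, j, hj, h⟩ := wallCoeff_log_ne_zero blk (D.f_mem x.block) x.2
  have := nsmul_left_injective (D.m_primitive x.block).ne_zero h
  rw [weight, this]
  exact hj

end Leaf

/-- The labels of a set of elementary walls. -/
def allLabels (T : Finset (Leaf D blk)) : Finset E := T.biUnion Leaf.labels

open Classical in
/-- The product of the coefficients of elementary walls with disjoint labels. -/
def leafProd (T : Finset (Leaf D blk)) : 𝕜 :=
  if T.Nonempty ∧ ∀ x ∈ T, ∀ y ∈ T, x ≠ y → Disjoint x.labels y.labels then
    ∏ x ∈ T, x.coeff else 0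

theorem leafProd_eq_zero {T : Finset (Leaf D blk)} (h : allLabels T = ∅) : leafProd T = 0 := by
  refine if_neg fun h1 => ?_
  obtain ⟨x, hx⟩ := h1.1
  refine x.labels_ne_empty (Finset.subset_empty.1 ?_)
  rw [← h]
  exact Finset.subset_biUnion_of_mem Leaf.labels hx

theorem leafProd_singleton (x : Leaf D blk) : leafProd {x} = x.coeff := by
  rw [leafProd, if_pos]
  · simp
  · simp

theorem leafProd_union {T U : Finset (Leaf D blk)} (hd : Disjoint T U) (hT : T.Nonempty)
    (hU : U.Nonempty) :
    leafProd (T ∪ U) = if Disjoint (allLabels T) (allLabels U) then leafProd T * leafProd U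
      else 0 := by
  split_ifs with h
  · have key : (∀ x ∈ T ∪ U, ∀ y ∈ T ∪ U, x ≠ y → Disjoint x.labels y.labels) ↔
        (∀ x ∈ T, ∀ y ∈ T, x ≠ y → Disjoint x.labels y.labels) ∧
        (∀ x ∈ U, ∀ y ∈ U, x ≠ y → Disjoint x.labels y.labels) := by
      refine ⟨fun h' => ⟨fun x hx y hy => h' x (Finset.mem_union_left _ hx) y
        (Finset.mem_union_left _ hy), fun x hx y hy => h' x (Finset.mem_union_right _ hx) y
        (Finset.mem_union_right _ hy)⟩, fun h' x hx y hy hxy => ?_⟩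
      rcases Finset.mem_union.1 hx with h1 | h1 <;> rcases Finset.mem_union.1 hy with h2 | h2
      · exact h'.1 x h1 y h2 hxy
      · exact h.mono (Finset.subset_biUnion_of_mem Leaf.labels h1)
          (Finset.subset_biUnion_of_mem Leaf.labels h2)
      · exact (h.mono (Finset.subset_biUnion_of_mem Leaf.labels h2)
          (Finset.subset_biUnion_of_mem Leaf.labels h1)).symm
      · exact h'.2 x h1 y h2 hxy
    rw [leafProd, leafProd, leafProd, Finset.prod_union hd]
    simp only [key, hT, hU, hT.mono Finset.subset_union_left, true_and]
    by_cases h1 : ∀ x ∈ T, ∀ y ∈ T, x ≠ y → Disjoint x.labels y.labels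
    · by_cases h2 : ∀ x ∈ U, ∀ y ∈ U, x ≠ y → Disjoint x.labels y.labels
      · rw [if_pos ⟨h1, h2⟩, if_pos h1, if_pos h2]
      · rw [if_neg (fun h => h2 h.2), if_neg h2, mul_zero]
    · rw [if_neg (fun h => h1 h.1), if_neg h1, zero_mul]
  · refine if_neg fun h1 => h ?_
    rw [allLabels, allLabels, Finset.disjoint_biUnion_left]
    intro x hx
    rw [Finset.disjoint_biUnion_right]
    intro y hy
    refine h1.2 x (Finset.mem_union_left _ hx) y (Finset.mem_union_right _ hy) ?_
    rintro rfl
    exact Finset.disjoint_left.1 hd hx hy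

theorem allLabels_union (T U : Finset (Leaf D blk)) :
    allLabels (T ∪ U) = allLabels T ∪ allLabels U := by
  ext e
  simp [allLabels, or_and_right, exists_or]

/-- A one-element set of elementary walls is a single term of a single log f_i, determined by block,
labels and weight. -/
theorem tropLines_leaf (I : Finset E) (u : ℤ × ℤ) :
    tropLines (Leaf.vec (D := D) (blk := blk)) allLabels leafProd I u =
      ∑ i, wallCoeff blk (log (D.f i)) I u := by
  symm
  have hex : ∀ i, wallCoeff blk (log (D.f i)) I u ≠ 0 → ∃ x : Leaf D blk, x.block = i ∧
      x.labels = I ∧ x.vec = u ∧ x.coeff = wallCoeff blk (log (D.f i)) I u := fun i h => by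
    obtain ⟨-, j, -, rfl⟩ := wallCoeff_log_ne_zero blk (D.f_mem i) h
    exact ⟨⟨(i, I, j), h⟩, rfl, rfl, rfl, rfl⟩
  choose lf hb hl hv hc using hex
  refine Finset.sum_bij_ne_zero (fun i _ h => {lf i h}) ?_ ?_ ?_ ?_
  · intro i _ h
    refine Finset.mem_filter.2 ⟨Finset.mem_univ _, ?_, ?_⟩
    · rw [allLabels, Finset.singleton_biUnion, hl]
    · rw [vecSum, Finset.sum_singleton, hv]
  · intro i _ h i' _ h' he
    rw [← hb i h, ← hb i' h', Finset.singleton_injective he]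
  · intro T hT hne
    obtain ⟨-, h1, h2⟩ := Finset.mem_filter.1 hT
    have hcard : T.card = 1 := by
      by_contra hc
      exact hne (if_neg hc)
    obtain ⟨x, rfl⟩ := Finset.card_eq_one.1 hcard
    simp only [allLabels, Finset.singleton_biUnion] at h1
    simp only [vecSum, Finset.sum_singleton] at h2
    have h3 : wallCoeff blk (log (D.f x.block)) I u ≠ 0 := by
      rw [← h1, ← h2]
      exact x.2
    refine ⟨x.block, Finset.mem_univ _, h3, ?_⟩
    rw [Finset.singleton_inj]
    have hvx := (hv _ h3).trans h2.symm
    rw [Leaf.vec, Leaf.vec, hb] at hvx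
    exact Leaf.ext (hb _ h3) ((hl _ h3).trans h1.symm)
      (nsmul_left_injective (D.m_primitive x.block).ne_zero hvx)
  · intro i _ h
    rw [if_pos (Finset.card_singleton _), leafProd_singleton, hc]

variable [CharZero 𝕜]

/-- The coefficient is multiplicative on sets with disjoint labels; sets of terms that share a label
contribute nothing, as the variables have square zero. -/
theorem isWallFamily_leaf : IsWallFamily (Leaf.vec (D := D) (blk := blk)) fun T =>
    leafProd T • wallOp 𝕜 (allLabels T) (vecSum Leaf.vec T) := by
  constructor
  · intro T U h
    obtain ⟨x, hx, hx'⟩ := Finset.not_disjoint_iff.1 h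
    have : ¬ Disjoint (allLabels T) (allLabels U) := by
      obtain ⟨e, he⟩ := Finset.nonempty_iff_ne_empty.2 x.labels_ne_empty
      exact Finset.not_disjoint_iff.2 ⟨e, Finset.mem_biUnion.2 ⟨x, hx, he⟩,
        Finset.mem_biUnion.2 ⟨x, hx', he⟩⟩
    rw [smul_mul_smul_comm, wallOp_mul_of_not_disjoint this, smul_zero]
  · intro T U h
    rcases T.eq_empty_or_nonempty with rfl | hT
    · have h0 : leafProd (∅ : Finset (Leaf D blk)) = 0 := leafProd_eq_zero rfl
      rw [h0, vecSum_empty, wedge_zero_left]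
      simp
    rcases U.eq_empty_or_nonempty with rfl | hU
    · have h0 : leafProd (∅ : Finset (Leaf D blk)) = 0 := leafProd_eq_zero rfl
      rw [h0, vecSum_empty, wedge_zero_right]
      simp
    rw [leafProd_union h hT hU, smul_mul_smul_comm, smul_mul_smul_comm]
    split_ifs with hd
    · rw [allLabels_union, vecSum_union h, mul_comm (leafProd U), smul_comm,
        ← wallOp_commutator hd, smul_sub]
    · rw [wallOp_mul_of_not_disjoint hd, wallOp_mul_of_not_disjoint fun h' => hd h'.symm]
      simp

/-! ### The rays of a consistent diagram -/

variable {S : Set (Wall 𝕜 n)} {F : Finset (Wall 𝕜 n)} {r : ℕ}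

theorem totalCoeff_lines (hS : IsScatter D.walls S) (hr : Fintype.card E < r)
    (hF : ∀ d, d ∈ F ↔ d ∈ S ∧ ¬ CongrMod r d.func 1) (I : Finset E) (v : ℤ × ℤ) :
    totalCoeff blk F false I v = ∑ i, wallCoeff blk (log (D.f i)) I v := by
  symm
  refine Finset.sum_bij_ne_zero (fun i _ _ => D.line i) ?_ ?_ ?_ ?_
  · intro i _ h
    refine Finset.mem_filter.2 ⟨(hF _).2 ⟨hS.subset ⟨i, rfl⟩, fun hc => h ?_⟩, rfl⟩
    have hc' : CongrMod r (D.f i) 1 := hc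
    rw [wallCoeff, sqMap_log_of_congrMod blk hc' hr, zero_div]
  · intro i _ h i' _ h' he
    -- Distinct indices can give the same wall. Its function then involves neither of the two
    -- variables, so its logarithm vanishes and nothing is counted twice.
    by_contra hne
    have hf : D.f i = D.f i' := congrArg Wall.func he
    have h1 : coef (blockDeg blk I) v (log (D.f i)) ≠ 0 := by
      intro h0
      rw [wallCoeff, sqMap_apply, h0, mul_zero, zero_div] at h
      exact h rfl
    refine (coef_log_ne_zero (D.f_mem i) h1).1 (Finsupp.ext fun j => ?_)
    by_cases hj : j = i
    · subst hj
      exact D.coef_log_ne_zero (i := i') (hf ▸ h1) hne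
    · exact D.coef_log_ne_zero h1 hj
  · intro d hd _
    obtain ⟨hd1, hd2⟩ := Finset.mem_filter.1 hd
    have hmem : d ∈ D.walls := by
      by_contra h
      have := hS.isRay_of_new d ((hF d).1 hd1).1 h
      rw [hd2] at this
      exact absurd this (by simp)
    obtain ⟨i, rfl⟩ := hmem
    exact ⟨i, Finset.mem_univ _, by assumption, rfl⟩
  · intro i _ _
    rfl

-- No other ray has exponents along d, because directions are primitive and rays in the same
-- direction coincide. If d is trivial modulo order r, both sides vanish.
omit [CharZero 𝕜] in
theorem totalCoeff_rays (hdir : AtMostOneRayPerDirection S) (hr : Fintype.card E < r)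
    (hF : ∀ d, d ∈ F ↔ d ∈ S ∧ ¬ CongrMod r d.func 1) {d : Wall 𝕜 n} (hd : d ∈ S)
    (hray : d.isRay = true) (I : Finset E) {j : ℕ} (hj : 0 < j) :
    totalCoeff blk F true I (j • d.dir) = wallCoeff blk (log d.func) I (j • d.dir) := by
  refine Finset.sum_eq_single d (fun d' hd' hne => ?_) fun h => ?_
  · by_contra h
    obtain ⟨h1, h2⟩ := Finset.mem_filter.1 hd'
    obtain ⟨-, j', -, h3⟩ := wallCoeff_log_ne_zero blk d'.func_mem h
    exact hne (hdir d' ((hF d').1 h1).1 d hd h2 hray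
      (d.dir_primitive.eq_of_nsmul_eq d'.dir_primitive hj h3).symm)
  · have hc : CongrMod r d.func 1 := by
      by_contra hc
      exact h (Finset.mem_filter.2 ⟨(hF d).2 ⟨hd, hc⟩, hray⟩)
    rw [wallCoeff, sqMap_log_of_congrMod blk hc hr, zero_div]

/-- The squarefree part of the logarithm of the function of a ray, in terms of tropical counts. -/
theorem wallCoeff_ray (hS : IsScatter D.walls S) (hdir : AtMostOneRayPerDirection S)
    {d : Wall 𝕜 n} (hd : d ∈ S) (hray : d.isRay = true) {j : ℕ} (hj : 0 < j)
    {μ : Leaf D blk → ℝ} (hμ : IsGeneric Leaf.vec μ) (I : Finset E) :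
    wallCoeff blk (log d.func) I (j • d.dir) =
      tropRays Leaf.vec μ allLabels leafProd I (j • d.dir) := by
  classical
  rcases I.eq_empty_or_nonempty with rfl | hI
  · have h1 : wallCoeff blk (log d.func) (∅ : Finset E) (j • d.dir) = 0 := by
      by_contra h
      exact (wallCoeff_log_ne_zero blk d.func_mem h).1 rfl
    rw [h1, tropRays, Finset.sum_eq_zero]
    intro T hT
    rw [leafProd_eq_zero (Finset.mem_filter.1 hT).2.1, mul_zero]
  set r := Fintype.card E + 1
  have hr : Fintype.card E < r := Nat.lt_succ_self _
  set F : Finset (Wall 𝕜 n) := (hS.isScatteringDiagram r).toFinset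
  have hF : ∀ d, d ∈ F ↔ d ∈ S ∧ ¬ CongrMod r d.func 1 := fun d => by simp [F]
  -- A finite set containing every exponent of the diagram modulo order r, every vector of a set of
  -- elementary walls, and the exponent in question.
  set P : Finset (ℤ × ℤ) := ((F.biUnion fun d => Finset.univ.biUnion fun J : Finset E =>
    (sqPart blk (log d.func) J).coeff.support) ∪ Finset.univ.image (vecSum (Leaf.vec (D := D)
      (blk := blk))) ∪ {j • d.dir}).erase 0
  set K : List ℝ := (P.image (fun u => slope (toPlane u)) ∪
    F.image fun d => slope (toPlane d.dir)).sort (· ≥ ·)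
  have hK : K.Pairwise (· > ·) := (Finset.sortedGT_sort _).pairwise
  have hP0 : (0 : ℤ × ℤ) ∉ P := Finset.notMem_erase _ _
  have hKP : ∀ u ∈ P, slope (toPlane u) ∈ K := fun u hu =>
    (Finset.mem_sort _).2 (Finset.mem_union_left _
      (Finset.mem_image_of_mem (fun u => slope (toPlane u)) hu))
  have hKF : ∀ d ∈ F, slope (toPlane d.dir) ∈ K := fun d hd =>
    (Finset.mem_sort _).2 (Finset.mem_union_right _
      (Finset.mem_image_of_mem (fun d : Wall 𝕜 n => slope (toPlane d.dir)) hd))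
  have hPF : ∀ d ∈ F, ∀ (J : Finset E) v, sqMap blk (log d.func) J v ≠ 0 → v ∈ P := by
    intro d hd J v h
    refine Finset.mem_erase.2 ⟨?_, Finset.mem_union_left _ (Finset.mem_union_left _
      (Finset.mem_biUnion.2 ⟨d, hd, Finset.mem_biUnion.2 ⟨J, Finset.mem_univ _,
        Finsupp.mem_support_iff.2 h⟩⟩))⟩
    obtain ⟨-, k, hk, rfl⟩ := sqMap_log_ne_zero blk d.func_mem h
    exact smul_ne_zero hk.ne' d.dir_ne_zero
  have hPT : ∀ T : Finset (Leaf D blk), vecSum Leaf.vec T ≠ 0 → vecSum Leaf.vec T ∈ P :=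
    fun T h => Finset.mem_erase.2 ⟨h, Finset.mem_union_left _ (Finset.mem_union_right _
      (Finset.mem_image_of_mem _ (Finset.mem_univ _)))⟩
  have hPv : j • d.dir ∈ P := Finset.mem_erase.2 ⟨smul_ne_zero hj.ne' d.dir_ne_zero,
    Finset.mem_union_right _ (Finset.mem_singleton_self _)⟩
  have h1 := hS.loopProduct blk hdir hr hF P hPF hK hKF
  -- The diagram and the tropical solution have the same lines in the loop identity, hence the same
  -- rays.
  have hlines : totalCoeff (E := E) blk F false =
      tropLines (Leaf.vec (D := D) (blk := blk)) allLabels leafProd := by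
    funext J v
    rw [totalCoeff_lines hS hr hF, tropLines_leaf]
  rw [hlines] at h1
  have h2 := loopProduct_tropical hμ allLabels leafProd (fun T h => leafProd_eq_zero h) P hP0
    (fun T _ => hPT T) isWallFamily_leaf K hK fun T hT => hKP _ (hPT T hT)
  rw [← totalCoeff_rays hdir hr hF hd hray I hj]
  exact loopProduct_unique K (hK.imp fun h => ne_of_gt h) P hP0 hKP _ _ _ h1
    (fun m => by rw [h2]; rfl) I hI _ hPv

end Leaves

/-! ### The terms of the formula -/

section Terms

variable {𝕜 : Type*} [Field 𝕜] {n : ℕ} {E : Type*} [Fintype E] [DecidableEq E]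
  (D : StandardDiagram 𝕜 n) (blk : E → Fin n)

/-- The product `∏ a_{i k_{ij} w_{ij}} tᵢ^{k_{ij}}`. -/
def labelMonomial (x : LabelType n) : CRing 𝕜 n :=
  ∏ y : InEdge x.1, D.a y.1 (x.2.1 y.1 y.2) ((x.1 y.1).entry y.2) •
    (MvPowerSeries.X y.1 : CRing 𝕜 n) ^ x.2.1 y.1 y.2

theorem term_eq (x : LabelType n) : term D x.1 x.2.1 =
    (((index (outVec D.m x.1) : 𝕜) * (Ntrop D.m x.1 : 𝕜)) /
      ((∏ i, autCard (x.1 i) (x.2.1 i) : ℕ) : 𝕜)) •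
      (labelMonomial D x * zpow 𝕜 n (outVec D.m x.1)) := by
  rw [term, labelMonomial, Fintype.prod_sigma]

theorem exists_coeff_labelMonomial (x : LabelType n) (α : Fin n →₀ ℕ) :
    ∃ c : 𝕜, MvPowerSeries.coeff α (labelMonomial D x) = AddMonoidAlgebra.single 0 c := by
  let ψ : 𝕜 →+* AddMonoidAlgebra 𝕜 (ℤ × ℤ) := AddMonoidAlgebra.singleZeroRingHom
  have h1 : ∀ (a : 𝕜) (i : Fin n) (k : ℕ), a • (MvPowerSeries.X i : CRing 𝕜 n) ^ k =
      MvPowerSeries.map ψ (MvPowerSeries.C a * MvPowerSeries.X i ^ k) := by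
    intro a i k
    rw [map_mul, map_pow, MvPowerSeries.map_X, MvPowerSeries.map_C]
    ext1 β
    rw [MvPowerSeries.coeff_C_mul]
    change a • MvPowerSeries.coeff β ((MvPowerSeries.X i : CRing 𝕜 n) ^ k) = _
    ext v
    simp [ψ, AddMonoidAlgebra.singleZeroRingHom]
  refine ⟨MvPowerSeries.coeff α (∏ y : InEdge x.1, (MvPowerSeries.C (D.a y.1 (x.2.1 y.1 y.2)
    ((x.1 y.1).entry y.2)) * MvPowerSeries.X y.1 ^ x.2.1 y.1 y.2) : MvPowerSeries (Fin n) 𝕜), ?_⟩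
  rw [labelMonomial]
  simp only [h1]
  rw [← map_prod, MvPowerSeries.coeff_map]
  rfl

theorem coef_term (x : LabelType n) (α : Fin n →₀ ℕ) (v : ℤ × ℤ) :
    coef α v (term D x.1 x.2.1) = if outVec D.m x.1 = v then
      (index v : 𝕜) * (Ntrop D.m x.1 : 𝕜) * coef α 0 (labelMonomial D x) /
        ((∏ i, autCard (x.1 i) (x.2.1 i) : ℕ) : 𝕜) else 0 := by
  obtain ⟨c, hc⟩ := exists_coeff_labelMonomial D x α
  rw [term_eq, coef_smul, coef, coef, zpow, MvPowerSeries.coeff_mul_C, hc,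
    AddMonoidAlgebra.single_mul_single, zero_add, mul_one, AddMonoidAlgebra.coeff_single,
    AddMonoidAlgebra.coeff_single, Finsupp.single_eq_same, Finsupp.single_apply]
  split_ifs with h
  · rw [h]
    ring
  · rw [mul_zero]

theorem coeff_term_ne_zero {x : LabelType n} {α : Fin n →₀ ℕ}
    (h : MvPowerSeries.coeff α (term D x.1 x.2.1) ≠ 0) : coef α 0 (labelMonomial D x) ≠ 0 := by
  intro h0
  refine h ?_
  ext v
  have := coef_term D x α v
  rw [h0] at this
  simpa [coef] using this

variable [CharZero 𝕜]

-- A power of t_i only sees sets of k labels in block i, and there the factorial and the division by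
-- w turn a_{ikw} into `leafCoeff`. For k labels not all in block i, `leafCoeff` vanishes since f_i
-- involves t_i alone.
omit [CharZero 𝕜] in
theorem sqPart_smul_X_pow (i : Fin n) (k : ℕ) {w : ℕ} (J : Finset E) :
    sqPart blk (D.a i k w • (MvPowerSeries.X i : CRing 𝕜 n) ^ k) J =
      AddMonoidAlgebra.singleZeroRingHom (if J.card = k then leafCoeff D blk (i, J, w) else 0) := by
  classical
  have h0 : MvPowerSeries.coeff (blockDeg blk J) (D.a i k w • (MvPowerSeries.X i : CRing 𝕜 n) ^ k) =
      D.a i k w • MvPowerSeries.coeff (blockDeg blk J) ((MvPowerSeries.X i : CRing 𝕜 n) ^ k) := rfl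
  rw [sqPart, h0, MvPowerSeries.coeff_X_pow]
  by_cases h : blockDeg blk J = Finsupp.single i k
  · have hk : J.card = k := by
      rw [← degree_blockDeg blk J, h]
      simp
    rw [if_pos h, if_pos hk, leafCoeff, wallCoeff, sqMap_apply]
    simp only
    rw [h, index_nsmul (D.m_primitive i)]
    ext v
    simp [AddMonoidAlgebra.singleZeroRingHom, AddMonoidAlgebra.one_def, StandardDiagram.a,
      Finsupp.single_apply]
    split_ifs
    · ring
    · rfl
  · rw [if_neg h, smul_zero, smul_zero]
    split_ifs with hk
    · have : leafCoeff D blk (i, J, w) = 0 := by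
        by_contra h1
        have h2 : coef (blockDeg blk J) (w • D.m i) (log (D.f i)) ≠ 0 := by
          intro h3
          rw [leafCoeff, wallCoeff, sqMap_apply] at h1
          simp only at h1
          rw [h3] at h1
          simp at h1
        have h3 : blockDeg blk J = Finsupp.single i (blockDeg blk J i) := by
          ext j
          by_cases hj : j = i
          · subst hj
            simp
          · rw [D.coef_log_ne_zero h2 hj, Finsupp.single_eq_of_ne hj]
        have h4 : blockDeg blk J i = k := by
          have := congrArg Finsupp.degree h3
          rw [degree_blockDeg, hk] at this
          simpa using this.symm
        rw [h4] at h3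
        exact h h3
      rw [this, map_zero]
    · rw [map_zero]

variable {D blk}

/-- Labellings by elementary walls. -/
abbrev IsLeafLabelling (x : LabelType n) (g : InEdge x.1 → Leaf D blk) : Prop :=
  IsLabelling Leaf.block Leaf.weight (fun l => l.labels.card) x.1 x.2.1 g

omit [CharZero 𝕜] in
theorem leafProd_image {x : LabelType n} (hx : Nonempty (InEdge x.1)) {g : InEdge x.1 → Leaf D blk}
    (hg : Function.Injective g) (hd : ∀ y y', y ≠ y' → Disjoint (g y).labels (g y').labels) :
    leafProd (Finset.univ.image g) = ∏ y, (g y).coeff := by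
  rw [leafProd, if_pos, Finset.prod_image hg.injOn]
  refine ⟨Finset.univ_nonempty.image g, ?_⟩
  simp only [Finset.mem_image, Finset.mem_univ, true_and]
  rintro _ ⟨y, rfl⟩ _ ⟨y', rfl⟩ h
  exact hd y y' fun h' => h (by rw [h'])

omit [CharZero 𝕜] in
theorem disjoint_of_leafProd_ne_zero {x : LabelType n} {g : InEdge x.1 → Leaf D blk}
    (hg : Function.Injective g) (h : leafProd (Finset.univ.image g) ≠ 0) (y y' : InEdge x.1)
    (hy : y ≠ y') : Disjoint (g y).labels (g y').labels := by
  have h1 : (Finset.univ.image g).Nonempty ∧ ∀ x ∈ Finset.univ.image g,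
      ∀ y ∈ Finset.univ.image g, x ≠ y → Disjoint x.labels y.labels := by
    by_contra h1
    exact h (if_neg h1)
  exact h1.2 _ (Finset.mem_image_of_mem _ (Finset.mem_univ _)) _
    (Finset.mem_image_of_mem _ (Finset.mem_univ _)) fun h' => hy (hg h')

omit [CharZero 𝕜] [Fintype E] in
theorem allLabels_image [Fintype E] {x : LabelType n} (g : InEdge x.1 → Leaf D blk) :
    allLabels (Finset.univ.image g) = Finset.univ.biUnion fun y => (g y).labels :=
  Finset.image_biUnion

-- Distributing all labels among the factors, with nonzero contributions, means labelling the edges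
-- by elementary walls with disjoint labels that exhaust E. At least one edge is required, because
-- `leafProd` is zero on the empty set while an empty product is one.
open Classical in
omit [CharZero 𝕜] in
theorem coef_labelMonomial {x : LabelType n} (hx : Nonempty (InEdge x.1)) :
    (blockFact blk Finset.univ : 𝕜) * coef (blockDeg blk Finset.univ) 0 (labelMonomial D x) =
      ∑ g : InEdge x.1 → Leaf D blk with IsLeafLabelling x g,
        if allLabels (Finset.univ.image g) = Finset.univ then leafProd (Finset.univ.image g)
        else 0 := by
  rw [← sqMap_apply, sqMap, labelMonomial, sqPart_prod]
  simp only [sqPart_smul_X_pow, ← map_prod, ← map_sum]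
  have h0 : ∀ c : 𝕜, (AddMonoidAlgebra.singleZeroRingHom c : AddMonoidAlgebra 𝕜 (ℤ × ℤ)).coeff 0 =
      c := fun c => by
    simp [AddMonoidAlgebra.singleZeroRingHom]
  rw [h0]
  symm
  refine Finset.sum_bij_ne_zero (fun g _ _ y => (g y).labels) ?_ ?_ ?_ ?_
  · intro g hg hne
    have hl := (Finset.mem_filter.1 hg).2
    obtain ⟨h1, h2⟩ := ite_ne_right_iff.1 hne
    refine Finset.mem_filter.2 ⟨Finset.mem_univ _, fun y hy => absurd (Finset.mem_univ y) hy,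
      disjoint_of_leafProd_ne_zero hl.injective h2, ?_⟩
    rw [← allLabels_image, h1]
  · intro g hg _ g' hg' _ h
    have hl := (Finset.mem_filter.1 hg).2
    have hl' := (Finset.mem_filter.1 hg').2
    funext y
    exact Leaf.ext ((hl.block y).trans (hl'.block y).symm) (congrFun h y)
      ((hl.weight y).trans (hl'.weight y).symm)
  · intro J hJ hne
    obtain ⟨-, -, hd, hc⟩ := Finset.mem_filter.1 hJ
    have h1 := fun y => ite_ne_right_iff.1 (Finset.prod_ne_zero_iff.1 hne y (Finset.mem_univ y))
    let g : InEdge x.1 → Leaf D blk := fun y => ⟨(y.1, J y, (x.1 y.1).entry y.2), (h1 y).2⟩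
    have hinj : Function.Injective g := by
      intro y y' h
      by_contra hy
      have h2 : (g y).labels = (g y').labels := congrArg Leaf.labels h
      have h3 : Disjoint (g y).labels (g y').labels := hd y y' hy
      rw [← h2, disjoint_self] at h3
      exact (g y).labels_ne_empty h3
    refine ⟨g, Finset.mem_filter.2 ⟨Finset.mem_univ _, hinj, fun y => rfl, fun y => rfl,
      fun y => (h1 y).1⟩, ?_, rfl⟩
    rw [if_pos ((allLabels_image g).trans hc), leafProd_image hx hinj hd]
    exact Finset.prod_ne_zero_iff.2 fun y _ => (h1 y).2
  · intro g hg hne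
    have hl := (Finset.mem_filter.1 hg).2
    obtain ⟨h1, h2⟩ := ite_ne_right_iff.1 hne
    rw [if_pos h1, leafProd_image hx hl.injective (disjoint_of_leafProd_ne_zero hl.injective h2)]
    refine Finset.prod_congr rfl fun y _ => ?_
    rw [if_pos (hl.exponent y), ← hl.weight y]
    change leafCoeff D blk (g y).1 = _
    congr 1
    exact Prod.ext (hl.block y) rfl

omit [CharZero 𝕜] in
theorem IsLabelling.vecSum_image {x : LabelType n} {g : InEdge x.1 → Leaf D blk}
    (hg : IsLeafLabelling x g) : vecSum Leaf.vec (Finset.univ.image g) = outVec D.m x.1 := by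
  rw [← vecSum_inVec, vecSum, vecSum, Finset.sum_image hg.injective.injOn]
  refine Finset.sum_congr rfl fun y _ => ?_
  rw [Leaf.vec, hg.block, hg.weight, inVec]

omit [CharZero 𝕜] in
theorem IsLabelling.treeCount_image {x : LabelType n} {g : InEdge x.1 → Leaf D blk}
    (hg : IsLeafLabelling x g) (hout : outVec D.m x.1 ≠ 0) {μ : Leaf D blk → ℝ}
    (hμ : IsGeneric Leaf.vec μ) :
    treeCount Leaf.vec μ (Finset.univ.image g) = Ntrop D.m x.1 := by
  have hv : Leaf.vec ∘ g = inVec D.m x.1 := by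
    funext y
    rw [Function.comp_apply, Leaf.vec, hg.block, hg.weight, inVec]
  let ι : InEdge x.1 ↪ Leaf D blk := ⟨g, hg.injective⟩
  have h1 : Finset.univ.image g = Finset.univ.map ι := (Finset.map_eq_image ι Finset.univ).symm
  have h2 := hμ.comp ι
  have h3 : Leaf.vec ∘ ι = inVec D.m x.1 := hv
  rw [h3] at h2
  rw [h1, treeCount_map, h3, ntrop_eq_treeCount (fun i => (D.m_primitive i).ne_zero) hout h2]

open Classical in
theorem coef_term_eq_sum (x : LabelType n) {v : ℤ × ℤ} (hv : v ≠ 0) {μ : Leaf D blk → ℝ}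
    (hμ : IsGeneric Leaf.vec μ) :
    coef (blockDeg blk Finset.univ) v (term D x.1 x.2.1) =
      (∑ g : InEdge x.1 → Leaf D blk with IsLeafLabelling x g,
        if allLabels (Finset.univ.image g) = Finset.univ ∧
            vecSum Leaf.vec (Finset.univ.image g) = v then
          (index v : 𝕜) / (blockFact blk Finset.univ : 𝕜) *
            ((treeCount Leaf.vec μ (Finset.univ.image g) : 𝕜) * leafProd (Finset.univ.image g))
        else 0) / ((∏ i, autCard (x.1 i) (x.2.1 i) : ℕ) : 𝕜) := by
  have hfact : (blockFact blk Finset.univ : 𝕜) ≠ 0 :=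
    Nat.cast_ne_zero.2 (Finset.prod_ne_zero_iff.2 fun i _ => Nat.factorial_ne_zero _)
  rw [coef_term]
  split_ifs with h
  -- Without edges the out vector would be zero.
  · have hx : Nonempty (InEdge x.1) := by
      by_contra hx
      rw [not_nonempty_iff] at hx
      refine hv ?_
      rw [← h, ← vecSum_inVec, vecSum, Finset.univ_eq_empty, Finset.sum_empty]
    congr 1
    have h1 : ∀ g ∈ Finset.univ.filter fun g : InEdge x.1 → Leaf D blk => IsLeafLabelling x g,
        (if allLabels (Finset.univ.image g) = Finset.univ ∧
            vecSum Leaf.vec (Finset.univ.image g) = v then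
          (index v : 𝕜) / (blockFact blk Finset.univ : 𝕜) *
            ((treeCount Leaf.vec μ (Finset.univ.image g) : 𝕜) * leafProd (Finset.univ.image g))
        else 0) = (index v : 𝕜) / (blockFact blk Finset.univ : 𝕜) * (Ntrop D.m x.1 : 𝕜) *
          if allLabels (Finset.univ.image g) = Finset.univ then leafProd (Finset.univ.image g)
          else 0 := by
      intro g hg
      have hl := (Finset.mem_filter.1 hg).2
      rw [hl.vecSum_image, hl.treeCount_image (h ▸ hv) hμ]
      simp only [h, and_true]
      split_ifs
      · ring
      · ring
    rw [Finset.sum_congr rfl h1, ← Finset.mul_sum, ← coef_labelMonomial hx]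
    field_simp
  · rw [Finset.sum_eq_zero, zero_div]
    intro g hg
    refine if_neg fun h1 => h ?_
    rw [← (Finset.mem_filter.1 hg).2.vecSum_image]
    exact h1.2

-- A type that contributes to the full squarefree monomial comes from a set of elementary walls, and
-- there are only finitely many such sets.
open Classical in
theorem finite_support_labelMonomial :
    {x : LabelType n | outVec D.m x.1 ≠ 0 ∧
      coef (blockDeg blk Finset.univ) 0 (labelMonomial D x) ≠ 0}.Finite := by
  refine (sum_labellings (𝕜 := 𝕜) (b := Leaf.block) (p := Leaf.weight)
    (q := fun l : Leaf D blk => l.labels.card)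
    (fun l => l.weight_pos) (fun l => Finset.card_pos.2 (Finset.nonempty_iff_ne_empty.2
      l.labels_ne_empty)) (fun T => if allLabels T = Finset.univ then leafProd T
      else 0)).1.subset fun x hx => ?_
  have hne : Nonempty (InEdge x.1) := by
    by_contra h
    rw [not_nonempty_iff] at h
    refine hx.1 ?_
    rw [← vecSum_inVec, vecSum, Finset.univ_eq_empty, Finset.sum_empty]
  have hfact : (blockFact blk Finset.univ : 𝕜) ≠ 0 :=
    Nat.cast_ne_zero.2 (Finset.prod_ne_zero_iff.2 fun i _ => Nat.factorial_ne_zero _)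
  have h1 := mul_ne_zero hfact hx.2
  rw [coef_labelMonomial hne] at h1
  exact h1

/-- Types with their labellings, divided by the order of Aut, amount to sets of elementary walls; on
these the summand is a tree count times a product of coefficients, which is the ray of the tropical
solution. -/
theorem finsum_coef_term {v : ℤ × ℤ} (hv : v ≠ 0) {μ : Leaf D blk → ℝ}
    (hμ : IsGeneric Leaf.vec μ) :
    ∑ᶠ x : LabelType n, coef (blockDeg blk Finset.univ) v (term D x.1 x.2.1) =
      (index v : 𝕜) / (blockFact blk Finset.univ : 𝕜) *
        tropRays Leaf.vec μ allLabels leafProd Finset.univ v := by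
  classical
  simp only [coef_term_eq_sum _ hv hμ]
  refine ((sum_labellings (𝕜 := 𝕜) (b := Leaf.block) (p := Leaf.weight)
    (q := fun l : Leaf D blk => l.labels.card)
    (fun l => l.weight_pos) (fun l => Finset.card_pos.2 (Finset.nonempty_iff_ne_empty.2
      l.labels_ne_empty)) (fun T => if allLabels T = Finset.univ ∧ vecSum Leaf.vec T = v then
          (index v : 𝕜) / (blockFact blk Finset.univ : 𝕜) *
            ((treeCount Leaf.vec μ T : 𝕜) * leafProd T) else 0)).2).trans ?_
  rw [tropRays, Finset.mul_sum, Finset.sum_filter]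

end Terms

/-! ### Passage from squarefree coefficients to the coefficients of the formula -/

section Conclusion

variable {𝕜 : Type*} [Field 𝕜] {n : ℕ}

theorem blockDeg_sigma_fst (α : Fin n →₀ ℕ) :
    blockDeg (fun e : (i : Fin n) × Fin (α i) => e.1) Finset.univ = α := by
  ext i
  rw [blockDeg, Finsupp.finsetSum_apply, Fintype.sum_sigma]
  simp [Finsupp.single_apply]

/-- As the direction is primitive, Bézout coefficients show that the real factor is an integer. -/
theorem exists_nsmul_of_mem_directionRay (d : Wall 𝕜 n) {v : ℤ × ℤ} (hv : v ≠ 0)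
    (h : toPlane v ∈ d.directionRay) : ∃ j : ℕ, 0 < j ∧ v = j • d.dir := by
  obtain ⟨s, hs, hsv⟩ := h
  have h1 : (v.1 : ℝ) = s * d.dir.1 := congrArg Prod.fst hsv
  have h2 : (v.2 : ℝ) = s * d.dir.2 := congrArg Prod.snd hsv
  have hb : d.dir.1 * d.dir.1.gcdA d.dir.2 + d.dir.2 * d.dir.1.gcdB d.dir.2 = 1 := by
    rw [← Int.gcd_eq_gcd_ab]
    exact_mod_cast d.dir_primitive
  set k : ℤ := v.1 * d.dir.1.gcdA d.dir.2 + v.2 * d.dir.1.gcdB d.dir.2 with hk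
  have hks : (k : ℝ) = s := by
    have hb' : (d.dir.1 : ℝ) * d.dir.1.gcdA d.dir.2 + d.dir.2 * d.dir.1.gcdB d.dir.2 = 1 := by
      exact_mod_cast hb
    rw [hk]
    push_cast
    rw [h1, h2]
    linear_combination s * hb'
  rw [← hks] at h1 h2 hs
  have hk0 : 0 ≤ k := by exact_mod_cast hs
  have hv1 : v.1 = k * d.dir.1 := by exact_mod_cast h1
  have hv2 : v.2 = k * d.dir.2 := by exact_mod_cast h2
  obtain ⟨j, hj⟩ : ∃ j : ℕ, k = j := ⟨k.toNat, (Int.toNat_of_nonneg hk0).symm⟩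
  rw [hj] at hv1 hv2
  refine ⟨j, Nat.pos_of_ne_zero ?_, Prod.ext ?_ ?_⟩
  · intro h0
    rw [h0] at hv1 hv2
    exact hv (Prod.ext (by simpa using hv1) (by simpa using hv2))
  · simpa using hv1
  · simpa using hv2

variable {D : StandardDiagram 𝕜 n}

/-- The inclusion of the index set of the formula. -/
def TermIndex.toLabelType {d : Wall 𝕜 n} (x : TermIndex D d) : LabelType n := ⟨x.1.1, x.2⟩

theorem TermIndex.toLabelType_injective (d : Wall 𝕜 n) :
    Function.Injective (TermIndex.toLabelType (D := D) (d := d)) := by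
  rintro ⟨⟨w, hw⟩, κ⟩ ⟨⟨w', hw'⟩, κ'⟩ h
  obtain ⟨rfl, h2⟩ := Sigma.mk.inj h
  obtain rfl := eq_of_heq h2
  rfl

theorem TermIndex.mem_range {d : Wall 𝕜 n} {x : LabelType n} (h : outVec D.m x.1 ≠ 0)
    (h' : toPlane (outVec D.m x.1) ∈ d.directionRay) :
    x ∈ Set.range (TermIndex.toLabelType (D := D) (d := d)) :=
  ⟨⟨⟨x.1, h, h'⟩, x.2⟩, rfl⟩

variable [CharZero 𝕜]

theorem finite_support_term (d : Wall 𝕜 n) (α : Fin n →₀ ℕ) :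
    (Function.support fun x : TermIndex D d =>
      MvPowerSeries.coeff α (term D x.1.1 x.2.1)).Finite := by
  have h := finite_support_labelMonomial (D := D) (blk := fun e : (i : Fin n) × Fin (α i) => e.1)
  rw [blockDeg_sigma_fst] at h
  refine (h.preimage (TermIndex.toLabelType_injective d).injOn).subset fun x hx => ?_
  exact ⟨x.1.2.1, coeff_term_ne_zero D (x := x.toLabelType) hx⟩

/-- The labels are chosen with α_i of them in block i, so that the full squarefree monomial
corresponds to t^α. The factorial and the index occur on both sides and cancel. -/
theorem coef_log_ray {S : Set (Wall 𝕜 n)} (hS : IsScatter D.walls S)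
    (hdir : AtMostOneRayPerDirection S) {d : Wall 𝕜 n} (hd : d ∈ S) (hray : d.isRay = true)
    (α : Fin n →₀ ℕ) (v : ℤ × ℤ) :
    coef α v (log d.func) = ∑ᶠ x : TermIndex D d, coef α v (term D x.1.1 x.2.1) := by
  by_cases hv : ∃ j : ℕ, 0 < j ∧ v = j • d.dir
  · obtain ⟨j, hj, rfl⟩ := hv
    have hv0 : j • d.dir ≠ 0 := smul_ne_zero hj.ne' d.dir_ne_zero
    let blk := fun e : (i : Fin n) × Fin (α i) => e.1
    obtain ⟨μ, hμ⟩ := exists_isGeneric (Leaf.vec (D := D) (blk := blk))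
    have h1 := wallCoeff_ray hS hdir hd hray hj hμ Finset.univ
    have h2 := finsum_coef_term hv0 hμ
    have hα : blockDeg blk Finset.univ = α := blockDeg_sigma_fst α
    rw [hα] at h2
    rw [wallCoeff, sqMap_apply, hα] at h1
    -- Types outside the index set of d have another out vector and contribute nothing to the
    -- exponent j • d.dir, so the sum may be taken over all types.
    have h3 : ∑ᶠ x : TermIndex D d, coef α (j • d.dir) (term D x.1.1 x.2.1) =
        ∑ᶠ x : LabelType n, coef α (j • d.dir) (term D x.1 x.2.1) := by
      rw [← finsum_mem_univ (f := fun x : LabelType n => coef α (j • d.dir) (term D x.1 x.2.1)),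
        ← finsum_mem_inter_support_eq (f := fun x : LabelType n =>
          coef α (j • d.dir) (term D x.1 x.2.1))
          (s := Set.range (TermIndex.toLabelType (D := D) (d := d))),
        finsum_mem_range (TermIndex.toLabelType_injective d)]
      · rfl
      · rw [Set.univ_inter, Set.inter_eq_right]
        intro x hx
        have h4 : outVec D.m x.1 = j • d.dir := by
          by_contra h4
          refine hx ?_
          simp only
          rw [coef_term, if_neg h4]
        refine TermIndex.mem_range (h4 ▸ hv0) ⟨j, Nat.cast_nonneg j, ?_⟩
        rw [h4, toPlane_nsmul]
    have hfact : (blockFact blk Finset.univ : 𝕜) ≠ 0 :=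
      Nat.cast_ne_zero.2 (Finset.prod_ne_zero_iff.2 fun i _ => Nat.factorial_ne_zero _)
    have hind : (index (j • d.dir) : 𝕜) ≠ 0 := Nat.cast_ne_zero.2 (index_pos hv0).ne'
    rw [h3, h2, ← h1]
    field_simp
  · have h1 : coef α v (log d.func) = 0 := by
      by_contra h
      exact hv (coef_log_ne_zero d.func_mem h).2
    have h2 : ∀ x : TermIndex D d, coef α v (term D x.1.1 x.2.1) = 0 := by
      intro x
      refine (coef_term D x.toLabelType α v).trans (if_neg ?_)
      rintro rfl
      exact hv (exists_nsmul_of_mem_directionRay d x.1.2.1 x.1.2.2)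
    simp only [h2, finsum_zero]
    exact h1

theorem coeff_log_ray {S : Set (Wall 𝕜 n)} (hS : IsScatter D.walls S)
    (hdir : AtMostOneRayPerDirection S) {d : Wall 𝕜 n} (hd : d ∈ S) (hray : d.isRay = true)
    (α : Fin n →₀ ℕ) : MvPowerSeries.coeff α (log d.func) =
      ∑ᶠ x : TermIndex D d, MvPowerSeries.coeff α (term D x.1.1 x.2.1) := by
  have hfin := finite_support_term (D := D) d α
  ext v
  refine (coef_log_ray hS hdir hd hray α v).trans ?_
  have h0 : (Function.support fun x : TermIndex D d => coef α v (term D x.1.1 x.2.1)) ⊆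
      hfin.toFinset := by
    intro x hx
    rw [Set.Finite.coe_toFinset]
    intro h0
    refine hx ?_
    change (MvPowerSeries.coeff α (term D x.1.1 x.2.1)).coeff v = 0
    have h1 : MvPowerSeries.coeff α (term D x.1.1 x.2.1) = 0 := h0
    rw [h1]
    rfl
  rw [finsum_eq_sum_of_support_subset _ h0, finsum_eq_sum_of_support_subset
    (s := hfin.toFinset) _ (by rw [Set.Finite.coe_toFinset]), AddMonoidAlgebra.coeff_sum, Finsupp.finsetSum_apply]
  rfl

end Conclusion

end TropVertex

end

theorem theorem2p8 {𝕜 : Type*} [Field 𝕜] [CharZero 𝕜] {n : ℕ}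
    (D : TropVertex.StandardDiagram 𝕜 n) (S : Set (TropVertex.Wall 𝕜 n))
    (hS : TropVertex.IsScatter D.walls S)
    (hdir : TropVertex.AtMostOneRayPerDirection S) :
    (∀ w : Fin n → TropVertex.WeightVector, TropVertex.outVec D.m w ≠ 0 →
      TropVertex.IsTropicalCount D.m w (TropVertex.Ntrop D.m w)) ∧
    ∀ d ∈ S, d ∉ D.walls → ∀ α : Fin n →₀ ℕ,
      (Function.support fun x : TropVertex.TermIndex D d =>
        MvPowerSeries.coeff α (TropVertex.term D x.1.1 x.2.1)).Finite ∧
      MvPowerSeries.coeff α (TropVertex.log d.func) =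
        ∑ᶠ x : TropVertex.TermIndex D d,
          MvPowerSeries.coeff α (TropVertex.term D x.1.1 x.2.1) :=
  ⟨fun _ hw => TropVertex.isTropicalCount_ntrop (fun i => (D.m_primitive i).ne_zero) hw,
    fun d hd hnew α => ⟨TropVertex.finite_support_term d α,
      TropVertex.coeff_log_ray hS hdir hd (hS.isRay_of_new d hd hnew) α⟩⟩
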